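/- Let $k$ be a field and let $V$ be a $\mathbb Z$-graded $k$-vector space, with degree $|v|$. Let $\overline TV=\bigoplus_{n\ge 1}V^{\otimes n}$ be the reduced tensor algebra, bigraded so that $v_1\otimes\cdots\otimes v_n$ has internal degree $\sum_i|v_i|$ and external degree $n$; its total degree is $|v_1\otimes\cdots\otimes v_n|_{tot}=n+\sum_i|v_i|$. All signs below are Koszul signs for the total degree, unless stated otherwise. A Cacti algebra is a cochain complex $(T,d)$ ($|d|=1$) with an associative product $C_2$ of degree $0$ and operations $B_m:T^{\otimes m}\to T$ of degree $1-m$ for $m\ge 2$ (put $B_1=\mathrm{id}$) such that the following hold. (a) $d$ is a derivation of $C_2$. (b) The braces $$x\{y_1,\dots,y_n\}=(-1)^{\sum_{j=1}^n(|x|+|y_1|+\cdots+|y_{j-1}|)}B_{n+1}(x,y_1,\dots,y_n)$$ satisfy $$x\{y_1,\dots,y_m\}\{z_1,\dots,z_n\}=\sum\pm\, x\{z_1,\dots,z_{i_1},\,y_1\{z_{i_1+1},\dots,z_{j_1}\},\dots,\,y_m\{z_{i_m+1},\dots,z_{j_m}\},\dots,z_n\},$$ summed over $0\le i_1\le j_1\le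 i_2\le\cdots\le j_m\le n$, with sign exponent $\sum_p(|y_p|-1)\sum_{q\le i_p}(|z_q|-1)$. (c) $B_m(x\,x',y_1,\dots,y_{m-1})=\sum_{i=0}^{m-1}\pm\,B_{i+1}(x,y_1,\dots,y_i)\,B_{m-i}(x',y_{i+1},\dots,y_{m-1})$, with the Koszul sign of permuting the arguments and of moving $B_{m-i}$ past $x,y_1,\dots,y_i$. (d) For $m\ge 2$, with $\partial P=d\circ P-(-1)^{|P|}P\circ d$, $$\begin{aligned}(\partial B_m)(x,y_1,\dots,y_{m-1})={}&(-1)^{|x||y_1|+m|y_1|}\,y_1\,B_{m-1}(x,y_2,\dots,y_{m-1})\\&+\sum_{i=2}^{m-1}(-1)^{i+1}B_{m-1}(x,\dots,y_{i-1}y_i,\dots,y_{m-1})\\&+(-1)^{m+1}B_{m-1}(x,y_1,\dots,y_{m-2})\,y_{m-1}.\end{aligned}$$ A Cacti algebra structure, with respect to the total degree, on a bigraded vector space is well graded if $B_m(a,\dots)=0$ whenever the external degree of $a$ is less than $m-1$, if $d=d_i+d_e$ with $d_i$ of bidegree (internal, external) $(1,0)$ and $d_e$ of bidegree $(0,1)$,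 and if $C_2$ and all $B_m$ preserve the internal degree. **Theorem.** There is a bijection between (i) well graded Cacti algebra structures on $\overline TV$ whose product $C_2$ is the free product $C_2(x,y)=x\otimes y$, and (ii) unital, counital differential graded bialgebra structures on $H=V\oplus k1_H$ with unit $1_H$ (of degree $0$) and counit $\epsilon$ given by $\epsilon|_V=0$, $\epsilon(1_H)=1$. (In particular the coproduct is multiplicative, $\Delta(xy)=\sum(-1)^{|x_{(2)}||y_{(1)}|}x_{(1)}y_{(1)}\otimes x_{(2)}y_{(2)}$, and the differential is a derivation and a coderivation.) From (i) to (ii): on $V$, the differential $d_H$ is $d_i|_V$; the external differential is $d_e(v)=\sum(-1)^{|v_1|}v_1\otimes v_2$, where $\sum v_1\otimes v_2=\Delta(v)-1_H\otimes v-v\otimes 1_H$ is the reduced coproduct; and the product of $x,y\in V$ is $x*y=(-1)^{|x|_{tot}}B_2(x,y)$. From (ii) to (i): $(\overline TV,d)$ is the cobar construction $\Omega(H)$, with Kadeishvili's operations $$B_{m}(x_1\otimes\cdots\otimes x_n,\mathbf y_1,\dots,\mathbf y_{m-1})=\sum_{1\le i_1<\cdots<i_{m-1}\le n}\pm\,x_1\otimes\cdots\otimes(x_{i_1}*\mathbf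 y_1)\otimes\cdots\otimes(x_{i_{m-1}}*\mathbf y_{m-1})\otimes\cdots\otimes x_n ,$$ where $x*(y_1\otimes\cdots\otimes y_r)=\sum\pm\, x_{(1)}y_1\otimes\cdots\otimes x_{(r)}y_r$ is the diagonal action, with the Koszul sign for the degrees $|x_{(i)}|$ of the $x_{(i)}$ and $|y_j|+1$ of the $y_j$; the sign in $B_m$ is the Koszul sign of $*\cdots*\,x_1\cdots x_n\,\mathbf y_1\cdots\mathbf y_{m-1}\mapsto x_1\cdots x_{i_1}*\mathbf y_1\cdots x_{i_{m-1}}*\mathbf y_{m-1}\cdots x_n$, where each $*$ is odd and the other symbols have their total degree. -/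

import Mathlib

open scoped TensorProduct DirectSum

universe u v

noncomputable section

/-! ## Graded vector spaces and Koszul signs

`n.negOnePow` is the sign `(-1) ^ n`. A pair `(n, x) : ℤ × T` with `x ∈ 𝒯 n` is a homogeneous
element together with its degree. -/

/-- All members of the list are homogeneous of the degree they are labelled with. -/
def Homogeneous {k : Type u} [Field k] {T : Type v} [AddCommGroup T] [Module k T]
    (𝒯 : ℤ → Submodule k T) (l : List (ℤ × T)) : Prop :=
  ∀ a ∈ l, a.2 ∈ 𝒯 a.1

/-- Sum of the degrees. -/
def degSum {T : Type v} (l : List (ℤ × T)) : ℤ := (l.map Prod.fst).sum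

/-- Sum of the degrees lowered by one. -/
def shiftedDegSum {T : Type v} (l : List (ℤ × T)) : ℤ := (l.map fun a => a.1 - 1).sum

/-- `decalage x [y₁, …, yₙ] = ∑ j, (x + y₁ + ⋯ + yⱼ₋₁)`, the exponent of the Koszul sign of the
permutation `• ⋯ • x y₁ ⋯ yₙ ↦ x • y₁ • y₂ ⋯ • yₙ`, where the `n` dots are odd and the other
symbols have the given degrees. -/
def decalage : ℤ → List ℤ → ℤ
  | _, [] => 0
  | x, y :: ys => x + decalage (x + y) ys

section Signs

variable {k : Type u} [Field k] {H : Type v} [AddCommGroup H] [Module k H]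
  (ℋ : ℤ → Submodule k H) [DirectSum.Decomposition ℋ]

/-- The linear map `x ↦ (-1) ^ (|x| * n) x`. -/
def signMap (n : ℤ) : H →ₗ[k] H :=
  DirectSum.toModule k ℤ H (fun m => (m * n).negOnePow • (ℋ m).subtype) ∘ₗ
    (DirectSum.decomposeLinearEquiv ℋ).toLinearMap

/-- The Koszul symmetry `x ⊗ y ↦ (-1) ^ (|x| |y|) y ⊗ x`. -/
def koszulSwap : H ⊗[k] H →ₗ[k] H ⊗[k] H :=
  (TensorProduct.congr (DirectSum.decomposeLinearEquiv ℋ)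
      (DirectSum.decomposeLinearEquiv ℋ)).symm.toLinearMap ∘ₗ
    (TensorProduct.gradedComm k (fun i => ℋ i) (fun i => ℋ i)).toLinearMap ∘ₗ
    (TensorProduct.congr (DirectSum.decomposeLinearEquiv ℋ)
      (DirectSum.decomposeLinearEquiv ℋ)).toLinearMap

/-- For a product `μ` on `H`, the product
`(a ⊗ b) (a' ⊗ b') = (-1) ^ (|b| |a'|) μ a a' ⊗ μ b b'` on `H ⊗ H`. -/
def koszulMul (μ : H →ₗ[k] H →ₗ[k] H) : H ⊗[k] H →ₗ[k] H ⊗[k] H →ₗ[k] H ⊗[k] H :=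
  TensorProduct.curry
    (TensorProduct.map (TensorProduct.lift μ) (TensorProduct.lift μ) ∘ₗ
      (TensorProduct.assoc k H H (H ⊗[k] H)).symm.toLinearMap ∘ₗ
      LinearMap.lTensor H
        ((TensorProduct.assoc k H H H).toLinearMap ∘ₗ
          LinearMap.rTensor H (koszulSwap ℋ) ∘ₗ
          (TensorProduct.assoc k H H H).symm.toLinearMap) ∘ₗ
      (TensorProduct.assoc k H H (H ⊗[k] H)).toLinearMap)

theorem signMap_of_mem (n : ℤ) {m : ℤ} {x : H} (hx : x ∈ ℋ m) :
    signMap ℋ n x = (m * n).negOnePow • x := by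
  lift x to ℋ m using hx
  simp [signMap]

theorem koszulSwap_tmul {m n : ℤ} {x y : H} (hx : x ∈ ℋ m) (hy : y ∈ ℋ n) :
    koszulSwap ℋ (x ⊗ₜ y) = (m * n).negOnePow • (y ⊗ₜ[k] x) := by
  lift x to ℋ m using hx
  lift y to ℋ n using hy
  have h := TensorProduct.gradedComm_of_tmul_of k (fun i => ℋ i) (fun i => ℋ i) m n x y
  simp only [koszulSwap, LinearMap.comp_apply, LinearEquiv.coe_coe, TensorProduct.congr_tmul,
    DirectSum.decomposeLinearEquiv_apply_coe]
  rw [h, mul_comm n m]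
  rw [LinearEquiv.symm_apply_eq, Units.smul_def, Units.smul_def, map_zsmul,
    TensorProduct.congr_tmul]
  simp [Int.negOnePow]

theorem koszulMul_tmul (μ : H →ₗ[k] H →ₗ[k] H) {m n : ℤ} {b a' : H} (hb : b ∈ ℋ m)
    (ha' : a' ∈ ℋ n) (a b' : H) :
    koszulMul ℋ μ (a ⊗ₜ b) (a' ⊗ₜ b') = (m * n).negOnePow • (μ a a' ⊗ₜ[k] μ b b') := by
  simp only [koszulMul, TensorProduct.curry_apply, LinearMap.comp_apply, LinearEquiv.coe_coe,
    TensorProduct.assoc_tmul, LinearMap.lTensor_tmul, TensorProduct.assoc_symm_tmul,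
    LinearMap.rTensor_tmul, koszulSwap_tmul ℋ hb ha']
  simp [Units.smul_def, ← Int.cast_smul_eq_zsmul k, TensorProduct.smul_tmul']

end Signs

/-! ## Differential graded bialgebras -/

/-- A unital and counital differential graded associative bialgebra structure on the graded vector
space `(H, ℋ)`; the coalgebra part (coassociativity and counit laws) is Mathlib's `Coalgebra`. -/
structure DGBialgebra (k : Type u) [Field k] (H : Type v) [AddCommGroup H] [Module k H]
    (ℋ : ℤ → Submodule k H) [DirectSum.Decomposition ℋ] extends Coalgebra k H where
  d : H →ₗ[k] H
  mul : H →ₗ[k] H →ₗ[k] H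
  one : H
  -- degrees
  d_mem : ∀ n, ∀ x ∈ ℋ n, d x ∈ ℋ (n + 1)
  mul_mem : ∀ m n, ∀ x ∈ ℋ m, ∀ y ∈ ℋ n, mul x y ∈ ℋ (m + n)
  one_mem : one ∈ ℋ 0
  comul_mem : ∀ n, ∀ x ∈ ℋ n,
    comul x ∈ ⨆ p : ℤ, LinearMap.range (TensorProduct.map (ℋ p).subtype (ℋ (n - p)).subtype)
  counit_eq_zero : ∀ n, n ≠ 0 → ∀ x ∈ ℋ n, counit x = 0
  -- unital associative algebra
  mul_assoc : ∀ x y z, mul (mul x y) z = mul x (mul y z)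
  one_mul : ∀ x, mul one x = x
  mul_one : ∀ x, mul x one = x
  -- the coproduct and the counit are morphisms of unital graded algebras
  comul_mul : ∀ x y, comul (mul x y) = koszulMul ℋ mul (comul x) (comul y)
  comul_one : comul one = one ⊗ₜ[k] one
  counit_mul : ∀ x y, counit (mul x y) = counit x * counit y
  counit_one : counit one = 1
  -- the differential
  d_d : ∀ x, d (d x) = 0
  d_mul : ∀ n, ∀ x ∈ ℋ n, ∀ y, d (mul x y) = mul (d x) y + n.negOnePow • mul x (d y)
  comul_d : ∀ x, comul (d x) =
    TensorProduct.map d LinearMap.id (comul x) + TensorProduct.map (signMap ℋ 1) d (comul x)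
  counit_d : ∀ x, counit (d x) = 0

/-! ## Cacti algebras -/

/-- The data of a Cacti algebra on `T`: the differential, the product `C₂`, and the operations
`B₁, B₂, …`, where `B n`, with `n + 1` arguments, is `Bₙ₊₁`. -/
structure CactiData (k : Type u) [Field k] (T : Type v) [AddCommGroup T] [Module k T] where
  d : T →ₗ[k] T
  mul : T →ₗ[k] T →ₗ[k] T
  B : ∀ n : ℕ, MultilinearMap k (fun _ : Fin (n + 1) => T) T

namespace CactiData

variable {k : Type u} [Field k] {T : Type v} [AddCommGroup T] [Module k T] (C : CactiData k T)

/-- `C.op x [y₁, …, yₙ] = Bₙ₊₁(x, y₁, …, yₙ)`. -/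
def op (x : T) (ys : List T) : T := C.B ys.length (Fin.cons x ys.get)

/-- The brace `x{y₁, …, yₙ}` of homogeneous elements, of degree `|x| + ∑ (|yⱼ| - 1)`: the
operation `Bₙ₊₁(x, y₁, …, yₙ)` with the Koszul sign that moves the `n` dots of `Bₙ₊₁` in front of
`y₁, …, yₙ`. For `n = 1` it is `x * y = (-1) ^ |x| B₂(x, y)`. -/
def brace (x : ℤ × T) (ys : List (ℤ × T)) : ℤ × T :=
  (x.1 + shiftedDegSum ys,
    (decalage x.1 (ys.map Prod.fst)).negOnePow • C.op x.2 (ys.map Prod.snd))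

/-- The sum of all
`± x{acc, z₁, …, y₁{zᵢ₊₁, …}, …, y₂{…}, …, yₘ{…}, …, zₙ}`, where consecutive (possibly empty)
blocks of `zs` are inserted into the `y`'s and the order of the `y`'s and of the `z`'s is kept; the
sign is the Koszul sign of the shuffle of the `y`'s and the `z`'s, for the degrees lowered by one.
In each summand the block in front of `y₁` is `zs.take i`, and the one inserted into `y₁` has
length `j`. -/
def braceSum (x : ℤ × T) : List (ℤ × T) → List (ℤ × T) → List (ℤ × T) → T
  | acc, [], zs => (C.brace x (acc ++ zs)).2
  | acc, y :: ys, zs =>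
    ∑ i ∈ Finset.range (zs.length + 1), ∑ j ∈ Finset.range (zs.length - i + 1),
      ((y.1 - 1) * shiftedDegSum (zs.take i) +
          shiftedDegSum ys * shiftedDegSum (zs.take (i + j))).negOnePow •
        braceSum x (acc ++ zs.take i ++ [C.brace y ((zs.drop i).take j)]) ys (zs.drop (i + j))

end CactiData

/-- A Cacti algebra structure on the graded vector space `(T, 𝒯)`. -/
structure CactiAlgebra (k : Type u) [Field k] (T : Type v) [AddCommGroup T] [Module k T]
    (𝒯 : ℤ → Submodule k T) extends CactiData k T where
  /-- `B₁` is the identity operation. -/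
  B_zero : ∀ t : Fin 1 → T, B 0 t = t 0
  -- degrees: `|d| = 1`, `|C₂| = 0`, `|Bₙ₊₁| = -n`
  d_mem : ∀ n, ∀ x ∈ 𝒯 n, d x ∈ 𝒯 (n + 1)
  mul_mem : ∀ m n, ∀ x ∈ 𝒯 m, ∀ y ∈ 𝒯 n, mul x y ∈ 𝒯 (m + n)
  B_mem : ∀ (n : ℕ) (deg : Fin (n + 1) → ℤ) (t : Fin (n + 1) → T), (∀ i, t i ∈ 𝒯 (deg i)) →
    B n t ∈ 𝒯 (∑ i, deg i - n)
  d_d : ∀ x, d (d x) = 0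
  mul_assoc : ∀ x y z, mul (mul x y) z = mul x (mul y z)
  /-- `∂C₂ = 0`. -/
  d_mul : ∀ n, ∀ x ∈ 𝒯 n, ∀ y, d (mul x y) = mul (d x) y + n.negOnePow • mul x (d y)
  /-- The brace relations `Bₙ ∘₁ Bₘ`:
  `x{y₁, …, yₘ}{z₁, …, zₙ} = ∑ ± x{z₁, …, y₁{…}, …, yₘ{…}, …, zₙ}`. -/
  brace_brace : ∀ (x : ℤ × T) (ys zs : List (ℤ × T)), x.2 ∈ 𝒯 x.1 → Homogeneous 𝒯 ys →
    Homogeneous 𝒯 zs →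
      (toCactiData.brace (toCactiData.brace x ys) zs).2 = toCactiData.braceSum x [] ys zs
  /-- The distributivity `Bₘ ∘₁ C₂` of the `Bₘ` over the product:
  `Bₘ(x x', y₁, …) = ∑ ± Bᵢ₊₁(x, y₁, …, yᵢ) Bₘ₋ᵢ(x', yᵢ₊₁, …)` with the Koszul sign. -/
  op_mul : ∀ (x x' : ℤ × T) (ys : List (ℤ × T)), x.2 ∈ 𝒯 x.1 → x'.2 ∈ 𝒯 x'.1 →
    Homogeneous 𝒯 ys →
      toCactiData.op (mul x.2 x'.2) (ys.map Prod.snd) =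
        ∑ i ∈ Finset.range (ys.length + 1),
          (x'.1 * degSum (ys.take i) +
              ((ys.length : ℤ) - i) * (x.1 + degSum (ys.take i))).negOnePow •
            mul (toCactiData.op x.2 ((ys.take i).map Prod.snd))
              (toCactiData.op x'.2 ((ys.drop i).map Prod.snd))
  /-- The boundary `∂Bₘ`, for `m = n + 2` and arguments `t 0, …, t (n + 1)`. The left-hand side is
  `d ∘ Bₘ - (-1) ^ |Bₘ| Bₘ ∘ d`. On the right, `t 1` is moved in front, two neighbours among
  `t 1, …, t (n + 1)` are multiplied, and `t (n + 1)` is split off, respectively. -/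
  boundary_B : ∀ (n : ℕ) (deg : Fin (n + 2) → ℤ) (t : Fin (n + 2) → T),
    (∀ i, t i ∈ 𝒯 (deg i)) →
      d (B (n + 1) t) -
          ∑ i, (-((n : ℤ) + 1) + ∑ j ∈ Finset.univ.filter (· < i), deg j).negOnePow •
            B (n + 1) (Function.update t i (d (t i))) =
        (deg 0 * deg 1 + n * deg 1).negOnePow • mul (t 1) (B n (Fin.removeNth 1 t)) +
          ∑ j ∈ Finset.univ.filter (fun j : Fin (n + 2) => 1 ≤ (j : ℕ) ∧ (j : ℕ) ≤ n),
            ((j : ℕ) : ℤ).negOnePow • B n (Fin.contractNth j (fun a b => mul a b) t) +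
          ((n : ℤ) + 1).negOnePow • mul (B n (Fin.init t)) (t (Fin.last (n + 1)))

/-! ## Bigradings and well graded Cacti algebras

A bigrading is a family `𝒞 p q`, with `p` the internal and `q` the external degree. -/

section Bigraded

variable {k : Type u} [Field k] {T : Type v} [AddCommGroup T] [Module k T]
  (𝒞 : ℤ → ℤ → Submodule k T)

/-- The part of total degree `n`. -/
def totalPart (n : ℤ) : Submodule k T := ⨆ p : ℤ, 𝒞 p (n - p)

/-- The part of internal degree `p`. -/
def internalPart (p : ℤ) : Submodule k T := ⨆ q : ℤ, 𝒞 p q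

/-- The part of external degree `q`. -/
def externalPart (q : ℤ) : Submodule k T := ⨆ p : ℤ, 𝒞 p q

/-- `d = dᵢ + dₑ` with `dᵢ` of bidegree `(1, 0)` and `dₑ` of bidegree `(0, 1)`. -/
structure IsSplitting (d di de : T →ₗ[k] T) : Prop where
  eq_add : d = di + de
  di_mem : ∀ p q, ∀ x ∈ 𝒞 p q, di x ∈ 𝒞 (p + 1) q
  de_mem : ∀ p q, ∀ x ∈ 𝒞 p q, de x ∈ 𝒞 p (q + 1)

/-- A Cacti algebra structure for the total degree of a bigraded vector space is well graded. -/
structure CactiAlgebra.IsWellGraded (C : CactiAlgebra k T (totalPart 𝒞)) : Prop where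
  /-- `Bₘ₊₁(a, …) = 0` if the external degree of `a` is less than `m`. -/
  B_eq_zero : ∀ (m : ℕ) (q : ℤ), 1 ≤ m → q < m → ∀ a ∈ externalPart 𝒞 q, ∀ t : Fin m → T,
    C.B m (Fin.cons a t) = 0
  exists_splitting : ∃ di de : T →ₗ[k] T, IsSplitting 𝒞 C.d di de
  mul_internal : ∀ p p', ∀ x ∈ internalPart 𝒞 p, ∀ y ∈ internalPart 𝒞 p',
    C.mul x y ∈ internalPart 𝒞 (p + p')
  B_internal : ∀ (m : ℕ) (p : Fin (m + 1) → ℤ) (t : Fin (m + 1) → T),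
    (∀ i, t i ∈ internalPart 𝒞 (p i)) → C.B m t ∈ internalPart 𝒞 (∑ i, p i)

end Bigraded

/-! ## The reduced tensor algebra -/

section Tensor

variable {k : Type u} [Field k] {V : Type v} [AddCommGroup V] [Module k V]
  (𝒱 : ℤ → Submodule k V)

variable (k V) in
/-- The reduced tensor algebra `⨁ n ≥ 1, V ^ ⊗ n`, as the augmentation ideal of the tensor
algebra. -/
abbrev ReducedTensor : Submodule k (TensorAlgebra k V) :=
  LinearMap.ker (TensorAlgebra.algebraMapInv (R := k) (M := V)).toLinearMap

variable (k) in
/-- The inclusion of `V` in the reduced tensor algebra. -/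
def ReducedTensor.incl (v : V) : ReducedTensor k V :=
  ⟨TensorAlgebra.ι k v, by simp [TensorAlgebra.algebraMapInv]⟩

variable (k) in
/-- `v₁ ⊗ ⋯ ⊗ vₙ`, for a list of elements that are labelled with degrees. -/
def tensorOf (l : List (ℤ × V)) : TensorAlgebra k V :=
  (l.map fun a => TensorAlgebra.ι k a.2).prod

/-- The bigrading of the reduced tensor algebra: `v₁ ⊗ ⋯ ⊗ v_q` has bidegree
`(|v₁| + ⋯ + |v_q|, q)`. -/
def tensorBigrading (p q : ℤ) : Submodule k (ReducedTensor k V) :=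
  Submodule.span k {t | ∃ l : List (ℤ × V), Homogeneous 𝒱 l ∧ degSum l = p ∧ (l.length : ℤ) = q ∧
    (t : TensorAlgebra k V) = tensorOf k l}

/-- `C₂` is the product of the reduced tensor algebra. -/
def CactiData.ExtendsTensor (C : CactiData k (ReducedTensor k V)) : Prop :=
  ∀ x y : ReducedTensor k V, ((C.mul x y : ReducedTensor k V) : TensorAlgebra k V) = x * y

/-! ## The graded vector space `H = V ⊕ k 1_H` -/

/-- The grading of `H = V ⊕ k 1_H`, realized as `V × k` with `1_H = (0, 1)` of degree `0`. -/
def unitGrading (n : ℤ) : Submodule k (V × k) :=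
  (𝒱 n).prod (if n = 0 then ⊤ else ⊥)

/-- The inclusion `V_n → H_n`. -/
def unitGrading.inl (n : ℤ) : 𝒱 n →ₗ[k] unitGrading 𝒱 n where
  toFun v := ⟨(v, 0), by simp [unitGrading]⟩
  map_add' x y := by ext <;> simp
  map_smul' c x := by ext <;> simp

/-- The inclusion `k 1_H → H_0`. -/
def unitGrading.inr : k →ₗ[k] unitGrading 𝒱 0 where
  toFun c := ⟨(0, c), by simp [unitGrading]⟩
  map_add' x y := by ext <;> simp
  map_smul' c x := by ext <;> simp

variable [DirectSum.Decomposition 𝒱]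

instance unitGrading.decomposition : DirectSum.Decomposition (unitGrading 𝒱) :=
  DirectSum.Decomposition.ofLinearMap (unitGrading 𝒱)
    (DirectSum.toModule k ℤ (⨁ n, unitGrading 𝒱 n)
        (fun n => DirectSum.lof k ℤ (fun i => unitGrading 𝒱 i) n ∘ₗ unitGrading.inl 𝒱 n) ∘ₗ
        (DirectSum.decomposeLinearEquiv 𝒱).toLinearMap ∘ₗ LinearMap.fst k V k +
      DirectSum.lof k ℤ (fun i => unitGrading 𝒱 i) 0 ∘ₗ unitGrading.inr 𝒱 ∘ₗ LinearMap.snd k V k)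
    (by
      refine LinearMap.prod_ext (LinearMap.ext fun v => ?_) (LinearMap.ext fun c => ?_)
      · induction v using DirectSum.Decomposition.inductionOn 𝒱 with
        | zero => rw [map_zero, map_zero]
        | homogeneous x => simp [unitGrading.inl]
        | add x y hx hy => rw [map_add, map_add, hx, hy]
      · simp [unitGrading.inr])
    (by
      refine DirectSum.linearMap_ext k fun n => LinearMap.ext fun ⟨⟨v, c⟩, hv, hc⟩ => ?_
      replace hv : v ∈ 𝒱 n := hv
      lift v to 𝒱 n using hv
      simp only [LinearMap.comp_apply, DirectSum.coeLinearMap_lof, LinearMap.add_apply,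
        LinearMap.fst_apply, LinearMap.snd_apply, LinearEquiv.coe_coe, LinearMap.id_apply,
        DirectSum.decomposeLinearEquiv_apply_coe, DirectSum.toModule_lof]
      by_cases hn : n = 0
      · subst hn
        rw [← map_add]
        congr 1
        ext <;> simp [unitGrading.inl, unitGrading.inr]
      · have hc0 : c = 0 := by simpa [hn] using hc
        subst hc0
        simp [unitGrading.inl])

/-! ## The two directions of the correspondence -/

/-- The bialgebra structure `S` on `H = V ⊕ k 1_H` is read off from the Cacti algebra structure `C`
on the reduced tensor algebra of `V`:
* `d_H` restricted to `V` is the internal differential `dᵢ`;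
* `dₑ v = ∑ (-1) ^ |v₁| v₁ ⊗ v₂`, where `∑ v₁ ⊗ v₂ = (π ⊗ π) (Δ v)` is the reduced coproduct, for
  the projection `π : H → V`;
* the product of `x, y ∈ V` is `x * y = (-1) ^ |x| B₂(x, y)`, with `|x|` the total degree of `x`. -/
structure Induces (C : CactiData k (ReducedTensor k V))
    (S : DGBialgebra k (V × k) (unitGrading 𝒱)) : Prop where
  differential : ∃ di de : ReducedTensor k V →ₗ[k] ReducedTensor k V,
    IsSplitting (tensorBigrading 𝒱) C.d di de ∧
    (∀ v : V, di (ReducedTensor.incl k v) = ReducedTensor.incl k (S.d (v, 0)).1) ∧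
    ∀ v : V, (de (ReducedTensor.incl k v) : TensorAlgebra k V) =
      LinearMap.mul' k (TensorAlgebra k V)
        (TensorProduct.map
          (TensorAlgebra.ι k ∘ₗ LinearMap.fst k V k ∘ₗ signMap (unitGrading 𝒱) 1)
          (TensorAlgebra.ι k ∘ₗ LinearMap.fst k V k) (S.comul (v, 0)))
  product : ∀ p : ℤ, ∀ x ∈ 𝒱 p, ∀ y : V, ReducedTensor.incl k (S.mul (x, 0) (y, 0)).1 =
    (p + 1).negOnePow • C.B 1 ![ReducedTensor.incl k x, ReducedTensor.incl k y]

variable {𝒱}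

/-- Total degree of `v₁ ⊗ ⋯ ⊗ vₙ`. -/
def totalDeg (l : List (ℤ × V)) : ℤ := degSum l + l.length

/-- The diagonal action of `x ∈ H` on `y₁ ⊗ ⋯ ⊗ yₙ`,
`x * (y₁ ⊗ ⋯ ⊗ yₙ) = ∑ ± (x₁ y₁) ⊗ ⋯ ⊗ (xₙ yₙ)` for `∑ x₁ ⊗ ⋯ ⊗ xₙ` the iterated coproduct, with
the Koszul sign of moving each `xᵢ`, of degree `|xᵢ|`, past the `yⱼ`, of degree `|yⱼ| + 1`, with
`j < i`. -/
def DGBialgebra.act (S : DGBialgebra k (V × k) (unitGrading 𝒱)) :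
    List (ℤ × V) → (V × k →ₗ[k] TensorAlgebra k V)
  | [] => Algebra.linearMap k (TensorAlgebra k V) ∘ₗ S.counit
  | y :: ys =>
    LinearMap.mul' k (TensorAlgebra k V) ∘ₗ
      TensorProduct.map
        (TensorAlgebra.ι k ∘ₗ LinearMap.fst k V k ∘ₗ S.mul.flip (y.2, 0))
        (S.act ys ∘ₗ signMap (unitGrading 𝒱) (y.1 + 1)) ∘ₗ
      S.comul

/-- The sum over all `i₁ < ⋯ < iₘ` of
`± x₁ ⊗ ⋯ ⊗ (x_{i₁} * 𝐲₁) ⊗ ⋯ ⊗ (x_{iₘ} * 𝐲ₘ) ⊗ ⋯ ⊗ xₙ`, with the Koszul sign of moving each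
`𝐲ⱼ`, with its total degree lowered by one, past the `xᵢ` with `i > iⱼ`. -/
def DGBialgebra.insertions (S : DGBialgebra k (V × k) (unitGrading 𝒱)) :
    List (ℤ × V) → List (List (ℤ × V)) → TensorAlgebra k V
  | xs, [] => tensorOf k xs
  | [], _ :: _ => 0
  | x :: xs, y :: ys =>
    TensorAlgebra.ι k x.2 * S.insertions xs (y :: ys) +
      (totalDeg xs * (totalDeg y - 1)).negOnePow •
        (S.act y (x.2, 0) * S.insertions xs ys)

/-- The operations `Bₘ` are those of Kadeishvili's structure on the cobar construction `Ω(H)`: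
`Bₘ₊₁(x₁ ⊗ ⋯ ⊗ xₙ, 𝐲₁, …, 𝐲ₘ) = ∑ ± x₁ ⊗ ⋯ ⊗ (x_{i₁} * 𝐲₁) ⊗ ⋯ ⊗ (x_{iₘ} * 𝐲ₘ) ⊗ ⋯ ⊗ xₙ`, the sign
being the Koszul sign of
`* ⋯ * x₁ ⋯ xₙ 𝐲₁ ⋯ 𝐲ₘ ↦ x₁ ⋯ x_{i₁} * 𝐲₁ ⋯ x_{iₘ} * 𝐲ₘ ⋯ xₙ`, where each `*` is odd and the other
symbols have their total degree. -/
def IsKadeishvili (C : CactiData k (ReducedTensor k V))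
    (S : DGBialgebra k (V × k) (unitGrading 𝒱)) : Prop :=
  ∀ (m : ℕ) (xs : List (ℤ × V)) (ys : Fin m → List (ℤ × V)),
    Homogeneous 𝒱 xs → (∀ i, Homogeneous 𝒱 (ys i)) →
    ∀ (x : ReducedTensor k V) (y : Fin m → ReducedTensor k V),
      (x : TensorAlgebra k V) = tensorOf k xs →
      (∀ i, (y i : TensorAlgebra k V) = tensorOf k (ys i)) →
        (C.B m (Fin.cons x y) : TensorAlgebra k V) =
          (decalage (totalDeg xs) (List.ofFn fun i => totalDeg (ys i))).negOnePow •
            S.insertions xs (List.ofFn ys)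

end Tensor

end

/-! Both structures are determined by their values on `V`, and the relations of one translate into the
relations of the other.

From a bialgebra `H = V ⊕ k 1_H` to a Cacti algebra: the algebra `H` acts diagonally on the tensor
algebra (`diagAct`), because the coproduct is coassociative and multiplicative. The braces
`braceMap` extend this action: `v{y} = v * y` and `v{y₁, …, yₙ} = 0` for `v ∈ V` and `n ≥ 2`, and the
braces of a product are given by distributivity. All three objects (the action, the braces, and the
cobar differential `cobarD`) are defined by recursion on the left tensor factor, and all identities
are proved by induction on the length of monomials. The brace relation (`braceMap_braceMap`)
reduces to `(x * y){Z} = x * (y{Z})` (`braceMap_diagAct`). The boundary formula (`hasBoundary`)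
reduces to two identities for a generator `v`: the differential of `x * y` is given by the Leibniz
rule up to terms that split off a tensor factor (`actLeibniz`), and `(d v){y, y'}` is the failure of
`v * -` to be a derivation (`braceMap_cobarGen_pair`), as the quadratic part of `d v` is the reduced
coproduct. In these calculations it is convenient to use convolutions over the full coproduct of
`H`, since the quadratic part of the differential vanishes on `1_H`. The result is
`kadeishviliAlgebra`.

From a well graded Cacti algebra to a bialgebra: for reasons of degree, the differential of `v ∈ V`
has a linear part `genD` and a quadratic part, the reduced coproduct `genComul`, and `B₂` restricts
to a product `genMul` on `V`. Moreover `Bₘ(v, …) = 0` for `m ≥ 3`. The brace relation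
`u{v}{w} = u{v{w}}` is the associativity of the product. The parts of external degree `1`, `2` and
`3` of `d (d v) = 0` say that `genD` is a differential, that it is a coderivation, and that the
coproduct is coassociative. Finally the boundary of `B₂(v, w)` is a formula in external degrees `1`
and `2`; the first part says that the differential is a derivation. For the second part,
`B₂(v, a ⊗ b)` is needed, which is determined by the boundary of `B₃(v, a, b) = 0`: it is the
product of the coproduct of `v` with `a ⊗ b`. Then the second part says that the coproduct is
multiplicative (`isReducedBialgebra`).

The constructions are inverse to each other because a well graded Cacti algebra is determined by
`d` and `B₂` on generators (`eq_of_generators`): by distributivity, the operations are determined by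
the maps `B₂(v, -)` with `v ∈ V`, and the boundary of `B₃(v, y, z) = 0` expresses `B₂(v, y ⊗ z)` by
operations on shorter tensors. -/

noncomputable section

set_option linter.unusedSectionVars false


/-! ### Signs -/

/-- Signs are compared by comparing their exponents modulo two. -/
theorem Int.negOnePow_congr {a b : ℤ} (h : (a : ZMod 2) = b) : a.negOnePow = b.negOnePow := by
  rw [Int.negOnePow_eq_iff, ← ZMod.intCast_eq_zero_iff_even]
  push_cast
  rw [h, sub_self]

section LeftRec

variable {k : Type u} [Field k] {V : Type v} [AddCommGroup V] [Module k V]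

/-! ### Linear maps on a tensor algebra defined by recursion on the left factor -/

/-- The linear map `φ` on the tensor algebra with `φ 1 = m` and `φ (v * t) = L v (φ t)`. -/
def leftRec {M : Type*} [AddCommGroup M] [Module k M] (L : V →ₗ[k] Module.End k M) (m : M) :
    TensorAlgebra k V →ₗ[k] M :=
  LinearMap.applyₗ m ∘ₗ (TensorAlgebra.lift k L).toLinearMap

section
variable {M : Type*} [AddCommGroup M] [Module k M] (L : V →ₗ[k] Module.End k M) (m : M)

@[simp] theorem leftRec_one : leftRec L m 1 = m := by simp [leftRec]

theorem leftRec_ι_mul (v : V) (t : TensorAlgebra k V) :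
    leftRec L m (TensorAlgebra.ι k v * t) = L v (leftRec L m t) := by
  simp [leftRec]

end

section
variable {M : Type*} [AddCommGroup M] [Module k M]
  (L : V →ₗ[k] TensorAlgebra k V × M →ₗ[k] M) (m : M)

/-- The step `(t, m) ↦ (v * t, L v (t, m))` of `leftPara`. -/
def leftParaStep : V →ₗ[k] Module.End k (TensorAlgebra k V × M) :=
  LinearMap.mk₂ k (fun v p => (TensorAlgebra.ι k v * p.1, L v p))
    (fun a b c => by simp [add_mul]) (fun c a b => by ext <;> simp)
    (fun a b c => by simp [mul_add]) (fun c a b => by ext <;> simp)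

theorem leftParaStep_apply (v : V) (p : TensorAlgebra k V × M) :
    leftParaStep L v p = (TensorAlgebra.ι k v * p.1, L v p) := rfl

/-- The linear map `φ` on the tensor algebra with `φ 1 = m` and `φ (v * t) = L v (t, φ t)`. -/
def leftPara : TensorAlgebra k V →ₗ[k] M :=
  LinearMap.snd k _ _ ∘ₗ leftRec (leftParaStep L) (1, m)

theorem leftRec_leftParaStep_fst (t : TensorAlgebra k V) :
    (leftRec (leftParaStep L) (1, m) t).1 = t := by
  suffices h : ∀ t u : TensorAlgebra k V, (leftRec (leftParaStep L) (1, m) u).1 = u →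
      (leftRec (leftParaStep L) (1, m) (t * u)).1 = t * u by
    simpa using h t 1 (by simp)
  intro t
  induction t using TensorAlgebra.induction with
  | algebraMap r =>
    intro u hu
    rw [← Algebra.smul_def, map_smul, Prod.smul_fst, hu]
  | ι x =>
    intro u hu
    rw [leftRec_ι_mul, leftParaStep_apply, hu]
  | mul a b ha hb =>
    intro u hu
    rw [mul_assoc, ha _ (hb _ hu)]
  | add a b ha hb =>
    intro u hu
    rw [add_mul, map_add, Prod.fst_add, ha _ hu, hb _ hu]

@[simp] theorem leftPara_one : leftPara L m 1 = m := by simp [leftPara]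

theorem leftPara_ι_mul (v : V) (t : TensorAlgebra k V) :
    leftPara L m (TensorAlgebra.ι k v * t) = L v (t, leftPara L m t) := by
  rw [leftPara, LinearMap.comp_apply, leftRec_ι_mul, leftParaStep_apply]
  simp only [LinearMap.snd_apply, LinearMap.comp_apply]
  congr 1
  exact Prod.ext (leftRec_leftParaStep_fst L m t) rfl

end

variable (k V) in
/-- The linear map `v * t ↦ v ⊗ t`, `1 ↦ 0`: a left inverse of the multiplication
`V ⊗ TV → TV`. -/
def stripLeft : TensorAlgebra k V →ₗ[k] V ⊗[k] TensorAlgebra k V :=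
  leftPara (((LinearMap.fst k _ _).lcomp k _) ∘ₗ TensorProduct.mk k V (TensorAlgebra k V)) 0

theorem stripLeft_ι_mul (v : V) (t : TensorAlgebra k V) :
    stripLeft k V (TensorAlgebra.ι k v * t) = v ⊗ₜ t := by
  rw [stripLeft, leftPara_ι_mul]
  rfl

end LeftRec

section Weights

variable {k : Type u} [Field k] {V : Type v} [AddCommGroup V] [Module k V]
  (𝒱 : ℤ → Submodule k V)

/-! ### Gradings of the tensor algebra -/

@[simp] theorem tensorOf_nil : tensorOf k ([] : List (ℤ × V)) = 1 := rfl

@[simp] theorem tensorOf_cons (a : ℤ × V) (l : List (ℤ × V)) :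
    tensorOf k (a :: l) = TensorAlgebra.ι k a.2 * tensorOf k l := by simp [tensorOf]

theorem tensorOf_append (l l' : List (ℤ × V)) :
    tensorOf k (l ++ l') = tensorOf k l * tensorOf k l' := by simp [tensorOf]

section Homogeneous
variable {T : Type*} [AddCommGroup T] [Module k T] {𝒯 : ℤ → Submodule k T}

@[simp] theorem homogeneous_nil : Homogeneous 𝒯 [] := by simp [Homogeneous]

@[simp] theorem homogeneous_cons {a : ℤ × T} {l : List (ℤ × T)} :
    Homogeneous 𝒯 (a :: l) ↔ a.2 ∈ 𝒯 a.1 ∧ Homogeneous 𝒯 l := by simp [Homogeneous]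

@[simp] theorem homogeneous_append {l l' : List (ℤ × T)} :
    Homogeneous 𝒯 (l ++ l') ↔ Homogeneous 𝒯 l ∧ Homogeneous 𝒯 l' := by
  simp [Homogeneous, or_imp, forall_and]

theorem Homogeneous.take {l : List (ℤ × T)} (h : Homogeneous 𝒯 l) (n : ℕ) :
    Homogeneous 𝒯 (l.take n) := fun a ha => h a (List.mem_of_mem_take ha)

theorem Homogeneous.drop {l : List (ℤ × T)} (h : Homogeneous 𝒯 l) (n : ℕ) :
    Homogeneous 𝒯 (l.drop n) := fun a ha => h a (List.mem_of_mem_drop ha)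

end Homogeneous

@[simp] theorem degSum_nil {T : Type*} : degSum ([] : List (ℤ × T)) = 0 := rfl
@[simp] theorem degSum_cons {T : Type*} (a : ℤ × T) (l : List (ℤ × T)) :
    degSum (a :: l) = a.1 + degSum l := by simp [degSum]
@[simp] theorem degSum_append {T : Type*} (l l' : List (ℤ × T)) :
    degSum (l ++ l') = degSum l + degSum l' := by simp [degSum]

@[simp] theorem shiftedDegSum_nil {T : Type*} : shiftedDegSum ([] : List (ℤ × T)) = 0 := rfl
@[simp] theorem shiftedDegSum_cons {T : Type*} (a : ℤ × T) (l : List (ℤ × T)) :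
    shiftedDegSum (a :: l) = a.1 - 1 + shiftedDegSum l := by simp [shiftedDegSum]
@[simp] theorem shiftedDegSum_append {T : Type*} (l l' : List (ℤ × T)) :
    shiftedDegSum (l ++ l') = shiftedDegSum l + shiftedDegSum l' := by simp [shiftedDegSum]

@[simp] theorem totalDeg_nil : totalDeg ([] : List (ℤ × V)) = 0 := by simp [totalDeg]
@[simp] theorem totalDeg_cons (a : ℤ × V) (l : List (ℤ × V)) :
    totalDeg (a :: l) = a.1 + 1 + totalDeg l := by simp [totalDeg]; ring

/-- The degree of `v₁ ⊗ ⋯ ⊗ vₙ` in the grading in which `v ∈ 𝒱 p` has degree `p • α + β`. -/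
def weight {G : Type*} [AddCommGroup G] (α β : G) (l : List (ℤ × V)) : G :=
  degSum l • α + (l.length : ℤ) • β

section weight
variable {G : Type*} [AddCommGroup G] (α β : G)

@[simp] theorem weight_nil : weight α β ([] : List (ℤ × V)) = 0 := by simp [weight]

theorem weight_cons (a : ℤ × V) (l : List (ℤ × V)) :
    weight α β (a :: l) = a.1 • α + β + weight α β l := by
  simp only [weight, degSum_cons, List.length_cons, Nat.cast_add, Nat.cast_one, add_smul, one_smul]
  abel

theorem weight_append (l l' : List (ℤ × V)) :
    weight α β (l ++ l') = weight α β l + weight α β l' := by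
  simp only [weight, degSum_append, List.length_append, Nat.cast_add, add_smul]
  abel

theorem weight_one_one (l : List (ℤ × V)) : weight (1 : ℤ) 1 l = totalDeg l := by
  simp [weight, totalDeg]

/-- The part of degree `g` of the tensor algebra in the grading in which `v ∈ 𝒱 p` has degree
`p • α + β`. For `(α, β)` equal to `(1, 1)`, `(1, 0)` and `(0, 1)` in `ℤ` this is the grading by the
total, internal and external degree, and for `((1, 0), (0, 1))` in `ℤ × ℤ` the bigrading. -/
def weightPart (g : G) : Submodule k (TensorAlgebra k V) :=
  Submodule.span k {t | ∃ l : List (ℤ × V), Homogeneous 𝒱 l ∧ weight α β l = g ∧ t = tensorOf k l}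

variable {𝒱 α β}

theorem tensorOf_mem {l : List (ℤ × V)} (h : Homogeneous 𝒱 l) {g : G} (hg : weight α β l = g) :
    tensorOf k l ∈ weightPart 𝒱 α β g :=
  Submodule.subset_span ⟨l, h, hg, rfl⟩

theorem ι_mem {p : ℤ} {v : V} (h : v ∈ 𝒱 p) : TensorAlgebra.ι k v ∈ weightPart 𝒱 α β (p • α + β) := by
  have := tensorOf_mem (k := k) (𝒱 := 𝒱) (α := α) (β := β) (l := [(p, v)]) (by simpa using h) rfl
  simpa [weight_cons] using this

theorem one_mem_weightPart : (1 : TensorAlgebra k V) ∈ weightPart 𝒱 α β 0 := by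
  simpa using tensorOf_mem (k := k) (𝒱 := 𝒱) (α := α) (β := β) (l := []) (by simp) rfl

theorem weightPart_le {g : G} {W : Submodule k (TensorAlgebra k V)}
    (h : ∀ l : List (ℤ × V), Homogeneous 𝒱 l → weight α β l = g → tensorOf k l ∈ W) :
    weightPart 𝒱 α β g ≤ W := by
  rw [weightPart, Submodule.span_le]
  rintro _ ⟨l, h1, h2, rfl⟩
  exact h l h1 h2

/-- Linear maps on a graded part agree if they agree on the monomials. -/
theorem weightPart_ext {g : G} {M : Type*} [AddCommGroup M] [Module k M]
    {φ ψ : TensorAlgebra k V →ₗ[k] M}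
    (h : ∀ l : List (ℤ × V), Homogeneous 𝒱 l → weight α β l = g →
      φ (tensorOf k l) = ψ (tensorOf k l)) {t : TensorAlgebra k V}
    (ht : t ∈ weightPart 𝒱 α β g) : φ t = ψ t :=
  weightPart_le (W := LinearMap.eqLocus φ ψ) h ht

theorem map_weightPart_mem {g : G} {M : Type*} [AddCommGroup M] [Module k M]
    {φ : TensorAlgebra k V →ₗ[k] M} {W : Submodule k M}
    (h : ∀ l : List (ℤ × V), Homogeneous 𝒱 l → weight α β l = g → φ (tensorOf k l) ∈ W)
    {t : TensorAlgebra k V} (ht : t ∈ weightPart 𝒱 α β g) : φ t ∈ W :=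
  weightPart_le (W := W.comap φ) h ht

theorem mul_mem_weightPart {g h : G} {s t : TensorAlgebra k V} (hs : s ∈ weightPart 𝒱 α β g)
    (ht : t ∈ weightPart 𝒱 α β h) : s * t ∈ weightPart 𝒱 α β (g + h) := by
  refine map_weightPart_mem (φ := LinearMap.mulRight k t) (fun l hl hg => ?_) hs
  refine map_weightPart_mem (φ := LinearMap.mulLeft k (tensorOf k l)) (fun l' hl' hh => ?_) ht
  simp only [LinearMap.mulLeft_apply, ← tensorOf_append]
  exact tensorOf_mem (by simp [hl, hl']) (by rw [weight_append, hg, hh])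

end weight

variable [DirectSum.Decomposition 𝒱]

/-- Homogeneous elements span `V`. -/
theorem homogeneous_induction {W : Submodule k V} (h : ∀ p, ∀ v ∈ 𝒱 p, v ∈ W) (v : V) : v ∈ W := by
  induction v using DirectSum.Decomposition.inductionOn 𝒱 with
  | zero => exact W.zero_mem
  | homogeneous x => exact h _ _ x.2
  | add x y hx hy => exact W.add_mem hx hy

theorem homogeneous_ext {M : Type*} [AddCommGroup M] [Module k M] {φ ψ : V →ₗ[k] M}
    (h : ∀ p, ∀ v ∈ 𝒱 p, φ v = ψ v) : φ = ψ :=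
  LinearMap.ext fun v => homogeneous_induction 𝒱 (W := LinearMap.eqLocus φ ψ) h v

/-- Monomials in homogeneous elements span the tensor algebra. -/
theorem tensor_mem_of_monomials {W : Submodule k (TensorAlgebra k V)}
    (h : ∀ l : List (ℤ × V), Homogeneous 𝒱 l → tensorOf k l ∈ W) (t : TensorAlgebra k V) :
    t ∈ W := by
  suffices H : ∀ t ∈ Submodule.span k {t | ∃ l : List (ℤ × V), Homogeneous 𝒱 l ∧
      t = tensorOf k l}, ∀ s : TensorAlgebra k V, s * t ∈ Submodule.span k
        {t | ∃ l : List (ℤ × V), Homogeneous 𝒱 l ∧ t = tensorOf k l} by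
    have h1 := H 1 (Submodule.subset_span ⟨[], by simp, rfl⟩) t
    rw [mul_one] at h1
    refine Submodule.span_le.2 ?_ h1
    rintro _ ⟨l, hl, rfl⟩
    exact h l hl
  intro t ht s
  induction s using TensorAlgebra.induction generalizing t with
  | algebraMap r => rw [← Algebra.smul_def]; exact Submodule.smul_mem _ _ ht
  | ι x =>
    refine homogeneous_induction 𝒱
      (W := (Submodule.span k {t | ∃ l : List (ℤ × V), Homogeneous 𝒱 l ∧
        t = tensorOf k l}).comap (LinearMap.mulRight k t ∘ₗ TensorAlgebra.ι k)) (fun p v hv => ?_) x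
    simp only [Submodule.mem_comap, LinearMap.comp_apply, LinearMap.mulRight_apply]
    induction ht using Submodule.span_induction with
    | mem t ht =>
      obtain ⟨l, hl, rfl⟩ := ht
      exact Submodule.subset_span ⟨(p, v) :: l, by simp [hv, hl], by simp⟩
    | zero => simp
    | add a b _ _ ha hb => rw [mul_add]; exact Submodule.add_mem _ ha hb
    | smul c a _ ha => rw [mul_smul_comm]; exact Submodule.smul_mem _ _ ha
  | mul a b ha hb => rw [mul_assoc]; exact ha _ (hb _ ht)
  | add a b ha hb => rw [add_mul]; exact Submodule.add_mem _ (ha _ ht) (hb _ ht)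

theorem tensor_ext {M : Type*} [AddCommGroup M] [Module k M] {φ ψ : TensorAlgebra k V →ₗ[k] M}
    (h : ∀ l : List (ℤ × V), Homogeneous 𝒱 l → φ (tensorOf k l) = ψ (tensorOf k l)) : φ = ψ :=
  LinearMap.ext fun t => tensor_mem_of_monomials 𝒱 (W := LinearMap.eqLocus φ ψ) h t

section graded
variable {G : Type*} [AddCommGroup G] [DecidableEq G] (α β : G)

instance weightPart.gradedMonoid : SetLike.GradedMonoid (weightPart 𝒱 α β) where
  one_mem := one_mem_weightPart
  mul_mem _ _ _ _ ha hb := mul_mem_weightPart ha hb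

/-- The map `V → ⨁ g, weightPart 𝒱 α β g` that extends to the decomposition of the tensor
algebra. -/
def weightPart.decomposeι : V →ₗ[k] ⨁ g, weightPart 𝒱 α β g :=
  DirectSum.toModule k ℤ _ (fun p => DirectSum.lof k G (fun g => weightPart 𝒱 α β g) (p • α + β) ∘ₗ
    ((TensorAlgebra.ι k ∘ₗ (𝒱 p).subtype).codRestrict _ fun v => ι_mem v.2)) ∘ₗ
  (DirectSum.decomposeLinearEquiv 𝒱).toLinearMap

theorem weightPart.decomposeι_of_mem {p : ℤ} {v : V} (hv : v ∈ 𝒱 p) :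
    weightPart.decomposeι 𝒱 α β v = DirectSum.of (fun g => weightPart 𝒱 α β g) (p • α + β)
      ⟨TensorAlgebra.ι k v, ι_mem hv⟩ := by
  lift v to 𝒱 p using hv
  simp only [decomposeι, LinearMap.comp_apply, LinearEquiv.coe_coe,
    DirectSum.decomposeLinearEquiv_apply_coe, DirectSum.toModule_lof]
  rfl

theorem weightPart.lift_tensorOf (l : List (ℤ × V)) (hl : Homogeneous 𝒱 l) :
    TensorAlgebra.lift k (weightPart.decomposeι 𝒱 α β) (tensorOf k l) =
      DirectSum.of (fun g => weightPart 𝒱 α β g) (weight α β l)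
        ⟨tensorOf k l, tensorOf_mem hl rfl⟩ := by
  induction l with
  | nil =>
    rw [show TensorAlgebra.lift k (weightPart.decomposeι 𝒱 α β) (tensorOf k []) = 1 from map_one _]
    exact DirectSum.of_eq_of_gradedMonoid_eq (Sigma.subtype_ext (weight_nil α β).symm rfl)
  | cons a l ih =>
    have hl' := homogeneous_cons.1 hl
    have h1 : TensorAlgebra.lift k (weightPart.decomposeι 𝒱 α β) (tensorOf k (a :: l)) =
        TensorAlgebra.lift k (weightPart.decomposeι 𝒱 α β) (TensorAlgebra.ι k a.2) *
          TensorAlgebra.lift k (weightPart.decomposeι 𝒱 α β) (tensorOf k l) := by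
      rw [tensorOf_cons, map_mul]
    rw [h1, ih hl'.2, TensorAlgebra.lift_ι_apply,
      decomposeι_of_mem 𝒱 α β hl'.1, DirectSum.of_mul_of]
    exact DirectSum.of_eq_of_gradedMonoid_eq
      (Sigma.subtype_ext (weight_cons α β a l).symm (tensorOf_cons a l).symm)

instance weightPart.gradedAlgebra : GradedAlgebra (weightPart 𝒱 α β) :=
  GradedAlgebra.ofAlgHom _ (TensorAlgebra.lift k (weightPart.decomposeι 𝒱 α β))
    (by
      apply TensorAlgebra.hom_ext
      refine homogeneous_ext 𝒱 fun p v hv => ?_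
      simp only [LinearMap.comp_apply, AlgHom.toLinearMap_apply, AlgHom.comp_apply,
        TensorAlgebra.lift_ι_apply, decomposeι_of_mem 𝒱 α β hv, DirectSum.coeAlgHom_of,
        AlgHom.id_apply])
    (fun g x => by
      obtain ⟨x, hx⟩ := x
      refine Submodule.span_induction (p := fun x hx =>
        TensorAlgebra.lift k (weightPart.decomposeι 𝒱 α β) x =
          DirectSum.lof k G (fun g => weightPart 𝒱 α β g) g ⟨x, hx⟩) ?_ ?_ ?_ ?_ hx
      · rintro _ ⟨l, hl, rfl, rfl⟩
        exact weightPart.lift_tensorOf 𝒱 α β l hl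
      · rw [map_zero]
        exact (map_zero _).symm
      · intro x y hx hy h1 h2
        rw [map_add, h1, h2, ← map_add]
        rfl
      · intro c x hx h1
        rw [map_smul, h1, ← map_smul]
        rfl)

end graded
end Weights

section General

variable {k : Type u} [Field k] {H : Type v} [AddCommGroup H] [Module k H]
  (ℋ : ℤ → Submodule k H) [DirectSum.Decomposition ℋ]

/-! ### Sign automorphisms -/

theorem tmul_homogeneous_ext {M : Type*} [AddCommGroup M] [Module k M]
    {H' : Type*} [AddCommGroup H'] [Module k H'] (ℋ' : ℤ → Submodule k H')
    [DirectSum.Decomposition ℋ'] {φ ψ : H ⊗[k] H' →ₗ[k] M}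
    (h : ∀ p q, ∀ a ∈ ℋ p, ∀ b ∈ ℋ' q, φ (a ⊗ₜ b) = ψ (a ⊗ₜ b)) : φ = ψ := by
  refine TensorProduct.ext (homogeneous_ext ℋ fun p a ha => ?_)
  exact homogeneous_ext ℋ' fun q b hb => h p q a ha b hb

theorem signMap_comp_signMap (m n : ℤ) : signMap ℋ m ∘ₗ signMap ℋ n = signMap ℋ (m + n) := by
  refine homogeneous_ext ℋ fun p a ha => ?_
  rw [LinearMap.comp_apply, signMap_of_mem ℋ n ha, LinearMap.map_smul_of_tower,
    signMap_of_mem ℋ m ha, signMap_of_mem ℋ _ ha, smul_smul, ← Int.negOnePow_add]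
  congr 2; ring

theorem signMap_congr {m n : ℤ} (h : (m : ZMod 2) = n) : signMap ℋ m = signMap ℋ n := by
  refine homogeneous_ext ℋ fun p a ha => ?_
  rw [signMap_of_mem ℋ m ha, signMap_of_mem ℋ _ ha]
  congr 1
  exact Int.negOnePow_congr (by push_cast; rw [h])

@[simp] theorem signMap_zero : signMap ℋ 0 = LinearMap.id := by
  refine homogeneous_ext ℋ fun p a ha => ?_
  rw [signMap_of_mem ℋ 0 ha]
  simp

section
variable {H' : Type*} [AddCommGroup H'] [Module k H']

theorem negOnePow_smul_tmul (n : ℤ) (a : H) (b : H') :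
    (n.negOnePow • a) ⊗ₜ[k] b = n.negOnePow • (a ⊗ₜ[k] b) :=
  (TensorProduct.smul_tmul' _ _ _).symm

theorem tmul_negOnePow_smul (n : ℤ) (a : H) (b : H') :
    a ⊗ₜ[k] (n.negOnePow • b) = n.negOnePow • (a ⊗ₜ[k] b) :=
  TensorProduct.tmul_smul _ _ _

end

/-- The tensors of degree `n` in `H ⊗ H`. -/
def tensorPart (n : ℤ) : Submodule k (H ⊗[k] H) :=
  ⨆ p : ℤ, LinearMap.range (TensorProduct.map (ℋ p).subtype (ℋ (n - p)).subtype)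

variable {ℋ} in
theorem tmul_mem_tensorPart {p q n : ℤ} {a b : H} (ha : a ∈ ℋ p) (hb : b ∈ ℋ q) (h : p + q = n) :
    a ⊗ₜ b ∈ tensorPart ℋ n := by
  obtain rfl : q = n - p := by omega
  exact Submodule.mem_iSup_of_mem p ⟨⟨a, ha⟩ ⊗ₜ ⟨b, hb⟩, rfl⟩

variable {ℋ} in
theorem tensorPart_le {n : ℤ} {W : Submodule k (H ⊗[k] H)}
    (h : ∀ p q, p + q = n → ∀ a ∈ ℋ p, ∀ b ∈ ℋ q, a ⊗ₜ b ∈ W) : tensorPart ℋ n ≤ W := by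
  refine iSup_le fun p => ?_
  rintro _ ⟨t, rfl⟩
  induction t with
  | zero => simp
  | tmul a b => exact h p (n - p) (by ring) a a.2 b b.2
  | add a b ha hb => rw [map_add]; exact W.add_mem ha hb

variable {ℋ} in
theorem tensorPart_ext {n : ℤ} {M : Type*} [AddCommGroup M] [Module k M]
    {φ ψ : H ⊗[k] H →ₗ[k] M}
    (h : ∀ p q, p + q = n → ∀ a ∈ ℋ p, ∀ b ∈ ℋ q, φ (a ⊗ₜ b) = ψ (a ⊗ₜ b)) {t : H ⊗[k] H}
    (ht : t ∈ tensorPart ℋ n) : φ t = ψ t :=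
  tensorPart_le (W := LinearMap.eqLocus φ ψ) h ht

end General

section Act

variable {k : Type u} [Field k] {V : Type v} [AddCommGroup V] [Module k V]
  (𝒱 : ℤ → Submodule k V) [DirectSum.Decomposition 𝒱]

theorem inl_mem_unitGrading {n : ℤ} {v : V} (h : v ∈ 𝒱 n) : ((v, 0) : V × k) ∈ unitGrading 𝒱 n := by
  simp [unitGrading, h]

theorem one_mem_unitGrading : ((0, 1) : V × k) ∈ unitGrading 𝒱 0 := by
  simp [unitGrading]

theorem fst_mem_of_unitGrading {n : ℤ} {x : V × k} (h : x ∈ unitGrading 𝒱 n) : x.1 ∈ 𝒱 n :=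
  h.1

theorem snd_eq_zero_of_unitGrading {n : ℤ} (hn : n ≠ 0) {x : V × k} (h : x ∈ unitGrading 𝒱 n) :
    x.2 = 0 := by
  have := h.2
  simpa [hn] using this

/-- The degree-wise sign `t ↦ (-1) ^ (|t| * n) t` of the tensor algebra, for the total degree. -/
def tensorSign (n : ℤ) : TensorAlgebra k V →ₐ[k] TensorAlgebra k V :=
  TensorAlgebra.lift k (n.negOnePow • (TensorAlgebra.ι k ∘ₗ signMap 𝒱 n))

theorem tensorSign_tensorOf (n : ℤ) {l : List (ℤ × V)} (hl : Homogeneous 𝒱 l) :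
    tensorSign 𝒱 n (tensorOf k l) = (totalDeg l * n).negOnePow • tensorOf k l := by
  induction l with
  | nil => simp
  | cons a l ih =>
    rw [homogeneous_cons] at hl
    rw [tensorOf_cons, map_mul, ih hl.2, tensorSign, TensorAlgebra.lift_ι_apply,
      LinearMap.smul_apply, LinearMap.comp_apply, signMap_of_mem 𝒱 n hl.1,
      LinearMap.map_smul_of_tower]
    simp only [smul_mul_assoc, mul_smul_comm, smul_smul, ← Int.negOnePow_add, totalDeg_cons]
    congr 2; ring

/-- Abbreviation for the part of total degree `n` of the tensor algebra. -/
abbrev tensorTotal (n : ℤ) : Submodule k (TensorAlgebra k V) := weightPart 𝒱 (1 : ℤ) 1 n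

variable {𝒱} in
theorem tensorOf_mem_total {l : List (ℤ × V)} (hl : Homogeneous 𝒱 l) :
    tensorOf k l ∈ tensorTotal 𝒱 (totalDeg l) := tensorOf_mem hl (weight_one_one l)

theorem ι_mem_total {p : ℤ} {v : V} (h : v ∈ 𝒱 p) :
    TensorAlgebra.ι k v ∈ tensorTotal 𝒱 (p + 1) := by
  simpa using ι_mem (k := k) (α := (1 : ℤ)) (β := 1) h

theorem tensorSign_of_mem (n : ℤ) {m : ℤ} {t : TensorAlgebra k V} (ht : t ∈ tensorTotal 𝒱 m) :
    tensorSign 𝒱 n t = (m * n).negOnePow • t := by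
  refine weightPart_ext (φ := (tensorSign 𝒱 n).toLinearMap)
    (ψ := (m * n).negOnePow • LinearMap.id) (fun l hl hm => ?_) ht
  rw [weight_one_one] at hm
  subst hm
  exact tensorSign_tensorOf 𝒱 n hl

/-! ### The diagonal action -/

/-- The convolution `x ↦ ∑ f x₁ * g x₂` for `Δ x = ∑ x₁ ⊗ x₂`. -/
def conv (Δ : V × k →ₗ[k] (V × k) ⊗[k] (V × k)) (f g : V × k →ₗ[k] TensorAlgebra k V) :
    V × k →ₗ[k] TensorAlgebra k V :=
  LinearMap.mul' k (TensorAlgebra k V) ∘ₗ TensorProduct.map f g ∘ₗ Δ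

/-- The projection `H → V`, as a map to the tensor algebra. -/
def projV : V × k →ₗ[k] TensorAlgebra k V := TensorAlgebra.ι k ∘ₗ LinearMap.fst k V k

section conv
variable (Δ : V × k →ₗ[k] (V × k) ⊗[k] (V × k)) (f f' g g' : V × k →ₗ[k] TensorAlgebra k V)

theorem conv_add_left : conv Δ (f + f') g = conv Δ f g + conv Δ f' g := by
  simp [conv, TensorProduct.map_add_left, LinearMap.add_comp, LinearMap.comp_add]

theorem conv_add_right : conv Δ f (g + g') = conv Δ f g + conv Δ f g' := by
  simp [conv, TensorProduct.map_add_right, LinearMap.add_comp, LinearMap.comp_add]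

theorem conv_smul_left (c : k) : conv Δ (c • f) g = c • conv Δ f g := by
  simp [conv, TensorProduct.map_smul_left, LinearMap.smul_comp, LinearMap.comp_smul]

theorem conv_smul_right (c : k) : conv Δ f (c • g) = c • conv Δ f g := by
  simp [conv, TensorProduct.map_smul_right, LinearMap.smul_comp, LinearMap.comp_smul]

theorem conv_sign_left (n : ℤ) : conv Δ (n.negOnePow • f) g = n.negOnePow • conv Δ f g := by
  simp only [Units.smul_def, ← Int.cast_smul_eq_zsmul k, conv_smul_left]

theorem conv_sign_right (n : ℤ) : conv Δ f (n.negOnePow • g) = n.negOnePow • conv Δ f g := by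
  simp only [Units.smul_def, ← Int.cast_smul_eq_zsmul k, conv_smul_right]

end conv

/-- `x ↦ x * v`, for `v ∈ V` and the product `μ` of `H`, as a map to the tensor algebra. -/
def rightMul (μ : V × k →ₗ[k] V × k →ₗ[k] V × k) : V →ₗ[k] V × k →ₗ[k] TensorAlgebra k V :=
  LinearMap.compRight k projV ∘ₗ μ.flip ∘ₗ LinearMap.inl k V k

theorem rightMul_apply (μ : V × k →ₗ[k] V × k →ₗ[k] V × k) (v : V) (x : V × k) :
    rightMul μ v x = TensorAlgebra.ι k (μ x (v, 0)).1 := rfl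

/-- The operation `g ↦ (x ↦ ∑ ± (x₁ v) * g x₂)` on linear maps `g` from `H` to the tensor
algebra. -/
def actStep (μ : V × k →ₗ[k] V × k →ₗ[k] V × k) (Δ : V × k →ₗ[k] (V × k) ⊗[k] (V × k)) :
    V →ₗ[k] Module.End k (V × k →ₗ[k] TensorAlgebra k V) :=
  DirectSum.toModule k ℤ _ (fun p =>
    LinearMap.mk₂ k (fun (v : 𝒱 p) g => conv Δ (rightMul μ v) (g ∘ₗ signMap (unitGrading 𝒱) (p + 1)))
      (fun a b g => by simp [conv_add_left])
      (fun c a g => by simp [conv_smul_left])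
      (fun a g g' => by simp [LinearMap.add_comp, conv_add_right])
      (fun c a g => by simp [LinearMap.smul_comp, conv_smul_right])) ∘ₗ
  (DirectSum.decomposeLinearEquiv 𝒱).toLinearMap

/-- The diagonal action `y ↦ (x ↦ x * y)` of `H` on the tensor algebra, for the product `μ` and the
coproduct `Δ` on `H`. -/
def diagAct (μ : V × k →ₗ[k] V × k →ₗ[k] V × k) (Δ : V × k →ₗ[k] (V × k) ⊗[k] (V × k)) :
    TensorAlgebra k V →ₗ[k] V × k →ₗ[k] TensorAlgebra k V :=
  leftRec (actStep 𝒱 μ Δ) (Algebra.linearMap k (TensorAlgebra k V) ∘ₗ LinearMap.snd k V k)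

section act
variable (μ : V × k →ₗ[k] V × k →ₗ[k] V × k) (Δ : V × k →ₗ[k] (V × k) ⊗[k] (V × k))

theorem diagAct_one :
    diagAct 𝒱 μ Δ 1 = Algebra.linearMap k (TensorAlgebra k V) ∘ₗ LinearMap.snd k V k := by
  simp [diagAct]

variable {𝒱} in
/-- The recursion for the diagonal action: `x * (v t) = ∑ ± (x₁ v) ⊗ (x₂ * t)`, where `x₂` moves past
`v`, which has total degree `p + 1`. -/
theorem diagAct_ι_mul {p : ℤ} {v : V} (hv : v ∈ 𝒱 p) (t : TensorAlgebra k V) :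
    diagAct 𝒱 μ Δ (TensorAlgebra.ι k v * t) =
      conv Δ (rightMul μ v) (diagAct 𝒱 μ Δ t ∘ₗ signMap (unitGrading 𝒱) (p + 1)) := by
  rw [diagAct, leftRec_ι_mul]
  lift v to 𝒱 p using hv
  simp only [actStep, LinearMap.comp_apply, LinearEquiv.coe_coe,
    DirectSum.decomposeLinearEquiv_apply_coe, DirectSum.toModule_lof]
  rfl

/-- The diagonal action, defined by recursion, agrees with the action of the statement on monomials. -/
theorem diagAct_tensorOf (S : DGBialgebra k (V × k) (unitGrading 𝒱))
    (hε : S.counit = LinearMap.snd k V k) {l : List (ℤ × V)} (hl : Homogeneous 𝒱 l) :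
    diagAct 𝒱 S.mul S.comul (tensorOf k l) = S.act l := by
  induction l with
  | nil => rw [tensorOf_nil, diagAct_one, DGBialgebra.act, hε]
  | cons a l ih =>
    rw [homogeneous_cons] at hl
    rw [tensorOf_cons, diagAct_ι_mul S.mul S.comul hl.1, ih hl.2]
    rfl

end act

/-- Elements of `H ⊗ H` are sums of homogeneous ones, so the degree of the coproduct gives
the compatibility with signs. -/
theorem comul_signMap {Δ : V × k →ₗ[k] (V × k) ⊗[k] (V × k)}
    (hΔ : ∀ n, ∀ x ∈ unitGrading 𝒱 n, Δ x ∈ tensorPart (unitGrading 𝒱) n) (n : ℤ) :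
    Δ ∘ₗ signMap (unitGrading 𝒱) n =
      TensorProduct.map (signMap (unitGrading 𝒱) n) (signMap (unitGrading 𝒱) n) ∘ₗ Δ := by
  refine homogeneous_ext (unitGrading 𝒱) fun p x hx => ?_
  rw [LinearMap.comp_apply, signMap_of_mem _ n hx, LinearMap.map_smul_of_tower]
  refine tensorPart_ext (φ := (p * n).negOnePow • LinearMap.id) (ψ := TensorProduct.map _ _)
    (fun q r hqr a ha b hb => ?_) (hΔ p x hx)
  rw [TensorProduct.map_tmul, signMap_of_mem _ n ha, signMap_of_mem _ n hb]
  simp only [negOnePow_smul_tmul, tmul_negOnePow_smul, smul_smul, ← Int.negOnePow_add,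
    LinearMap.smul_apply, LinearMap.id_apply]
  congr 2
  rw [← hqr]; ring

theorem conv_comp_signMap {Δ : V × k →ₗ[k] (V × k) ⊗[k] (V × k)}
    (hΔ : ∀ n, ∀ x ∈ unitGrading 𝒱 n, Δ x ∈ tensorPart (unitGrading 𝒱) n)
    (f g : V × k →ₗ[k] TensorAlgebra k V) (n : ℤ) :
    conv Δ f g ∘ₗ signMap (unitGrading 𝒱) n =
      conv Δ (f ∘ₗ signMap (unitGrading 𝒱) n) (g ∘ₗ signMap (unitGrading 𝒱) n) := by
  simp only [conv, LinearMap.comp_assoc, comul_signMap 𝒱 hΔ, TensorProduct.map_comp]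

/-- The coassociativity of `Δ` makes the convolution associative. -/
theorem conv_assoc {Δ : V × k →ₗ[k] (V × k) ⊗[k] (V × k)}
    (hΔ : (TensorProduct.assoc k _ _ _).toLinearMap ∘ₗ Δ.rTensor (V × k) ∘ₗ Δ =
      Δ.lTensor (V × k) ∘ₗ Δ) (f g h : V × k →ₗ[k] TensorAlgebra k V) :
    conv Δ (conv Δ f g) h = conv Δ f (conv Δ g h) := by
  have h1 : conv Δ (conv Δ f g) h =
      (LinearMap.mul' k _ ∘ₗ TensorProduct.map f (LinearMap.mul' k _ ∘ₗ TensorProduct.map g h)) ∘ₗ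
        (TensorProduct.assoc k _ _ _).toLinearMap ∘ₗ Δ.rTensor (V × k) ∘ₗ Δ := by
    simp only [conv, ← LinearMap.comp_assoc]
    congr 1
    refine TensorProduct.ext' fun x y => ?_
    simp only [LinearMap.comp_apply, TensorProduct.map_tmul, LinearMap.rTensor_tmul,
      LinearEquiv.coe_coe]
    generalize Δ x = w
    induction w with
    | zero => simp
    | tmul a b => simp [mul_assoc]
    | add a b ha hb => simp only [map_add, TensorProduct.add_tmul] at *; rw [ha, hb]
  rw [h1, hΔ]
  simp only [conv, ← LinearMap.comp_assoc]
  congr 1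
  refine TensorProduct.ext' fun x y => ?_
  simp


section Bialgebra

variable {𝒱}
variable (S : DGBialgebra k (V × k) (unitGrading 𝒱))

theorem DGBialgebra.comul_mem' (n : ℤ) (x : V × k) (hx : x ∈ unitGrading 𝒱 n) :
    S.comul x ∈ tensorPart (unitGrading 𝒱) n := S.comul_mem n x hx

theorem conv_counit_left (hε : S.counit = LinearMap.snd k V k)
    (g : V × k →ₗ[k] TensorAlgebra k V) :
    conv S.comul (Algebra.linearMap k (TensorAlgebra k V) ∘ₗ LinearMap.snd k V k) g = g := by
  have h1 : conv S.comul (Algebra.linearMap k (TensorAlgebra k V) ∘ₗ LinearMap.snd k V k) g =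
      (g ∘ₗ (TensorProduct.lid k (V × k)).toLinearMap) ∘ₗ S.counit.rTensor (V × k) ∘ₗ S.comul := by
    rw [hε]
    simp only [conv, ← LinearMap.comp_assoc]
    congr 1
    refine TensorProduct.ext' fun x y => ?_
    simp [Algebra.smul_def]
  rw [h1, S.rTensor_counit_comp_comul]
  ext <;> simp

theorem conv_counit_right (hε : S.counit = LinearMap.snd k V k)
    (g : V × k →ₗ[k] TensorAlgebra k V) :
    conv S.comul g (Algebra.linearMap k (TensorAlgebra k V) ∘ₗ LinearMap.snd k V k) = g := by
  have h1 : conv S.comul g (Algebra.linearMap k (TensorAlgebra k V) ∘ₗ LinearMap.snd k V k) =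
      (g ∘ₗ (TensorProduct.rid k (V × k)).toLinearMap) ∘ₗ S.counit.lTensor (V × k) ∘ₗ S.comul := by
    rw [hε]
    simp only [conv, ← LinearMap.comp_assoc]
    congr 1
    refine TensorProduct.ext' fun x y => ?_
    simp [Algebra.smul_def, Algebra.commutes]
  rw [h1, S.lTensor_counit_comp_comul]
  ext <;> simp

/-- `V` is an ideal of `H`. -/
theorem mul_inl_eq (hε : S.counit = LinearMap.snd k V k) (x : V × k) (v : V) :
    S.mul x (v, 0) = ((S.mul x (v, 0)).1, 0) := by
  have := S.counit_mul x (v, 0)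
  rw [hε] at this
  exact Prod.ext rfl (by simpa using this)

/-- The action on a tensor algebra is an action on an algebra. -/
theorem diagAct_mul (hε : S.counit = LinearMap.snd k V k) {n : ℤ} {s : TensorAlgebra k V}
    (hs : s ∈ tensorTotal 𝒱 n) (t : TensorAlgebra k V) :
    diagAct 𝒱 S.mul S.comul (s * t) = conv S.comul (diagAct 𝒱 S.mul S.comul s)
      (diagAct 𝒱 S.mul S.comul t ∘ₗ signMap (unitGrading 𝒱) n) := by
  refine weightPart_ext (φ := diagAct 𝒱 S.mul S.comul ∘ₗ LinearMap.mulRight k t)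
    (ψ := (LinearMap.mk₂ k (conv S.comul) (conv_add_left _) (fun c f g => conv_smul_left _ f g c)
      (conv_add_right _) (fun c f g => conv_smul_right _ f g c)).flip
        (diagAct 𝒱 S.mul S.comul t ∘ₗ signMap (unitGrading 𝒱) n) ∘ₗ diagAct 𝒱 S.mul S.comul)
    (fun l hl hn => ?_) hs
  simp only [LinearMap.comp_apply, LinearMap.mulRight_apply, LinearMap.flip_apply,
    LinearMap.mk₂_apply]
  rw [weight_one_one] at hn
  clear hs
  induction l generalizing n with
  | nil =>
    rw [totalDeg_nil] at hn
    subst hn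
    rw [tensorOf_nil, one_mul, diagAct_one, conv_counit_left S hε, signMap_zero,
      LinearMap.comp_id]
  | cons a l ih =>
    rw [homogeneous_cons] at hl
    rw [totalDeg_cons] at hn
    rw [tensorOf_cons, mul_assoc, diagAct_ι_mul _ _ hl.1, diagAct_ι_mul _ _ hl.1, ih hl.2 rfl,
      conv_assoc S.coassoc, conv_comp_signMap 𝒱 S.comul_mem', LinearMap.comp_assoc,
      signMap_comp_signMap, ← hn, add_comm (totalDeg l)]

theorem diagAct_apply_one (h1 : S.one = (0, 1)) (t : TensorAlgebra k V) :
    diagAct 𝒱 S.mul S.comul t (0, 1) = t := by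
  have h2 : S.comul (0, 1) = (0, 1) ⊗ₜ (0, 1) := by rw [← h1, S.comul_one]
  have key : (LinearMap.applyₗ (0, 1)) ∘ₗ diagAct 𝒱 S.mul S.comul = LinearMap.id := by
    refine tensor_ext 𝒱 fun l hl => ?_
    induction l with
    | nil => simp [diagAct_one]
    | cons a l ih =>
      rw [homogeneous_cons] at hl
      simp only [LinearMap.comp_apply, LinearMap.applyₗ_apply_apply, LinearMap.id_apply] at ih ⊢
      rw [tensorOf_cons, diagAct_ι_mul _ _ hl.1, conv, LinearMap.comp_apply, LinearMap.comp_apply,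
        h2, TensorProduct.map_tmul, LinearMap.comp_apply,
        signMap_of_mem _ _ (one_mem_unitGrading 𝒱), LinearMap.mul'_apply]
      rw [zero_mul, Int.negOnePow_zero, one_smul, ih hl.2, rightMul_apply, ← h1, S.one_mul]
  exact LinearMap.congr_fun key t

/-- The associativity of the action. -/
theorem diagAct_apply_mul (hε : S.counit = LinearMap.snd k V k) (x x' : V × k)
    (t : TensorAlgebra k V) :
    diagAct 𝒱 S.mul S.comul t (S.mul x x') =
      diagAct 𝒱 S.mul S.comul (diagAct 𝒱 S.mul S.comul t x') x := by
  suffices key : ∀ l : List (ℤ × V), Homogeneous 𝒱 l → ∀ x x' : V × k,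
      diagAct 𝒱 S.mul S.comul (tensorOf k l) (S.mul x x') =
        diagAct 𝒱 S.mul S.comul (diagAct 𝒱 S.mul S.comul (tensorOf k l) x') x from
    LinearMap.congr_fun (tensor_ext 𝒱
      (φ := LinearMap.applyₗ (S.mul x x') ∘ₗ diagAct 𝒱 S.mul S.comul)
      (ψ := LinearMap.applyₗ x ∘ₗ diagAct 𝒱 S.mul S.comul ∘ₗ LinearMap.applyₗ x' ∘ₗ
        diagAct 𝒱 S.mul S.comul) fun l hl => key l hl x x') t
  intro l hl
  induction l with
  | nil =>
    intro x x'
    have h := S.counit_mul x x'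
    rw [hε] at h
    simp only [LinearMap.snd_apply] at h
    simp only [tensorOf_nil, diagAct_one, LinearMap.comp_apply, LinearMap.snd_apply,
      Algebra.linearMap_apply, h]
    rw [Algebra.algebraMap_eq_smul_one x'.2, map_smul, diagAct_one, LinearMap.smul_apply,
      LinearMap.comp_apply, Algebra.linearMap_apply, map_mul, LinearMap.snd_apply, Algebra.smul_def,
      ← map_mul, ← map_mul, mul_comm]
  | cons a l ih =>
    -- Both sides are linear in the coproducts of `x` and `x'`, which are replaced by pure tensors;
    -- the identity is then the associativity of the product, and a comparison of signs.
    rw [homogeneous_cons] at hl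
    obtain ⟨p, v⟩ := a
    intro x x'
    replace ih := ih hl.2
    simp only at hl
    rw [tensorOf_cons, diagAct_ι_mul _ _ hl.1]
    simp only [conv, LinearMap.comp_apply, S.comul_mul]
    generalize S.comul x' = w'
    refine LinearMap.congr_fun (tmul_homogeneous_ext (unitGrading 𝒱) (unitGrading 𝒱)
      (φ := (LinearMap.mul' k (TensorAlgebra k V) ∘ₗ TensorProduct.map (rightMul S.mul v)
        (diagAct 𝒱 S.mul S.comul (tensorOf k l) ∘ₗ signMap (unitGrading 𝒱) (p + 1))) ∘ₗ
        koszulMul (unitGrading 𝒱) S.mul (S.comul x))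
      (ψ := LinearMap.applyₗ x ∘ₗ diagAct 𝒱 S.mul S.comul ∘ₗ
        LinearMap.mul' k (TensorAlgebra k V) ∘ₗ TensorProduct.map (rightMul S.mul v)
        (diagAct 𝒱 S.mul S.comul (tensorOf k l) ∘ₗ signMap (unitGrading 𝒱) (p + 1)))
      fun q r a' ha' b' hb' => ?_) w'
    simp only [LinearMap.comp_apply, LinearMap.applyₗ_apply_apply, TensorProduct.map_tmul,
      signMap_of_mem _ _ hb', LinearMap.mul'_apply, rightMul_apply, LinearMap.map_smul_of_tower,
      mul_smul_comm]
    have hav := S.mul_mem _ _ a' ha' _ (inl_mem_unitGrading 𝒱 hl.1)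
    rw [diagAct_ι_mul _ _ (fst_mem_of_unitGrading 𝒱 hav)]
    simp only [conv, LinearMap.comp_apply]
    generalize S.comul x = w
    refine LinearMap.congr_fun (tmul_homogeneous_ext (unitGrading 𝒱) (unitGrading 𝒱)
      (φ := (LinearMap.mul' k (TensorAlgebra k V) ∘ₗ TensorProduct.map (rightMul S.mul v)
        (diagAct 𝒱 S.mul S.comul (tensorOf k l) ∘ₗ signMap (unitGrading 𝒱) (p + 1))) ∘ₗ
        (koszulMul (unitGrading 𝒱) S.mul).flip (a' ⊗ₜ b'))
      (ψ := (r * (p + 1)).negOnePow • (LinearMap.mul' k (TensorAlgebra k V) ∘ₗ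
        TensorProduct.map (rightMul S.mul (S.mul a' (v, 0)).1)
        (diagAct 𝒱 S.mul S.comul (diagAct 𝒱 S.mul S.comul (tensorOf k l) b') ∘ₗ
          signMap (unitGrading 𝒱) (q + p + 1))))
      fun q' r' a ha b hb => ?_) w
    simp only [LinearMap.comp_apply, TensorProduct.map_tmul, LinearMap.flip_apply,
      LinearMap.smul_apply, koszulMul_tmul (unitGrading 𝒱) S.mul hb ha',
      LinearMap.map_smul_of_tower, signMap_of_mem _ _ hb,
      signMap_of_mem _ _ (S.mul_mem _ _ b hb _ hb'), LinearMap.mul'_apply, mul_smul_comm,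
      smul_smul, ih, rightMul_apply, ← Int.negOnePow_add]
    rw [← mul_inl_eq S hε, S.mul_assoc]
    congr 1
    exact Int.negOnePow_congr (by push_cast; grind)

section weight
variable {G : Type*} [AddCommGroup G] {α β : G}

theorem conv_mem {f g : V × k →ₗ[k] TensorAlgebra k V} {a b : G} 
    (hf : ∀ p, ∀ x ∈ unitGrading 𝒱 p, f x ∈ weightPart 𝒱 α β (p • α + a))
    (hg : ∀ p, ∀ x ∈ unitGrading 𝒱 p, g x ∈ weightPart 𝒱 α β (p • α + b)) {p : ℤ} {x : V × k}
    (hx : x ∈ unitGrading 𝒱 p) : conv S.comul f g x ∈ weightPart 𝒱 α β (p • α + (a + b)) := by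
  refine tensorPart_le (W := (weightPart 𝒱 α β (p • α + (a + b))).comap
    (LinearMap.mul' k (TensorAlgebra k V) ∘ₗ TensorProduct.map f g)) (fun q r hqr y hy z hz => ?_)
    (S.comul_mem' p x hx)
  simp only [Submodule.mem_comap, LinearMap.comp_apply, TensorProduct.map_tmul,
    LinearMap.mul'_apply]
  have := mul_mem_weightPart (hf q y hy) (hg r z hz)
  rwa [add_add_add_comm, ← add_smul, hqr] at this

theorem diagAct_mem {p : ℤ} {x : V × k}
    (hx : x ∈ unitGrading 𝒱 p) {g : G} {t : TensorAlgebra k V} (ht : t ∈ weightPart 𝒱 α β g) :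
    diagAct 𝒱 S.mul S.comul t x ∈ weightPart 𝒱 α β (p • α + g) := by
  refine map_weightPart_mem (φ := LinearMap.applyₗ x ∘ₗ diagAct 𝒱 S.mul S.comul)
    (fun l hl hg => ?_) ht
  simp only [LinearMap.comp_apply, LinearMap.applyₗ_apply_apply]
  clear ht
  induction l generalizing p x g with
  | nil =>
    rw [weight_nil] at hg
    subst hg
    rw [tensorOf_nil, diagAct_one, LinearMap.comp_apply, LinearMap.snd_apply,
      Algebra.linearMap_apply]
    by_cases hp : p = 0
    · subst hp
      rw [zero_smul, add_zero, Algebra.algebraMap_eq_smul_one]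
      exact Submodule.smul_mem _ _ one_mem_weightPart
    · rw [snd_eq_zero_of_unitGrading 𝒱 hp hx, map_zero]
      exact Submodule.zero_mem _
  | cons a l ih =>
    rw [homogeneous_cons] at hl
    rw [tensorOf_cons, diagAct_ι_mul _ _ hl.1, ← hg, weight_cons]
    refine conv_mem S (fun q y hy => ?_) (fun q y hy => ?_) hx
    · have := ι_mem (k := k) (α := α) (β := β)
        (fst_mem_of_unitGrading 𝒱 (S.mul_mem _ _ y hy _ (inl_mem_unitGrading 𝒱 hl.1)))
      rwa [add_smul, add_assoc] at this
    · rw [LinearMap.comp_apply, signMap_of_mem _ _ hy, LinearMap.map_smul_of_tower]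
      exact (Submodule.smul_of_tower_mem _ _ (ih hy hl.2 rfl))

end weight

end Bialgebra

end Act

section Brace

variable {k : Type u} [Field k] {V : Type v} [AddCommGroup V] [Module k V]
  (𝒱 : ℤ → Submodule k V) [DirectSum.Decomposition 𝒱]

/-! ### The braces on the tensor algebra -/

section
variable (μ : V × k →ₗ[k] V × k →ₗ[k] V × k) (Δ : V × k →ₗ[k] (V × k) ⊗[k] (V × k))

/-- The recursion step of `braceMap`. -/
def braceStep : V →ₗ[k] Module.End k (List (ℤ × TensorAlgebra k V) → TensorAlgebra k V) :=
  LinearMap.mk₂ k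
    (fun v g Y => match Y with
      | [] => TensorAlgebra.ι k v * g []
      | y :: Y => TensorAlgebra.ι k v * g (y :: Y) + ((y.1 - 1) * shiftedDegSum Y).negOnePow •
          (diagAct 𝒱 μ Δ y.2 (v, 0) * tensorSign 𝒱 (y.1 - 1) (g Y)))
    (fun a b g => by
      funext Y
      have h (t) : diagAct 𝒱 μ Δ t (a + b, 0) = diagAct 𝒱 μ Δ t (a, 0) + diagAct 𝒱 μ Δ t (b, 0) := by
        rw [← map_add]; simp
      cases Y <;> simp [add_mul, h]
      abel)
    (fun c a g => by
      funext Y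
      have h (t) : diagAct 𝒱 μ Δ t (c • a, 0) = c • diagAct 𝒱 μ Δ t (a, 0) := by
        rw [← map_smul]; simp
      cases Y <;> simp [h, smul_comm c])
    (fun a g g' => by
      funext Y
      cases Y <;> simp [mul_add]
      abel)
    (fun c a g => by
      funext Y
      cases Y <;> simp [smul_comm c])

/-- The brace `x{y₁, …, yₙ}` of `x` in the tensor algebra with a list of elements of the tensor
algebra that are labelled with degrees. It is determined by `v{y} = v * y` (the diagonal action)
and `v{y₁, …, yₙ} = 0` for `v ∈ V` and `n ≥ 2`, and by the distributivity over the product,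
`(v t){y₁, …, yₙ} = v t{y₁, …, yₙ} ± v{y₁} t{y₂, …, yₙ}`. -/
def braceMap : TensorAlgebra k V →ₗ[k] List (ℤ × TensorAlgebra k V) → TensorAlgebra k V :=
  leftRec (braceStep 𝒱 μ Δ) fun Y => match Y with
    | [] => 1
    | _ :: _ => 0

@[simp] theorem braceMap_one_nil : braceMap 𝒱 μ Δ 1 [] = 1 := by simp [braceMap]

@[simp] theorem braceMap_one_cons (y : ℤ × TensorAlgebra k V) (Y : List (ℤ × TensorAlgebra k V)) :
    braceMap 𝒱 μ Δ 1 (y :: Y) = 0 := by simp [braceMap]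

theorem braceMap_ι_mul_nil (v : V) (t : TensorAlgebra k V) :
    braceMap 𝒱 μ Δ (TensorAlgebra.ι k v * t) [] = TensorAlgebra.ι k v * braceMap 𝒱 μ Δ t [] := by
  rw [braceMap, leftRec_ι_mul]; rfl

theorem braceMap_ι_mul_cons' (v : V) (t : TensorAlgebra k V) (y : ℤ × TensorAlgebra k V)
    (Y : List (ℤ × TensorAlgebra k V)) :
    braceMap 𝒱 μ Δ (TensorAlgebra.ι k v * t) (y :: Y) =
      TensorAlgebra.ι k v * braceMap 𝒱 μ Δ t (y :: Y) +
        ((y.1 - 1) * shiftedDegSum Y).negOnePow •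
          (diagAct 𝒱 μ Δ y.2 (v, 0) * tensorSign 𝒱 (y.1 - 1) (braceMap 𝒱 μ Δ t Y)) := by
  rw [braceMap, leftRec_ι_mul]; rfl

/-- Evaluation of the brace at a fixed list. -/
def braceAt (Y : List (ℤ × TensorAlgebra k V)) : TensorAlgebra k V →ₗ[k] TensorAlgebra k V :=
  LinearMap.proj Y ∘ₗ braceMap 𝒱 μ Δ

@[simp] theorem braceAt_apply (Y : List (ℤ × TensorAlgebra k V)) (t : TensorAlgebra k V) :
    braceAt 𝒱 μ Δ Y t = braceMap 𝒱 μ Δ t Y := rfl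

@[simp] theorem braceMap_nil (t : TensorAlgebra k V) : braceMap 𝒱 μ Δ t [] = t := by
  refine LinearMap.congr_fun (tensor_ext 𝒱 (φ := braceAt 𝒱 μ Δ []) (ψ := LinearMap.id)
    fun l hl => ?_) t
  induction l with
  | nil => simp
  | cons a l ih =>
    rw [homogeneous_cons] at hl
    rw [braceAt_apply, tensorOf_cons, braceMap_ι_mul_nil, ← braceAt_apply, ih hl.2]
    rfl

theorem braceMap_add_slot (t : TensorAlgebra k V) (Y Z : List (ℤ × TensorAlgebra k V)) (n : ℤ)
    (a b : TensorAlgebra k V) :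
    braceMap 𝒱 μ Δ t (Y ++ (n, a + b) :: Z) =
      braceMap 𝒱 μ Δ t (Y ++ (n, a) :: Z) + braceMap 𝒱 μ Δ t (Y ++ (n, b) :: Z) := by
  refine LinearMap.congr_fun (tensor_ext 𝒱 (φ := braceAt 𝒱 μ Δ (Y ++ (n, a + b) :: Z))
    (ψ := braceAt 𝒱 μ Δ (Y ++ (n, a) :: Z) + braceAt 𝒱 μ Δ (Y ++ (n, b) :: Z)) fun l hl => ?_) t
  simp only [LinearMap.add_apply, braceAt_apply]
  clear hl
  induction l generalizing Y with
  | nil => cases Y <;> simp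
  | cons c l ih =>
    cases Y with
    | nil =>
      simp only [tensorOf_cons, List.nil_append, braceMap_ι_mul_cons'] at ih ⊢
      have := ih []
      simp only [List.nil_append] at this
      rw [this]
      simp only [map_add, LinearMap.add_apply, add_mul, mul_add, smul_add]
      abel
    | cons y Y =>
      have h1 := ih (y :: Y)
      simp only [tensorOf_cons, List.cons_append, braceMap_ι_mul_cons'] at h1 ⊢
      rw [h1, ih Y]
      simp only [map_add, mul_add, smul_add, shiftedDegSum_append, shiftedDegSum_cons]
      abel

theorem braceMap_smul_slot (t : TensorAlgebra k V) (Y Z : List (ℤ × TensorAlgebra k V)) (n : ℤ)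
    (c : k) (a : TensorAlgebra k V) :
    braceMap 𝒱 μ Δ t (Y ++ (n, c • a) :: Z) = c • braceMap 𝒱 μ Δ t (Y ++ (n, a) :: Z) := by
  refine LinearMap.congr_fun (tensor_ext 𝒱 (φ := braceAt 𝒱 μ Δ (Y ++ (n, c • a) :: Z))
    (ψ := c • braceAt 𝒱 μ Δ (Y ++ (n, a) :: Z)) fun l hl => ?_) t
  simp only [LinearMap.smul_apply, braceAt_apply]
  clear hl
  induction l generalizing Y with
  | nil => cases Y <;> simp
  | cons d l ih =>
    cases Y with
    | nil =>
      have := ih []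
      simp only [tensorOf_cons, List.nil_append, braceMap_ι_mul_cons'] at this ⊢
      rw [this]
      simp only [map_smul, LinearMap.smul_apply, smul_mul_assoc, mul_smul_comm, smul_add,
        smul_comm c]
    | cons y Y =>
      have h1 := ih (y :: Y)
      simp only [tensorOf_cons, List.cons_append, braceMap_ι_mul_cons'] at h1 ⊢
      rw [h1, ih Y]
      simp only [map_smul, mul_smul_comm, smul_add, shiftedDegSum_append,
        shiftedDegSum_cons, smul_comm c]

end

section weight
variable {𝒱}
variable {G : Type*} [AddCommGroup G] {α β : G}

theorem tensorSign_mem_weightPart (n : ℤ) {g : G} {t : TensorAlgebra k V}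
    (ht : t ∈ weightPart 𝒱 α β g) : tensorSign 𝒱 n t ∈ weightPart 𝒱 α β g := by
  refine map_weightPart_mem (φ := (tensorSign 𝒱 n).toLinearMap) (fun l hl hg => ?_) ht
  rw [AlgHom.toLinearMap_apply, tensorSign_tensorOf 𝒱 n hl]
  exact Submodule.smul_of_tower_mem _ _ (tensorOf_mem hl hg)

end weight

section Bialgebra
variable {𝒱}
variable (S : DGBialgebra k (V × k) (unitGrading 𝒱))

/-- The degree of a brace, for each of the gradings of the tensor algebra. -/
theorem braceMap_mem_weightPart {G : Type*} [AddCommGroup G] {α β : G} {g : G}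
    {t : TensorAlgebra k V} (ht : t ∈ weightPart 𝒱 α β g) {Y : List (ℤ × TensorAlgebra k V)}
    {gs : List G} (hY : List.Forall₂ (fun y h => y.2 ∈ weightPart 𝒱 α β h) Y gs) :
    braceMap 𝒱 S.mul S.comul t Y ∈ weightPart 𝒱 α β (g + (gs.map (· - β)).sum) := by
  refine map_weightPart_mem (φ := braceAt 𝒱 S.mul S.comul Y) (fun l hl hg => ?_) ht
  rw [braceAt_apply]
  clear ht
  induction l generalizing Y gs g with
  | nil =>
    subst hg
    cases hY with
    | nil => simpa using one_mem_weightPart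
    | cons => simp
  | cons a l ih =>
    rw [homogeneous_cons] at hl
    subst hg
    cases hY with
    | nil =>
      rw [braceMap_nil]
      simpa using tensorOf_mem (α := α) (β := β) (homogeneous_cons.2 hl) rfl
    | @cons y h Y hs hy hY =>
      rw [tensorOf_cons, braceMap_ι_mul_cons']
      refine Submodule.add_mem _ ?_ (Submodule.smul_of_tower_mem _ _ ?_)
      · have := mul_mem_weightPart (ι_mem (α := α) (β := β) hl.1)
          (ih (List.Forall₂.cons hy hY) hl.2 rfl)
        rwa [← add_assoc, ← weight_cons] at this
      · have := mul_mem_weightPart (diagAct_mem S (inl_mem_unitGrading 𝒱 hl.1) hy)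
          (tensorSign_mem_weightPart (y.1 - 1) (ih hY hl.2 rfl))
        convert this using 2
        rw [weight_cons, List.map_cons, List.sum_cons]
        abel

theorem diagAct_mem_total {p n : ℤ} {x : V × k} (hx : x ∈ unitGrading 𝒱 p)
    {t : TensorAlgebra k V} (ht : t ∈ tensorTotal 𝒱 n) :
    diagAct 𝒱 S.mul S.comul t x ∈ tensorTotal 𝒱 (p + n) := by
  simpa using diagAct_mem S hx ht

theorem braceMap_mem {n : ℤ} {t : TensorAlgebra k V} (ht : t ∈ tensorTotal 𝒱 n)
    {Y : List (ℤ × TensorAlgebra k V)} (hY : Homogeneous (tensorTotal 𝒱) Y) :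
    braceMap 𝒱 S.mul S.comul t Y ∈ tensorTotal 𝒱 (n + shiftedDegSum Y) := by
  have h := braceMap_mem_weightPart S ht (gs := Y.map Prod.fst)
    (by rw [List.forall₂_map_right_iff, List.forall₂_same]; exact hY)
  rwa [List.map_map] at h

theorem braceMap_ι_mul_cons (v : V) {n : ℤ} {t : TensorAlgebra k V} (ht : t ∈ tensorTotal 𝒱 n)
    {y : ℤ × TensorAlgebra k V} {Y : List (ℤ × TensorAlgebra k V)}
    (hY : Homogeneous (tensorTotal 𝒱) Y) :
    braceMap 𝒱 S.mul S.comul (TensorAlgebra.ι k v * t) (y :: Y) =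
      TensorAlgebra.ι k v * braceMap 𝒱 S.mul S.comul t (y :: Y) +
        (n * (y.1 - 1)).negOnePow • (diagAct 𝒱 S.mul S.comul y.2 (v, 0) *
          braceMap 𝒱 S.mul S.comul t Y) := by
  rw [braceMap_ι_mul_cons', tensorSign_of_mem 𝒱 _ (braceMap_mem S ht hY), mul_smul_comm, smul_smul,
    ← Int.negOnePow_add]
  congr 2
  exact Int.negOnePow_congr (by push_cast; grind)

theorem braceMap_ι_cons (v : V) (y : ℤ × TensorAlgebra k V) (Y : List (ℤ × TensorAlgebra k V)) :
    braceMap 𝒱 S.mul S.comul (TensorAlgebra.ι k v) (y :: Y) = match Y with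
      | [] => diagAct 𝒱 S.mul S.comul y.2 (v, 0)
      | _ :: _ => 0 := by
  have := braceMap_ι_mul_cons' 𝒱 S.mul S.comul v 1 y Y
  rw [mul_one] at this
  rw [this]
  cases Y <;> simp

/-- The braces are distributive over the product. -/
theorem braceMap_mul {m n : ℤ} {s t : TensorAlgebra k V} (hs : s ∈ tensorTotal 𝒱 m)
    (ht : t ∈ tensorTotal 𝒱 n) {Y : List (ℤ × TensorAlgebra k V)}
    (hY : Homogeneous (tensorTotal 𝒱) Y) :
    braceMap 𝒱 S.mul S.comul (s * t) Y = ∑ i ∈ Finset.range (Y.length + 1),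
      (n * shiftedDegSum (Y.take i)).negOnePow •
        (braceMap 𝒱 S.mul S.comul s (Y.take i) * braceMap 𝒱 S.mul S.comul t (Y.drop i)) := by
  have key := weightPart_ext
    (φ := braceAt 𝒱 S.mul S.comul Y ∘ₗ LinearMap.mulRight k t)
    (ψ := ∑ i ∈ Finset.range (Y.length + 1), (n * shiftedDegSum (Y.take i)).negOnePow •
      (LinearMap.mulRight k (braceMap 𝒱 S.mul S.comul t (Y.drop i)) ∘ₗ
        braceAt 𝒱 S.mul S.comul (Y.take i))) (fun l hl hm => ?_) hs
  · simpa using key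
  simp only [LinearMap.comp_apply, LinearMap.sum_apply, LinearMap.smul_apply,
    LinearMap.mulRight_apply, braceAt_apply]
  clear hs hm
  induction l generalizing Y with
  | nil =>
    rw [Finset.sum_range_succ', Finset.sum_eq_zero]
    · simp
    · intro i hi
      cases Y with
      | nil => simp at hi
      | cons y Y => simp
  | cons a l ih =>
    rw [homogeneous_cons] at hl
    cases Y with
    | nil => simp
    | cons y Y =>
      have hY' := homogeneous_cons.1 hY
      have htl := mul_mem_weightPart (tensorOf_mem_total hl.2) ht
      rw [tensorOf_cons, mul_assoc, braceMap_ι_mul_cons S a.2 htl hY'.2, ih hY hl.2,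
        ih hY'.2 hl.2, List.length_cons, Finset.sum_range_succ', Finset.sum_range_succ' _ (_ + 1)]
      simp only [List.take_zero, List.drop_zero, List.take_succ_cons, List.drop_succ_cons,
        shiftedDegSum_nil, shiftedDegSum_cons, mul_zero, Int.negOnePow_zero, one_smul, braceMap_nil,
        mul_add, Finset.mul_sum, Finset.smul_sum, add_assoc]
      rw [add_left_comm, add_comm, ← Finset.sum_add_distrib, add_comm, mul_assoc]
      rw [add_comm]
      congr 1
      refine Finset.sum_congr rfl fun i _ => ?_
      rw [braceMap_ι_mul_cons S a.2 (tensorOf_mem_total hl.2) (hY'.2.take i)]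
      simp only [add_mul, smul_add, mul_smul_comm, smul_mul_assoc, smul_smul, mul_assoc,
        ← Int.negOnePow_add]
      congr 2
      exact Int.negOnePow_congr (by push_cast; ring)

/-- The compatibility of the braces with the diagonal action, `(x * y){Z} = x * (y{Z})`. -/
theorem braceMap_diagAct (hε : S.counit = LinearMap.snd k V k)
    {Z : List (ℤ × TensorAlgebra k V)} (hZ : Homogeneous (tensorTotal 𝒱) Z)
    (t : TensorAlgebra k V) (x : V × k) :
    braceMap 𝒱 S.mul S.comul (diagAct 𝒱 S.mul S.comul t x) Z =
      diagAct 𝒱 S.mul S.comul (braceMap 𝒱 S.mul S.comul t Z) x := by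
  suffices key : ∀ l : List (ℤ × V), Homogeneous 𝒱 l → ∀ x : V × k,
      braceMap 𝒱 S.mul S.comul (diagAct 𝒱 S.mul S.comul (tensorOf k l) x) Z =
        diagAct 𝒱 S.mul S.comul (braceMap 𝒱 S.mul S.comul (tensorOf k l) Z) x from
    LinearMap.congr_fun (tensor_ext 𝒱
      (φ := braceAt 𝒱 S.mul S.comul Z ∘ₗ LinearMap.applyₗ x ∘ₗ diagAct 𝒱 S.mul S.comul)
      (ψ := LinearMap.applyₗ x ∘ₗ diagAct 𝒱 S.mul S.comul ∘ₗ braceAt 𝒱 S.mul S.comul Z)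
      fun l hl => key l hl x) t
  intro l hl
  induction l generalizing Z with
  | nil =>
    intro x
    rw [tensorOf_nil, diagAct_one, LinearMap.comp_apply, Algebra.linearMap_apply,
      Algebra.algebraMap_eq_smul_one, map_smul, Pi.smul_apply]
    cases Z with
    | nil => simp [diagAct_one, Algebra.algebraMap_eq_smul_one]
    | cons z Z => simp
  | cons a l ih =>
    rw [homogeneous_cons] at hl
    obtain ⟨p, v⟩ := a
    intro x
    cases Z with
    | nil => simp
    | cons z Z =>
      have hZ' := homogeneous_cons.1 hZ
      have hv := hl.1
      simp only at hv
      rw [tensorOf_cons, braceMap_ι_mul_cons S v (tensorOf_mem_total hl.2) hZ'.2, map_add,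
        LinearMap.map_smul_of_tower, diagAct_ι_mul _ _ hv, diagAct_ι_mul _ _ hv,
        diagAct_mul S hε (diagAct_mem_total S (inl_mem_unitGrading 𝒱 hv) hZ'.1)]
      simp only [conv, LinearMap.comp_apply, LinearMap.add_apply, LinearMap.smul_apply]
      -- Both sides are linear in the coproduct of `x`, which is replaced by a pure tensor.
      refine LinearMap.congr_fun (tmul_homogeneous_ext (unitGrading 𝒱) (unitGrading 𝒱)
        (φ := braceAt 𝒱 S.mul S.comul (z :: Z) ∘ₗ
          LinearMap.mul' k (TensorAlgebra k V) ∘ₗ TensorProduct.map (rightMul S.mul v)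
          (diagAct 𝒱 S.mul S.comul (tensorOf k l) ∘ₗ signMap (unitGrading 𝒱) (p + 1)))
        (ψ := LinearMap.mul' k (TensorAlgebra k V) ∘ₗ TensorProduct.map (rightMul S.mul v)
            (diagAct 𝒱 S.mul S.comul (braceMap 𝒱 S.mul S.comul (tensorOf k l) (z :: Z)) ∘ₗ
              signMap (unitGrading 𝒱) (p + 1)) +
          (totalDeg l * (z.1 - 1)).negOnePow • (LinearMap.mul' k (TensorAlgebra k V) ∘ₗ
            TensorProduct.map (diagAct 𝒱 S.mul S.comul (diagAct 𝒱 S.mul S.comul z.2 (v, 0)))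
            (diagAct 𝒱 S.mul S.comul (braceMap 𝒱 S.mul S.comul (tensorOf k l) Z) ∘ₗ
              signMap (unitGrading 𝒱) (p + z.1))))
        (fun q r b hb c hc => ?_)) _
      simp only [LinearMap.comp_apply, LinearMap.add_apply, LinearMap.smul_apply,
        TensorProduct.map_tmul, signMap_of_mem _ _ hc, LinearMap.mul'_apply, rightMul_apply,
        LinearMap.map_smul_of_tower, mul_smul_comm, braceAt_apply]
      rw [braceMap_ι_mul_cons S _ (diagAct_mem_total S hc (tensorOf_mem_total hl.2)) hZ'.2,
        ← mul_inl_eq S hε, ih hZ hl.2, ih hZ'.2 hl.2, diagAct_apply_mul S hε]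
      simp only [smul_add, smul_smul, ← Int.negOnePow_add]
      congr 2
      exact Int.negOnePow_congr (by push_cast; grind)

end Bialgebra

end Brace

section BraceRelation

variable {k : Type u} [Field k] {V : Type v} [AddCommGroup V] [Module k V]
  {𝒱 : ℤ → Submodule k V} [DirectSum.Decomposition 𝒱]
  (S : DGBialgebra k (V × k) (unitGrading 𝒱))

/-! ### The brace relations -/

/-- The brace `y{z₁, …, zₙ}` in the tensor algebra, labelled with its degree. -/
def bracePair (y : ℤ × TensorAlgebra k V) (Z : List (ℤ × TensorAlgebra k V)) :
    ℤ × TensorAlgebra k V :=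
  (y.1 + shiftedDegSum Z, braceMap 𝒱 S.mul S.comul y.2 Z)

/-- The sum over all ways to insert consecutive blocks of the `z`'s into the `y`'s, of the values of
`F` at the resulting lists `z₁, …, y₁{…}, …, yₘ{…}, …, zₙ`, with Koszul signs. For
`F = (x{·})` this is the right-hand side of the brace relation. -/
def insertSum : (List (ℤ × TensorAlgebra k V) → TensorAlgebra k V) →
    List (ℤ × TensorAlgebra k V) → List (ℤ × TensorAlgebra k V) → TensorAlgebra k V
  | F, [], Z => F Z
  | F, y :: Y, Z =>
    ∑ i ∈ Finset.range (Z.length + 1), ∑ j ∈ Finset.range (Z.length - i + 1),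
      ((y.1 - 1) * shiftedDegSum (Z.take i) +
          shiftedDegSum Y * shiftedDegSum (Z.take (i + j))).negOnePow •
        insertSum (fun W => F (Z.take i ++ bracePair S y ((Z.drop i).take j) :: W)) Y
          (Z.drop (i + j))

variable {S} in
theorem bracePair_mem {y : ℤ × TensorAlgebra k V} (hy : y.2 ∈ tensorTotal 𝒱 y.1)
    {Z : List (ℤ × TensorAlgebra k V)} (hZ : Homogeneous (tensorTotal 𝒱) Z) :
    (bracePair S y Z).2 ∈ tensorTotal 𝒱 (bracePair S y Z).1 := braceMap_mem S hy hZ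

theorem insertSum_congr {F G : List (ℤ × TensorAlgebra k V) → TensorAlgebra k V}
    (h : ∀ W, Homogeneous (tensorTotal 𝒱) W → F W = G W) {Y Z : List (ℤ × TensorAlgebra k V)}
    (hY : Homogeneous (tensorTotal 𝒱) Y) (hZ : Homogeneous (tensorTotal 𝒱) Z) :
    insertSum S F Y Z = insertSum S G Y Z := by
  induction Y generalizing F G Z with
  | nil => exact h Z hZ
  | cons y Y ih =>
    rw [homogeneous_cons] at hY
    rw [insertSum, insertSum]
    refine Finset.sum_congr rfl fun i _ => Finset.sum_congr rfl fun j _ => ?_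
    congr 1
    refine ih (fun W hW => h _ ?_) hY.2 (hZ.drop _)
    simp only [homogeneous_append, homogeneous_cons]
    exact ⟨hZ.take _, bracePair_mem hY.1 ((hZ.drop _).take _), hW⟩

/-- The sum `insertSum` is linear in the function that is summed. -/
theorem insertSum_mul_add (a b : TensorAlgebra k V) (n : ℤ)
    (F G : List (ℤ × TensorAlgebra k V) → TensorAlgebra k V) (Y Z : List (ℤ × TensorAlgebra k V)) :
    insertSum S (fun W => a * F W + n.negOnePow • (b * G W)) Y Z =
      a * insertSum S F Y Z + n.negOnePow • (b * insertSum S G Y Z) := by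
  induction Y generalizing F G Z with
  | nil => rfl
  | cons y Y ih =>
    simp only [insertSum, ih, Finset.mul_sum, Finset.smul_sum, ← Finset.sum_add_distrib]
    refine Finset.sum_congr rfl fun i _ => Finset.sum_congr rfl fun j _ => ?_
    rw [smul_add, mul_smul_comm, mul_smul_comm, smul_comm n.negOnePow]

theorem insertSum_zero (Y Z : List (ℤ × TensorAlgebra k V)) :
    insertSum S (fun _ => 0) Y Z = 0 := by
  simpa using insertSum_mul_add S 0 0 0 (fun _ => 0) (fun _ => 0) Y Z

theorem insertSum_cons_nil (F : List (ℤ × TensorAlgebra k V) → TensorAlgebra k V)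
    (y : ℤ × TensorAlgebra k V) (Y : List (ℤ × TensorAlgebra k V)) :
    insertSum S F (y :: Y) [] = ∑ j ∈ Finset.range (([] : List (ℤ × TensorAlgebra k V)).length + 1),
      (shiftedDegSum Y * shiftedDegSum (([] : List (ℤ × TensorAlgebra k V)).take j)).negOnePow •
        insertSum S (fun W => F (bracePair S y (([] : List (ℤ × TensorAlgebra k V)).take j) :: W)) Y
          (([] : List (ℤ × TensorAlgebra k V)).drop j) := by
  simp [insertSum]

/-- The first `z` either stays in front of all of the `y`'s or it does not. -/
theorem insertSum_cons_cons (F : List (ℤ × TensorAlgebra k V) → TensorAlgebra k V)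
    (y z : ℤ × TensorAlgebra k V) (Y Z : List (ℤ × TensorAlgebra k V)) :
    insertSum S F (y :: Y) (z :: Z) = ∑ j ∈ Finset.range ((z :: Z).length + 1),
      (shiftedDegSum Y * shiftedDegSum ((z :: Z).take j)).negOnePow •
        insertSum S (fun W => F (bracePair S y ((z :: Z).take j) :: W)) Y ((z :: Z).drop j) +
      (shiftedDegSum (y :: Y) * (z.1 - 1)).negOnePow •
        insertSum S (fun W => F (z :: W)) (y :: Y) Z := by
  rw [insertSum, List.length_cons, Finset.sum_range_succ', add_comm]
  congr 1
  · simp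
  · rw [insertSum, Finset.smul_sum]
    refine Finset.sum_congr rfl fun i _ => ?_
    rw [Finset.smul_sum, Nat.add_sub_add_right]
    refine Finset.sum_congr rfl fun j _ => ?_
    rw [smul_smul, ← Int.negOnePow_add, show i + 1 + j = (i + j) + 1 by ring]
    simp only [List.take_succ_cons, List.drop_succ_cons, shiftedDegSum_cons, List.cons_append]
    congr 2
    ring

/-- The brace relations. -/
theorem braceMap_braceMap (hε : S.counit = LinearMap.snd k V k) {n : ℤ} {t : TensorAlgebra k V}
    (ht : t ∈ tensorTotal 𝒱 n) {Y Z : List (ℤ × TensorAlgebra k V)}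
    (hY : Homogeneous (tensorTotal 𝒱) Y) (hZ : Homogeneous (tensorTotal 𝒱) Z) :
    braceMap 𝒱 S.mul S.comul (braceMap 𝒱 S.mul S.comul t Y) Z =
      insertSum S (braceMap 𝒱 S.mul S.comul t) Y Z := by
  have key : ∀ l : List (ℤ × V), Homogeneous 𝒱 l →
      braceMap 𝒱 S.mul S.comul (braceMap 𝒱 S.mul S.comul (tensorOf k l) Y) Z =
        insertSum S (braceMap 𝒱 S.mul S.comul (tensorOf k l)) Y Z := by
    intro l hl
    clear ht
    induction l generalizing Y Z with
    | nil =>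
      cases Y with
      | nil => simp [insertSum]
      | cons y Y =>
        have h (l W : List (ℤ × TensorAlgebra k V)) (w : ℤ × TensorAlgebra k V) :
            braceMap 𝒱 S.mul S.comul 1 (l ++ w :: W) = 0 := by cases l <;> simp
        simp [insertSum, h, insertSum_zero]
    | cons a l ih =>
      rw [homogeneous_cons] at hl
      cases Y with
      | nil => simp [insertSum]
      | cons y Y =>
        have hY' := homogeneous_cons.1 hY
        have htl := tensorOf_mem_total (k := k) hl.2
        have step (w : ℤ × TensorAlgebra k V) {Y' Z' : List (ℤ × TensorAlgebra k V)}
            (hY' : Homogeneous (tensorTotal 𝒱) Y') (hZ' : Homogeneous (tensorTotal 𝒱) Z') :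
            insertSum S (fun W => braceMap 𝒱 S.mul S.comul (tensorOf k (a :: l)) (w :: W)) Y' Z' =
              TensorAlgebra.ι k a.2 *
                insertSum S (fun W => braceMap 𝒱 S.mul S.comul (tensorOf k l) (w :: W)) Y' Z' +
              (totalDeg l * (w.1 - 1)).negOnePow • (diagAct 𝒱 S.mul S.comul w.2 (a.2, 0) *
                braceMap 𝒱 S.mul S.comul (braceMap 𝒱 S.mul S.comul (tensorOf k l) Y') Z') := by
          rw [ih hY' hZ' hl.2, ← insertSum_mul_add]
          refine insertSum_congr S (fun W hW => ?_) hY' hZ'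
          rw [tensorOf_cons, braceMap_ι_mul_cons S _ htl hW]
        -- The terms in which the first `z`'s are inserted into `y`: either `y` is not inserted into
        -- the first factor `a` of the monomial, or it is, and then `(a * y){Z'} = a * y{Z'}`.
        have step2 : ∑ j ∈ Finset.range (Z.length + 1),
            (shiftedDegSum Y * shiftedDegSum (Z.take j)).negOnePow •
              insertSum S (fun W => braceMap 𝒱 S.mul S.comul (tensorOf k (a :: l))
                (bracePair S y (Z.take j) :: W)) Y (Z.drop j) =
            TensorAlgebra.ι k a.2 * ∑ j ∈ Finset.range (Z.length + 1),
              (shiftedDegSum Y * shiftedDegSum (Z.take j)).negOnePow •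
                insertSum S (fun W => braceMap 𝒱 S.mul S.comul (tensorOf k l)
                  (bracePair S y (Z.take j) :: W)) Y (Z.drop j) +
            (totalDeg l * (y.1 - 1)).negOnePow • braceMap 𝒱 S.mul S.comul
              (diagAct 𝒱 S.mul S.comul y.2 (a.2, 0) *
                braceMap 𝒱 S.mul S.comul (tensorOf k l) Y) Z := by
          rw [braceMap_mul S (diagAct_mem_total S (inl_mem_unitGrading 𝒱 hl.1) hY'.1)
            (braceMap_mem S htl hY'.2) hZ, Finset.mul_sum, Finset.smul_sum,
            ← Finset.sum_add_distrib]
          refine Finset.sum_congr rfl fun j _ => ?_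
          rw [step _ hY'.2 (hZ.drop j), braceMap_diagAct S hε (hZ.take j), smul_add, mul_smul_comm,
            smul_smul, smul_smul, ← Int.negOnePow_add, ← Int.negOnePow_add]
          simp only [bracePair]
          congr 2
          exact Int.negOnePow_congr (by push_cast; ring)
        have hL : braceMap 𝒱 S.mul S.comul (tensorOf k (a :: l)) (y :: Y) =
            TensorAlgebra.ι k a.2 * braceMap 𝒱 S.mul S.comul (tensorOf k l) (y :: Y) +
            (totalDeg l * (y.1 - 1)).negOnePow • (diagAct 𝒱 S.mul S.comul y.2 (a.2, 0) *
              braceMap 𝒱 S.mul S.comul (tensorOf k l) Y) := by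
          rw [tensorOf_cons, braceMap_ι_mul_cons S _ htl hY'.2]
        rw [hL, map_add, Pi.add_apply, LinearMap.map_smul_of_tower, Pi.smul_apply]
        cases Z with
        | nil =>
          rw [insertSum_cons_nil, step2, ← insertSum_cons_nil, ← ih hY hZ hl.2,
            braceMap_ι_mul_nil]
        | cons z Z =>
          have hZ' := homogeneous_cons.1 hZ
          rw [insertSum_cons_cons, step2, step z hY hZ'.2,
            braceMap_ι_mul_cons S _ (braceMap_mem S htl hY) hZ'.2, ih hY hZ hl.2,
            insertSum_cons_cons]
          simp only [mul_add, smul_add, mul_smul_comm, smul_smul, ← Int.negOnePow_add]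
          rw [show (totalDeg l + shiftedDegSum (y :: Y)) * (z.1 - 1) =
            shiftedDegSum (y :: Y) * (z.1 - 1) + totalDeg l * (z.1 - 1) by ring]
          abel
  suffices H : ∃ ψ : TensorAlgebra k V →ₗ[k] TensorAlgebra k V, ∀ t,
      ψ t = insertSum S (braceMap 𝒱 S.mul S.comul t) Y Z by
    obtain ⟨ψ, hψ⟩ := H
    rw [← hψ]
    refine weightPart_ext (φ := braceAt 𝒱 S.mul S.comul Z ∘ₗ braceAt 𝒱 S.mul S.comul Y)
      (fun l hl _ => ?_) ht
    rw [hψ, ← key l hl]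
    rfl
  refine ⟨⟨⟨fun t => insertSum S (braceMap 𝒱 S.mul S.comul t) Y Z, fun a b => ?_⟩,
    fun c a => ?_⟩, fun t => rfl⟩
  · have := insertSum_mul_add S 1 1 0 (braceMap 𝒱 S.mul S.comul a) (braceMap 𝒱 S.mul S.comul b) Y Z
    simp only [one_mul, Int.negOnePow_zero, one_smul] at this
    rw [map_add, ← this]
    rfl
  · have := insertSum_mul_add S (algebraMap k _ c) 0 0 (braceMap 𝒱 S.mul S.comul a)
      (braceMap 𝒱 S.mul S.comul a) Y Z
    simp only [zero_mul, smul_zero, add_zero, ← Algebra.smul_def] at this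
    simp only [map_smul, RingHom.id_apply]
    rw [← this]
    rfl

end BraceRelation

section Derivation

variable {k : Type u} [Field k] {V : Type v} [AddCommGroup V] [Module k V]
  (𝒱 : ℤ → Submodule k V) [DirectSum.Decomposition 𝒱]

/-! ### Derivations of the tensor algebra -/

/-- The derivation, of odd total degree, of the tensor algebra that extends `δ : V → TV`. -/
def derivationOf (δ : V →ₗ[k] TensorAlgebra k V) : TensorAlgebra k V →ₗ[k] TensorAlgebra k V :=
  leftPara (LinearMap.mk₂ k (fun v p => δ v * p.1 - TensorAlgebra.ι k (signMap 𝒱 1 v) * p.2)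
    (fun a b c => by simp [add_mul]; abel) (fun c a b => by simp [smul_sub])
    (fun a b c => by simp [mul_add]; abel) (fun c a b => by simp [smul_sub])) 0

section
variable (δ : V →ₗ[k] TensorAlgebra k V)

@[simp] theorem derivationOf_one : derivationOf 𝒱 δ 1 = 0 := by simp [derivationOf]

variable {𝒱} in
theorem derivationOf_ι_mul {p : ℤ} {v : V} (hv : v ∈ 𝒱 p) (t : TensorAlgebra k V) :
    derivationOf 𝒱 δ (TensorAlgebra.ι k v * t) =
      δ v * t + (p + 1).negOnePow • (TensorAlgebra.ι k v * derivationOf 𝒱 δ t) := by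
  rw [derivationOf, leftPara_ι_mul, LinearMap.mk₂_apply, signMap_of_mem _ _ hv, mul_one,
    LinearMap.map_smul_of_tower, smul_mul_assoc, Int.negOnePow_succ, Units.neg_smul, sub_eq_add_neg]

@[simp] theorem derivationOf_ι (v : V) : derivationOf 𝒱 δ (TensorAlgebra.ι k v) = δ v := by
  refine LinearMap.congr_fun (homogeneous_ext 𝒱 (φ := derivationOf 𝒱 δ ∘ₗ TensorAlgebra.ι k)
    fun p v hv => ?_) v
  have := derivationOf_ι_mul δ hv 1
  simpa using this

variable {𝒱}

theorem derivationOf_mul {n : ℤ} {s : TensorAlgebra k V} (hs : s ∈ tensorTotal 𝒱 n)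
    (t : TensorAlgebra k V) :
    derivationOf 𝒱 δ (s * t) =
      derivationOf 𝒱 δ s * t + n.negOnePow • (s * derivationOf 𝒱 δ t) := by
  refine weightPart_ext (φ := derivationOf 𝒱 δ ∘ₗ LinearMap.mulRight k t)
    (ψ := LinearMap.mulRight k t ∘ₗ derivationOf 𝒱 δ +
      n.negOnePow • LinearMap.mulRight k (derivationOf 𝒱 δ t)) (fun l hl hn => ?_) hs
  simp only [LinearMap.comp_apply, LinearMap.mulRight_apply, LinearMap.add_apply,
    LinearMap.smul_apply]
  rw [weight_one_one] at hn
  subst hn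
  clear hs
  induction l with
  | nil => simp
  | cons a l ih =>
    rw [homogeneous_cons] at hl
    rw [tensorOf_cons, mul_assoc, derivationOf_ι_mul δ hl.1, derivationOf_ι_mul δ hl.1, ih hl.2,
      totalDeg_cons, Int.negOnePow_add (a.1 + 1)]
    simp only [mul_add, add_mul, smul_add, smul_mul_assoc, mul_smul_comm, smul_smul, mul_assoc,
      add_assoc]

theorem derivationOf_add (δ' : V →ₗ[k] TensorAlgebra k V) :
    derivationOf 𝒱 (δ + δ') = derivationOf 𝒱 δ + derivationOf 𝒱 δ' := by
  refine tensor_ext 𝒱 fun l hl => ?_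
  induction l with
  | nil => simp
  | cons a l ih =>
    rw [homogeneous_cons] at hl
    rw [LinearMap.add_apply, tensorOf_cons, derivationOf_ι_mul _ hl.1, derivationOf_ι_mul _ hl.1,
      derivationOf_ι_mul _ hl.1, ih hl.2, LinearMap.add_apply, LinearMap.add_apply, mul_add,
      add_mul, smul_add]
    abel

theorem derivationOf_mem {G : Type*} [AddCommGroup G] {α β γ : G} {δ : V →ₗ[k] TensorAlgebra k V}
    (hδ : ∀ p, ∀ v ∈ 𝒱 p, δ v ∈ weightPart 𝒱 α β (p • α + β + γ)) {g : G} {t : TensorAlgebra k V}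
    (ht : t ∈ weightPart 𝒱 α β g) : derivationOf 𝒱 δ t ∈ weightPart 𝒱 α β (g + γ) := by
  refine map_weightPart_mem (φ := derivationOf 𝒱 δ) (fun l hl hg => ?_) ht
  clear ht
  induction l generalizing g with
  | nil => simp
  | cons a l ih =>
    rw [homogeneous_cons] at hl
    rw [tensorOf_cons, derivationOf_ι_mul δ hl.1, ← hg, weight_cons]
    refine Submodule.add_mem _ ?_ (Submodule.smul_of_tower_mem _ _ ?_)
    · have := mul_mem_weightPart (hδ _ _ hl.1) (tensorOf_mem (k := k) (α := α) (β := β) hl.2 rfl)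
      rwa [add_right_comm] at this
    · have := mul_mem_weightPart (ι_mem (α := α) (β := β) hl.1) (ih hl.2 rfl)
      rwa [← add_assoc] at this

/-- A derivation squares to zero if it does so on `V`. -/
theorem derivationOf_sq {δ : V →ₗ[k] TensorAlgebra k V}
    (hδ : ∀ p, ∀ v ∈ 𝒱 p, δ v ∈ tensorTotal 𝒱 (p + 1 + 1))
    (h0 : ∀ v, derivationOf 𝒱 δ (δ v) = 0) (t : TensorAlgebra k V) :
    derivationOf 𝒱 δ (derivationOf 𝒱 δ t) = 0 := by
  refine LinearMap.congr_fun (tensor_ext 𝒱 (φ := derivationOf 𝒱 δ ∘ₗ derivationOf 𝒱 δ) (ψ := 0)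
    fun l hl => ?_) t
  rw [LinearMap.comp_apply, LinearMap.zero_apply]
  induction l with
  | nil => simp
  | cons a l ih =>
    rw [homogeneous_cons] at hl
    rw [tensorOf_cons, derivationOf_ι_mul δ hl.1, map_add, derivationOf_mul δ (hδ _ _ hl.1), h0,
      LinearMap.map_smul_of_tower, derivationOf_ι_mul δ hl.1, ih hl.2,
      Int.negOnePow_succ (a.1 + 1)]
    simp

theorem derivationOf_mul' :
    derivationOf 𝒱 δ ∘ₗ LinearMap.mul' k (TensorAlgebra k V) =
      LinearMap.mul' k (TensorAlgebra k V) ∘ₗ (TensorProduct.map (derivationOf 𝒱 δ) LinearMap.id +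
        TensorProduct.map (tensorSign 𝒱 1).toLinearMap (derivationOf 𝒱 δ)) := by
  refine TensorProduct.ext (tensor_ext 𝒱 fun l hl => LinearMap.ext fun t => ?_)
  simp only [TensorProduct.mk_apply, LinearMap.comp_apply,
    LinearMap.mul'_apply, LinearMap.add_apply, TensorProduct.map_tmul, map_add, LinearMap.id_apply,
    AlgHom.toLinearMap_apply, LinearMap.compr₂ₛₗ_apply]
  rw [derivationOf_mul δ (tensorOf_mem_total hl), tensorSign_tensorOf 𝒱 _ hl, mul_one,
    smul_mul_assoc]

/-- A derivation of odd degree satisfies the Leibniz rule for convolutions. -/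
theorem derivationOf_conv (Δ : V × k →ₗ[k] (V × k) ⊗[k] (V × k))
    (f g : V × k →ₗ[k] TensorAlgebra k V) :
    derivationOf 𝒱 δ ∘ₗ conv Δ f g = conv Δ (derivationOf 𝒱 δ ∘ₗ f) g +
      conv Δ ((tensorSign 𝒱 1).toLinearMap ∘ₗ f) (derivationOf 𝒱 δ ∘ₗ g) := by
  rw [conv, ← LinearMap.comp_assoc, derivationOf_mul']
  simp only [conv, LinearMap.comp_assoc, LinearMap.add_comp, LinearMap.comp_add, 
    ← LinearMap.comp_assoc _ (TensorProduct.map f g), ← TensorProduct.map_comp, LinearMap.id_comp]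

end

/-! ### The cobar differential -/

section
variable (Δ : V × k →ₗ[k] (V × k) ⊗[k] (V × k)) (D : V × k →ₗ[k] V × k)

/-- The map `x ↦ ∑ (-1) ^ |x₁| π x₁ ⊗ π x₂` from `H` to `V ⊗ V`, inside the tensor algebra, for the
projection `π : H → V`. -/
def cobarExt : V × k →ₗ[k] TensorAlgebra k V :=
  conv Δ (projV ∘ₗ signMap (unitGrading 𝒱) 1) projV

/-- The differential of the cobar construction, restricted to the generators (and extended by zero
to `1`). -/
def cobarGen : V × k →ₗ[k] TensorAlgebra k V := projV ∘ₗ D + cobarExt 𝒱 Δ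

/-- The differential of the cobar construction: the derivation that extends
`v ↦ d v + ∑ (-1) ^ |v₁| v₁ ⊗ v₂`. -/
def cobarD : TensorAlgebra k V →ₗ[k] TensorAlgebra k V :=
  derivationOf 𝒱 (cobarGen 𝒱 Δ D ∘ₗ LinearMap.inl k V k)

end

variable {𝒱}
variable (S : DGBialgebra k (V × k) (unitGrading 𝒱))

theorem signMap_d (n : ℤ) : signMap (unitGrading 𝒱) n ∘ₗ S.d =
    n.negOnePow • (S.d ∘ₗ signMap (unitGrading 𝒱) n) := by
  refine homogeneous_ext (unitGrading 𝒱) fun p x hx => ?_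
  simp only [LinearMap.comp_apply, LinearMap.smul_apply]
  rw [signMap_of_mem _ _ hx, signMap_of_mem _ _ (S.d_mem _ _ hx), LinearMap.map_smul_of_tower,
    smul_smul, ← Int.negOnePow_add]
  congr 2
  ring

/-- The differential of `H` is a coderivation. -/
theorem conv_comp_d (f g : V × k →ₗ[k] TensorAlgebra k V) :
    conv S.comul f g ∘ₗ S.d = conv S.comul (f ∘ₗ S.d) g +
      conv S.comul (f ∘ₗ signMap (unitGrading 𝒱) 1) (g ∘ₗ S.d) := by
  refine LinearMap.ext fun x => ?_
  simp only [conv, LinearMap.comp_apply, LinearMap.add_apply, S.comul_d, map_add,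
    TensorProduct.map_map, LinearMap.comp_id]

theorem d_one_eq_zero (h1 : S.one = (0, 1)) : S.d (0, 1) = 0 := by
  have h := S.d_mul 0 S.one S.one_mem S.one
  rw [S.one_mul, S.one_mul, S.mul_one, Int.negOnePow_zero, one_smul] at h
  rw [← h1]
  simpa using h

theorem d_inl_eq (hε : S.counit = LinearMap.snd k V k) (v : V) :
    S.d (v, 0) = ((S.d (v, 0)).1, 0) := by
  have := S.counit_d (v, 0)
  rw [hε] at this
  exact Prod.ext rfl (by simpa using this)

theorem cobarExt_one (h1 : S.one = (0, 1)) : cobarExt 𝒱 S.comul (0, 1) = 0 := by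
  have h2 : S.comul (0, 1) = (0, 1) ⊗ₜ (0, 1) := by rw [← h1, S.comul_one]
  simp [cobarExt, conv, h2, projV]

theorem cobarGen_one (h1 : S.one = (0, 1)) : cobarGen 𝒱 S.comul S.d (0, 1) = 0 := by
  simp [cobarGen, cobarExt_one S h1, d_one_eq_zero S h1]

/-- On the image of all of `H`, the cobar differential is `cobarGen`, because `d 1_H = 0` and the
quadratic part vanishes at `1_H`. This allows calculations with the full coproduct in place of the
reduced one. -/
theorem cobarD_projV (h1 : S.one = (0, 1)) :
    cobarD 𝒱 S.comul S.d ∘ₗ projV = cobarGen 𝒱 S.comul S.d := by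
  refine LinearMap.prod_ext (LinearMap.ext fun v => ?_) (LinearMap.ext_ring ?_)
  · simp [cobarD, projV]
  · simp [projV, cobarGen_one S h1]

theorem tensorSign_projV (n : ℤ) : (tensorSign 𝒱 n).toLinearMap ∘ₗ projV =
    n.negOnePow • (projV ∘ₗ signMap (unitGrading 𝒱) n) := by
  refine homogeneous_ext (unitGrading 𝒱) fun p x hx => ?_
  simp only [LinearMap.comp_apply, LinearMap.smul_apply, projV, AlgHom.toLinearMap_apply,
    LinearMap.fst_apply]
  rw [tensorSign_of_mem 𝒱 n (ι_mem_total 𝒱 (fst_mem_of_unitGrading 𝒱 hx)), signMap_of_mem _ _ hx,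
    Prod.smul_fst, LinearMap.map_smul_of_tower, smul_smul, ← Int.negOnePow_add]
  congr 2
  ring

theorem projV_mem {G : Type*} [AddCommGroup G] {α β : G} {p : ℤ} {x : V × k}
    (hx : x ∈ unitGrading 𝒱 p) : projV x ∈ weightPart 𝒱 α β (p • α + β) :=
  ι_mem (fst_mem_of_unitGrading 𝒱 hx)

theorem cobarExt_mem {G : Type*} [AddCommGroup G] {α β : G} {p : ℤ} {x : V × k}
    (hx : x ∈ unitGrading 𝒱 p) :
    cobarExt 𝒱 S.comul x ∈ weightPart 𝒱 α β (p • α + (β + β)) := by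
  refine conv_mem S (fun q y hy => ?_) (fun q y hy => projV_mem hy) hx
  rw [LinearMap.comp_apply, signMap_of_mem _ _ hy, LinearMap.map_smul_of_tower]
  exact Submodule.smul_of_tower_mem _ _ (projV_mem hy)

theorem cobarGen_mem {p : ℤ} {x : V × k} (hx : x ∈ unitGrading 𝒱 p) :
    cobarGen 𝒱 S.comul S.d x ∈ tensorTotal 𝒱 (p + 1 + 1) := by
  refine Submodule.add_mem _ ?_ ?_
  · simpa using projV_mem (α := (1 : ℤ)) (β := 1) (S.d_mem p x hx)
  · simpa [add_assoc] using cobarExt_mem S (α := (1 : ℤ)) (β := 1) hx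

theorem cobarD_mem {n : ℤ} {t : TensorAlgebra k V} (ht : t ∈ tensorTotal 𝒱 n) :
    cobarD 𝒱 S.comul S.d t ∈ tensorTotal 𝒱 (n + 1) :=
  derivationOf_mem (fun p v hv => by simpa using cobarGen_mem S (inl_mem_unitGrading 𝒱 hv)) ht

/-- The cobar differential squares to zero: by `d ^ 2 = 0`, the compatibility of `d` with the coproduct,
and coassociativity. -/
theorem cobarD_sq (h1 : S.one = (0, 1)) (t : TensorAlgebra k V) :
    cobarD 𝒱 S.comul S.d (cobarD 𝒱 S.comul S.d t) = 0 := by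
  refine derivationOf_sq (fun p v hv => cobarGen_mem S (inl_mem_unitGrading 𝒱 hv))
    (fun v => ?_) t
  have hdd : S.d ∘ₗ S.d = 0 := LinearMap.ext S.d_d
  have key : cobarD 𝒱 S.comul S.d ∘ₗ cobarGen 𝒱 S.comul S.d = 0 := by
    have hσσ (f : V × k →ₗ[k] TensorAlgebra k V) :
        (f ∘ₗ signMap (unitGrading 𝒱) 1) ∘ₗ signMap (unitGrading 𝒱) 1 = f := by
      rw [LinearMap.comp_assoc, signMap_comp_signMap,
        signMap_congr (unitGrading 𝒱) (n := 0) (by decide), signMap_zero, LinearMap.comp_id]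
    have hσd : (projV ∘ₗ signMap (unitGrading 𝒱) 1) ∘ₗ S.d =
        (1 : ℤ).negOnePow • ((projV ∘ₗ S.d) ∘ₗ signMap (unitGrading 𝒱) 1) := by
      rw [LinearMap.comp_assoc, signMap_d, LinearMap.comp_smul, LinearMap.comp_assoc]
    have hgd : cobarGen 𝒱 S.comul S.d ∘ₗ S.d =
        (1 : ℤ).negOnePow • conv S.comul ((projV ∘ₗ S.d) ∘ₗ signMap (unitGrading 𝒱) 1) projV +
          conv S.comul projV (projV ∘ₗ S.d) := by
      rw [cobarGen, cobarExt, LinearMap.add_comp, LinearMap.comp_assoc, hdd, LinearMap.comp_zero,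
        zero_add, conv_comp_d, hσσ, hσd, conv_sign_left]
    have hgσ : cobarGen 𝒱 S.comul S.d ∘ₗ signMap (unitGrading 𝒱) 1 =
        (projV ∘ₗ S.d) ∘ₗ signMap (unitGrading 𝒱) 1 +
          conv S.comul projV (projV ∘ₗ signMap (unitGrading 𝒱) 1) := by
      rw [cobarGen, cobarExt, LinearMap.add_comp, conv_comp_signMap 𝒱 S.comul_mem', hσσ]
    have hDext : cobarD 𝒱 S.comul S.d ∘ₗ cobarExt 𝒱 S.comul =
        conv S.comul (cobarGen 𝒱 S.comul S.d ∘ₗ signMap (unitGrading 𝒱) 1) projV +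
          (1 : ℤ).negOnePow • conv S.comul projV (cobarGen 𝒱 S.comul S.d) := by
      rw [cobarExt, cobarD, derivationOf_conv, ← cobarD, ← LinearMap.comp_assoc,
        ← LinearMap.comp_assoc, cobarD_projV S h1, tensorSign_projV, LinearMap.smul_comp, hσσ,
        conv_sign_left]
    have hg : cobarGen 𝒱 S.comul S.d = projV ∘ₗ S.d +
        conv S.comul (projV ∘ₗ signMap (unitGrading 𝒱) 1) projV := rfl
    change cobarD 𝒱 S.comul S.d ∘ₗ (projV ∘ₗ S.d + cobarExt 𝒱 S.comul) = 0
    rw [LinearMap.comp_add, ← LinearMap.comp_assoc, cobarD_projV S h1, hDext, hgσ, hgd]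
    rw [hg, conv_add_left, conv_add_right, conv_assoc S.coassoc]
    simp only [Int.negOnePow_one, Units.neg_smul, one_smul]
    abel
  exact LinearMap.congr_fun key (v, 0)

end Derivation

section ActDerivation

variable {k : Type u} [Field k] {V : Type v} [AddCommGroup V] [Module k V]
  {𝒱 : ℤ → Submodule k V} [DirectSum.Decomposition 𝒱]
  (S : DGBialgebra k (V × k) (unitGrading 𝒱))

/-! ### The cobar differential and the diagonal action -/

theorem conv_counit_sign_right (hε : S.counit = LinearMap.snd k V k) (n : ℤ)
    (g : V × k →ₗ[k] TensorAlgebra k V) :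
    conv S.comul g ((Algebra.linearMap k (TensorAlgebra k V) ∘ₗ LinearMap.snd k V k) ∘ₗ
      signMap (unitGrading 𝒱) n) = g := by
  have h : (Algebra.linearMap k (TensorAlgebra k V) ∘ₗ LinearMap.snd k V k) ∘ₗ
      signMap (unitGrading 𝒱) n = Algebra.linearMap k (TensorAlgebra k V) ∘ₗ LinearMap.snd k V k := by
    refine homogeneous_ext (unitGrading 𝒱) fun p x hx => ?_
    rw [LinearMap.comp_apply, signMap_of_mem _ _ hx, LinearMap.map_smul_of_tower]
    by_cases hp : p = 0
    · subst hp; simp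
    · simp [snd_eq_zero_of_unitGrading 𝒱 hp hx]
  rw [h, conv_counit_right S hε]

theorem diagAct_ι (hε : S.counit = LinearMap.snd k V k) (v : V) :
    diagAct 𝒱 S.mul S.comul (TensorAlgebra.ι k v) = rightMul S.mul v := by
  refine LinearMap.congr_fun (homogeneous_ext 𝒱
    (φ := diagAct 𝒱 S.mul S.comul ∘ₗ TensorAlgebra.ι k) (ψ := rightMul S.mul) fun p v hv => ?_) v
  have := diagAct_ι_mul (𝒱 := 𝒱) S.mul S.comul hv 1
  rwa [mul_one, diagAct_one, conv_counit_sign_right S hε] at this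

/-- The decomposition of `w` along `H = V ⊕ k 1_H` in both factors. The component `(ε ⊗ ε) w` occurs
twice on the right-hand side, which is why it is added on the left. -/
theorem tensor_counit_decomposition (w : (V × k) ⊗[k] (V × k)) :
    w + (TensorProduct.rid k k (TensorProduct.map (LinearMap.snd k V k) (LinearMap.snd k V k) w)) •
        ((0, 1) ⊗ₜ (0, 1)) =
      (TensorProduct.rid k (V × k) (LinearMap.lTensor (V × k) (LinearMap.snd k V k) w)) ⊗ₜ (0, 1) +
      (0, 1) ⊗ₜ (TensorProduct.lid k (V × k) (LinearMap.rTensor (V × k) (LinearMap.snd k V k) w)) +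
      TensorProduct.map (LinearMap.inl k V k) (LinearMap.inl k V k)
        (TensorProduct.map (LinearMap.fst k V k) (LinearMap.fst k V k) w) := by
  induction w with
  | zero => simp
  | tmul a b =>
    obtain ⟨a, c⟩ := a
    obtain ⟨b, d⟩ := b
    have e1 : ((a, c) : V × k) = (a, 0) + c • (0, 1) := by simp
    have e2 : ((b, d) : V × k) = (b, 0) + d • (0, 1) := by simp
    simp only [TensorProduct.map_tmul, LinearMap.snd_apply, LinearMap.fst_apply,
      LinearMap.lTensor_tmul, LinearMap.rTensor_tmul, TensorProduct.rid_tmul,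
      TensorProduct.lid_tmul, LinearMap.inl_apply]
    rw [e1, e2]
    simp only [TensorProduct.tmul_add, TensorProduct.add_tmul, TensorProduct.smul_tmul',
      TensorProduct.tmul_smul, smul_add, smul_smul, smul_eq_mul, mul_comm]
    abel
  | add x y hx hy =>
    simp only [map_add, TensorProduct.tmul_add, TensorProduct.add_tmul, add_smul]
    rw [add_add_add_comm, hx, hy]
    abel

/-- The coproduct of `v ∈ V` is `v ⊗ 1 + 1 ⊗ v` plus its reduced coproduct. -/
theorem comul_inl (hε : S.counit = LinearMap.snd k V k) (v : V) :
    S.comul (v, 0) = (v, 0) ⊗ₜ (0, 1) + (0, 1) ⊗ₜ (v, 0) +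
      TensorProduct.map (LinearMap.inl k V k) (LinearMap.inl k V k)
        (TensorProduct.map (LinearMap.fst k V k) (LinearMap.fst k V k) (S.comul (v, 0))) := by
  have h1 := S.rTensor_counit_comul (v, 0)
  have h2 := S.lTensor_counit_comul (v, 0)
  rw [hε] at h1 h2
  have h3 : (TensorProduct.rid k k (TensorProduct.map (LinearMap.snd k V k) (LinearMap.snd k V k)
      (S.comul (v, 0)))) = 0 := by
    have : TensorProduct.map (LinearMap.snd k V k) (LinearMap.snd k V k) (S.comul (v, 0)) =
        LinearMap.rTensor k (LinearMap.snd k V k) (LinearMap.lTensor (V × k) (LinearMap.snd k V k)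
          (S.comul (v, 0))) := by
      rw [LinearMap.rTensor, LinearMap.lTensor, TensorProduct.map_map]; rfl
    rw [this, h2]
    simp
  have := tensor_counit_decomposition (S.comul (v, 0))
  rw [h3, zero_smul, add_zero, h1, h2] at this
  simpa using this

/-- The cobar differential of the action `x ↦ x * y` of `H` on an element `y` of the tensor algebra
of degree `n`. The last two terms are the sums of `± π x₁ ⊗ (x₂ * y)` and `± (x₁ * y) ⊗ π x₂`. -/
def ActLeibniz (n : ℤ) (y : TensorAlgebra k V) : Prop :=
  cobarD 𝒱 S.comul S.d ∘ₗ diagAct 𝒱 S.mul S.comul y =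
    diagAct 𝒱 S.mul S.comul y ∘ₗ S.d +
    diagAct 𝒱 S.mul S.comul (cobarD 𝒱 S.comul S.d y) ∘ₗ signMap (unitGrading 𝒱) 1 +
    conv S.comul (projV ∘ₗ signMap (unitGrading 𝒱) 1) (diagAct 𝒱 S.mul S.comul y) +
    (n - 1).negOnePow • conv S.comul (diagAct 𝒱 S.mul S.comul y ∘ₗ signMap (unitGrading 𝒱) 1)
      (projV ∘ₗ signMap (unitGrading 𝒱) (n - 1))

theorem actLeibniz_one (hε : S.counit = LinearMap.snd k V k) :
    ActLeibniz S 0 1 := by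
  have hD : cobarD 𝒱 S.comul S.d 1 = 0 := by simp [cobarD]
  have h2 : conv S.comul ((Algebra.linearMap k (TensorAlgebra k V) ∘ₗ LinearMap.snd k V k) ∘ₗ
      signMap (unitGrading 𝒱) 1) (projV ∘ₗ signMap (unitGrading 𝒱) (0 - 1)) =
      projV ∘ₗ signMap (unitGrading 𝒱) 1 := by
    have := conv_comp_signMap 𝒱 S.comul_mem'
      (Algebra.linearMap k (TensorAlgebra k V) ∘ₗ LinearMap.snd k V k) projV 1
    rw [conv_counit_left S hε] at this
    rw [this, signMap_congr (unitGrading 𝒱) (m := 0 - 1) (n := 1) (by decide)]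
  have h3 : cobarD 𝒱 S.comul S.d ∘ₗ Algebra.linearMap k (TensorAlgebra k V) ∘ₗ LinearMap.snd k V k =
      0 := by
    ext <;> simp [hD]
  have h4 : (Algebra.linearMap k (TensorAlgebra k V) ∘ₗ LinearMap.snd k V k) ∘ₗ S.d = 0 := by
    rw [← hε]
    refine LinearMap.ext fun x => ?_
    simp [S.counit_d]
  rw [ActLeibniz, diagAct_one, h3, h4, h2, hD, map_zero, conv_counit_right S hε]
  simp

/-- The formula for the differential of `x * y` is multiplicative in `y`: the term `± (x₁ * s) ⊗ π x₂`
for `s` cancels the term `± π x₁ ⊗ (x₂ * t)` for `t` in the product `s t`. -/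
theorem ActLeibniz.mul (hε : S.counit = LinearMap.snd k V k) {m n : ℤ} {s t : TensorAlgebra k V}
    (hs : s ∈ tensorTotal 𝒱 m) (hs' : ActLeibniz S m s) (ht' : ActLeibniz S n t) :
    ActLeibniz S (m + n) (s * t) := by
  have hsign : (tensorSign 𝒱 1).toLinearMap ∘ₗ diagAct 𝒱 S.mul S.comul s =
      m.negOnePow • (diagAct 𝒱 S.mul S.comul s ∘ₗ signMap (unitGrading 𝒱) 1) := by
    refine homogeneous_ext (unitGrading 𝒱) fun p x hx => ?_
    simp only [LinearMap.comp_apply, LinearMap.smul_apply, AlgHom.toLinearMap_apply]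
    rw [tensorSign_of_mem 𝒱 1 (diagAct_mem_total S hx hs), signMap_of_mem _ _ hx,
      LinearMap.map_smul_of_tower, smul_smul, ← Int.negOnePow_add]
    congr 2
    ring
  have hσσ (f : V × k →ₗ[k] TensorAlgebra k V) (a b : ℤ) :
      (f ∘ₗ signMap (unitGrading 𝒱) a) ∘ₗ signMap (unitGrading 𝒱) b =
        f ∘ₗ signMap (unitGrading 𝒱) (a + b) := by
    rw [LinearMap.comp_assoc, signMap_comp_signMap]
  have hDst : diagAct 𝒱 S.mul S.comul (cobarD 𝒱 S.comul S.d (s * t)) ∘ₗ signMap (unitGrading 𝒱) 1 =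
      conv S.comul (diagAct 𝒱 S.mul S.comul (cobarD 𝒱 S.comul S.d s) ∘ₗ signMap (unitGrading 𝒱) 1)
        (diagAct 𝒱 S.mul S.comul t ∘ₗ signMap (unitGrading 𝒱) m) +
      m.negOnePow • conv S.comul (diagAct 𝒱 S.mul S.comul s ∘ₗ signMap (unitGrading 𝒱) 1)
        (diagAct 𝒱 S.mul S.comul (cobarD 𝒱 S.comul S.d t) ∘ₗ signMap (unitGrading 𝒱) (m + 1)) := by
    rw [cobarD, derivationOf_mul _ hs, ← cobarD, map_add, LinearMap.map_smul_of_tower,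
      diagAct_mul S hε (cobarD_mem S hs), diagAct_mul S hε hs, LinearMap.add_comp,
      LinearMap.smul_comp, conv_comp_signMap 𝒱 S.comul_mem', conv_comp_signMap 𝒱 S.comul_mem',
      hσσ, hσσ, signMap_congr (unitGrading 𝒱) (m := m + 1 + 1) (n := m)
        (by push_cast; grind)]
  have hσd (f : V × k →ₗ[k] TensorAlgebra k V) : (f ∘ₗ signMap (unitGrading 𝒱) m) ∘ₗ S.d =
      m.negOnePow • ((f ∘ₗ S.d) ∘ₗ signMap (unitGrading 𝒱) m) := by
    rw [LinearMap.comp_assoc, signMap_d, LinearMap.comp_smul, LinearMap.comp_assoc]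
  have e1 : signMap (unitGrading 𝒱) (m - 1) = signMap (unitGrading 𝒱) (1 + m) :=
    signMap_congr _ (by push_cast; grind)
  have e2 : signMap (unitGrading 𝒱) (n - 1 + m) = signMap (unitGrading 𝒱) (m + n - 1) :=
    signMap_congr _ (by push_cast; ring)
  rw [ActLeibniz] at hs' ht' ⊢
  rw [hDst, diagAct_mul S hε hs, cobarD, derivationOf_conv, ← cobarD, hs', hsign,
    ← LinearMap.comp_assoc, ht', conv_comp_d, hσd]
  simp only [LinearMap.add_comp, LinearMap.smul_comp, conv_add_left, conv_add_right,
    conv_sign_left, conv_sign_right, conv_comp_signMap 𝒱 S.comul_mem', hσσ, smul_smul,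
    conv_assoc S.coassoc, e1, e2, add_comm m 1, ← Int.negOnePow_add]
  rw [show (m - 1).negOnePow = -m.negOnePow by simp [Int.negOnePow_sub],
    show n - 1 + m = m + n - 1 by ring, Units.neg_smul]
  abel

theorem cobarGen_inl_mul (hε : S.counit = LinearMap.snd k V k) {q : ℤ} {x : V × k}
    (hx : x ∈ unitGrading 𝒱 q) (v : V) :
    projV (S.d (S.mul x (v, 0))) = rightMul S.mul v (S.d x) +
      q.negOnePow • rightMul S.mul (S.d (v, 0)).1 x := by
  rw [S.d_mul q x hx, map_add, LinearMap.map_smul_of_tower, rightMul_apply, rightMul_apply,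
    ← d_inl_eq S hε]
  rfl

theorem cobarD_ι (v : V) :
    cobarD 𝒱 S.comul S.d (TensorAlgebra.ι k v) = cobarGen 𝒱 S.comul S.d (v, 0) := by
  simp [cobarD]

variable (𝒱) in
/-- The map `x ⊗ y ↦ (-1) ^ |x| π x ⊗ π y`. -/
def cobarCup : (V × k) ⊗[k] (V × k) →ₗ[k] TensorAlgebra k V :=
  LinearMap.mul' k (TensorAlgebra k V) ∘ₗ
    TensorProduct.map (projV ∘ₗ signMap (unitGrading 𝒱) 1) projV

theorem cobarCup_tmul {p : ℤ} {x : V × k} (hx : x ∈ unitGrading 𝒱 p) (y : V × k) :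
    cobarCup 𝒱 (x ⊗ₜ y) = p.negOnePow • (TensorAlgebra.ι k x.1 * TensorAlgebra.ι k y.1) := by
  simp only [cobarCup, LinearMap.comp_apply, TensorProduct.map_tmul, signMap_of_mem _ _ hx, mul_one,
    LinearMap.map_smul_of_tower, LinearMap.mul'_apply, smul_mul_assoc]
  rfl

theorem cobarCup_comul (x : V × k) : cobarCup 𝒱 (S.comul x) = cobarExt 𝒱 S.comul x := rfl

theorem cobarCup_mul_one {p : ℤ} {v : V} (hv : v ∈ 𝒱 p) (h1 : S.one = (0, 1))
    (w : (V × k) ⊗[k] (V × k)) :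
    cobarCup 𝒱 (koszulMul (unitGrading 𝒱) S.mul w ((v, 0) ⊗ₜ (0, 1))) =
      p.negOnePow • LinearMap.mul' k (TensorAlgebra k V)
        (TensorProduct.map (rightMul S.mul v ∘ₗ signMap (unitGrading 𝒱) 1)
          (projV ∘ₗ signMap (unitGrading 𝒱) p) w) := by
  refine LinearMap.congr_fun (tmul_homogeneous_ext (unitGrading 𝒱) (unitGrading 𝒱)
    (φ := cobarCup 𝒱 ∘ₗ (koszulMul (unitGrading 𝒱) S.mul).flip ((v, 0) ⊗ₜ (0, 1)))
    (ψ := p.negOnePow • (LinearMap.mul' k (TensorAlgebra k V) ∘ₗ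
        TensorProduct.map (rightMul S.mul v ∘ₗ signMap (unitGrading 𝒱) 1)
          (projV ∘ₗ signMap (unitGrading 𝒱) p))) fun r s a ha b hb => ?_) w
  have hv' := inl_mem_unitGrading 𝒱 hv
  simp only [LinearMap.comp_apply, LinearMap.flip_apply, LinearMap.smul_apply,
    TensorProduct.map_tmul, LinearMap.mul'_apply]
  rw [koszulMul_tmul _ _ hb hv', LinearMap.map_smul_of_tower,
    cobarCup_tmul (S.mul_mem _ _ _ ha _ hv'), ← h1, S.mul_one, signMap_of_mem _ _ ha,
    signMap_of_mem _ _ hb, LinearMap.map_smul_of_tower, LinearMap.map_smul_of_tower, rightMul_apply]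
  simp only [smul_mul_assoc, mul_smul_comm, smul_smul, ← Int.negOnePow_add, projV,
    LinearMap.comp_apply, LinearMap.fst_apply]
  congr 2
  ring

theorem cobarCup_one_mul {v : V} (h1 : S.one = (0, 1)) (w : (V × k) ⊗[k] (V × k)) :
    cobarCup 𝒱 (koszulMul (unitGrading 𝒱) S.mul w ((0, 1) ⊗ₜ (v, 0))) =
      LinearMap.mul' k (TensorAlgebra k V)
        (TensorProduct.map (projV ∘ₗ signMap (unitGrading 𝒱) 1) (rightMul S.mul v) w) := by
  refine LinearMap.congr_fun (tmul_homogeneous_ext (unitGrading 𝒱) (unitGrading 𝒱)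
    (φ := cobarCup 𝒱 ∘ₗ (koszulMul (unitGrading 𝒱) S.mul).flip ((0, 1) ⊗ₜ (v, 0)))
    (ψ := (LinearMap.mul' k (TensorAlgebra k V) ∘ₗ
        TensorProduct.map (projV ∘ₗ signMap (unitGrading 𝒱) 1) (rightMul S.mul v)))
      fun r s a ha b hb => ?_) w
  simp only [LinearMap.comp_apply, LinearMap.flip_apply, TensorProduct.map_tmul,
    LinearMap.mul'_apply]
  rw [koszulMul_tmul _ _ hb (one_mem_unitGrading 𝒱), mul_zero, Int.negOnePow_zero, one_smul, ← h1,
    S.mul_one, cobarCup_tmul ha, signMap_of_mem _ _ ha, mul_one, LinearMap.map_smul_of_tower,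
    smul_mul_assoc]
  rfl

/-- The action on `V ⊗ V` is the product of `H ⊗ H` with the coproduct. With the multiplicativity of
the coproduct it gives the quadratic part of the differential of `x * v`. -/
theorem diagAct_cobarCup (hε : S.counit = LinearMap.snd k V k) (u : V ⊗[k] V) (x : V × k) :
    diagAct 𝒱 S.mul S.comul
        (cobarCup 𝒱 (TensorProduct.map (LinearMap.inl k V k) (LinearMap.inl k V k) u))
        (signMap (unitGrading 𝒱) 1 x) =
      cobarCup 𝒱 (koszulMul (unitGrading 𝒱) S.mul (S.comul x)
        (TensorProduct.map (LinearMap.inl k V k) (LinearMap.inl k V k) u)) := by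
  refine LinearMap.congr_fun (tmul_homogeneous_ext 𝒱 𝒱
    (φ := (diagAct 𝒱 S.mul S.comul ∘ₗ cobarCup 𝒱 ∘ₗ
      TensorProduct.map (LinearMap.inl k V k) (LinearMap.inl k V k)).flip
        (signMap (unitGrading 𝒱) 1 x))
    (ψ := cobarCup 𝒱 ∘ₗ koszulMul (unitGrading 𝒱) S.mul (S.comul x) ∘ₗ
      TensorProduct.map (LinearMap.inl k V k) (LinearMap.inl k V k)) fun p q v hv v' hv' => ?_) u
  have hvi := inl_mem_unitGrading 𝒱 hv
  have hvi' := inl_mem_unitGrading 𝒱 hv'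
  simp only [LinearMap.comp_apply, LinearMap.flip_apply, TensorProduct.map_tmul,
    LinearMap.inl_apply]
  rw [cobarCup_tmul hvi, LinearMap.map_smul_of_tower, LinearMap.smul_apply, diagAct_ι_mul _ _ hv,
    diagAct_ι S hε, ← LinearMap.comp_apply (conv _ _ _), conv_comp_signMap 𝒱 S.comul_mem']
  refine LinearMap.congr_fun (tmul_homogeneous_ext (unitGrading 𝒱) (unitGrading 𝒱)
    (φ := p.negOnePow • (LinearMap.mul' k (TensorAlgebra k V) ∘ₗ
        TensorProduct.map (rightMul S.mul v ∘ₗ signMap (unitGrading 𝒱) 1)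
        ((rightMul S.mul v' ∘ₗ signMap (unitGrading 𝒱) (p + 1)) ∘ₗ signMap (unitGrading 𝒱) 1)))
    (ψ := cobarCup 𝒱 ∘ₗ (koszulMul (unitGrading 𝒱) S.mul).flip ((v, 0) ⊗ₜ (v', 0)))
      fun r s a ha b hb => ?_) (S.comul x)
  simp only [LinearMap.comp_apply, LinearMap.flip_apply, LinearMap.smul_apply,
    TensorProduct.map_tmul, LinearMap.mul'_apply]
  rw [koszulMul_tmul _ _ hb hvi, LinearMap.map_smul_of_tower,
    cobarCup_tmul (S.mul_mem _ _ _ ha _ hvi), signMap_of_mem _ _ ha, signMap_of_mem _ _ hb]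
  simp only [LinearMap.map_smul_of_tower]
  rw [signMap_of_mem _ _ hb]
  simp only [LinearMap.map_smul_of_tower, smul_mul_assoc, mul_smul_comm, smul_smul,
    ← Int.negOnePow_add, rightMul_apply]
  congr 1
  exact Int.negOnePow_congr (by push_cast; grind)

theorem actLeibniz_ι (h1 : S.one = (0, 1)) (hε : S.counit = LinearMap.snd k V k) {p : ℤ} {v : V}
    (hv : v ∈ 𝒱 p) : ActLeibniz S (p + 1) (TensorAlgebra.ι k v) := by
  rw [ActLeibniz, diagAct_ι S hε, cobarD_ι]
  refine homogeneous_ext (unitGrading 𝒱) fun q x hx => ?_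
  have hL : cobarD 𝒱 S.comul S.d (rightMul S.mul v x) = projV (S.d (S.mul x (v, 0))) +
      cobarCup 𝒱 (koszulMul (unitGrading 𝒱) S.mul (S.comul x) (S.comul (v, 0))) := by
    rw [rightMul_apply, cobarD_ι, ← mul_inl_eq S hε, cobarGen, LinearMap.add_apply,
      ← cobarCup_comul, S.comul_mul]
    rfl
  have hA : diagAct 𝒱 S.mul S.comul (projV (S.d (v, 0))) (signMap (unitGrading 𝒱) 1 x) =
      q.negOnePow • rightMul S.mul (S.d (v, 0)).1 x := by
    rw [signMap_of_mem _ _ hx, mul_one, LinearMap.map_smul_of_tower]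
    congr 1
    exact LinearMap.congr_fun (diagAct_ι S hε _) x
  have hE : diagAct 𝒱 S.mul S.comul (cobarExt 𝒱 S.comul (v, 0)) =
      diagAct 𝒱 S.mul S.comul (cobarCup 𝒱 (TensorProduct.map (LinearMap.inl k V k)
        (LinearMap.inl k V k) (TensorProduct.map (LinearMap.fst k V k) (LinearMap.fst k V k)
          (S.comul (v, 0))))) := by
    rw [← cobarCup_comul]
    nth_rw 1 [comul_inl S hε v]
    rw [map_add, map_add (cobarCup 𝒱), map_add, cobarCup_tmul (inl_mem_unitGrading 𝒱 hv),
      cobarCup_tmul (one_mem_unitGrading 𝒱)]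
    simp
  rw [LinearMap.comp_apply, hL, cobarGen_inl_mul S hε hx]
  simp only [cobarGen, LinearMap.add_apply, map_add, LinearMap.comp_apply, LinearMap.smul_apply]
  rw [hA, hE, diagAct_cobarCup S hε]
  nth_rw 1 [comul_inl S hε v]
  rw [map_add, map_add, map_add, map_add, cobarCup_mul_one S hv h1, cobarCup_one_mul S h1,
    add_sub_cancel_right]
  simp only [conv, LinearMap.comp_apply]
  abel

/-- The action of `H` on the cobar construction is compatible with the cobar differential, up to
terms that split off a tensor factor on the left or on the right. -/
theorem actLeibniz (h1 : S.one = (0, 1)) (hε : S.counit = LinearMap.snd k V k) {n : ℤ}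
    {y : TensorAlgebra k V} (hy : y ∈ tensorTotal 𝒱 n) : ActLeibniz S n y := by
  have key : ∀ l : List (ℤ × V), Homogeneous 𝒱 l → ActLeibniz S (totalDeg l) (tensorOf k l) := by
    intro l hl
    induction l with
    | nil => simpa [tensorOf_nil] using actLeibniz_one S hε
    | cons a l ih =>
      obtain ⟨ha, hl'⟩ := homogeneous_cons.1 hl
      rw [tensorOf_cons, totalDeg_cons]
      exact ActLeibniz.mul S hε (ι_mem_total 𝒱 ha) (actLeibniz_ι S h1 hε ha) (ih hl')
  refine weightPart_le (W := ⟨⟨⟨{y | ActLeibniz S n y}, fun {y z} hy hz => ?_⟩, ?_⟩,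
    fun c y hy => ?_⟩) (fun l hl hn => ?_) hy
  · simp only [Set.mem_ofPred_eq, ActLeibniz] at hy hz ⊢
    simp only [map_add, LinearMap.add_comp, LinearMap.comp_add, conv_add_left, conv_add_right,
      smul_add, hy, hz]
    abel
  · simp only [Set.mem_ofPred_eq, ActLeibniz, map_zero, LinearMap.zero_comp, LinearMap.comp_zero]
    simp [conv]
  · simp only [Set.mem_ofPred_eq, ActLeibniz] at hy ⊢
    simp only [map_smul, LinearMap.smul_comp, LinearMap.comp_smul, conv_smul_left, conv_smul_right,
      smul_add, hy, smul_comm c]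
  · rw [weight_one_one] at hn
    exact hn ▸ key l hl

end ActDerivation

section Boundary

variable {k : Type u} [Field k] {V : Type v} [AddCommGroup V] [Module k V]
  {𝒱 : ℤ → Submodule k V} [DirectSum.Decomposition 𝒱]
  (S : DGBialgebra k (V × k) (unitGrading 𝒱))

/-! ### The boundary of the braces -/

/-- The sign `(-1) ^ a` of a parity. -/
def paritySign (a : ZMod 2) : ℤˣ := (a.val : ℤ).negOnePow

theorem negOnePow_eq_paritySign (n : ℤ) : n.negOnePow = paritySign (n : ZMod 2) := by
  refine Int.negOnePow_congr ?_
  push_cast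
  rw [ZMod.natCast_val, ZMod.cast_id]

@[simp] theorem paritySign_zero : paritySign 0 = 1 := rfl

@[simp] theorem paritySign_one : paritySign 1 = -1 := rfl

theorem paritySign_add : ∀ a b, paritySign (a + b) = paritySign a * paritySign b := by decide

theorem paritySign_sub : ∀ a b, paritySign (a - b) = paritySign a * paritySign b := by decide

theorem ZMod.two_cases : ∀ a : ZMod 2, a = 0 ∨ a = 1 := by decide

/-- The part of the boundary of `F (y₁, …, yₙ)` that comes from differentiating the arguments,
multiplying neighbouring arguments, and splitting off the last argument on the right. -/
def boundarySum {T : Type*} [Ring T] (D : T → T) : (List (ℤ × T) → T) → List (ℤ × T) → T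
  | _, [] => 0
  | F, [y] => -F [(y.1 + 1, D y.2)] - F [] * y.2
  | F, y :: y' :: Y => -F ((y.1 + 1, D y.2) :: y' :: Y) +
      (y.1 - 1).negOnePow • F ((y.1 + y'.1, y.2 * y'.2) :: Y) +
      (y.1 - 1).negOnePow • boundarySum D (fun Z => F (y :: Z)) (y' :: Y)

/-- The part of the boundary of `F (y₁, …, yₙ)` that splits off the first argument on the left, for
the first argument `n` of a map `F` of the form `x ↦ x{y₁, …, yₙ}`. -/
def boundaryHead {T : Type*} [Ring T] (n : ℤ) (F : List (ℤ × T) → T) : List (ℤ × T) → T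
  | [] => 0
  | y :: Y => (n * y.1 + n).negOnePow • (y.2 * F Y)

section
variable {T : Type*} [Ring T] [Algebra k T] (D : T → T)

theorem boundarySum_add (F G : List (ℤ × T) → T) (Y : List (ℤ × T)) :
    boundarySum D (fun Z => F Z + G Z) Y = boundarySum D F Y + boundarySum D G Y := by
  induction Y generalizing F G with
  | nil => simp [boundarySum]
  | cons y Y ih =>
    cases Y with
    | nil => simp only [boundarySum, add_mul]; abel
    | cons y' Y => simp only [boundarySum, ih, smul_add, neg_add]; abel

theorem boundarySum_comp (L : T →ₗ[k] T) (hL : ∀ a b, L (a * b) = L a * b)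
    (F : List (ℤ × T) → T) (Y : List (ℤ × T)) :
    boundarySum D (fun Z => L (F Z)) Y = L (boundarySum D F Y) := by
  induction Y generalizing F with
  | nil => simp [boundarySum]
  | cons y Y ih =>
    cases Y with
    | nil => simp [boundarySum, hL]
    | cons y' Y =>
      simp only [boundarySum, ih, map_add, map_neg, LinearMap.map_smul_of_tower]

theorem boundarySum_congr {𝒯 : ℤ → Submodule k T} (hD : ∀ n, ∀ x ∈ 𝒯 n, D x ∈ 𝒯 (n + 1))
    (hmul : ∀ m n, ∀ x ∈ 𝒯 m, ∀ y ∈ 𝒯 n, x * y ∈ 𝒯 (m + n)) {F G : List (ℤ × T) → T}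
    {Y : List (ℤ × T)} (hY : Homogeneous 𝒯 Y) (h : ∀ Z, Homogeneous 𝒯 Z → F Z = G Z) :
    boundarySum D F Y = boundarySum D G Y := by
  induction Y generalizing F G with
  | nil => simp [boundarySum]
  | cons y Y ih =>
    obtain ⟨hy, hY'⟩ := homogeneous_cons.1 hY
    have h0 := h ((y.1 + 1, D y.2) :: Y) (homogeneous_cons.2 ⟨hD _ _ hy, hY'⟩)
    cases Y with
    | nil => simp only [boundarySum, h0, h [] hY']
    | cons y' Y =>
      obtain ⟨hy', hY''⟩ := homogeneous_cons.1 hY'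
      simp only [boundarySum, h0]
      rw [ih hY' (fun Z hZ => h (y :: Z) (homogeneous_cons.2 ⟨hy, hZ⟩)),
        h ((y.1 + y'.1, y.2 * y'.2) :: Y) (homogeneous_cons.2 ⟨hmul _ _ _ hy _ hy', hY''⟩)]

end

theorem boundarySum_zero {T : Type*} [Ring T] (D : T → T) (Y : List (ℤ × T)) :
    boundarySum D (fun _ => 0) Y = 0 := by
  have := boundarySum_add D (fun _ => 0) (fun _ => 0) Y
  simpa using this

local notation "ℬ" => braceMap 𝒱 (DGBialgebra.mul S) S.comul
local notation "∂" => cobarD 𝒱 S.comul (DGBialgebra.d S)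

theorem braceMap_ι_mul_ι {q : ℤ} (v : V) {v' : V} (hv' : v' ∈ 𝒱 q)
    {y y' : ℤ × TensorAlgebra k V}
    {Y : List (ℤ × TensorAlgebra k V)} (hY : Homogeneous (tensorTotal 𝒱) (y' :: Y)) :
    ℬ (TensorAlgebra.ι k v * TensorAlgebra.ι k v') (y :: y' :: Y) =
      ((q + 1) * (y.1 - 1)).negOnePow • (diagAct 𝒱 S.mul S.comul y.2 (v, 0) *
        ℬ (TensorAlgebra.ι k v') (y' :: Y)) := by
  rw [braceMap_ι_mul_cons S v (ι_mem_total 𝒱 hv') hY, braceMap_ι_cons, mul_zero, zero_add]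

theorem cobarGen_eq (hε : S.counit = LinearMap.snd k V k) {p : ℤ} {v : V} (hv : v ∈ 𝒱 p) :
    cobarGen 𝒱 S.comul S.d (v, 0) = TensorAlgebra.ι k (S.d (v, 0)).1 +
      cobarCup 𝒱 (TensorProduct.map (LinearMap.inl k V k)
        (LinearMap.inl k V k) (TensorProduct.map (LinearMap.fst k V k) (LinearMap.fst k V k)
          (S.comul (v, 0)))) := by
  rw [cobarGen, LinearMap.add_apply, ← cobarCup_comul]
  nth_rw 1 [comul_inl S hε v]
  rw [map_add, map_add (cobarCup 𝒱), cobarCup_tmul (inl_mem_unitGrading 𝒱 hv),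
      cobarCup_tmul (one_mem_unitGrading 𝒱)]
  simp [projV]

/-- The differential of a generator has external degree at most two, so that its braces with three or
more entries vanish. -/
theorem braceMap_cobarGen_eq_zero (hε : S.counit = LinearMap.snd k V k) {p : ℤ} {v : V}
    (hv : v ∈ 𝒱 p) {y y' y'' : ℤ × TensorAlgebra k V} {Y : List (ℤ × TensorAlgebra k V)}
    (hY : Homogeneous (tensorTotal 𝒱) (y' :: y'' :: Y)) :
    ℬ (cobarGen 𝒱 S.comul S.d (v, 0)) (y :: y' :: y'' :: Y) = 0 := by
  rw [cobarGen_eq S hε hv, map_add, Pi.add_apply, braceMap_ι_cons, zero_add]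
  refine LinearMap.congr_fun (tmul_homogeneous_ext 𝒱 𝒱
    (φ := braceAt 𝒱 S.mul S.comul (y :: y' :: y'' :: Y) ∘ₗ cobarCup 𝒱 ∘ₗ
      TensorProduct.map (LinearMap.inl k V k) (LinearMap.inl k V k)) (ψ := 0)
      fun r s a ha b hb => ?_) _
  simp only [LinearMap.comp_apply, TensorProduct.map_tmul, LinearMap.inl_apply, braceAt_apply,
    LinearMap.zero_apply]
  rw [cobarCup_tmul (inl_mem_unitGrading 𝒱 ha), LinearMap.map_smul_of_tower, Pi.smul_apply,
    braceMap_ι_mul_ι S a hb hY, braceMap_ι_cons, mul_zero, smul_zero, smul_zero]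

/-- The brace `(d v){y, y'}` is the failure of `y ↦ v * y` to be a derivation. In the boundary of
`v{y, y'} = 0` it cancels the terms `v{y y'}`, `v{y} y'` and `y v{y'}`. -/
theorem braceMap_cobarGen_pair (hε : S.counit = LinearMap.snd k V k) (h1 : S.one = (0, 1)) {p : ℤ}
    {v : V} (hv : v ∈ 𝒱 p) {y y' : ℤ × TensorAlgebra k V}
    (hY : Homogeneous (tensorTotal 𝒱) [y, y']) :
    ℬ (cobarGen 𝒱 S.comul S.d (v, 0)) [y, y'] = (p + y.1 - 1).negOnePow •
      (diagAct 𝒱 S.mul S.comul (y.2 * y'.2) (v, 0) - diagAct 𝒱 S.mul S.comul y.2 (v, 0) * y'.2 -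
        (p * y.1).negOnePow • (y.2 * diagAct 𝒱 S.mul S.comul y'.2 (v, 0))) := by
  have hy : y.2 ∈ tensorTotal 𝒱 y.1 := (homogeneous_cons.1 hY).1
  have hy' : Homogeneous (tensorTotal 𝒱) [y'] := (homogeneous_cons.1 hY).2
  have hvi := inl_mem_unitGrading 𝒱 hv
  -- The map `G` is evaluated on the coproduct of `v`, on its two primitive terms, and on the image of
  -- `V ⊗ V`, where it is the brace.
  set G : (V × k) ⊗[k] (V × k) →ₗ[k] TensorAlgebra k V := LinearMap.mul' k (TensorAlgebra k V) ∘ₗ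
    TensorProduct.map (diagAct 𝒱 S.mul S.comul y.2 ∘ₗ signMap (unitGrading 𝒱) 1)
      ((diagAct 𝒱 S.mul S.comul y'.2 ∘ₗ signMap (unitGrading 𝒱) y.1) ∘ₗ signMap (unitGrading 𝒱) 1)
    with hG
  have hGΔ : G (S.comul (v, 0)) = p.negOnePow • diagAct 𝒱 S.mul S.comul (y.2 * y'.2) (v, 0) := by
    rw [diagAct_mul S hε hy]
    have := LinearMap.congr_fun (conv_comp_signMap 𝒱 S.comul_mem' (diagAct 𝒱 S.mul S.comul y.2)
      (diagAct 𝒱 S.mul S.comul y'.2 ∘ₗ signMap (unitGrading 𝒱) y.1) 1) (v, 0)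
    rw [LinearMap.comp_apply, signMap_of_mem _ _ hvi, mul_one, LinearMap.map_smul_of_tower] at this
    exact this.symm
  have hG1 : G ((v, 0) ⊗ₜ (0, 1)) = p.negOnePow • (diagAct 𝒱 S.mul S.comul y.2 (v, 0) * y'.2) := by
    simp only [hG, LinearMap.comp_apply, TensorProduct.map_tmul, LinearMap.mul'_apply]
    rw [signMap_of_mem _ _ hvi, signMap_of_mem _ _ (one_mem_unitGrading 𝒱)]
    simp only [LinearMap.map_smul_of_tower]
    rw [signMap_of_mem _ _ (one_mem_unitGrading 𝒱)]
    simp [smul_mul_assoc, diagAct_apply_one S h1]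
  have hG2 : G ((0, 1) ⊗ₜ (v, 0)) =
      (p * y.1 + p).negOnePow • (y.2 * diagAct 𝒱 S.mul S.comul y'.2 (v, 0)) := by
    simp only [hG, LinearMap.comp_apply, TensorProduct.map_tmul, LinearMap.mul'_apply]
    rw [signMap_of_mem _ _ hvi, signMap_of_mem _ _ (one_mem_unitGrading 𝒱)]
    simp only [LinearMap.map_smul_of_tower]
    rw [signMap_of_mem _ _ hvi]
    simp only [LinearMap.map_smul_of_tower, diagAct_apply_one S h1, smul_mul_assoc, mul_smul_comm,
      smul_smul, ← Int.negOnePow_add]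
    congr 2
    ring
  have hG3 (u : V ⊗[k] V) : ℬ (cobarCup 𝒱 (TensorProduct.map (LinearMap.inl k V k)
      (LinearMap.inl k V k) u)) [y, y'] = (y.1 - 1).negOnePow •
        G (TensorProduct.map (LinearMap.inl k V k) (LinearMap.inl k V k) u) := by
    refine LinearMap.congr_fun (tmul_homogeneous_ext 𝒱 𝒱
      (φ := braceAt 𝒱 S.mul S.comul [y, y'] ∘ₗ cobarCup 𝒱 ∘ₗ
        TensorProduct.map (LinearMap.inl k V k) (LinearMap.inl k V k))
      (ψ := (y.1 - 1).negOnePow •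
        (G ∘ₗ TensorProduct.map (LinearMap.inl k V k) (LinearMap.inl k V k)))
        fun r s a ha b hb => ?_) u
    have hai := inl_mem_unitGrading 𝒱 ha
    have hbi := inl_mem_unitGrading 𝒱 hb
    simp only [LinearMap.comp_apply, TensorProduct.map_tmul, LinearMap.inl_apply, braceAt_apply,
      LinearMap.smul_apply, hG, LinearMap.mul'_apply]
    rw [cobarCup_tmul hai, LinearMap.map_smul_of_tower, Pi.smul_apply,
      braceMap_ι_mul_ι S a hb hy', braceMap_ι_cons, signMap_of_mem _ _ hai, signMap_of_mem _ _ hbi]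
    simp only [LinearMap.map_smul_of_tower]
    rw [signMap_of_mem _ _ hbi]
    simp only [LinearMap.map_smul_of_tower, smul_mul_assoc, mul_smul_comm,
      smul_smul, ← Int.negOnePow_add]
    congr 1
    exact Int.negOnePow_congr (by push_cast; grind)
  have h := congrArg G (comul_inl S hε v)
  rw [map_add, map_add, hGΔ, hG1, hG2] at h
  rw [cobarGen_eq S hε hv, map_add, Pi.add_apply, braceMap_ι_cons, zero_add, hG3,
    ← sub_eq_iff_eq_add'.2 h]
  simp only [smul_add, smul_sub, smul_smul, ← Int.negOnePow_add]
  rw [sub_sub, show y.1 - 1 + p = p + y.1 - 1 by ring,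
    show y.1 - 1 + (p * y.1 + p) = p + y.1 - 1 + p * y.1 by ring]

/-- The boundary of the braces `t{y₁, …, yₙ}` with `t` fixed. -/
def HasBoundary (n : ℤ) (t : TensorAlgebra k V) : Prop :=
  ∀ Y : List (ℤ × TensorAlgebra k V), Homogeneous (tensorTotal 𝒱) Y →
    ∂ (ℬ t Y) = ℬ (∂ t) Y + n.negOnePow • boundarySum ∂ (ℬ t) Y + boundaryHead n (ℬ t) Y

theorem hasBoundary_one : HasBoundary S 0 1 := by
  intro Y hY
  have hD : ∂ 1 = 0 := derivationOf_one 𝒱 _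
  match Y with
  | [] => simp [hD, boundarySum, boundaryHead]
  | [y] => simp [hD, boundarySum, boundaryHead]
  | y :: y' :: Y =>
    simp [hD, boundarySum, boundaryHead, boundarySum_zero]

/-- The boundary of `v{y}` for a generator `v`. The terms `v y` and `y v` come from the primitive part
`v ⊗ 1 + 1 ⊗ v` of the coproduct of `v` in the formula `ActLeibniz`. -/
theorem cobarD_diagAct_inl (hε : S.counit = LinearMap.snd k V k) (h1 : S.one = (0, 1)) {p : ℤ}
    {v : V} (hv : v ∈ 𝒱 p) {n : ℤ} {y : TensorAlgebra k V} (hy : y ∈ tensorTotal 𝒱 n) :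
    ∂ (diagAct 𝒱 S.mul S.comul y (v, 0)) = ℬ (cobarGen 𝒱 S.comul S.d (v, 0)) [(n, y)] +
      p.negOnePow • diagAct 𝒱 S.mul S.comul (∂ y) (v, 0) +
      p.negOnePow • (TensorAlgebra.ι k v * y) +
      ((p + 1) * n + p + 1).negOnePow • (y * TensorAlgebra.ι k v) := by
  have hvi := inl_mem_unitGrading 𝒱 hv
  have ho := one_mem_unitGrading (k := k) 𝒱
  have hact := LinearMap.congr_fun (actLeibniz S h1 hε hy) (v, 0)
  -- The last two terms of `ActLeibniz` are the value of `G` on the coproduct of `v`.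
  set G : (V × k) ⊗[k] (V × k) →ₗ[k] TensorAlgebra k V := LinearMap.mul' k (TensorAlgebra k V) ∘ₗ
    TensorProduct.map (projV ∘ₗ signMap (unitGrading 𝒱) 1) (diagAct 𝒱 S.mul S.comul y) +
    (n - 1).negOnePow • (LinearMap.mul' k (TensorAlgebra k V) ∘ₗ
    TensorProduct.map (diagAct 𝒱 S.mul S.comul y ∘ₗ signMap (unitGrading 𝒱) 1)
      (projV ∘ₗ signMap (unitGrading 𝒱) (n - 1))) with hG
  have hGΔ : G (S.comul (v, 0)) =
      conv S.comul (projV ∘ₗ signMap (unitGrading 𝒱) 1) (diagAct 𝒱 S.mul S.comul y) (v, 0) +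
      (n - 1).negOnePow • conv S.comul (diagAct 𝒱 S.mul S.comul y ∘ₗ signMap (unitGrading 𝒱) 1)
        (projV ∘ₗ signMap (unitGrading 𝒱) (n - 1)) (v, 0) := rfl
  have hG1 : G ((v, 0) ⊗ₜ (0, 1)) = p.negOnePow • (TensorAlgebra.ι k v * y) := by
    simp only [hG, LinearMap.add_apply, LinearMap.smul_apply, LinearMap.comp_apply,
      TensorProduct.map_tmul, LinearMap.mul'_apply]
    rw [signMap_of_mem _ _ hvi, signMap_of_mem _ _ ho]
    simp [smul_mul_assoc, diagAct_apply_one S h1, projV]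
  have hG2 : G ((0, 1) ⊗ₜ (v, 0)) =
      ((p + 1) * n + p + 1).negOnePow • (y * TensorAlgebra.ι k v) := by
    simp only [hG, LinearMap.add_apply, LinearMap.smul_apply, LinearMap.comp_apply,
      TensorProduct.map_tmul, LinearMap.mul'_apply]
    rw [signMap_of_mem _ _ hvi, signMap_of_mem _ _ ho]
    simp only [LinearMap.map_smul_of_tower, diagAct_apply_one S h1, smul_mul_assoc, mul_smul_comm,
      smul_smul, ← Int.negOnePow_add]
    rw [Int.negOnePow_congr (a := n - 1 + (p * (n - 1) + 0 * 1)) (b := (p + 1) * n + p + 1)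
      (by push_cast; grind)]
    simp [projV]
  have hG3 (u : V ⊗[k] V) : ℬ (cobarCup 𝒱 (TensorProduct.map (LinearMap.inl k V k)
      (LinearMap.inl k V k) u)) [(n, y)] =
        G (TensorProduct.map (LinearMap.inl k V k) (LinearMap.inl k V k) u) := by
    refine LinearMap.congr_fun (tmul_homogeneous_ext 𝒱 𝒱
      (φ := braceAt 𝒱 S.mul S.comul [(n, y)] ∘ₗ cobarCup 𝒱 ∘ₗ
        TensorProduct.map (LinearMap.inl k V k) (LinearMap.inl k V k))
      (ψ := G ∘ₗ TensorProduct.map (LinearMap.inl k V k) (LinearMap.inl k V k))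
        fun r s a ha b hb => ?_) u
    have hai := inl_mem_unitGrading 𝒱 ha
    have hbi := inl_mem_unitGrading 𝒱 hb
    simp only [LinearMap.comp_apply, TensorProduct.map_tmul, LinearMap.inl_apply, braceAt_apply,
      LinearMap.smul_apply, hG, LinearMap.mul'_apply, LinearMap.add_apply]
    rw [cobarCup_tmul hai, LinearMap.map_smul_of_tower, Pi.smul_apply,
      braceMap_ι_mul_cons S a (ι_mem_total 𝒱 hb) homogeneous_nil, braceMap_ι_cons, braceMap_nil,
      signMap_of_mem _ _ hai, signMap_of_mem _ _ hbi]
    simp only [LinearMap.map_smul_of_tower, smul_mul_assoc, mul_smul_comm,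
      smul_smul, ← Int.negOnePow_add, smul_add, projV, LinearMap.comp_apply, LinearMap.fst_apply,
      mul_one]
    congr 2
    exact Int.negOnePow_congr (by push_cast; grind)
  have h := congrArg G (comul_inl S hε v)
  rw [map_add, map_add, hGΔ, hG1, hG2, ← hG3] at h
  simp only [LinearMap.add_apply, LinearMap.comp_apply, LinearMap.smul_apply] at hact
  rw [hact, add_assoc, h, cobarGen_eq S hε hv, map_add, Pi.add_apply, braceMap_ι_cons,
    signMap_of_mem _ _ hvi, mul_one, LinearMap.map_smul_of_tower, ← d_inl_eq S hε v]
  abel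

/-- The induction step: by the distributivity of the braces, `(v t){y, Y}` is
`v t{y, Y} ± (v * y) t{Y}`, and the boundary formulas for `v{y}`, `v{y, y'}` and `t` add up. -/
theorem hasBoundary_ι_mul (hε : S.counit = LinearMap.snd k V k) (h1 : S.one = (0, 1)) {p n : ℤ}
    {v : V} (hv : v ∈ 𝒱 p) {t : TensorAlgebra k V} (ht : t ∈ tensorTotal 𝒱 n)
    (ih : HasBoundary S n t) : HasBoundary S (p + 1 + n) (TensorAlgebra.ι k v * t) := by
  intro Y hY
  have hDv : ∂ (TensorAlgebra.ι k v) = cobarGen 𝒱 S.comul S.d (v, 0) := cobarD_ι S v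
  have hvt := ι_mem_total (k := k) 𝒱 hv
  have hDv' : cobarGen 𝒱 S.comul S.d (v, 0) ∈ tensorTotal 𝒱 (p + 1 + 1) := hDv ▸ cobarD_mem S hvt
  have hDt := cobarD_mem S ht
  have hD (s : TensorAlgebra k V) {m : ℤ} (hs : s ∈ tensorTotal 𝒱 m) (s' : TensorAlgebra k V) :
    ∂ (s * s') = ∂ s * s' + m.negOnePow • (s * ∂ s') := derivationOf_mul _ hs s'
  match Y with
  | [] => simp [braceMap_nil, boundarySum, boundaryHead]
  | [y] =>
    have hy : y.2 ∈ tensorTotal 𝒱 y.1 := (homogeneous_cons.1 hY).1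
    have hnil : Homogeneous (tensorTotal 𝒱) [] := (homogeneous_cons.1 hY).2
    have hact := diagAct_mem_total S (inl_mem_unitGrading 𝒱 hv) hy
    have e1 := ih [y] hY
    simp only [boundarySum, boundaryHead, braceMap_nil] at e1 ⊢
    have e2 := braceMap_mul S hDv' ht hY
    simp only [List.length_cons, List.length_nil, Finset.sum_range_succ, Finset.sum_range_zero,
      List.take_zero, List.drop_zero, List.take_succ_cons, List.drop_succ_cons, braceMap_nil,
      shiftedDegSum_nil, shiftedDegSum_cons] at e2
    rw [braceMap_ι_mul_cons S v ht hnil, braceMap_ι_mul_cons S v ht hnil, map_add,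
      LinearMap.map_smul_of_tower, hD _ hvt, hD _ hvt, hD _ hact, e1, hDv, map_add,
      LinearMap.map_smul_of_tower, Pi.add_apply, Pi.smul_apply, e2,
      braceMap_ι_mul_cons S v hDt hnil, cobarD_diagAct_inl S hε h1 hv hy]
    -- Only the parities of the degrees enter the signs, and in each case the terms cancel.
    simp only [braceMap_nil, negOnePow_eq_paritySign]
    push_cast
    generalize (p : ZMod 2) = p, (n : ZMod 2) = n, (y.1 : ZMod 2) = c
    simp only [smul_add, mul_add, add_mul, smul_smul, mul_neg, smul_neg, mul_assoc, mul_sub,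
      smul_sub, mul_smul_comm, smul_mul_assoc]
    obtain rfl | rfl := ZMod.two_cases p <;> obtain rfl | rfl := ZMod.two_cases n <;>
    obtain rfl | rfl := ZMod.two_cases c <;>
    simp only [paritySign_add, paritySign_sub, paritySign_zero, paritySign_one, mul_zero,
      mul_one, mul_neg, neg_neg, Units.neg_smul, one_smul] <;> abel
  | y :: y' :: Y =>
    obtain ⟨hy, hY'⟩ := homogeneous_cons.1 hY
    obtain ⟨hy', hY''⟩ := homogeneous_cons.1 hY'
    have hact := diagAct_mem_total S (inl_mem_unitGrading 𝒱 hv) hy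
    have hyy' : Homogeneous (tensorTotal 𝒱) [y, y'] :=
      homogeneous_cons.2 ⟨hy, homogeneous_cons.2 ⟨hy', homogeneous_nil⟩⟩
    have hQ : boundarySum ∂ (fun Z => ℬ (TensorAlgebra.ι k v * t) (y :: Z)) (y' :: Y) =
        TensorAlgebra.ι k v * boundarySum ∂ (fun Z => ℬ t (y :: Z)) (y' :: Y) +
        (n * (y.1 - 1)).negOnePow • (diagAct 𝒱 S.mul S.comul y.2 (v, 0) *
          boundarySum ∂ (ℬ t) (y' :: Y)) := by
      rw [boundarySum_congr (𝒯 := tensorTotal 𝒱) ∂ (fun n x hx => cobarD_mem S hx)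
        (fun m n x hx y hy => mul_mem_weightPart hx hy) hY'
        (fun Z hZ => braceMap_ι_mul_cons S v ht hZ), boundarySum_add,
        ← LinearMap.mulLeft_apply (R := k) (TensorAlgebra.ι k v), ← boundarySum_comp (k := k) ∂
          (LinearMap.mulLeft k (TensorAlgebra.ι k v)) (fun a b => (mul_assoc _ a b).symm),
        ← LinearMap.mulLeft_apply (R := k) (diagAct 𝒱 S.mul S.comul y.2 (v, 0)),
        ← LinearMap.smul_apply, ← boundarySum_comp (k := k) ∂ _ (fun a b => by
          simp [mul_assoc, smul_mul_assoc])]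
      rfl
    have e1 := ih (y :: y' :: Y) hY
    have e1' := ih (y' :: Y) hY'
    have e2 := braceMap_mul S hDv' ht hY
    -- The braces of `d v` with three or more entries vanish.
    have hzero : ∑ i ∈ Finset.range Y.length,
        (n * shiftedDegSum ((y :: y' :: Y).take (i + 1 + 1 + 1))).negOnePow •
        (ℬ (cobarGen 𝒱 S.comul S.d (v, 0)) ((y :: y' :: Y).take (i + 1 + 1 + 1)) *
          ℬ t ((y :: y' :: Y).drop (i + 1 + 1 + 1))) = 0 := by
      refine Finset.sum_eq_zero fun i hi => ?_
      cases Y with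
      | nil => simp at hi
      | cons y'' Y =>
        simp only [List.take_succ_cons]
        rw [braceMap_cobarGen_eq_zero S hε hv, zero_mul, smul_zero]
        have := Homogeneous.take hY' (i + 1 + 1)
        simpa only [List.take_succ_cons] using this
    rw [List.length_cons, List.length_cons, Finset.sum_range_succ', Finset.sum_range_succ',
      Finset.sum_range_succ', hzero] at e2
    simp only [List.take_zero, List.drop_zero, List.take_succ_cons, List.drop_succ_cons,
      braceMap_nil, shiftedDegSum_nil, shiftedDegSum_cons, zero_add] at e2
    rw [boundarySum, boundaryHead] at e1 ⊢
    rw [boundaryHead] at e1'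
    have hDY : Homogeneous (tensorTotal 𝒱) ((y.1 + y'.1, y.2 * y'.2) :: Y) :=
      homogeneous_cons.2 ⟨mul_mem_weightPart hy hy', hY''⟩
    rw [braceMap_ι_mul_cons S v ht hY', braceMap_ι_mul_cons S v ht hY',
      braceMap_ι_mul_cons S v ht hY'', braceMap_ι_mul_cons S v ht hY'', map_add,
      LinearMap.map_smul_of_tower, hD _ hvt, hD _ hvt, hD _ hact, e1, e1', hDv, map_add,
      LinearMap.map_smul_of_tower, Pi.add_apply, Pi.smul_apply, e2, hQ,
      braceMap_ι_mul_cons S v hDt hY', cobarD_diagAct_inl S hε h1 hv hy,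
      braceMap_cobarGen_pair S hε h1 hv hyy']
    simp only [negOnePow_eq_paritySign]
    push_cast
    generalize boundarySum ∂ (fun Z => ℬ t (y :: Z)) (y' :: Y) = Q₁
    generalize boundarySum ∂ (ℬ t) (y' :: Y) = Q₂
    generalize (p : ZMod 2) = p, (n : ZMod 2) = n, (y.1 : ZMod 2) = c, (y'.1 : ZMod 2) = c'
    simp only [smul_add, mul_add, add_mul, smul_smul, mul_neg, smul_neg, mul_assoc, mul_sub,
      sub_mul, smul_sub, mul_smul_comm, smul_mul_assoc]
    obtain rfl | rfl := ZMod.two_cases p <;> obtain rfl | rfl := ZMod.two_cases n <;>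
    obtain rfl | rfl := ZMod.two_cases c <;> obtain rfl | rfl := ZMod.two_cases c' <;>
    simp only [paritySign_add, paritySign_sub, paritySign_zero, paritySign_one, mul_zero,
      mul_one, mul_neg, neg_neg, Units.neg_smul, one_smul] <;> abel

/-- The boundary of the braces of the cobar construction. -/
theorem hasBoundary (hε : S.counit = LinearMap.snd k V k) (h1 : S.one = (0, 1)) {n : ℤ}
    {t : TensorAlgebra k V} (ht : t ∈ tensorTotal 𝒱 n) : HasBoundary S n t := by
  have key : ∀ l : List (ℤ × V), Homogeneous 𝒱 l → HasBoundary S (totalDeg l) (tensorOf k l) := by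
    intro l hl
    induction l with
    | nil => simpa [tensorOf_nil] using hasBoundary_one S
    | cons a l ih =>
      obtain ⟨ha, hl'⟩ := homogeneous_cons.1 hl
      rw [tensorOf_cons, totalDeg_cons]
      exact hasBoundary_ι_mul S hε h1 ha (tensorOf_mem_total hl') (ih hl')
  have hhead_add (s t : TensorAlgebra k V) (Y) : boundaryHead n (ℬ (s + t)) Y =
      boundaryHead n (ℬ s) Y + boundaryHead n (ℬ t) Y := by
    cases Y <;> simp [boundaryHead, mul_add]
  have hhead_smul (c : k) (t : TensorAlgebra k V) (Y) : boundaryHead n (ℬ (c • t)) Y =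
      c • boundaryHead n (ℬ t) Y := by
    cases Y <;> simp [boundaryHead, smul_comm c]
  have hsum_add (s t : TensorAlgebra k V) (Y) : boundarySum ∂ (ℬ (s + t)) Y =
      boundarySum ∂ (ℬ s) Y + boundarySum ∂ (ℬ t) Y := by
    rw [map_add]
    exact boundarySum_add _ _ _ _
  have hsum_smul (c : k) (t : TensorAlgebra k V) (Y) : boundarySum ∂ (ℬ (c • t)) Y =
      c • boundarySum ∂ (ℬ t) Y := by
    rw [map_smul]
    exact boundarySum_comp ∂ (c • LinearMap.id (R := k) (M := TensorAlgebra k V)) (by simp) _ _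
  refine weightPart_le (W := ⟨⟨⟨{t | HasBoundary S n t}, fun {s t} hs ht Y hY => ?_⟩,
    fun Y hY => ?_⟩, fun c t ht Y hY => ?_⟩) (fun l hl hn => ?_) ht
  · rw [hhead_add, hsum_add, map_add, Pi.add_apply, map_add, hs Y hY, ht Y hY, map_add, map_add,
      Pi.add_apply, smul_add]
    abel
  · have h1 := hsum_smul 0 0 Y
    have h2 := hhead_smul 0 0 Y
    rw [zero_smul, zero_smul] at h1 h2
    change ∂ (ℬ 0 Y) = ℬ (∂ 0) Y + _ + _
    rw [h1, h2]
    simp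
  · rw [hhead_smul, hsum_smul, map_smul, Pi.smul_apply, map_smul, ht Y hY, map_smul, map_smul,
      Pi.smul_apply, smul_add, smul_add, smul_comm c]
  · rw [weight_one_one] at hn
    exact hn ▸ key l hl

end Boundary

/-! ### Exponents of décalage signs -/

section Decalage

@[simp] theorem decalage_nil (x : ℤ) : decalage x [] = 0 := rfl

@[simp] theorem decalage_cons (x y : ℤ) (l : List ℤ) :
    decalage x (y :: l) = x + decalage (x + y) l := rfl

theorem decalage_add (x a : ℤ) (l : List ℤ) :
    decalage (x + a) l = decalage x l + l.length * a := by
  induction l generalizing x with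
  | nil => simp
  | cons y l ih =>
    rw [decalage_cons, decalage_cons, show x + a + y = x + y + a by ring, ih]
    push_cast [List.length_cons]
    ring

theorem decalage_append (x : ℤ) (l l' : List ℤ) :
    decalage x (l ++ l') = decalage x l + decalage (x + l.sum) l' := by
  induction l generalizing x with
  | nil => simp
  | cons y l ih =>
    rw [List.cons_append, decalage_cons, decalage_cons, ih, List.sum_cons, add_assoc, ← add_assoc x]

/-- Raising the `i`-th degree by `a` changes the exponent of the décalage sign by `a` for each of the
dots behind position `i`. -/
theorem decalage_update {n : ℕ} (x : ℤ) (d : Fin (n + 1) → ℤ) (i : Fin (n + 1)) (a : ℤ) :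
    decalage x (List.ofFn (Function.update d i (d i + a))) =
      decalage x (List.ofFn d) + ((n : ℤ) - (i : ℕ)) * a := by
  induction n generalizing x with
  | zero =>
    obtain rfl : i = 0 := Fin.fin_one_eq_zero i
    simp
  | succ n ih =>
    rw [List.ofFn_succ, List.ofFn_succ (f := d), decalage_cons, decalage_cons]
    induction i using Fin.cases with
    | zero =>
      have h : (fun i : Fin (n + 1) => Function.update d 0 (d 0 + a) i.succ) = fun i => d i.succ := by
        funext i; simp
      rw [h, Function.update_self, ← add_assoc, decalage_add (x + d 0)]
      simp
      ring
    | succ i =>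
      have h : (fun j : Fin (n + 1) => Function.update d i.succ (d i.succ + a) j.succ) =
          Function.update (fun j : Fin (n + 1) => d j.succ) i (d i.succ + a) := by
        funext j
        simp [Function.update_apply]
      rw [h, ih, Function.update_of_ne (Fin.succ_ne_zero i).symm]
      simp
      ring

theorem Fin.contractNth_zero {α : Type*} {n : ℕ} (op : α → α → α) (f : Fin (n + 2) → α) :
    Fin.contractNth (n := n + 1) 0 op f = Fin.cons (op (f 0) (f 1)) fun i => f i.succ.succ := by
  funext i
  induction i using Fin.cases with
  | zero => simp [Fin.contractNth]
  | succ i => simp [Fin.contractNth]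

theorem Fin.contractNth_succ {α : Type*} {n : ℕ} (j : Fin (n + 1)) (op : α → α → α)
    (f : Fin (n + 2) → α) :
    Fin.contractNth (n := n + 1) j.succ op f =
      Fin.cons (f 0) (Fin.contractNth j op fun i => f i.succ) := by
  funext i
  induction i using Fin.cases with
  | zero => simp [Fin.contractNth]
  | succ i => simp [Fin.contractNth]

theorem decalage_contractNth {n : ℕ} (x : ℤ) (d : Fin (n + 1) → ℤ) (j : Fin n) :
    decalage x (List.ofFn (Fin.contractNth j.castSucc (· + ·) d)) + x +
      ((List.ofFn d).take (j + 1)).sum = decalage x (List.ofFn d) := by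
  induction n generalizing x with
  | zero => exact j.elim0
  | succ n ih =>
    induction j using Fin.cases with
    | zero =>
      rw [Fin.castSucc_zero, Fin.contractNth_zero, List.ofFn_cons, List.ofFn_succ (f := d),
        List.ofFn_succ (f := fun i : Fin (n + 1) => d i.succ)]
      simp only [decalage_cons, Fin.succ_zero_eq_one, ← add_assoc]
      simp
      ring
    | succ j =>
      rw [← Fin.succ_castSucc, Fin.contractNth_succ, List.ofFn_cons, List.ofFn_succ (f := d),
        decalage_cons, decalage_cons, ← ih (x + d 0) (fun i => d i.succ) j]
      simp
      ring

theorem decalage_init {n : ℕ} (x : ℤ) (d : Fin (n + 1) → ℤ) :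
    decalage x (List.ofFn (Fin.init d)) + x + ((List.ofFn d).take n).sum =
      decalage x (List.ofFn d) := by
  have h : List.ofFn d = List.ofFn (Fin.init d) ++ [d (Fin.last n)] := by
    rw [List.ofFn_succ_last]
    rfl
  rw [h, decalage_append]
  simp
  ring

end Decalage

/-! ### The boundary as a sum over positions -/

section BoundaryFin

theorem ofFn_update_zero {α : Type*} {n : ℕ} (f : Fin (n + 1) → α) (a : α) :
    List.ofFn (Function.update f 0 a) = a :: List.ofFn fun i => f i.succ := by
  rw [List.ofFn_succ, Function.update_self]
  congr 2

theorem ofFn_update_succ {α : Type*} {n : ℕ} (f : Fin (n + 1) → α) (i : Fin n) (a : α) :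
    List.ofFn (Function.update f i.succ a) =
      f 0 :: List.ofFn (Function.update (fun i => f i.succ) i a) := by
  rw [List.ofFn_succ, Function.update_of_ne (Fin.succ_ne_zero i).symm]
  congr 2
  funext j
  simp [Function.update_apply]

/-- The boundary, defined by recursion on the list of arguments, as the sum over positions that occurs
in the definition of a Cacti algebra. -/
theorem boundarySum_ofFn {T : Type*} [Ring T] (D : T → T) {n : ℕ} (f : Fin (n + 1) → ℤ × T)
    (F : List (ℤ × T) → T) :
    boundarySum D F (List.ofFn f) =
      -∑ i : Fin (n + 1), (shiftedDegSum ((List.ofFn f).take i)).negOnePow •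
          F (List.ofFn (Function.update f i ((f i).1 + 1, D (f i).2))) +
        ∑ j : Fin n, (shiftedDegSum ((List.ofFn f).take (j + 1))).negOnePow •
          F (List.ofFn (Fin.contractNth j.castSucc (fun a b => (a.1 + b.1, a.2 * b.2)) f)) -
        (shiftedDegSum ((List.ofFn f).take n)).negOnePow •
          (F (List.ofFn (Fin.init f)) * (f (Fin.last n)).2) := by
  induction n generalizing F with
  | zero => simp [boundarySum]
  | succ n ih =>
    have hlist : List.ofFn f = f 0 :: f 1 :: List.ofFn fun i : Fin n => f i.succ.succ := by
      rw [List.ofFn_succ, List.ofFn_succ]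
      rfl
    have htail : (f 1 :: List.ofFn fun i : Fin n => f i.succ.succ) =
        List.ofFn fun i : Fin (n + 1) => f i.succ := by
      rw [List.ofFn_succ]
      rfl
    have hinit : List.ofFn (Fin.init f) =
        f 0 :: List.ofFn (Fin.init fun i : Fin (n + 1) => f i.succ) := by
      rw [List.ofFn_succ]
      rfl
    rw [Fin.sum_univ_succ (n := n + 1), Fin.sum_univ_succ (f := fun j : Fin (n + 1) =>
      (shiftedDegSum ((List.ofFn f).take (j + 1))).negOnePow •
        F (List.ofFn (Fin.contractNth j.castSucc (fun a b => (a.1 + b.1, a.2 * b.2)) f))),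
      hlist, boundarySum, htail, ih]
    simp only [Fin.val_zero, List.take_zero, shiftedDegSum_nil, Int.negOnePow_zero, one_smul,
      ofFn_update_zero, Fin.val_succ, List.take_succ_cons, ofFn_update_succ, shiftedDegSum_cons,
      Fin.castSucc_zero, Fin.contractNth_zero, List.ofFn_cons, ← Fin.succ_castSucc,
      Fin.contractNth_succ, hinit, Fin.succ_last, zero_add, add_zero, smul_add, smul_sub, smul_neg,
      Finset.smul_sum, smul_smul, ← Int.negOnePow_add, ← htail, neg_add]
    abel

end BoundaryFin

section Reduced

variable {k : Type u} [Field k] {V : Type v} [AddCommGroup V] [Module k V]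
  (𝒱 : ℤ → Submodule k V)

/-! ### Gradings of the reduced tensor algebra -/

variable (k V) in
/-- The projection `t ↦ t - ε t` of the tensor algebra onto its augmentation ideal. -/
def reducedProj : TensorAlgebra k V →ₗ[k] ReducedTensor k V :=
  (LinearMap.id - Algebra.linearMap k (TensorAlgebra k V) ∘ₗ
    (TensorAlgebra.algebraMapInv (R := k) (M := V)).toLinearMap).codRestrict _ fun t => by
      rw [LinearMap.mem_ker]
      simp [TensorAlgebra.algebraMapInv]

theorem reducedProj_of_mem {t : TensorAlgebra k V}
    (ht : TensorAlgebra.algebraMapInv (R := k) (M := V) t = 0) :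
    (reducedProj k V t : TensorAlgebra k V) = t := by
  simp [reducedProj, ht]

theorem algebraMapInv_coe (x : ReducedTensor k V) :
    TensorAlgebra.algebraMapInv (R := k) (M := V) (x : TensorAlgebra k V) = 0 :=
  LinearMap.mem_ker.1 x.2

@[simp] theorem reducedProj_coe (x : ReducedTensor k V) :
    reducedProj k V (x : TensorAlgebra k V) = x :=
  Subtype.ext (reducedProj_of_mem (algebraMapInv_coe x))

@[simp] theorem reducedProj_one : reducedProj k V 1 = 0 := by
  ext
  simp [reducedProj]

@[simp] theorem algebraMapInv_ι (v : V) :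
    TensorAlgebra.algebraMapInv (R := k) (M := V) (TensorAlgebra.ι k v) = 0 := by
  simp [TensorAlgebra.algebraMapInv]

theorem algebraMapInv_tensorOf {l : List (ℤ × V)} (hl : l ≠ []) :
    TensorAlgebra.algebraMapInv (R := k) (M := V) (tensorOf k l) = 0 := by
  cases l with
  | nil => exact absurd rfl hl
  | cons a l => rw [tensorOf_cons, map_mul, algebraMapInv_ι, zero_mul]

/-- A submodule of the reduced tensor algebra that contains all monomials of degree `g` contains
all elements of degree `g`. -/
theorem mem_of_weightPart {G : Type*} [AddCommGroup G] {α β g : G}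
    {W : Submodule k (ReducedTensor k V)}
    (h : ∀ l : List (ℤ × V), Homogeneous 𝒱 l → l ≠ [] → weight α β l = g →
      ∀ x : ReducedTensor k V, (x : TensorAlgebra k V) = tensorOf k l → x ∈ W)
    {x : ReducedTensor k V} (hx : (x : TensorAlgebra k V) ∈ weightPart 𝒱 α β g) : x ∈ W := by
  rw [← reducedProj_coe x]
  refine weightPart_le (W := W.comap (reducedProj k V)) (fun l hl hg => ?_) hx
  rw [Submodule.mem_comap]
  by_cases hnil : l = []
  · subst hnil
    rw [tensorOf_nil, reducedProj_one]
    exact zero_mem _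
  · exact h l hl hnil hg _ (reducedProj_of_mem (algebraMapInv_tensorOf hnil))

theorem weight_bidegree (l : List (ℤ × V)) :
    weight ((1 : ℤ), (0 : ℤ)) (0, 1) l = (degSum l, (l.length : ℤ)) := by
  simp [weight]

theorem weight_one_zero (l : List (ℤ × V)) : weight (1 : ℤ) 0 l = degSum l := by
  simp [weight]

theorem weight_zero_one (l : List (ℤ × V)) : weight (0 : ℤ) 1 l = l.length := by
  simp [weight]

theorem mem_tensorBigrading {p q : ℤ} {x : ReducedTensor k V} :
    x ∈ tensorBigrading 𝒱 p q ↔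
      (x : TensorAlgebra k V) ∈ weightPart 𝒱 ((1 : ℤ), (0 : ℤ)) (0, 1) (p, q) := by
  refine ⟨fun hx => ?_, mem_of_weightPart 𝒱 fun l hl _ hg x hx => Submodule.subset_span ?_⟩
  · refine Submodule.span_le (p := (weightPart 𝒱 _ _ _).comap (ReducedTensor k V).subtype).2 ?_ hx
    rintro x ⟨l, hl, rfl, rfl, hl'⟩
    rw [SetLike.mem_coe, Submodule.mem_comap, Submodule.subtype_apply, hl']
    exact tensorOf_mem hl (weight_bidegree l)
  · rw [weight_bidegree, Prod.mk.injEq] at hg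
    exact ⟨l, hl, hg.1, hg.2, hx⟩

theorem tensorBigrading_of_eq_tensorOf {l : List (ℤ × V)} (hl : Homogeneous 𝒱 l)
    {x : ReducedTensor k V} (hx : (x : TensorAlgebra k V) = tensorOf k l) :
    x ∈ tensorBigrading 𝒱 (degSum l) l.length :=
  Submodule.subset_span ⟨l, hl, rfl, rfl, hx⟩

theorem mem_totalPart {n : ℤ} {x : ReducedTensor k V} :
    x ∈ totalPart (tensorBigrading 𝒱) n ↔ (x : TensorAlgebra k V) ∈ weightPart 𝒱 (1 : ℤ) 1 n := by
  refine ⟨fun hx => ?_, mem_of_weightPart 𝒱 fun l hl _ hg x hx => ?_⟩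
  · refine iSup_le (a := (weightPart 𝒱 (1 : ℤ) 1 n).comap (ReducedTensor k V).subtype)
      (fun p => Submodule.span_le.2 ?_) hx
    rintro x ⟨l, hl, hp, hq, hl'⟩
    rw [SetLike.mem_coe, Submodule.mem_comap, Submodule.subtype_apply, hl']
    exact tensorOf_mem hl (by rw [weight_one_one, totalDeg, hp, hq]; ring)
  · have := tensorBigrading_of_eq_tensorOf 𝒱 hl hx
    rw [weight_one_one, totalDeg] at hg
    rw [show (l.length : ℤ) = n - degSum l by rw [← hg]; ring] at this
    exact Submodule.mem_iSup_of_mem _ this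

theorem mem_internalPart {n : ℤ} {x : ReducedTensor k V} :
    x ∈ internalPart (tensorBigrading 𝒱) n ↔
      (x : TensorAlgebra k V) ∈ weightPart 𝒱 (1 : ℤ) 0 n := by
  refine ⟨fun hx => ?_, mem_of_weightPart 𝒱 fun l hl _ hg x hx => ?_⟩
  · refine iSup_le (a := (weightPart 𝒱 (1 : ℤ) 0 n).comap (ReducedTensor k V).subtype)
      (fun p => Submodule.span_le.2 ?_) hx
    rintro x ⟨l, hl, hp, hq, hl'⟩
    rw [SetLike.mem_coe, Submodule.mem_comap, Submodule.subtype_apply, hl']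
    exact tensorOf_mem hl (by rw [weight_one_zero, hp])
  · have := tensorBigrading_of_eq_tensorOf 𝒱 hl hx
    rw [weight_one_zero] at hg
    rw [hg] at this
    exact Submodule.mem_iSup_of_mem _ this

theorem mem_externalPart {n : ℤ} {x : ReducedTensor k V} :
    x ∈ externalPart (tensorBigrading 𝒱) n ↔
      (x : TensorAlgebra k V) ∈ weightPart 𝒱 (0 : ℤ) 1 n := by
  refine ⟨fun hx => ?_, mem_of_weightPart 𝒱 fun l hl _ hg x hx => ?_⟩
  · refine iSup_le (a := (weightPart 𝒱 (0 : ℤ) 1 n).comap (ReducedTensor k V).subtype)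
      (fun p => Submodule.span_le.2 ?_) hx
    rintro x ⟨l, hl, hp, hq, hl'⟩
    rw [SetLike.mem_coe, Submodule.mem_comap, Submodule.subtype_apply, hl']
    exact tensorOf_mem hl (by rw [weight_zero_one, hq])
  · have := tensorBigrading_of_eq_tensorOf 𝒱 hl hx
    rw [weight_zero_one] at hg
    rw [hg] at this
    exact Submodule.mem_iSup_of_mem _ this

variable {𝒱} in
/-- A multilinear map with values in a submodule on homogeneous monomials takes all of its values
there; here each argument ranges over one part of a grading. -/
theorem multilinear_mem {G : Type*} [AddCommGroup G] {α β : G} {n : ℕ} {M : Type*}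
    [AddCommGroup M] [Module k M]
    (f : MultilinearMap k (fun _ : Fin n => ReducedTensor k V) M) {W : Submodule k M} {g : Fin n → G}
    (h : ∀ (l : Fin n → List (ℤ × V)), (∀ i, Homogeneous 𝒱 (l i)) → (∀ i, weight α β (l i) = g i) →
      ∀ x : Fin n → ReducedTensor k V, (∀ i, (x i : TensorAlgebra k V) = tensorOf k (l i)) →
        f x ∈ W)
    {x : Fin n → ReducedTensor k V}
    (hx : ∀ i, (x i : TensorAlgebra k V) ∈ weightPart 𝒱 α β (g i)) : f x ∈ W := by
  suffices H : ∀ m : ℕ, ∀ x : Fin n → ReducedTensor k V,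
      (∀ i, (x i : TensorAlgebra k V) ∈ weightPart 𝒱 α β (g i)) →
      (∀ i : Fin n, m ≤ i → ∃ l : List (ℤ × V), Homogeneous 𝒱 l ∧ weight α β l = g i ∧
        (x i : TensorAlgebra k V) = tensorOf k l) → f x ∈ W from
    H n x hx fun i hi => absurd i.2 (not_lt.2 hi)
  intro m
  induction m with
  | zero =>
    intro x _ h'
    choose l h1 h2 h3 using fun i => h' i (Nat.zero_le _)
    exact h l h1 h2 x h3
  | succ m ih =>
    intro x hx h'
    by_cases hm : m < n
    · have key : x ⟨m, hm⟩ ∈ W.comap (f.toLinearMap x ⟨m, hm⟩) := by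
        refine mem_of_weightPart 𝒱 (fun l hl _ hg y hy => ?_) (hx ⟨m, hm⟩)
        rw [Submodule.mem_comap, MultilinearMap.toLinearMap_apply]
        refine ih _ (fun i => ?_) fun i hi => ?_
        · rcases eq_or_ne i ⟨m, hm⟩ with rfl | hne
          · rw [Function.update_self, hy]
            exact tensorOf_mem hl hg
          · rw [Function.update_of_ne hne]
            exact hx i
        · rcases eq_or_ne i ⟨m, hm⟩ with rfl | hne
          · rw [Function.update_self]
            exact ⟨l, hl, hg, hy⟩
          · rw [Function.update_of_ne hne]
            exact h' i (lt_of_le_of_ne hi fun h => hne (Fin.ext h.symm))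
      simpa using key
    · exact ih x hx fun i hi => absurd (hi.trans_lt i.2) hm

end Reduced

section Kadeishvili

variable {k : Type u} [Field k] {V : Type v} [AddCommGroup V] [Module k V]
  {𝒱 : ℤ → Submodule k V} [DirectSum.Decomposition 𝒱]
  (S : DGBialgebra k (V × k) (unitGrading 𝒱))

/-! ### The Cacti algebra structure on the cobar construction -/

theorem ofFn_update_eq_append {α : Type*} {n : ℕ} (f : Fin n → α) (i : Fin n) :
    ∃ Y Z : List α, ∀ a, List.ofFn (Function.update f i a) = Y ++ a :: Z := by
  induction n with
  | zero => exact i.elim0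
  | succ n ih =>
    induction i using Fin.cases with
    | zero => exact ⟨[], _, fun a => ofFn_update_zero f a⟩
    | succ i =>
      obtain ⟨Y, Z, h⟩ := ih (fun i => f i.succ) i
      exact ⟨f 0 :: Y, Z, fun a => by rw [ofFn_update_succ, h]; rfl⟩

/-- The operation `Bₙ₊₁` on arguments that are labelled with degrees. -/
def braceMultilinear {n : ℕ} (p : Fin (n + 1) → ℤ) :
    MultilinearMap k (fun _ : Fin (n + 1) => TensorAlgebra k V) (TensorAlgebra k V) :=
  (decalage (p 0) (List.ofFn fun i => p i.succ)).negOnePow •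
    MultilinearMap.mk' (fun t => braceMap 𝒱 S.mul S.comul (t 0)
        (List.ofFn fun i : Fin n => (p i.succ, t i.succ)))
      (fun t i x y => by
        induction i using Fin.cases with
        | zero => simp
        | succ i =>
          have h (a) : (fun j : Fin n => (p j.succ, Function.update t i.succ a j.succ)) =
              Function.update (fun j : Fin n => (p j.succ, t j.succ)) i (p i.succ, a) := by
            funext j
            by_cases hj : j = i
            · subst hj; simp
            · simp [hj]
          obtain ⟨Y, Z, h'⟩ := ofFn_update_eq_append (fun j : Fin n => (p j.succ, t j.succ)) i
          simp only [h, h', Function.update_of_ne (Fin.succ_ne_zero i).symm]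
          exact braceMap_add_slot 𝒱 _ _ _ _ _ _ _ _)
      (fun t i c x => by
        induction i using Fin.cases with
        | zero => simp
        | succ i =>
          have h (a) : (fun j : Fin n => (p j.succ, Function.update t i.succ a j.succ)) =
              Function.update (fun j : Fin n => (p j.succ, t j.succ)) i (p i.succ, a) := by
            funext j
            by_cases hj : j = i
            · subst hj; simp
            · simp [hj]
          obtain ⟨Y, Z, h'⟩ := ofFn_update_eq_append (fun j : Fin n => (p j.succ, t j.succ)) i
          simp only [h, h', Function.update_of_ne (Fin.succ_ne_zero i).symm]
          exact braceMap_smul_slot 𝒱 _ _ _ _ _ _ _ _)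

theorem braceMultilinear_apply {n : ℕ} (p : Fin (n + 1) → ℤ) (t : Fin (n + 1) → TensorAlgebra k V) :
    braceMultilinear S p t = (decalage (p 0) (List.ofFn fun i => p i.succ)).negOnePow •
      braceMap 𝒱 S.mul S.comul (t 0) (List.ofFn fun i : Fin n => (p i.succ, t i.succ)) := rfl

theorem algebraMapInv_diagAct (t : TensorAlgebra k V) (x : V × k) :
    TensorAlgebra.algebraMapInv (R := k) (M := V) (diagAct 𝒱 S.mul S.comul t x) =
      TensorAlgebra.algebraMapInv (R := k) (M := V) t * x.2 := by
  refine LinearMap.congr_fun (tensor_ext 𝒱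
    (φ := (TensorAlgebra.algebraMapInv (R := k) (M := V)).toLinearMap ∘ₗ
      (diagAct 𝒱 S.mul S.comul).flip x)
    (ψ := LinearMap.mulRight k x.2 ∘ₗ
      (TensorAlgebra.algebraMapInv (R := k) (M := V)).toLinearMap) fun l hl => ?_) t
  simp only [LinearMap.comp_apply, LinearMap.flip_apply, AlgHom.toLinearMap_apply,
    LinearMap.mulRight_apply]
  cases l with
  | nil => simp [tensorOf_nil, diagAct_one]
  | cons a l =>
    rw [algebraMapInv_tensorOf (List.cons_ne_nil a l), zero_mul, tensorOf_cons,
      diagAct_ι_mul _ _ (homogeneous_cons.1 hl).1, conv]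
    have h : (TensorAlgebra.algebraMapInv (R := k) (M := V)).toLinearMap ∘ₗ
        LinearMap.mul' k (TensorAlgebra k V) ∘ₗ TensorProduct.map (rightMul S.mul a.2)
          (diagAct 𝒱 S.mul S.comul (tensorOf k l) ∘ₗ signMap (unitGrading 𝒱) (a.1 + 1)) = 0 := by
      refine TensorProduct.ext' fun x y => ?_
      simp [rightMul_apply]
    exact LinearMap.congr_fun h (S.comul x)

theorem algebraMapInv_braceMap {t : TensorAlgebra k V}
    (ht : TensorAlgebra.algebraMapInv (R := k) (M := V) t = 0) (Y : List (ℤ × TensorAlgebra k V)) :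
    TensorAlgebra.algebraMapInv (R := k) (M := V) (braceMap 𝒱 S.mul S.comul t Y) = 0 := by
  have key : (TensorAlgebra.algebraMapInv (R := k) (M := V)).toLinearMap ∘ₗ
      braceAt 𝒱 S.mul S.comul Y ∘ₗ (ReducedTensor k V).subtype ∘ₗ reducedProj k V = 0 := by
    refine tensor_ext 𝒱 fun l hl => ?_
    cases l with
    | nil => simp
    | cons a l =>
      simp only [LinearMap.comp_apply, Submodule.subtype_apply,
        reducedProj_of_mem (algebraMapInv_tensorOf (List.cons_ne_nil a l)), braceAt_apply]
      cases Y with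
      | nil => simp [braceMap_nil]
      | cons y Y =>
        rw [tensorOf_cons, braceMap_ι_mul_cons', AlgHom.toLinearMap_apply, map_add, map_mul,
          algebraMapInv_ι, Units.smul_def, map_zsmul, map_mul, algebraMapInv_diagAct]
        simp
  have := LinearMap.congr_fun key t
  simpa [reducedProj_of_mem ht] using this

theorem algebraMapInv_derivationOf {δ : V →ₗ[k] TensorAlgebra k V}
    (hδ : ∀ v, TensorAlgebra.algebraMapInv (R := k) (M := V) (δ v) = 0) (t : TensorAlgebra k V) :
    TensorAlgebra.algebraMapInv (R := k) (M := V) (derivationOf 𝒱 δ t) = 0 := by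
  refine LinearMap.congr_fun (tensor_ext 𝒱
    (φ := (TensorAlgebra.algebraMapInv (R := k) (M := V)).toLinearMap ∘ₗ derivationOf 𝒱 δ)
    (ψ := 0) fun l hl => ?_) t
  simp only [LinearMap.comp_apply, AlgHom.toLinearMap_apply, LinearMap.zero_apply]
  cases l with
  | nil => simp [tensorOf_nil, derivationOf_one]
  | cons a l =>
    rw [tensorOf_cons, derivationOf_ι_mul _ (homogeneous_cons.1 hl).1, Units.smul_def]
    simp [hδ]

theorem algebraMapInv_cobarExt (x : V × k) :
    TensorAlgebra.algebraMapInv (R := k) (M := V) (cobarExt 𝒱 S.comul x) = 0 := by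
  have h : (TensorAlgebra.algebraMapInv (R := k) (M := V)).toLinearMap ∘ₗ cobarCup 𝒱 = 0 := by
    refine TensorProduct.ext' fun x y => ?_
    simp [cobarCup, projV]
  exact LinearMap.congr_fun h (S.comul x)

theorem algebraMapInv_cobarD (t : TensorAlgebra k V) :
    TensorAlgebra.algebraMapInv (R := k) (M := V) (cobarD 𝒱 S.comul S.d t) = 0 :=
  algebraMapInv_derivationOf (fun v => by
    simp [cobarGen, algebraMapInv_cobarExt, projV]) t

/-- The operation `Bₙ₊₁` on the reduced tensor algebra, glued from the homogeneous parts. -/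
def kadeishviliB (n : ℕ) :
    MultilinearMap k (fun _ : Fin (n + 1) => ReducedTensor k V) (ReducedTensor k V) :=
  (reducedProj k V).compMultilinearMap
    ((MultilinearMap.fromDirectSumEquiv (ι := Fin (n + 1)) (R := k)
      (M := fun _ (p : ℤ) => weightPart 𝒱 (1 : ℤ) 1 p)
      (fun p => (braceMultilinear S p).compLinearMap fun _ => Submodule.subtype _)).compLinearMap
        fun _ => (DirectSum.decomposeLinearEquiv (weightPart 𝒱 (1 : ℤ) 1)).toLinearMap ∘ₗ
          (ReducedTensor k V).subtype)

/-- A labelled element of the reduced tensor algebra as a labelled element of the tensor algebra. -/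
def coePair (a : ℤ × ReducedTensor k V) : ℤ × TensorAlgebra k V := (a.1, a.2)

@[simp] theorem coePair_fst (a : ℤ × ReducedTensor k V) : (coePair a).1 = a.1 := rfl

@[simp] theorem coePair_snd (a : ℤ × ReducedTensor k V) :
    (coePair a).2 = (a.2 : TensorAlgebra k V) := rfl

/-- The operation `Bₙ₊₁` on homogeneous elements is the brace with the décalage sign. -/
theorem kadeishviliB_apply {n : ℕ} {P : Fin (n + 1) → ℤ × ReducedTensor k V}
    (hP : ∀ i, (P i).2 ∈ totalPart (tensorBigrading 𝒱) (P i).1) :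
    (kadeishviliB S n (fun i => (P i).2) : TensorAlgebra k V) =
      (decalage (P 0).1 (List.ofFn fun i => (P i.succ).1)).negOnePow •
        braceMap 𝒱 S.mul S.comul (P 0).2 (List.ofFn fun i : Fin n => coePair (P i.succ)) := by
  have h (i : Fin (n + 1)) := (mem_totalPart 𝒱).1 (hP i)
  have key : (fun i => DirectSum.decomposeLinearEquiv (weightPart 𝒱 (1 : ℤ) 1)
      ((P i).2 : TensorAlgebra k V)) = fun i => DirectSum.lof k ℤ
        (fun p => weightPart 𝒱 (1 : ℤ) 1 p) (P i).1 ⟨(P i).2, h i⟩ := by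
    funext i
    exact DirectSum.decompose_of_mem _ (h i)
  simp only [kadeishviliB, LinearMap.compMultilinearMap_apply, MultilinearMap.compLinearMap_apply,
    LinearMap.comp_apply, Submodule.subtype_apply, LinearEquiv.coe_coe]
  rw [key, MultilinearMap.fromDirectSumEquiv_lof]
  rw [reducedProj_of_mem]
  · rfl
  · rw [MultilinearMap.compLinearMap_apply, braceMultilinear_apply, Units.smul_def, map_zsmul]
    exact (congrArg _ (algebraMapInv_braceMap S (algebraMapInv_coe (P 0).2) _)).trans (smul_zero _)

/-- The differential, the product and the operations `Bₙ` of the Cacti algebra that belongs to a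
differential graded bialgebra. -/
def kadeishviliData : CactiData k (ReducedTensor k V) where
  d := reducedProj k V ∘ₗ cobarD 𝒱 S.comul S.d ∘ₗ (ReducedTensor k V).subtype
  mul := ((LinearMap.mul k (TensorAlgebra k V)).compl₁₂ (ReducedTensor k V).subtype
    (ReducedTensor k V).subtype).compr₂ (reducedProj k V)
  B := kadeishviliB S

theorem coe_kadeishvili_d (x : ReducedTensor k V) :
    ((kadeishviliData S).d x : TensorAlgebra k V) = cobarD 𝒱 S.comul S.d x :=
  reducedProj_of_mem (algebraMapInv_cobarD S _)

theorem coe_kadeishvili_mul (x y : ReducedTensor k V) :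
    ((kadeishviliData S).mul x y : TensorAlgebra k V) = x * y :=
  reducedProj_of_mem (by simp [algebraMapInv_coe])

theorem Homogeneous.coePair {l : List (ℤ × ReducedTensor k V)}
    (h : Homogeneous (totalPart (tensorBigrading 𝒱)) l) :
    Homogeneous (tensorTotal 𝒱) (l.map coePair) := by
  intro a ha
  obtain ⟨b, hb, rfl⟩ := List.mem_map.1 ha
  exact (mem_totalPart 𝒱).1 (h b hb)

theorem coe_kadeishvili_op {x : ℤ × ReducedTensor k V}
    (hx : x.2 ∈ totalPart (tensorBigrading 𝒱) x.1)
    {ys : List (ℤ × ReducedTensor k V)} (hys : Homogeneous (totalPart (tensorBigrading 𝒱)) ys) :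
    ((kadeishviliData S).op x.2 (ys.map Prod.snd) : TensorAlgebra k V) =
      (decalage x.1 (ys.map Prod.fst)).negOnePow •
        braceMap 𝒱 S.mul S.comul x.2 (ys.map coePair) := by
  have hlen : (ys.map Prod.snd).length = ys.length := List.length_map _
  set P : Fin ((ys.map Prod.snd).length + 1) → ℤ × ReducedTensor k V :=
    Fin.cons x fun i => ys.get (i.cast hlen) with hP
  have h1 : (Fin.cons x.2 (ys.map Prod.snd).get : Fin ((ys.map Prod.snd).length + 1) → _) =
      fun i => (P i).2 := by
    funext i
    induction i using Fin.cases with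
    | zero => rfl
    | succ i => simp [hP]
  rw [CactiData.op, h1]
  refine (kadeishviliB_apply S (P := P) fun i => ?_).trans ?_
  · induction i using Fin.cases with
    | zero => exact hx
    | succ i => exact hys _ (List.get_mem _ _)
  · have h2 : (List.ofFn fun i => (P (Fin.succ i)).1) = ys.map Prod.fst :=
      List.ext_getElem (by simp) (by simp [hP])
    have h3 : (List.ofFn fun i => coePair (P (Fin.succ i))) = ys.map coePair :=
      List.ext_getElem (by simp) (by simp [hP])
    rw [h2, h3]
    rfl

theorem coe_kadeishvili_brace {x : ℤ × ReducedTensor k V}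
    (hx : x.2 ∈ totalPart (tensorBigrading 𝒱) x.1)
    {ys : List (ℤ × ReducedTensor k V)} (hys : Homogeneous (totalPart (tensorBigrading 𝒱)) ys) :
    coePair ((kadeishviliData S).brace x ys) = bracePair S (coePair x) (ys.map coePair) := by
  refine Prod.ext ?_ ?_
  · simp [CactiData.brace, bracePair, shiftedDegSum, Function.comp_def]
  · simp only [CactiData.brace, bracePair, coePair_snd]
    rw [Units.smul_def, Submodule.coe_smul_of_tower, coe_kadeishvili_op S hx hys, ← Units.smul_def,
      smul_smul, ← Int.negOnePow_add, Int.negOnePow_even _ ⟨_, rfl⟩, one_smul]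

theorem shiftedDegSum_map_coePair (l : List (ℤ × ReducedTensor k V)) :
    shiftedDegSum (l.map coePair) = shiftedDegSum l := by
  simp [shiftedDegSum, Function.comp_def]

theorem kadeishvili_brace_mem {x : ℤ × ReducedTensor k V}
    (hx : x.2 ∈ totalPart (tensorBigrading 𝒱) x.1)
    {ys : List (ℤ × ReducedTensor k V)} (hys : Homogeneous (totalPart (tensorBigrading 𝒱)) ys) :
    ((kadeishviliData S).brace x ys).2 ∈
      totalPart (tensorBigrading 𝒱) ((kadeishviliData S).brace x ys).1 := by
  rw [mem_totalPart, ← coePair_snd, ← coePair_fst, coe_kadeishvili_brace S hx hys]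
  have hx' : (coePair x).2 ∈ tensorTotal 𝒱 (coePair x).1 := (mem_totalPart 𝒱).1 hx
  exact bracePair_mem (S := S) hx' hys.coePair

theorem coe_kadeishvili_braceSum {x : ℤ × ReducedTensor k V}
    (hx : x.2 ∈ totalPart (tensorBigrading 𝒱) x.1) {acc ys zs : List (ℤ × ReducedTensor k V)}
    (hacc : Homogeneous (totalPart (tensorBigrading 𝒱)) acc)
    (hys : Homogeneous (totalPart (tensorBigrading 𝒱)) ys)
    (hzs : Homogeneous (totalPart (tensorBigrading 𝒱)) zs) :
    ((kadeishviliData S).braceSum x acc ys zs : TensorAlgebra k V) =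
      insertSum S (fun W => braceMap 𝒱 S.mul S.comul x.2 (acc.map coePair ++ W)) (ys.map coePair)
        (zs.map coePair) := by
  induction ys generalizing acc zs with
  | nil =>
    rw [CactiData.braceSum, List.map_nil, insertSum, ← List.map_append]
    exact congrArg Prod.snd (coe_kadeishvili_brace S hx (homogeneous_append.2 ⟨hacc, hzs⟩))
  | cons y ys ih =>
    obtain ⟨hy, hys⟩ := homogeneous_cons.1 hys
    rw [CactiData.braceSum, List.map_cons, insertSum, List.length_map, AddSubmonoidClass.coe_finsetSum]
    refine Finset.sum_congr rfl fun i _ => ?_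
    rw [AddSubmonoidClass.coe_finsetSum]
    refine Finset.sum_congr rfl fun j _ => ?_
    have hb := kadeishvili_brace_mem S hy ((hzs.drop i).take j)
    rw [Units.smul_def, Submodule.coe_smul_of_tower, ih (homogeneous_append.2
      ⟨homogeneous_append.2 ⟨hacc, hzs.take i⟩, homogeneous_cons.2 ⟨hb, homogeneous_nil⟩⟩) hys
      (hzs.drop _), ← Units.smul_def]
    simp only [List.map_append, List.map_cons, List.map_nil, List.append_assoc, List.cons_append,
      List.nil_append, coe_kadeishvili_brace S hy ((hzs.drop i).take j), List.map_take, List.map_drop,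
      coePair_fst]
    rw [← List.map_take, ← List.map_take, shiftedDegSum_map_coePair, shiftedDegSum_map_coePair,
      shiftedDegSum_map_coePair]

theorem coe_kadeishvili_op_mul {x x' : ℤ × ReducedTensor k V}
    (hx : x.2 ∈ totalPart (tensorBigrading 𝒱) x.1) (hx' : x'.2 ∈ totalPart (tensorBigrading 𝒱) x'.1)
    {ys : List (ℤ × ReducedTensor k V)} (hys : Homogeneous (totalPart (tensorBigrading 𝒱)) ys) :
    (kadeishviliData S).op ((kadeishviliData S).mul x.2 x'.2) (ys.map Prod.snd) =
      ∑ i ∈ Finset.range (ys.length + 1),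
        (x'.1 * degSum (ys.take i) +
            ((ys.length : ℤ) - i) * (x.1 + degSum (ys.take i))).negOnePow •
          (kadeishviliData S).mul ((kadeishviliData S).op x.2 ((ys.take i).map Prod.snd))
            ((kadeishviliData S).op x'.2 ((ys.drop i).map Prod.snd)) := by
  ext
  have hxx : ((kadeishviliData S).mul x.2 x'.2) ∈ totalPart (tensorBigrading 𝒱) (x.1 + x'.1) := by
    rw [mem_totalPart, coe_kadeishvili_mul]
    exact mul_mem_weightPart ((mem_totalPart 𝒱).1 hx) ((mem_totalPart 𝒱).1 hx')
  rw [coe_kadeishvili_op S (x := (x.1 + x'.1, _)) hxx hys, coe_kadeishvili_mul,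
    braceMap_mul S ((mem_totalPart 𝒱).1 hx) ((mem_totalPart 𝒱).1 hx') hys.coePair,
    AddSubmonoidClass.coe_finsetSum, List.length_map, Finset.smul_sum]
  refine Finset.sum_congr rfl fun i hi => ?_
  rw [Units.smul_def ((x'.1 * _ + _ : ℤ).negOnePow), Submodule.coe_smul_of_tower, ← Units.smul_def,
    coe_kadeishvili_mul, coe_kadeishvili_op S hx (hys.take i), coe_kadeishvili_op S hx' (hys.drop i),
    ← List.map_take, ← List.map_drop, shiftedDegSum_map_coePair]
  simp only [smul_mul_assoc, mul_smul_comm, smul_smul, ← Int.negOnePow_add]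
  congr 1
  have hi' : i ≤ ys.length := Nat.lt_succ_iff.1 (Finset.mem_range.1 hi)
  have hl1 : ((ys.take i).length : ℤ) = i := by rw [List.length_take, min_eq_left hi']
  have hl2 : ((ys.drop i).length : ℤ) = ys.length - i := by
    rw [List.length_drop, Nat.cast_sub hi']
  have hs : shiftedDegSum (ys.take i) = degSum (ys.take i) - i := by
    rw [← hl1]
    generalize ys.take i = l
    induction l with
    | nil => simp
    | cons a l ih => rw [shiftedDegSum_cons, degSum_cons, ih]; push_cast [List.length_cons]; ring
  have hd : decalage (x.1 + x'.1) (ys.map Prod.fst) = decalage x.1 ((ys.take i).map Prod.fst) +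
      i * x'.1 + (decalage x'.1 ((ys.drop i).map Prod.fst) +
        (ys.length - i) * (x.1 + degSum (ys.take i))) := by
    conv_lhs => rw [← List.take_append_drop i ys]
    rw [List.map_append, decalage_append, decalage_add, List.length_map, hl1,
      show x.1 + x'.1 + ((ys.take i).map Prod.fst).sum = x'.1 + (x.1 + degSum (ys.take i)) by
        rw [degSum]; ring, decalage_add, List.length_map, hl2]
  rw [hd, hs]
  exact Int.negOnePow_congr (by push_cast; grind)

end Kadeishvili

section KadeishviliAlgebra

variable {k : Type u} [Field k] {V : Type v} [AddCommGroup V] [Module k V]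
  {𝒱 : ℤ → Submodule k V} [DirectSum.Decomposition 𝒱]
  (S : DGBialgebra k (V × k) (unitGrading 𝒱))

/-! ### The boundary of the operations on the cobar construction -/

theorem coe_negOnePow_smul (n : ℤ) (x : ReducedTensor k V) :
    ((n.negOnePow • x : ReducedTensor k V) : TensorAlgebra k V) = n.negOnePow • (x : TensorAlgebra k V) := by
  rw [Units.smul_def, Submodule.coe_smul_of_tower, ← Units.smul_def]

theorem shiftedDegSum_eq {T : Type*} (l : List (ℤ × T)) :
    shiftedDegSum l = (l.map Prod.fst).sum - l.length := by
  induction l with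
  | nil => simp
  | cons a l ih => rw [shiftedDegSum_cons, ih]; push_cast [List.length_cons, List.map_cons, List.sum_cons]; ring

theorem shiftedDegSum_take_ofFn {T : Type*} {n m : ℕ} (f : Fin n → ℤ × T) (hm : m ≤ n) :
    shiftedDegSum ((List.ofFn f).take m) = ((List.ofFn fun i => (f i).1).take m).sum - m := by
  rw [shiftedDegSum_eq, List.map_take, List.map_ofFn, List.length_take, List.length_ofFn,
    min_eq_left hm]
  rfl

theorem sum_take_ofFn {n : ℕ} (d : Fin n → ℤ) (i : Fin n) :
    ((List.ofFn d).take i).sum = ∑ j ∈ Finset.univ.filter (· < i), d j := by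
  induction n with
  | zero => exact i.elim0
  | succ n ih =>
    rw [List.ofFn_succ, Finset.sum_filter, Fin.sum_univ_succ]
    induction i using Fin.cases with
    | zero => simp
    | succ i =>
      rw [Fin.val_succ, List.take_succ_cons, List.sum_cons, ih, Finset.sum_filter]
      simp

theorem Fin.map_contractNth {α β : Type*} {n : ℕ} (j : Fin (n + 1)) (op : α → α → α)
    (op' : β → β → β) (φ : α → β) (h : ∀ a b, φ (op a b) = op' (φ a) (φ b)) (f : Fin (n + 1) → α)
    (i : Fin n) :
    φ (Fin.contractNth j op f i) = Fin.contractNth j op' (fun i => φ (f i)) i := by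
  simp only [Fin.contractNth]
  split_ifs
  · rfl
  · exact h _ _
  · rfl

/-- The product of labelled elements. -/
def mulPair (a b : ℤ × ReducedTensor k V) : ℤ × ReducedTensor k V :=
  (a.1 + b.1, (kadeishviliData S).mul a.2 b.2)

/-- The boundary of `Bₙ₊₂` on the cobar construction: the formula `hasBoundary` for the braces, with
the décalage signs removed. -/
theorem kadeishvili_boundary (h1 : S.one = (0, 1)) (hε : S.counit = LinearMap.snd k V k) {n : ℕ}
    {P : Fin (n + 2) → ℤ × ReducedTensor k V}
    (hP : ∀ i, (P i).2 ∈ totalPart (tensorBigrading 𝒱) (P i).1) :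
    (kadeishviliData S).d (kadeishviliB S (n + 1) fun i => (P i).2) -
        ∑ i, (-((n : ℤ) + 1) + ∑ j ∈ Finset.univ.filter (· < i), (P j).1).negOnePow •
          kadeishviliB S (n + 1)
            (Function.update (fun i => (P i).2) i ((kadeishviliData S).d (P i).2)) =
      ((P 0).1 * (P 1).1 + n * (P 1).1).negOnePow •
          (kadeishviliData S).mul (P 1).2 (kadeishviliB S n (Fin.removeNth 1 fun i => (P i).2)) +
        ∑ j ∈ Finset.univ.filter (fun j : Fin (n + 2) => 1 ≤ (j : ℕ) ∧ (j : ℕ) ≤ n),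
          ((j : ℕ) : ℤ).negOnePow • kadeishviliB S n
            (Fin.contractNth j (fun a b => (kadeishviliData S).mul a b) fun i => (P i).2) +
        ((n : ℤ) + 1).negOnePow •
          (kadeishviliData S).mul (kadeishviliB S n (Fin.init fun i => (P i).2))
            (P (Fin.last (n + 1))).2 := by
  set Y : Fin (n + 1) → ℤ × TensorAlgebra k V := fun i => coePair (P i.succ) with hYdef
  set e : ℤ := decalage (P 0).1 (List.ofFn fun i : Fin (n + 1) => (P i.succ).1) with he
  have hPt (i) : ((P i).2 : TensorAlgebra k V) ∈ tensorTotal 𝒱 (P i).1 := (mem_totalPart 𝒱).1 (hP i)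
  have hYm : Homogeneous (tensorTotal 𝒱) (List.ofFn Y) := by
    intro a ha
    obtain ⟨i, rfl⟩ := (List.mem_ofFn' _ _).1 ha
    exact hPt _
  have hdmem (i) : (kadeishviliData S).d (P i).2 ∈ totalPart (tensorBigrading 𝒱) ((P i).1 + 1) := by
    rw [mem_totalPart, coe_kadeishvili_d]
    exact cobarD_mem S (hPt i)
  -- the values of the operations in terms of the braces
  have hB : (kadeishviliB S (n + 1) (fun i => (P i).2) : TensorAlgebra k V) =
      e.negOnePow • braceMap 𝒱 S.mul S.comul (P 0).2 (List.ofFn Y) := kadeishviliB_apply S hP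
  have hupd (i : Fin (n + 2)) : Function.update (fun i => (P i).2) i ((kadeishviliData S).d (P i).2) =
      fun j => (Function.update P i ((P i).1 + 1, (kadeishviliData S).d (P i).2) j).2 := by
    funext j
    by_cases hj : j = i
    · subst hj; simp
    · simp [hj]
  have hupd_mem (i j : Fin (n + 2)) :
      (Function.update P i ((P i).1 + 1, (kadeishviliData S).d (P i).2) j).2 ∈
        totalPart (tensorBigrading 𝒱)
          (Function.update P i ((P i).1 + 1, (kadeishviliData S).d (P i).2) j).1 := by
    by_cases hj : j = i
    · subst hj; simpa using hdmem j
    · simpa [hj] using hP j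
  have hB0 : (kadeishviliB S (n + 1) (Function.update (fun i => (P i).2) 0
      ((kadeishviliData S).d (P 0).2)) : TensorAlgebra k V) = (e + (n + 1)).negOnePow •
        braceMap 𝒱 S.mul S.comul (cobarD 𝒱 S.comul S.d (P 0).2) (List.ofFn Y) := by
    rw [hupd, kadeishviliB_apply S (hupd_mem 0)]
    simp only [Function.update_self, Function.update_of_ne (Fin.succ_ne_zero _), coe_kadeishvili_d,
      decalage_add, List.length_ofFn]
    simp [he, hYdef]
  have hBs (i : Fin (n + 1)) : (kadeishviliB S (n + 1) (Function.update (fun i => (P i).2) i.succ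
      ((kadeishviliData S).d (P i.succ).2)) : TensorAlgebra k V) = (e + (n - (i : ℕ))).negOnePow •
        braceMap 𝒱 S.mul S.comul (P 0).2 (List.ofFn (Function.update Y i
          ((Y i).1 + 1, cobarD 𝒱 S.comul S.d (Y i).2))) := by
    rw [hupd, kadeishviliB_apply S (hupd_mem i.succ)]
    have e1 : (fun j : Fin (n + 1) => (Function.update P i.succ ((P i.succ).1 + 1,
        (kadeishviliData S).d (P i.succ).2) j.succ).1) =
        Function.update (fun j : Fin (n + 1) => (P j.succ).1) i ((P i.succ).1 + 1) := by
      funext j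
      by_cases hj : j = i
      · subst hj; simp
      · simp [hj]
    have e2 : (fun j : Fin (n + 1) => coePair (Function.update P i.succ ((P i.succ).1 + 1,
        (kadeishviliData S).d (P i.succ).2) j.succ)) =
        Function.update Y i ((Y i).1 + 1, cobarD 𝒱 S.comul S.d (Y i).2) := by
      funext j
      by_cases hj : j = i
      · subst hj; simp [coePair, hYdef, coe_kadeishvili_d]
      · simp [hj, hYdef]
    rw [e1, e2, Function.update_of_ne (Fin.succ_ne_zero _).symm,
      decalage_update (P 0).1 (fun j : Fin (n + 1) => (P j.succ).1) i 1, mul_one]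
  have hBc (j : Fin n) : (kadeishviliB S n (Fin.contractNth j.castSucc.succ
      (fun a b => (kadeishviliData S).mul a b) fun i => (P i).2) : TensorAlgebra k V) =
      (decalage (P 0).1 (List.ofFn (Fin.contractNth j.castSucc (· + ·)
        fun i : Fin (n + 1) => (P i.succ).1))).negOnePow • braceMap 𝒱 S.mul S.comul (P 0).2
        (List.ofFn (Fin.contractNth j.castSucc (fun a b => (a.1 + b.1, a.2 * b.2)) Y)) := by
    have e1 : Fin.contractNth j.castSucc.succ (fun a b => (kadeishviliData S).mul a b)
        (fun i => (P i).2) = fun i => (Fin.contractNth j.castSucc.succ (mulPair S) P i).2 := by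
      funext i
      exact (Fin.map_contractNth _ _ _ Prod.snd (fun a b => rfl) P i).symm
    have e2 (i) : (Fin.contractNth j.castSucc.succ (mulPair S) P i).2 ∈
        totalPart (tensorBigrading 𝒱) (Fin.contractNth j.castSucc.succ (mulPair S) P i).1 := by
      simp only [Fin.contractNth]
      split_ifs
      · exact hP _
      · rw [mem_totalPart]
        simp only [mulPair, coe_kadeishvili_mul]
        exact mul_mem_weightPart (hPt _) (hPt _)
      · exact hP _
    rw [e1, kadeishviliB_apply S e2, Fin.contractNth_succ]
    simp only [Fin.cons_zero, Fin.cons_succ]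
    rw [funext fun i => Fin.map_contractNth j.castSucc (mulPair S) (· + ·) Prod.fst
        (fun a b => rfl) (fun i => P i.succ) i, funext fun i => Fin.map_contractNth j.castSucc
          (mulPair S) (fun a b => (a.1 + b.1, a.2 * b.2)) coePair (fun a b => by
            simp [coePair, mulPair, coe_kadeishvili_mul]) (fun i => P i.succ) i]
  have hBi : (kadeishviliB S n (Fin.init fun i => (P i).2) : TensorAlgebra k V) =
      (decalage (P 0).1 (List.ofFn (Fin.init fun i : Fin (n + 1) => (P i.succ).1))).negOnePow •
        braceMap 𝒱 S.mul S.comul (P 0).2 (List.ofFn (Fin.init Y)) :=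
    kadeishviliB_apply S (P := Fin.init P) fun i => hP _
  have hBh : (kadeishviliB S n (Fin.removeNth 1 fun i => (P i).2) : TensorAlgebra k V) =
      (decalage (P 0).1 (List.ofFn fun i : Fin n => (P i.succ.succ).1)).negOnePow •
        braceMap 𝒱 S.mul S.comul (P 0).2 (List.ofFn fun i : Fin n => Y i.succ) := by
    have e1 (i : Fin n) : (1 : Fin (n + 2)).succAbove i.succ = i.succ.succ := by
      rw [← Fin.succ_zero_eq_one, Fin.succ_succAbove_succ, Fin.succAbove_zero]
    refine (kadeishviliB_apply S (P := Fin.removeNth 1 P) fun i => hP _).trans ?_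
    simp [Fin.removeNth, e1, hYdef]
  have hfilter (g : Fin (n + 2) → ReducedTensor k V) :
      ∑ j ∈ Finset.univ.filter (fun j : Fin (n + 2) => 1 ≤ (j : ℕ) ∧ (j : ℕ) ≤ n), g j =
        ∑ j : Fin n, g j.castSucc.succ := by
    rw [Finset.sum_filter, Fin.sum_univ_succ, Fin.sum_univ_castSucc]
    simp
  have hbd := hasBoundary S hε h1 (hPt 0) (List.ofFn Y) hYm
  have hhead : boundaryHead (P 0).1 (braceMap 𝒱 S.mul S.comul (P 0).2) (List.ofFn Y) =
      ((P 0).1 * (P 1).1 + (P 0).1).negOnePow • (((P 1).2 : TensorAlgebra k V) *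
        braceMap 𝒱 S.mul S.comul (P 0).2 (List.ofFn fun i : Fin n => Y i.succ)) := by
    rw [List.ofFn_succ]
    rfl
  rw [boundarySum_ofFn, hhead] at hbd
  apply Subtype.ext
  rw [hfilter, Fin.sum_univ_succ]
  simp only [Submodule.coe_sub, Submodule.coe_add, AddSubmonoidClass.coe_finsetSum,
    coe_negOnePow_smul, coe_kadeishvili_mul, coe_kadeishvili_d, hB, hB0, hBs, hBc, hBi, hBh,
    LinearMap.map_smul_of_tower, smul_mul_assoc, mul_smul_comm, hbd, smul_add, smul_sub, smul_neg,
    Finset.smul_sum, smul_smul, ← Int.negOnePow_add]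
  have s1 (i : Fin (n + 1)) : (-((n : ℤ) + 1) +
      ∑ j ∈ Finset.univ.filter (· < i.succ), (P j).1 + (e + (n - (i : ℕ)))).negOnePow =
      -(e + ((P 0).1 + shiftedDegSum ((List.ofFn Y).take i))).negOnePow := by
    rw [shiftedDegSum_take_ofFn Y i.2.le, sum_take_ofFn, Finset.sum_filter, Fin.sum_univ_succ,
      if_pos (Fin.succ_pos i), Finset.sum_filter]
    simp only [Fin.succ_lt_succ_iff, hYdef, coePair_fst]
    rw [← Int.negOnePow_succ]
    exact Int.negOnePow_congr (by push_cast; grind)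
  have s2 (j : Fin n) : (((j.castSucc.succ : Fin (n + 2)) : ℕ) + decalage (P 0).1
      (List.ofFn (Fin.contractNth j.castSucc (· + ·)
        fun i : Fin (n + 1) => (P i.succ).1)) : ℤ).negOnePow =
      (e + ((P 0).1 + shiftedDegSum ((List.ofFn Y).take (j + 1)))).negOnePow := by
    rw [shiftedDegSum_take_ofFn Y (Nat.succ_lt_succ j.2).le, he, ← decalage_contractNth (P 0).1
      (fun i : Fin (n + 1) => (P i.succ).1) j]
    simp only [hYdef, coePair_fst, Fin.val_succ, Fin.val_castSucc]
    exact Int.negOnePow_congr (by push_cast; grind)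
  have s3 : ((n : ℤ) + 1 + decalage (P 0).1
      (List.ofFn (Fin.init fun i : Fin (n + 1) => (P i.succ).1))).negOnePow =
      -(e + ((P 0).1 + shiftedDegSum ((List.ofFn Y).take n))).negOnePow := by
    rw [shiftedDegSum_take_ofFn Y n.le_succ, he, ← decalage_init (P 0).1
      (fun i : Fin (n + 1) => (P i.succ).1), ← Int.negOnePow_succ]
    simp only [hYdef, coePair_fst]
    exact Int.negOnePow_congr (by push_cast; grind)
  have s4 : ((P 0).1 * (P 1).1 + n * (P 1).1 +
      decalage (P 0).1 (List.ofFn fun i : Fin n => (P i.succ.succ).1)).negOnePow =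
      (e + ((P 0).1 * (P 1).1 + (P 0).1)).negOnePow := by
    rw [he, List.ofFn_succ, decalage_cons, decalage_add, List.length_ofFn, Fin.succ_zero_eq_one]
    exact Int.negOnePow_congr (by push_cast; grind)
  have s5 : (-((n : ℤ) + 1) + ∑ j ∈ Finset.univ.filter (· < (0 : Fin (n + 2))), (P j).1 +
      (e + (n + 1))).negOnePow = e.negOnePow := by
    rw [Finset.sum_eq_zero (by simp)]
    congr 1
    ring
  simp only [s1, s2, s3, s4, s5, Units.neg_smul, Finset.sum_neg_distrib]
  have hlast : ((P (Fin.last (n + 1))).2 : TensorAlgebra k V) = (Y (Fin.last n)).2 := rfl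
  rw [hlast]
  abel

end KadeishviliAlgebra

section KadeishviliAlgebra

variable {k : Type u} [Field k] {V : Type v} [AddCommGroup V] [Module k V]
  {𝒱 : ℤ → Submodule k V} [DirectSum.Decomposition 𝒱]
  (S : DGBialgebra k (V × k) (unitGrading 𝒱))

/-! ### The cobar construction is a well graded Cacti algebra -/

theorem homogeneous_ofFn {T : Type*} [AddCommGroup T] [Module k T] {𝒯 : ℤ → Submodule k T} {n : ℕ}
    {f : Fin n → ℤ × T} : Homogeneous 𝒯 (List.ofFn f) ↔ ∀ i, (f i).2 ∈ 𝒯 (f i).1 := by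
  simp [Homogeneous, List.mem_ofFn']

theorem kadeishviliB_mem {n : ℕ} {P : Fin (n + 1) → ℤ × ReducedTensor k V}
    (hP : ∀ i, (P i).2 ∈ totalPart (tensorBigrading 𝒱) (P i).1) :
    kadeishviliB S n (fun i => (P i).2) ∈ totalPart (tensorBigrading 𝒱) (∑ i, (P i).1 - n) := by
  rw [mem_totalPart, kadeishviliB_apply S hP, Units.smul_def]
  refine zsmul_mem ?_ _
  have hY : Homogeneous (tensorTotal 𝒱) (List.ofFn fun i : Fin n => coePair (P i.succ)) :=
    homogeneous_ofFn.2 fun i => (mem_totalPart 𝒱).1 (hP _)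
  have := braceMap_mem S ((mem_totalPart 𝒱).1 (hP 0)) hY
  rw [shiftedDegSum_eq, List.map_ofFn, List.length_ofFn, List.sum_ofFn] at this
  rw [Fin.sum_univ_succ, add_sub_assoc]
  exact this

variable (𝒱) in
theorem mem_weightPart_zero (t : TensorAlgebra k V) : t ∈ weightPart 𝒱 (0 : ℤ) 0 0 :=
  tensor_mem_of_monomials 𝒱 (fun _ hl => tensorOf_mem hl (by simp [weight])) t

variable (𝒱) in
/-- Monomials in homogeneous elements span the reduced tensor algebra. -/
theorem reducedTensor_ext {M : Type*} [AddCommGroup M] [Module k M]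
    {φ ψ : ReducedTensor k V →ₗ[k] M}
    (h : ∀ l : List (ℤ × V), Homogeneous 𝒱 l → l ≠ [] → ∀ x : ReducedTensor k V,
      (x : TensorAlgebra k V) = tensorOf k l → φ x = ψ x) : φ = ψ :=
  LinearMap.ext fun x => mem_of_weightPart 𝒱 (W := LinearMap.eqLocus φ ψ)
    (fun l hl hl' _ => h l hl hl') (mem_weightPart_zero 𝒱 x)

theorem mem_totalPart_of_eq_tensorOf {l : List (ℤ × V)} (hl : Homogeneous 𝒱 l)
    {x : ReducedTensor k V} (hx : (x : TensorAlgebra k V) = tensorOf k l) :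
    x ∈ totalPart (tensorBigrading 𝒱) (totalDeg l) := by
  rw [mem_totalPart, hx]
  exact tensorOf_mem_total hl

theorem kadeishviliB_zero (t : Fin (0 + 1) → ReducedTensor k V) : kadeishviliB S 0 t = t 0 := by
  have key : (kadeishviliB S 0).toLinearMap t 0 = LinearMap.id := by
    refine reducedTensor_ext 𝒱 fun l hl _ x hx => ?_
    have hx' : x ∈ totalPart (tensorBigrading 𝒱) (totalDeg l) := mem_totalPart_of_eq_tensorOf hl hx
    have h := kadeishviliB_apply S (n := 0) (P := fun _ => (totalDeg l, x)) fun _ => hx'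
    have e : Function.update t 0 x = fun _ => x := by
      funext i
      obtain rfl : i = 0 := Fin.fin_one_eq_zero i
      exact Function.update_self ..
    rw [MultilinearMap.toLinearMap_apply, e]
    refine Subtype.ext (h.trans ?_)
    simp
  have h := LinearMap.congr_fun key (t 0)
  rwa [MultilinearMap.toLinearMap_apply, Function.update_eq_self] at h

/-- The Cacti algebra that belongs to a differential graded bialgebra: the cobar construction with
the operations of Kadeishvili. -/
def kadeishviliAlgebra (h1 : S.one = (0, 1)) (hε : S.counit = LinearMap.snd k V k) :
    CactiAlgebra k (ReducedTensor k V) (totalPart (tensorBigrading 𝒱)) where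
  toCactiData := kadeishviliData S
  B_zero t := kadeishviliB_zero S t
  d_mem n x hx := by
    rw [mem_totalPart, coe_kadeishvili_d]
    exact cobarD_mem S ((mem_totalPart 𝒱).1 hx)
  mul_mem m n x hx y hy := by
    rw [mem_totalPart, coe_kadeishvili_mul]
    exact mul_mem_weightPart ((mem_totalPart 𝒱).1 hx) ((mem_totalPart 𝒱).1 hy)
  B_mem n deg t ht := kadeishviliB_mem S (P := fun i => (deg i, t i)) ht
  d_d x := by
    ext
    rw [coe_kadeishvili_d, coe_kadeishvili_d, cobarD_sq S h1]
    rfl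
  mul_assoc x y z := by
    ext
    simp only [coe_kadeishvili_mul, mul_assoc]
  d_mul n x hx y := by
    ext
    rw [Submodule.coe_add, coe_negOnePow_smul]
    simp only [coe_kadeishvili_mul, coe_kadeishvili_d]
    exact derivationOf_mul _ ((mem_totalPart 𝒱).1 hx) _
  brace_brace x ys zs hx hys hzs := by
    have hy := kadeishvili_brace_mem S hx hys
    ext
    rw [coe_kadeishvili_braceSum S hx homogeneous_nil hys hzs, ← coePair_snd,
      coe_kadeishvili_brace S hy hzs, coe_kadeishvili_brace S hx hys]
    exact braceMap_braceMap S hε ((mem_totalPart 𝒱).1 hx) hys.coePair hzs.coePair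
  op_mul x x' ys hx hx' hys := coe_kadeishvili_op_mul S hx hx' hys
  boundary_B n deg t ht := kadeishvili_boundary S h1 hε (P := fun i => (deg i, t i)) ht

/-- A monomial of length `n` has at most `n` places for arguments, so that its braces with more than
`n` entries vanish. -/
theorem braceMap_tensorOf_eq_zero {l : List (ℤ × V)} {Y : List (ℤ × TensorAlgebra k V)}
    (h : l.length < Y.length) : braceMap 𝒱 S.mul S.comul (tensorOf k l) Y = 0 := by
  induction l generalizing Y with
  | nil =>
    cases Y with
    | nil => simp at h
    | cons y Y => simp
  | cons a l ih =>
    cases Y with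
    | nil => simp at h
    | cons y Y =>
      rw [List.length_cons, List.length_cons] at h
      rw [tensorOf_cons, braceMap_ι_mul_cons', ih (Y := Y) (by omega),
        ih (Y := y :: Y) (by rw [List.length_cons]; omega)]
      simp

/-- The braces, defined by recursion, agree with Kadeishvili's formula on monomials. -/
theorem braceMap_insertions (hε : S.counit = LinearMap.snd k V k) {xs : List (ℤ × V)}
    (hxs : Homogeneous 𝒱 xs) {ys : List (List (ℤ × V))} (hys : ∀ l ∈ ys, Homogeneous 𝒱 l) :
    braceMap 𝒱 S.mul S.comul (tensorOf k xs) (ys.map fun l => (totalDeg l, tensorOf k l)) =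
      S.insertions xs ys := by
  induction xs generalizing ys with
  | nil => cases ys <;> simp [DGBialgebra.insertions]
  | cons x xs ih =>
    obtain ⟨hx, hxs⟩ := homogeneous_cons.1 hxs
    cases ys with
    | nil => simp [DGBialgebra.insertions]
    | cons y ys =>
      have hys' : ∀ l ∈ ys, Homogeneous 𝒱 l := fun l hl => hys l (List.mem_cons_of_mem _ hl)
      have hY : Homogeneous (tensorTotal 𝒱) (ys.map fun l => (totalDeg l, tensorOf k l)) := by
        intro a ha
        obtain ⟨l, hl, rfl⟩ := List.mem_map.1 ha
        exact tensorOf_mem_total (hys' l hl)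
      rw [List.map_cons, tensorOf_cons, braceMap_ι_mul_cons S _ (tensorOf_mem_total hxs) hY,
        DGBialgebra.insertions, ih hxs hys', ← ih hxs hys, List.map_cons,
        diagAct_tensorOf 𝒱 S hε (hys y (List.mem_cons_self ..))]

theorem isKadeishvili_kadeishviliAlgebra (h1 : S.one = (0, 1))
    (hε : S.counit = LinearMap.snd k V k) :
    IsKadeishvili (kadeishviliAlgebra S h1 hε).toCactiData S := by
  intro m xs ys hxs hys x y hx hy
  have e : (Fin.cons x y : Fin (m + 1) → ReducedTensor k V) = fun i =>
      ((Fin.cons (totalDeg xs, x) fun i => (totalDeg (ys i), y i) :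
        Fin (m + 1) → ℤ × ReducedTensor k V) i).2 := by
    funext i
    induction i using Fin.cases <;> rfl
  change (kadeishviliB S m (Fin.cons x y) : TensorAlgebra k V) = _
  rw [e, kadeishviliB_apply S]
  · have := braceMap_insertions S hε hxs (ys := List.ofFn ys) (by simpa [List.mem_ofFn'] using hys)
    rw [← this, ← hx, List.map_ofFn]
    simp [Function.comp_def, coePair, hy]
  · intro i
    rw [mem_totalPart]
    induction i using Fin.cases with
    | zero => simpa [hx] using tensorOf_mem_total hxs
    | succ i => simpa [hy] using tensorOf_mem_total (hys i)

theorem kadeishviliAlgebra_extendsTensor (h1 : S.one = (0, 1))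
    (hε : S.counit = LinearMap.snd k V k) :
    (kadeishviliAlgebra S h1 hε).toCactiData.ExtendsTensor := coe_kadeishvili_mul S

/-- The part of the differential of the cobar construction that comes from a map `V → T V`. -/
def reducedDerivation (δ : V →ₗ[k] TensorAlgebra k V) : ReducedTensor k V →ₗ[k] ReducedTensor k V :=
  reducedProj k V ∘ₗ derivationOf 𝒱 δ ∘ₗ (ReducedTensor k V).subtype

theorem coe_reducedDerivation {δ : V →ₗ[k] TensorAlgebra k V}
    (hδ : ∀ v, TensorAlgebra.algebraMapInv (R := k) (M := V) (δ v) = 0) (x : ReducedTensor k V) :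
    (reducedDerivation (𝒱 := 𝒱) δ x : TensorAlgebra k V) = derivationOf 𝒱 δ x :=
  reducedProj_of_mem (algebraMapInv_derivationOf hδ _)

/-- The internal differential is the derivation that extends the differential of `V`, and the external
differential is the derivation that extends the reduced coproduct. -/
theorem kadeishvili_isSplitting : IsSplitting (tensorBigrading 𝒱) (kadeishviliData S).d
    (reducedDerivation (𝒱 := 𝒱) (projV ∘ₗ S.d ∘ₗ LinearMap.inl k V k))
    (reducedDerivation (𝒱 := 𝒱) (cobarExt 𝒱 S.comul ∘ₗ LinearMap.inl k V k)) := by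
  have h1 : ∀ v, TensorAlgebra.algebraMapInv (R := k) (M := V)
      ((projV ∘ₗ S.d ∘ₗ LinearMap.inl k V k) v) = 0 := fun v => by simp [projV]
  have h2 : ∀ v, TensorAlgebra.algebraMapInv (R := k) (M := V)
      ((cobarExt 𝒱 S.comul ∘ₗ LinearMap.inl k V k) v) = 0 := fun v => algebraMapInv_cobarExt S _
  refine ⟨LinearMap.ext fun x => Subtype.ext ?_, fun p q x hx => ?_, fun p q x hx => ?_⟩
  · rw [LinearMap.add_apply, Submodule.coe_add, coe_kadeishvili_d, coe_reducedDerivation h1,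
      coe_reducedDerivation h2, ← LinearMap.add_apply, ← derivationOf_add]
    rfl
  · rw [mem_tensorBigrading] at hx ⊢
    rw [coe_reducedDerivation h1]
    have := derivationOf_mem (𝒱 := 𝒱) (α := ((1 : ℤ), (0 : ℤ))) (β := (0, 1)) (γ := (1, 0))
      (δ := projV ∘ₗ S.d ∘ₗ LinearMap.inl k V k) (fun p v hv => by
        have := projV_mem (k := k) (α := ((1 : ℤ), (0 : ℤ))) (β := (0, 1))
          (S.d_mem _ _ (inl_mem_unitGrading 𝒱 hv))
        rwa [add_smul, one_smul, add_right_comm] at this) hx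
    simpa using this
  · rw [mem_tensorBigrading] at hx ⊢
    rw [coe_reducedDerivation h2]
    have := derivationOf_mem (𝒱 := 𝒱) (α := ((1 : ℤ), (0 : ℤ))) (β := (0, 1)) (γ := (0, 1))
      (δ := cobarExt 𝒱 S.comul ∘ₗ LinearMap.inl k V k) (fun p v hv => by
        have := cobarExt_mem S (α := ((1 : ℤ), (0 : ℤ))) (β := (0, 1))
          (inl_mem_unitGrading 𝒱 hv)
        rwa [← add_assoc] at this) hx
    simpa using this

theorem kadeishviliB_eq_zero {m : ℕ} {q : ℤ} (hq : q < m) {a : ReducedTensor k V}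
    (ha : a ∈ externalPart (tensorBigrading 𝒱) q) (t : Fin m → ReducedTensor k V) :
    kadeishviliB S m (Fin.cons a t) = 0 := by
  have hmono : ∀ l : List (ℤ × V), Homogeneous 𝒱 l → (l.length : ℤ) = q →
      ∀ a : ReducedTensor k V, (a : TensorAlgebra k V) = tensorOf k l →
        (kadeishviliB S m).curryLeft a t ∈ (⊥ : Submodule k (ReducedTensor k V)) := by
    intro l hl hlen a ha
    refine multilinear_mem (𝒱 := 𝒱) (α := (0 : ℤ)) (β := 0) (g := fun _ => 0) _
      (fun ls hls _ x hx => ?_) (fun i => mem_weightPart_zero 𝒱 _)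
    rw [Submodule.mem_bot, MultilinearMap.curryLeft_apply]
    have e : (Fin.cons a x : Fin (m + 1) → ReducedTensor k V) = fun i =>
        ((Fin.cons (totalDeg l, a) fun i => (totalDeg (ls i), x i) :
          Fin (m + 1) → ℤ × ReducedTensor k V) i).2 := by
      funext i
      induction i using Fin.cases <;> rfl
    ext
    rw [e, kadeishviliB_apply S]
    · simp only [Fin.cons_zero, ha]
      rw [braceMap_tensorOf_eq_zero S (by rw [List.length_ofFn]; omega), smul_zero]
      rfl
    · intro i
      induction i using Fin.cases with
      | zero => exact mem_totalPart_of_eq_tensorOf hl ha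
      | succ i => exact mem_totalPart_of_eq_tensorOf (hls i) (hx i)
  refine mem_of_weightPart 𝒱 (W := LinearMap.ker ((kadeishviliB S m).toLinearMap (Fin.cons 0 t) 0))
    (fun l hl _ hlen x hx => ?_) ((mem_externalPart 𝒱).1 ha) |> fun h => ?_
  · rwa [LinearMap.mem_ker, MultilinearMap.toLinearMap_apply, Fin.update_cons_zero] at h
  · rw [LinearMap.mem_ker, MultilinearMap.toLinearMap_apply, Fin.update_cons_zero]
    exact hmono l hl (by rw [← hlen, weight_zero_one]) x hx

/-- The operations preserve the internal degree. -/
theorem kadeishviliB_internal {m : ℕ} {p : Fin (m + 1) → ℤ} {t : Fin (m + 1) → ReducedTensor k V}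
    (ht : ∀ i, t i ∈ internalPart (tensorBigrading 𝒱) (p i)) :
    kadeishviliB S m t ∈ internalPart (tensorBigrading 𝒱) (∑ i, p i) := by
  refine multilinear_mem (𝒱 := 𝒱) (α := (1 : ℤ)) (β := 0) (g := p) _
    (fun ls hls hg x hx => ?_) (fun i => (mem_internalPart 𝒱).1 (ht i))
  rw [mem_internalPart, kadeishviliB_apply S (P := fun i => (totalDeg (ls i), x i))
    fun i => mem_totalPart_of_eq_tensorOf (hls i) (hx i), Units.smul_def]
  refine zsmul_mem ?_ _
  have h (i) : (x i : TensorAlgebra k V) ∈ weightPart 𝒱 (1 : ℤ) 0 (p i) := by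
    rw [hx]
    exact tensorOf_mem (hls i) (hg i)
  have := braceMap_mem_weightPart S (h 0) (Y := List.ofFn fun i : Fin m =>
    coePair (totalDeg (ls i.succ), x i.succ)) (gs := List.ofFn fun i : Fin m => p i.succ) (by
      rw [List.forall₂_iff_get]
      refine ⟨by simp, fun i h1 h2 => ?_⟩
      simpa using h _)
  simpa [Fin.sum_univ_succ, List.sum_ofFn, Function.comp_def] using this

theorem isWellGraded_kadeishviliAlgebra (h1 : S.one = (0, 1))
    (hε : S.counit = LinearMap.snd k V k) :
    (kadeishviliAlgebra S h1 hε).IsWellGraded (tensorBigrading 𝒱) where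
  B_eq_zero m q _ hq a ha t := kadeishviliB_eq_zero S hq ha t
  exists_splitting := ⟨_, _, kadeishvili_isSplitting S⟩
  mul_internal p p' x hx y hy := by
    rw [mem_internalPart] at hx hy ⊢
    change ((kadeishviliData S).mul x y : TensorAlgebra k V) ∈ _
    rw [coe_kadeishvili_mul]
    exact mul_mem_weightPart hx hy
  B_internal m p t ht := kadeishviliB_internal S ht

theorem reducedProj_ι (v : V) : reducedProj k V (TensorAlgebra.ι k v) = ReducedTensor.incl k v :=
  Subtype.ext (reducedProj_of_mem (algebraMapInv_ι v))

theorem incl_mem_totalPart {p : ℤ} {v : V} (hv : v ∈ 𝒱 p) :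
    ReducedTensor.incl k v ∈ totalPart (tensorBigrading 𝒱) (p + 1) :=
  (mem_totalPart 𝒱).2 (ι_mem_total 𝒱 hv)

theorem kadeishvili_product (hε : S.counit = LinearMap.snd k V k) {p : ℤ} {x : V} (hx : x ∈ 𝒱 p)
    (y : V) : ReducedTensor.incl k (S.mul (x, 0) (y, 0)).1 =
      (p + 1).negOnePow • kadeishviliB S 1 ![ReducedTensor.incl k x, ReducedTensor.incl k y] := by
  have e (z : ReducedTensor k V) : ![ReducedTensor.incl k x, z] =
      Function.update ![ReducedTensor.incl k x, 0] 1 z := by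
    funext i
    fin_cases i <;> simp
  have key := homogeneous_ext 𝒱 (φ := reducedProj k V ∘ₗ TensorAlgebra.ι k ∘ₗ LinearMap.fst k V k ∘ₗ
      S.mul (x, 0) ∘ₗ LinearMap.inl k V k)
    (ψ := (p + 1).negOnePow • ((kadeishviliB S 1).toLinearMap ![ReducedTensor.incl k x, 0] 1 ∘ₗ
      reducedProj k V ∘ₗ TensorAlgebra.ι k)) fun q y hy => ?_
  · have := LinearMap.congr_fun key y
    simp only [LinearMap.comp_apply, LinearMap.smul_apply, MultilinearMap.toLinearMap_apply,
      reducedProj_ι, ← e] at this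
    exact this
  · simp only [LinearMap.comp_apply, LinearMap.smul_apply, MultilinearMap.toLinearMap_apply,
      reducedProj_ι, ← e]
    have e' : ![ReducedTensor.incl k x, ReducedTensor.incl k y] = fun i =>
        (![(p + 1, ReducedTensor.incl k x), (q + 1, ReducedTensor.incl k y)] i).2 := by
      funext i
      fin_cases i <;> rfl
    ext
    rw [coe_negOnePow_smul, e', kadeishviliB_apply S]
    · simp only [List.ofFn_succ, List.ofFn_zero, Matrix.cons_val_zero, Fin.succ_zero_eq_one,
        Matrix.cons_val_one, decalage_cons, decalage_nil, add_zero, coePair, smul_smul,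
        ← Int.negOnePow_add]
      rw [Int.negOnePow_even _ ⟨_, rfl⟩, one_smul]
      change _ = braceMap 𝒱 S.mul S.comul (TensorAlgebra.ι k x) [(q + 1, TensorAlgebra.ι k y)]
      rw [braceMap_ι_cons, diagAct_ι S hε]
      rfl
    · intro i
      fin_cases i
      · exact incl_mem_totalPart hx
      · exact incl_mem_totalPart hy

theorem induces_kadeishviliAlgebra (h1 : S.one = (0, 1)) (hε : S.counit = LinearMap.snd k V k) :
    Induces 𝒱 (kadeishviliAlgebra S h1 hε).toCactiData S where
  differential := by
    refine ⟨_, _, kadeishvili_isSplitting S, fun v => Subtype.ext ?_, fun v => ?_⟩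
    · rw [coe_reducedDerivation fun v => by simp [projV]]
      exact derivationOf_ι 𝒱 _ v
    · rw [coe_reducedDerivation fun v => algebraMapInv_cobarExt S _]
      exact derivationOf_ι 𝒱 _ v
  product p x hx y := kadeishvili_product S hε hx y

end KadeishviliAlgebra

section LowOperations

variable {k : Type u} [Field k] {T : Type v} [AddCommGroup T] [Module k T]
  {𝒯 : ℤ → Submodule k T} (C : CactiAlgebra k T 𝒯)

/-! ### Cacti algebras: the operations with few arguments -/

namespace CactiAlgebra

theorem op_nil (x : T) : C.op x [] = x := C.B_zero _

theorem op_singleton (x y : T) : C.op x [y] = C.B 1 ![x, y] := by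
  refine congrArg (C.B 1) (funext fun i => ?_)
  fin_cases i <;> rfl

theorem op_pair (x y z : T) : C.op x [y, z] = C.B 2 ![x, y, z] := by
  refine congrArg (C.B 2) (funext fun i => ?_)
  fin_cases i <;> rfl

theorem B_zero' (x : T) : C.B 0 ![x] = x := C.B_zero _

/-- Distributivity of the operations over the product, for one further argument. -/
theorem B_one_mul {p q r : ℤ} {a b y : T} (ha : a ∈ 𝒯 p) (hb : b ∈ 𝒯 q) (hy : y ∈ 𝒯 r) :
    C.B 1 ![C.mul a b, y] = p.negOnePow • C.mul a (C.B 1 ![b, y]) +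
      (q * r).negOnePow • C.mul (C.B 1 ![a, y]) b := by
  have := C.op_mul (p, a) (q, b) [(r, y)] ha hb (by simpa using hy)
  simpa [op_singleton, op_nil, Finset.sum_range_succ] using this

/-- Distributivity of the operations over the product for two further arguments, on elements for which
the terms with `B₃` vanish. -/
theorem B_two_mul {p q r s : ℤ} {a b y z : T} (ha : a ∈ 𝒯 p) (hb : b ∈ 𝒯 q) (hy : y ∈ 𝒯 r)
    (hz : z ∈ 𝒯 s) (ha0 : C.B 2 ![a, y, z] = 0) (hb0 : C.B 2 ![b, y, z] = 0) :
    C.B 2 ![C.mul a b, y, z] =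
      (q * r + p + r).negOnePow • C.mul (C.B 1 ![a, y]) (C.B 1 ![b, z]) := by
  have := C.op_mul (p, a) (q, b) [(r, y), (s, z)] ha hb (by simp [hy, hz])
  simp only [List.length_cons, List.length_nil, zero_add, Finset.sum_range_succ,
    Finset.sum_range_zero, List.map_cons, List.map_nil, List.take_zero, List.drop_zero,
    List.take_succ_cons, List.drop_succ_cons, op_nil, op_singleton, op_pair, ha0, hb0, map_zero,
    LinearMap.zero_apply, smul_zero, add_zero] at this
  rw [this]
  congr 2
  simp
  ring

/-- The boundary of `B₂` is the graded commutator of the product. -/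
theorem d_B_one {p q : ℤ} {x y : T} (hx : x ∈ 𝒯 p) (hy : y ∈ 𝒯 q) :
    C.d (C.B 1 ![x, y]) = -C.B 1 ![C.d x, y] - p.negOnePow • C.B 1 ![x, C.d y] +
      (p * q).negOnePow • C.mul y x - C.mul x y := by
  have h := C.boundary_B 0 ![p, q] ![x, y] (fun i => by fin_cases i <;> assumption)
  have e0 : Function.update ![x, y] 0 (C.d x) = ![C.d x, y] := by
    funext i; fin_cases i <;> simp
  have e1 : Function.update ![x, y] 1 (C.d y) = ![x, C.d y] := by
    funext i; fin_cases i <;> simp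
  have e2 : Fin.removeNth 1 ![x, y] = ![x] := by
    funext i; fin_cases i; rfl
  have e3 : Fin.init ![x, y] = ![x] := by
    funext i; fin_cases i; rfl
  have e4 : Finset.univ.filter (fun j : Fin 2 => 1 ≤ (j : ℕ) ∧ (j : ℕ) ≤ 0) = ∅ := by decide
  have e5 : Finset.univ.filter (fun j : Fin 2 => j < 1) = {0} := by decide
  have e6 : Finset.univ.filter (fun j : Fin 2 => j < 0) = ∅ := by decide
  rw [e4, Fin.sum_univ_two] at h
  simp only [Matrix.cons_val_zero, Matrix.cons_val_one, e0, e1, e2, e3, e5, e6, B_zero',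
    Finset.sum_empty, Finset.sum_singleton, Fin.last, Fin.mk_one, CharP.cast_eq_zero, zero_add,
    zero_mul, add_zero, Int.negOnePow_neg, Int.negOnePow_one, Units.neg_smul, one_smul,
    neg_add_eq_sub, Int.negOnePow_sub, mul_neg, mul_one] at h
  rw [sub_eq_iff_eq_add] at h
  have e7 : (![x, y] : Fin 2 → T) ⟨0 + 1, by omega⟩ = y := rfl
  rw [h]
  abel

/-- If `B₃(x, -, -) = 0` then the boundary of `B₃` expresses `B₂(x, y z)` in terms of `B₃(d x, y, z)`
and of `B₂(x, -)` on `y` and `z`. -/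
theorem B_one_mul_right {p q r : ℤ} {x y z : T} (hx : x ∈ 𝒯 p) (hy : y ∈ 𝒯 q) (hz : z ∈ 𝒯 r)
    (h0 : ∀ y z, C.B 2 ![x, y, z] = 0) :
    C.B 1 ![x, C.mul y z] = C.B 2 ![C.d x, y, z] +
      (p * q + q).negOnePow • C.mul y (C.B 1 ![x, z]) + C.mul (C.B 1 ![x, y]) z := by
  have h := C.boundary_B 1 ![p, q, r] ![x, y, z] (fun i => by fin_cases i <;> assumption)
  have e0 : Function.update ![x, y, z] 0 (C.d x) = ![C.d x, y, z] := by
    funext i; fin_cases i <;> simp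
  have e1 : Function.update ![x, y, z] 1 (C.d y) = ![x, C.d y, z] := by
    funext i; fin_cases i <;> simp
  have e1' : Function.update ![x, y, z] 2 (C.d z) = ![x, y, C.d z] := by
    funext i; fin_cases i <;> simp
  have e2 : Fin.removeNth 1 ![x, y, z] = ![x, z] := by
    funext i; fin_cases i <;> rfl
  have e3 : Fin.init ![x, y, z] = ![x, y] := by
    funext i; fin_cases i <;> rfl
  have e4 : Finset.univ.filter (fun j : Fin 3 => 1 ≤ (j : ℕ) ∧ (j : ℕ) ≤ 1) = {1} := by decide
  have e5 : Fin.contractNth 1 (fun a b => C.mul a b) ![x, y, z] = ![x, C.mul y z] := by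
    funext i; fin_cases i <;> simp [Fin.contractNth]
  have e6 : Finset.univ.filter (fun j : Fin 3 => j < 0) = ∅ := by decide
  rw [e4, Fin.sum_univ_three] at h
  simp only [Matrix.cons_val_zero, Matrix.cons_val_one, Matrix.cons_val, e0, e1, e1', e2, e3, e5, e6, h0, map_zero, smul_zero,
    Finset.sum_empty, Finset.sum_singleton, Fin.last] at h
  have e7 : (![x, y, z] : Fin 3 → T) ⟨1 + 1, by omega⟩ = z := rfl
  rw [sub_eq_iff_eq_add, e7] at h
  have s1 : (((1 : Fin (1 + 2)) : ℕ) : ℤ).negOnePow = -1 := rfl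
  have s2 : ((1 : ℤ) + 1).negOnePow = 1 := rfl
  have s3 : (-((1 : ℤ) + 1) + 0).negOnePow = 1 := rfl
  simp only [s1, s2, s3, Units.neg_smul, one_smul, Nat.cast_one, one_mul] at h
  rw [← sub_eq_zero, ← neg_eq_zero, h]
  abel

end CactiAlgebra

end LowOperations

section Uniqueness

variable {k : Type u} [Field k] {V : Type v} [AddCommGroup V] [Module k V]

/-! ### Well graded Cacti algebras are determined by their values on generators -/

namespace ReducedTensor

variable (k V) in
/-- The inclusion of `V` in the reduced tensor algebra as a linear map. -/
def inclLinear : V →ₗ[k] ReducedTensor k V := reducedProj k V ∘ₗ TensorAlgebra.ι k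

theorem inclLinear_apply (v : V) : inclLinear k V v = incl k v := reducedProj_ι v

variable (k V) in
/-- The embedding of `V ⊗ V` in the reduced tensor algebra. -/
def cup : V ⊗[k] V →ₗ[k] ReducedTensor k V :=
  reducedProj k V ∘ₗ LinearMap.mul' k (TensorAlgebra k V) ∘ₗ
    TensorProduct.map (TensorAlgebra.ι k) (TensorAlgebra.ι k)

variable (k V) in
/-- The retraction `v₁ ⊗ v₂ ⊗ v₃ ⊗ ⋯ ↦ v₁ ⊗ π (v₂ ⊗ v₃ ⊗ ⋯)` of `V ⊗ V` from the tensor algebra. -/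
def quadratic : TensorAlgebra k V →ₗ[k] V ⊗[k] V :=
  LinearMap.lTensor V TensorAlgebra.ιInv ∘ₗ stripLeft k V

theorem coe_cup (u : V ⊗[k] V) : (cup k V u : TensorAlgebra k V) =
    LinearMap.mul' k (TensorAlgebra k V)
      (TensorProduct.map (TensorAlgebra.ι k) (TensorAlgebra.ι k) u) := by
  refine reducedProj_of_mem ?_
  induction u with
  | zero => simp
  | tmul a b => simp
  | add x y hx hy => simp only [map_add, hx, hy, add_zero]

theorem coe_cup_tmul (a b : V) : (cup k V (a ⊗ₜ b) : TensorAlgebra k V) =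
    TensorAlgebra.ι k a * TensorAlgebra.ι k b := by
  simp [coe_cup]

theorem quadratic_cup (u : V ⊗[k] V) : quadratic k V (cup k V u) = u := by
  induction u with
  | zero => simp
  | tmul a b =>
    rw [coe_cup_tmul, quadratic, LinearMap.comp_apply, stripLeft_ι_mul, LinearMap.lTensor_tmul,
      TensorAlgebra.ι_leftInverse]
  | add x y hx hy => rw [map_add, Submodule.coe_add, map_add, hx, hy]

end ReducedTensor

variable (𝒱 : ℤ → Submodule k V)

theorem incl_mem_tensorBigrading {p : ℤ} {v : V} (hv : v ∈ 𝒱 p) :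
    ReducedTensor.incl k v ∈ tensorBigrading 𝒱 p 1 := by
  have := tensorBigrading_of_eq_tensorOf 𝒱 (l := [(p, v)]) (x := ReducedTensor.incl k v)
    (by simpa [Homogeneous] using hv) (by simp [tensorOf, ReducedTensor.incl])
  simpa [degSum] using this

theorem eq_incl_of_mem_externalPart {x : ReducedTensor k V}
    (hx : x ∈ externalPart (tensorBigrading 𝒱) 1) :
    x = ReducedTensor.incl k (TensorAlgebra.ιInv (x : TensorAlgebra k V)) := by
  rw [← ReducedTensor.inclLinear_apply]
  refine mem_of_weightPart 𝒱 (W := LinearMap.eqLocus LinearMap.id (ReducedTensor.inclLinear k V ∘ₗ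
    TensorAlgebra.ιInv ∘ₗ (ReducedTensor k V).subtype)) (fun l hl _ hlen x hx => ?_)
    ((mem_externalPart 𝒱).1 hx)
  rw [weight_zero_one] at hlen
  obtain ⟨a, rfl⟩ := List.length_eq_one_iff.1 (by exact_mod_cast hlen : l.length = 1)
  rw [tensorOf_cons, tensorOf_nil, mul_one] at hx
  rw [LinearMap.mem_eqLocus]
  simp only [LinearMap.id_apply, LinearMap.comp_apply, Submodule.subtype_apply, hx,
    TensorAlgebra.ι_leftInverse _]
  exact Subtype.ext (hx.trans (congrArg Subtype.val (ReducedTensor.inclLinear_apply a.2)).symm)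

theorem eq_cup_of_mem_externalPart {x : ReducedTensor k V}
    (hx : x ∈ externalPart (tensorBigrading 𝒱) 2) :
    x = ReducedTensor.cup k V (ReducedTensor.quadratic k V x) := by
  refine mem_of_weightPart 𝒱 (W := LinearMap.eqLocus LinearMap.id (ReducedTensor.cup k V ∘ₗ
    ReducedTensor.quadratic k V ∘ₗ (ReducedTensor k V).subtype)) (fun l hl _ hlen x hx => ?_)
    ((mem_externalPart 𝒱).1 hx)
  rw [weight_zero_one] at hlen
  obtain ⟨a, b, rfl⟩ := List.length_eq_two.1 (by exact_mod_cast hlen : l.length = 2)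
  rw [tensorOf_cons, tensorOf_cons, tensorOf_nil, mul_one, ← ReducedTensor.coe_cup_tmul] at hx
  rw [LinearMap.mem_eqLocus]
  simp only [LinearMap.id_apply, LinearMap.comp_apply, Submodule.subtype_apply, hx,
    ReducedTensor.quadratic_cup]
  exact Subtype.ext hx

variable [DirectSum.Decomposition 𝒱]

theorem incl_mem_externalPart (v : V) :
    ReducedTensor.incl k v ∈ externalPart (tensorBigrading 𝒱) 1 := by
  rw [← ReducedTensor.inclLinear_apply]
  refine homogeneous_induction 𝒱 (W := (externalPart (tensorBigrading 𝒱) 1).comap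
    (ReducedTensor.inclLinear k V)) (fun p v hv => ?_) v
  rw [Submodule.mem_comap, ReducedTensor.inclLinear_apply]
  exact Submodule.mem_iSup_of_mem p (incl_mem_tensorBigrading 𝒱 hv)

variable {𝒱}

theorem IsSplitting.exists_incl {d di de : ReducedTensor k V →ₗ[k] ReducedTensor k V}
    (h : IsSplitting (tensorBigrading 𝒱) d di de) (v : V) : ∃ (a : V) (u : V ⊗[k] V),
      di (ReducedTensor.incl k v) = ReducedTensor.incl k a ∧
      de (ReducedTensor.incl k v) = ReducedTensor.cup k V u := by
  have hv := incl_mem_externalPart (k := k) 𝒱 v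
  refine ⟨_, _, eq_incl_of_mem_externalPart 𝒱 ?_, eq_cup_of_mem_externalPart 𝒱 ?_⟩
  · refine iSup_le (a := (externalPart (tensorBigrading 𝒱) 1).comap di) (fun p x hx => ?_) hv
    exact Submodule.mem_iSup_of_mem (p + 1) (h.di_mem p 1 x hx)
  · refine iSup_le (a := (externalPart (tensorBigrading 𝒱) 2).comap de) (fun p x hx => ?_) hv
    exact Submodule.mem_iSup_of_mem p (h.de_mem p 1 x hx)

/-- The operation `Bₙ₊₁(-, t₁, …, tₙ)`. -/
def CactiData.opLeft {T : Type*} [AddCommGroup T] [Module k T] (C : CactiData k T) {n : ℕ}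
    (t : Fin n → T) : T →ₗ[k] T where
  toFun x := C.B n (Fin.cons x t)
  map_add' x y := (C.B n).cons_add t x y
  map_smul' c x := (C.B n).cons_smul t c x

/-- The operation `Bₙ₊₂(x, -, t₁, …, tₙ)`. -/
def CactiData.opRight {T : Type*} [AddCommGroup T] [Module k T] (C : CactiData k T) {n : ℕ}
    (x : T) (t : Fin n → T) : T →ₗ[k] T where
  toFun y := C.B (n + 1) (Fin.cons x (Fin.cons y t))
  map_add' y z := ((C.B (n + 1)).curryLeft x).cons_add t y z
  map_smul' c y := ((C.B (n + 1)).curryLeft x).cons_smul t c y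

namespace CactiAlgebra

theorem op_ofFn {T : Type*} [AddCommGroup T] [Module k T] {𝒯 : ℤ → Submodule k T}
    (C : CactiAlgebra k T 𝒯) (x : T) {n : ℕ} (f : Fin n → T) :
    C.op x (List.ofFn f) = C.B n (Fin.cons x f) := by
  have key : ∀ (m : ℕ) (h : m = n), C.B m (Fin.cons x (f ∘ Fin.cast h)) = C.B n (Fin.cons x f) := by
    rintro m rfl
    rfl
  rw [← key _ (List.length_ofFn (f := f)), CactiData.op]
  congr 2
  funext i
  rw [List.get_ofFn]
  rfl

variable {C C' : CactiAlgebra k (ReducedTensor k V) (totalPart (tensorBigrading 𝒱))}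

/-- On generators, which have external degree one, the operations `B₃, B₄, …` vanish. -/
theorem IsWellGraded.B_incl (hC : C.IsWellGraded (tensorBigrading 𝒱)) {m : ℕ} (v : V)
    (t : Fin (m + 2) → ReducedTensor k V) : C.B (m + 2) (Fin.cons (ReducedTensor.incl k v) t) = 0 :=
  hC.B_eq_zero (m + 2) 1 (by omega) (by push_cast; omega) _ (incl_mem_externalPart 𝒱 v) t

/-- The differential of a generator has parts of external degree `1` and `2`. -/
theorem IsWellGraded.exists_d_incl (hC : C.IsWellGraded (tensorBigrading 𝒱)) (v : V) :
    ∃ (a : V) (u : V ⊗[k] V), C.d (ReducedTensor.incl k v) =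
      ReducedTensor.incl k a + ReducedTensor.cup k V u := by
  obtain ⟨di, de, h⟩ := hC.exists_splitting
  obtain ⟨a, u, ha, hu⟩ := h.exists_incl v
  rw [h.eq_add, LinearMap.add_apply, ha, hu]
  exact ⟨_, _, rfl⟩

theorem mul_incl (hT : C.ExtendsTensor) (a b : V) :
    C.mul (ReducedTensor.incl k a) (ReducedTensor.incl k b) = ReducedTensor.cup k V (a ⊗ₜ b) :=
  Subtype.ext ((hT _ _).trans (ReducedTensor.coe_cup_tmul a b).symm)

theorem mul_eq_mul (hT : C.ExtendsTensor) (hT' : C'.ExtendsTensor) : C.mul = C'.mul :=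
  LinearMap.ext₂ fun x y => Subtype.ext ((hT x y).trans (hT' x y).symm)

/-- Induction on the length of monomials in the reduced tensor algebra. -/
theorem monomial_induction (hT : C.ExtendsTensor) {P : ReducedTensor k V → Prop}
    (h1 : ∀ p, ∀ v ∈ 𝒱 p, P (ReducedTensor.incl k v))
    (h2 : ∀ p, ∀ v ∈ 𝒱 p, ∀ n, ∀ x ∈ totalPart (tensorBigrading 𝒱) n, P x →
      P (C.mul (ReducedTensor.incl k v) x)) (l : List (ℤ × V)) (hl : Homogeneous 𝒱 l)
    (x : ReducedTensor k V) (hx : (x : TensorAlgebra k V) = tensorOf k l) : P x := by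
  induction l generalizing x with
  | nil =>
    have := algebraMapInv_coe x
    rw [hx, tensorOf_nil, map_one] at this
    exact absurd this one_ne_zero
  | cons a l ih =>
    obtain ⟨ha, hl'⟩ := homogeneous_cons.1 hl
    by_cases hnil : l = []
    · subst hnil
      rw [tensorOf_cons, tensorOf_nil, mul_one] at hx
      obtain rfl : x = ReducedTensor.incl k a.2 := Subtype.ext hx
      exact h1 _ _ ha
    · have hy : (reducedProj k V (tensorOf k l) : TensorAlgebra k V) = tensorOf k l :=
        reducedProj_of_mem (algebraMapInv_tensorOf hnil)
      obtain rfl : x = C.mul (ReducedTensor.incl k a.2) (reducedProj k V (tensorOf k l)) := by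
        refine Subtype.ext ?_
        rw [hT, hx, tensorOf_cons, hy]
        rfl
      exact h2 _ _ ha _ _ (mem_totalPart_of_eq_tensorOf hl' hy) (ih hl' _ hy)

/-- A derivation is determined by its values on generators. -/
theorem d_eq_d (hT : C.ExtendsTensor) (hT' : C'.ExtendsTensor)
    (hd : ∀ v : V, C.d (ReducedTensor.incl k v) = C'.d (ReducedTensor.incl k v)) : C.d = C'.d :=
  reducedTensor_ext 𝒱 fun l hl _ => monomial_induction hT (P := fun x => C.d x = C'.d x)
    (fun _ v _ => hd v) (fun p v hv n x hx ih => by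
      rw [C.d_mul _ _ (incl_mem_totalPart hv), mul_eq_mul hT hT', C'.d_mul _ _
        (incl_mem_totalPart hv), hd, ih]) l hl

/-- The operation `B₂(v, -)` with `v ∈ V` is determined by its values on `V` and by `d`: since
`B₃(v, -, -) = 0`, the boundary of `B₃` expresses `B₂(v, y z)` by operations on shorter tensors. -/
theorem B_one_incl_eq (hC : C.IsWellGraded (tensorBigrading 𝒱))
    (hC' : C'.IsWellGraded (tensorBigrading 𝒱)) (hT : C.ExtendsTensor) (hT' : C'.ExtendsTensor)
    (hd : ∀ v : V, C.d (ReducedTensor.incl k v) = C'.d (ReducedTensor.incl k v))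
    (hB : ∀ v w : V, C.B 1 ![ReducedTensor.incl k v, ReducedTensor.incl k w] =
      C'.B 1 ![ReducedTensor.incl k v, ReducedTensor.incl k w]) (v : V) (y : ReducedTensor k V) :
    C.B 1 ![ReducedTensor.incl k v, y] = C'.B 1 ![ReducedTensor.incl k v, y] := by
  refine LinearMap.congr_fun (f := C.opRight (ReducedTensor.incl k v) ![])
    (g := C'.opRight (ReducedTensor.incl k v) ![]) (reducedTensor_ext 𝒱 fun l hl _ y hy => ?_) y
  change C.B 1 ![ReducedTensor.incl k v, y] = C'.B 1 ![ReducedTensor.incl k v, y]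
  revert v
  refine monomial_induction hT (P := fun y => ∀ v, C.B 1 ![ReducedTensor.incl k v, y] =
    C'.B 1 ![ReducedTensor.incl k v, y]) (fun p w _ v => hB v w) (fun q w hw r y hy ih v => ?_)
    l hl y hy
  have hw' := incl_mem_totalPart hw
  rw [← ReducedTensor.inclLinear_apply v]
  refine homogeneous_induction 𝒱 (W := LinearMap.eqLocus
    (C.opLeft ![C.mul (ReducedTensor.incl k w) y] ∘ₗ ReducedTensor.inclLinear k V)
    (C'.opLeft ![C.mul (ReducedTensor.incl k w) y] ∘ₗ ReducedTensor.inclLinear k V))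
    (fun p v hv => ?_) v
  change C.B 1 ![ReducedTensor.inclLinear k V v, C.mul (ReducedTensor.incl k w) y] =
    C'.B 1 ![ReducedTensor.inclLinear k V v, C.mul (ReducedTensor.incl k w) y]
  rw [ReducedTensor.inclLinear_apply]
  have hv' := incl_mem_totalPart hv
  rw [C.B_one_mul_right hv' hw' hy fun y z => hC.B_incl v ![y, z], mul_eq_mul hT hT',
    C'.B_one_mul_right hv' hw' hy fun y z => hC'.B_incl v ![y, z], hB, ih, ← hd]
  congr 2
  -- It remains to compare `B₃(d v, w, y)`, for which only the quadratic part of `d v` counts; there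
  -- it is a product of values of `B₂` on generators and shorter tensors.
  obtain ⟨a, u, hau⟩ := hC.exists_d_incl v
  rw [hau]
  change C.opLeft ![ReducedTensor.incl k w, y] _ = C'.opLeft ![ReducedTensor.incl k w, y] _
  rw [map_add, map_add]
  congr 1
  · exact (hC.B_incl a ![ReducedTensor.incl k w, y]).trans
      (hC'.B_incl a ![ReducedTensor.incl k w, y]).symm
  · refine LinearMap.congr_fun (f := C.opLeft ![ReducedTensor.incl k w, y] ∘ₗ ReducedTensor.cup k V)
      (g := C'.opLeft ![ReducedTensor.incl k w, y] ∘ₗ ReducedTensor.cup k V)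
      (tmul_homogeneous_ext 𝒱 𝒱 fun r s a ha b hb => ?_) u
    change C.B 2 ![ReducedTensor.cup k V (a ⊗ₜ b), ReducedTensor.incl k w, y] =
      C'.B 2 ![ReducedTensor.cup k V (a ⊗ₜ b), ReducedTensor.incl k w, y]
    rw [← mul_incl hT, C.B_two_mul (incl_mem_totalPart ha) (incl_mem_totalPart hb) hw' hy
      (hC.B_incl _ ![_, _]) (hC.B_incl _ ![_, _]), mul_eq_mul hT hT',
      C'.B_two_mul (incl_mem_totalPart ha) (incl_mem_totalPart hb) hw' hy
      (hC'.B_incl _ ![_, _]) (hC'.B_incl _ ![_, _]), hB, ih]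

/-- A well graded Cacti algebra structure that extends the free product is determined by the
values of `d` and `B₂` on generators. -/
theorem eq_of_generators (hC : C.IsWellGraded (tensorBigrading 𝒱))
    (hC' : C'.IsWellGraded (tensorBigrading 𝒱)) (hT : C.ExtendsTensor) (hT' : C'.ExtendsTensor)
    (hd : ∀ v : V, C.d (ReducedTensor.incl k v) = C'.d (ReducedTensor.incl k v))
    (hB : ∀ v w : V, C.B 1 ![ReducedTensor.incl k v, ReducedTensor.incl k w] =
      C'.B 1 ![ReducedTensor.incl k v, ReducedTensor.incl k w]) : C = C' := by
  have hop : ∀ l : List (ℤ × V), Homogeneous 𝒱 l → ∀ x : ReducedTensor k V,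
      (x : TensorAlgebra k V) = tensorOf k l → ∀ ys : List (ℤ × ReducedTensor k V),
      Homogeneous (totalPart (tensorBigrading 𝒱)) ys →
        C.op x (ys.map Prod.snd) = C'.op x (ys.map Prod.snd) := by
    refine monomial_induction hT (fun p v hv ys hys => ?_) (fun p v hv n x hx ih ys hys => ?_)
    · rcases ys with _ | ⟨y, _ | ⟨z, ys⟩⟩
      · exact (C.op_nil _).trans (C'.op_nil _).symm
      · simp only [List.map_cons, List.map_nil, op_singleton]
        exact B_one_incl_eq hC hC' hT hT' hd hB v y.2
      · exact (hC.B_incl v _).trans (hC'.B_incl v _).symm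
    · have h := C.op_mul (p + 1, ReducedTensor.incl k v) (n, x) ys (incl_mem_totalPart hv) hx hys
      have h' := C'.op_mul (p + 1, ReducedTensor.incl k v) (n, x) ys (incl_mem_totalPart hv) hx hys
      have hv' : ∀ ys : List (ℤ × ReducedTensor k V),
          C.op (ReducedTensor.incl k v) (ys.map Prod.snd) =
            C'.op (ReducedTensor.incl k v) (ys.map Prod.snd) := by
        rintro (_ | ⟨y, _ | ⟨z, ys⟩⟩)
        · exact (C.op_nil _).trans (C'.op_nil _).symm
        · simp only [List.map_cons, List.map_nil, op_singleton]
          exact B_one_incl_eq hC hC' hT hT' hd hB v y.2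
        · exact (hC.B_incl v _).trans (hC'.B_incl v _).symm
      refine h.trans (Eq.trans ?_ (h'.symm.trans ?_))
      · refine Finset.sum_congr rfl fun i _ => ?_
        rw [ih _ (hys.drop i), hv', mul_eq_mul hT hT']
      · rw [mul_eq_mul hT hT']
  have hBn : C.B = C'.B := by
    funext n
    ext1 t
    rw [← sub_eq_zero]
    refine multilinear_mem (𝒱 := 𝒱) (α := (0 : ℤ)) (β := 0) (g := fun _ => 0) (C.B n - C'.B n)
      (W := ⊥) (fun ls hls _ x hx => ?_) (fun i => mem_weightPart_zero 𝒱 _)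
    have := hop (ls 0) (hls 0) (x 0) (hx 0)
      (List.ofFn fun i : Fin n => (totalDeg (ls i.succ), x i.succ))
      (homogeneous_ofFn.2 fun i => mem_totalPart_of_eq_tensorOf (hls _) (hx _))
    rw [List.map_ofFn, op_ofFn, op_ofFn] at this
    change C.B n (Fin.cons (x 0) (Fin.tail x)) = C'.B n (Fin.cons (x 0) (Fin.tail x)) at this
    rw [Fin.cons_self_tail] at this
    rw [Submodule.mem_bot, sub_apply, this, sub_self]
  have hdd := d_eq_d hT hT' hd
  have hm : C.mul = C'.mul := mul_eq_mul hT hT'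
  obtain ⟨⟨d, m, B⟩, _⟩ := C
  obtain ⟨⟨d', m', B'⟩, _⟩ := C'
  obtain rfl : d = d' := hdd
  obtain rfl : m = m' := hm
  obtain rfl : B = B' := hBn
  rfl

end CactiAlgebra

end Uniqueness

section Unitization

variable {k : Type u} [Field k] {V : Type v} [AddCommGroup V] [Module k V]

/-! ### Adjoining a unit to a reduced bialgebra -/

/-- The product of `V ⊕ k 1_H` with unit `1_H` that extends `μ`. -/
def unitMul (μ : V →ₗ[k] V →ₗ[k] V) : V × k →ₗ[k] V × k →ₗ[k] V × k :=
  LinearMap.mk₂ k (fun x y => (μ x.1 y.1 + y.2 • x.1 + x.2 • y.1, x.2 * y.2))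
    (fun x x' y => by ext <;> simp [add_smul, add_mul]; abel)
    (fun c x y => by ext <;> simp [mul_smul, smul_add, smul_comm c, mul_assoc])
    (fun x y y' => by ext <;> simp [add_smul, mul_add]; abel)
    (fun c x y => by ext <;> simp [mul_smul, smul_add, smul_comm c, mul_left_comm])

theorem unitMul_apply (μ : V →ₗ[k] V →ₗ[k] V) (x y : V × k) :
    unitMul μ x y = (μ x.1 y.1 + y.2 • x.1 + x.2 • y.1, x.2 * y.2) := rfl

/-- The coproduct of `V ⊕ k 1_H` with reduced coproduct `δ` and group-like element `1_H`. -/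
def unitComul (δ : V →ₗ[k] V ⊗[k] V) : V × k →ₗ[k] (V × k) ⊗[k] (V × k) :=
  LinearMap.coprod
    ((TensorProduct.mk k (V × k) (V × k)).flip (0, 1) ∘ₗ LinearMap.inl k V k +
      TensorProduct.mk k (V × k) (V × k) (0, 1) ∘ₗ LinearMap.inl k V k +
      TensorProduct.map (LinearMap.inl k V k) (LinearMap.inl k V k) ∘ₗ δ)
    (LinearMap.toSpanSingleton k _ ((0, 1) ⊗ₜ (0, 1)))

theorem unitComul_inl (δ : V →ₗ[k] V ⊗[k] V) (v : V) :
    unitComul δ (v, 0) = (v, 0) ⊗ₜ (0, 1) + (0, 1) ⊗ₜ (v, 0) +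
      TensorProduct.map (LinearMap.inl k V k) (LinearMap.inl k V k) (δ v) := by
  simp [unitComul]

theorem unitComul_one (δ : V →ₗ[k] V ⊗[k] V) :
    unitComul δ (0, 1) = (0, 1) ⊗ₜ (0, 1) := by
  simp [unitComul, show ((0, 0) : V × k) = 0 from rfl]

/-- The extension of an endomorphism of `V` by zero on `1_H`. -/
def unitD (D : V →ₗ[k] V) : V × k →ₗ[k] V × k := LinearMap.inl k V k ∘ₗ D ∘ₗ LinearMap.fst k V k

theorem unitD_apply (D : V →ₗ[k] V) (x : V × k) : unitD D x = (D x.1, 0) := rfl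

/-- An element of `H ⊗ H` is determined by its images under `id ⊗ ε`, `ε ⊗ id` and `π ⊗ π`. -/
theorem eq_of_counit_parts {w w' : (V × k) ⊗[k] (V × k)}
    (hl : LinearMap.lTensor (V × k) (LinearMap.snd k V k) w =
      LinearMap.lTensor (V × k) (LinearMap.snd k V k) w')
    (hr : LinearMap.rTensor (V × k) (LinearMap.snd k V k) w =
      LinearMap.rTensor (V × k) (LinearMap.snd k V k) w')
    (hf : TensorProduct.map (LinearMap.fst k V k) (LinearMap.fst k V k) w =
      TensorProduct.map (LinearMap.fst k V k) (LinearMap.fst k V k) w') : w = w' := by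
  have h : ∀ w : (V × k) ⊗[k] (V × k),
      TensorProduct.map (LinearMap.snd k V k) (LinearMap.snd k V k) w =
        LinearMap.rTensor k (LinearMap.snd k V k) (LinearMap.lTensor (V × k) (LinearMap.snd k V k)
          w) := fun w => by
    rw [LinearMap.rTensor, LinearMap.lTensor, TensorProduct.map_map]; rfl
  have e := tensor_counit_decomposition w
  have e' := tensor_counit_decomposition w'
  rw [h, hl, hr, hf] at e
  rw [h] at e'
  exact add_right_cancel (e.trans e'.symm)

variable (𝒱 : ℤ → Submodule k V) [DirectSum.Decomposition 𝒱]

theorem signMap_unitGrading_inl (n : ℤ) (v : V) :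
    signMap (unitGrading 𝒱) n (v, 0) = (signMap 𝒱 n v, 0) := by
  refine LinearMap.congr_fun (homogeneous_ext 𝒱
    (φ := signMap (unitGrading 𝒱) n ∘ₗ LinearMap.inl k V k)
    (ψ := LinearMap.inl k V k ∘ₗ signMap 𝒱 n) fun p v hv => ?_) v
  rw [LinearMap.comp_apply, LinearMap.comp_apply, signMap_of_mem _ _ hv,
    LinearMap.map_smul_of_tower]
  exact signMap_of_mem _ _ (inl_mem_unitGrading 𝒱 hv)

theorem signMap_unitGrading_one (n : ℤ) :
    signMap (unitGrading 𝒱) n (0, 1) = (0, 1) := by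
  rw [signMap_of_mem _ _ (one_mem_unitGrading 𝒱)]
  simp

/-- The axioms of a differential graded bialgebra without unit and counit, in terms of the reduced
coproduct `δ`. Multiplicativity of the coproduct is stated for the coproduct
`v ↦ v ⊗ 1 + 1 ⊗ v + δ v`. -/
structure IsReducedBialgebra (D : V →ₗ[k] V) (μ : V →ₗ[k] V →ₗ[k] V) (δ : V →ₗ[k] V ⊗[k] V) :
    Prop where
  d_mem : ∀ n, ∀ v ∈ 𝒱 n, D v ∈ 𝒱 (n + 1)
  mul_mem : ∀ m n, ∀ v ∈ 𝒱 m, ∀ w ∈ 𝒱 n, μ v w ∈ 𝒱 (m + n)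
  comul_mem : ∀ n, ∀ v ∈ 𝒱 n, δ v ∈ tensorPart 𝒱 n
  mul_assoc : ∀ u v w, μ (μ u v) w = μ u (μ v w)
  coassoc : ∀ v, TensorProduct.assoc k V V V (LinearMap.rTensor V δ (δ v)) =
    LinearMap.lTensor V δ (δ v)
  d_d : ∀ v, D (D v) = 0
  d_mul : ∀ n, ∀ v ∈ 𝒱 n, ∀ w, D (μ v w) = μ (D v) w + n.negOnePow • μ v (D w)
  comul_d : ∀ v, δ (D v) = TensorProduct.map D LinearMap.id (δ v) +
    TensorProduct.map (signMap 𝒱 1) D (δ v)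
  comul_mul : ∀ v w, TensorProduct.map (LinearMap.fst k V k) (LinearMap.fst k V k)
    (koszulMul (unitGrading 𝒱) (unitMul μ) (unitComul δ (v, 0)) (unitComul δ (w, 0))) = δ (μ v w)

variable {𝒱}
variable {D : V →ₗ[k] V} {μ : V →ₗ[k] V →ₗ[k] V} {δ : V →ₗ[k] V ⊗[k] V}

theorem rTensor_snd_unitComul : LinearMap.rTensor (V × k) (LinearMap.snd k V k) ∘ₗ unitComul δ =
    TensorProduct.mk k k (V × k) 1 := by
  have h : ∀ u : V ⊗[k] V, LinearMap.rTensor (V × k) (LinearMap.snd k V k)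
      (TensorProduct.map (LinearMap.inl k V k) (LinearMap.inl k V k) u) = 0 := fun u => by
    rw [LinearMap.rTensor, TensorProduct.map_map, LinearMap.snd_comp_inl, TensorProduct.map_zero_left,
      LinearMap.zero_apply]
  refine LinearMap.prod_ext (LinearMap.ext fun v => ?_) (LinearMap.ext_ring ?_)
  · simp [unitComul_inl, h]
  · simp [unitComul_one]

theorem lTensor_snd_unitComul : LinearMap.lTensor (V × k) (LinearMap.snd k V k) ∘ₗ unitComul δ =
    (TensorProduct.mk k (V × k) k).flip 1 := by
  have h : ∀ u : V ⊗[k] V, LinearMap.lTensor (V × k) (LinearMap.snd k V k)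
      (TensorProduct.map (LinearMap.inl k V k) (LinearMap.inl k V k) u) = 0 := fun u => by
    rw [LinearMap.lTensor, TensorProduct.map_map, LinearMap.snd_comp_inl,
      TensorProduct.map_zero_right, LinearMap.zero_apply]
  refine LinearMap.prod_ext (LinearMap.ext fun v => ?_) (LinearMap.ext_ring ?_)
  · simp [unitComul_inl, h]
  · simp [unitComul_one]

theorem unitComul_coassoc (h : ∀ v, TensorProduct.assoc k V V V (LinearMap.rTensor V δ (δ v)) =
    LinearMap.lTensor V δ (δ v)) :
    (TensorProduct.assoc k (V × k) (V × k) (V × k)).toLinearMap ∘ₗ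
      LinearMap.rTensor (V × k) (unitComul δ) ∘ₗ unitComul δ =
        LinearMap.lTensor (V × k) (unitComul δ) ∘ₗ unitComul δ := by
  have e1 : ∀ u : V ⊗[k] V, TensorProduct.assoc k (V × k) (V × k) (V × k)
      (LinearMap.rTensor (V × k) (unitComul δ) (TensorProduct.map (LinearMap.inl k V k) (LinearMap.inl k V k) u)) =
      TensorProduct.map (LinearMap.inl k V k) (TensorProduct.mk k (V × k) (V × k) (0, 1) ∘ₗ LinearMap.inl k V k) u +
        (0, 1) ⊗ₜ TensorProduct.map (LinearMap.inl k V k) (LinearMap.inl k V k) u +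
        TensorProduct.map (LinearMap.inl k V k) (TensorProduct.map (LinearMap.inl k V k) (LinearMap.inl k V k))
          (TensorProduct.assoc k V V V (LinearMap.rTensor V δ u)) := by
    intro u
    induction u with
    | zero => simp
    | tmul a b =>
      have : ∀ w : V ⊗[k] V, TensorProduct.assoc k (V × k) (V × k) (V × k)
          (TensorProduct.map (LinearMap.inl k V k) (LinearMap.inl k V k) w ⊗ₜ LinearMap.inl k V k b) =
          TensorProduct.map (LinearMap.inl k V k) (TensorProduct.map (LinearMap.inl k V k) (LinearMap.inl k V k)) (TensorProduct.assoc k V V V (w ⊗ₜ b)) := by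
        intro w
        induction w with
        | zero => simp
        | tmul c d => simp
        | add x y hx hy => simp only [map_add, TensorProduct.add_tmul, hx, hy]
      rw [TensorProduct.map_tmul, LinearMap.rTensor_tmul, LinearMap.rTensor_tmul, ← this]
      simp only [LinearMap.inl_apply, unitComul_inl, TensorProduct.add_tmul, map_add,
        TensorProduct.assoc_tmul, TensorProduct.map_tmul, LinearMap.comp_apply,
        TensorProduct.mk_apply]
    | add x y hx hy =>
      simp only [map_add, TensorProduct.tmul_add, hx, hy]
      abel
  have e2 : ∀ u : V ⊗[k] V,
      LinearMap.lTensor (V × k) (unitComul δ) (TensorProduct.map (LinearMap.inl k V k) (LinearMap.inl k V k) u) =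
      TensorProduct.assoc k (V × k) (V × k) (V × k) (TensorProduct.map (LinearMap.inl k V k) (LinearMap.inl k V k) u ⊗ₜ (0, 1)) +
        TensorProduct.map (LinearMap.inl k V k) (TensorProduct.mk k (V × k) (V × k) (0, 1) ∘ₗ LinearMap.inl k V k) u +
        TensorProduct.map (LinearMap.inl k V k) (TensorProduct.map (LinearMap.inl k V k) (LinearMap.inl k V k)) (LinearMap.lTensor V δ u) := by
    intro u
    induction u with
    | zero => simp
    | tmul a b =>
      simp only [LinearMap.inl_apply, unitComul_inl, TensorProduct.tmul_add,
        TensorProduct.assoc_tmul, TensorProduct.map_tmul, LinearMap.comp_apply,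
        TensorProduct.mk_apply, LinearMap.lTensor_tmul]
    | add x y hx hy =>
      simp only [map_add, TensorProduct.add_tmul, hx, hy]
      abel
  refine LinearMap.prod_ext (LinearMap.ext fun v => ?_) (LinearMap.ext_ring ?_)
  · simp only [LinearMap.comp_apply, LinearMap.inl_apply, unitComul_inl, map_add,
      LinearEquiv.coe_coe, LinearMap.rTensor_tmul, LinearMap.lTensor_tmul, unitComul_one, e1, e2, h,
      TensorProduct.add_tmul, TensorProduct.tmul_add, TensorProduct.assoc_tmul]
    abel
  · simp [unitComul_one]

theorem koszulMul_one_left (w : (V × k) ⊗[k] (V × k)) :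
    koszulMul (unitGrading 𝒱) (unitMul μ) ((0, 1) ⊗ₜ (0, 1)) w = w := by
  refine LinearMap.congr_fun (tmul_homogeneous_ext (unitGrading 𝒱) (unitGrading 𝒱)
    (φ := koszulMul (unitGrading 𝒱) (unitMul μ) ((0, 1) ⊗ₜ (0, 1))) (ψ := LinearMap.id)
    fun p q a ha b hb => ?_) w
  rw [koszulMul_tmul _ _ (one_mem_unitGrading 𝒱) ha]
  simp [unitMul_apply]

theorem koszulMul_one_right (w : (V × k) ⊗[k] (V × k)) :
    koszulMul (unitGrading 𝒱) (unitMul μ) w ((0, 1) ⊗ₜ (0, 1)) = w := by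
  refine LinearMap.congr_fun (tmul_homogeneous_ext (unitGrading 𝒱) (unitGrading 𝒱)
    (φ := (koszulMul (unitGrading 𝒱) (unitMul μ)).flip ((0, 1) ⊗ₜ (0, 1))) (ψ := LinearMap.id)
    fun p q a ha b hb => ?_) w
  rw [LinearMap.flip_apply, koszulMul_tmul _ _ hb (one_mem_unitGrading 𝒱)]
  simp [unitMul_apply]

theorem negOnePow_smul_mul_snd {m n : ℤ} {b : V × k} (hb : b ∈ unitGrading 𝒱 m)
    (c : k) : (m * n).negOnePow • (b.2 * c) = b.2 * c := by
  by_cases hm : m = 0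
  · subst hm; simp
  · simp [snd_eq_zero_of_unitGrading 𝒱 hm hb]

theorem lTensor_snd_koszulMul (w w' : (V × k) ⊗[k] (V × k)) :
    TensorProduct.rid k _ (LinearMap.lTensor (V × k) (LinearMap.snd k V k)
        (koszulMul (unitGrading 𝒱) (unitMul μ) w w')) =
      unitMul μ (TensorProduct.rid k _ (LinearMap.lTensor (V × k) (LinearMap.snd k V k) w))
        (TensorProduct.rid k _ (LinearMap.lTensor (V × k) (LinearMap.snd k V k) w')) := by
  set f : (V × k) ⊗[k] (V × k) →ₗ[k] V × k :=
    (TensorProduct.rid k (V × k)).toLinearMap ∘ₗ LinearMap.lTensor (V × k) (LinearMap.snd k V k)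
  have hf : ∀ a b : V × k, f (a ⊗ₜ b) = b.2 • a := fun a b => by simp [f]
  change f (koszulMul (unitGrading 𝒱) (unitMul μ) w w') = unitMul μ (f w) (f w')
  refine LinearMap.congr_fun (tmul_homogeneous_ext (unitGrading 𝒱) (unitGrading 𝒱)
    (φ := f ∘ₗ (koszulMul (unitGrading 𝒱) (unitMul μ)).flip w') (ψ := (unitMul μ).flip (f w') ∘ₗ f)
    fun p q a ha b hb => ?_) w
  simp only [LinearMap.comp_apply, LinearMap.flip_apply]
  refine LinearMap.congr_fun (tmul_homogeneous_ext (unitGrading 𝒱) (unitGrading 𝒱)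
    (φ := f ∘ₗ koszulMul (unitGrading 𝒱) (unitMul μ) (a ⊗ₜ b)) (ψ := unitMul μ (f (a ⊗ₜ b)) ∘ₗ f)
    fun r s a' ha' b' hb' => ?_) w'
  simp only [LinearMap.comp_apply]
  rw [koszulMul_tmul _ _ hb ha', LinearMap.map_smul_of_tower, hf, hf, hf, ← smul_assoc,
    unitMul_apply μ b b', negOnePow_smul_mul_snd hb]
  simp only [map_smul, LinearMap.smul_apply, smul_smul, mul_comm]

theorem rTensor_snd_koszulMul (w w' : (V × k) ⊗[k] (V × k)) :
    TensorProduct.lid k _ (LinearMap.rTensor (V × k) (LinearMap.snd k V k)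
        (koszulMul (unitGrading 𝒱) (unitMul μ) w w')) =
      unitMul μ (TensorProduct.lid k _ (LinearMap.rTensor (V × k) (LinearMap.snd k V k) w))
        (TensorProduct.lid k _ (LinearMap.rTensor (V × k) (LinearMap.snd k V k) w')) := by
  set f : (V × k) ⊗[k] (V × k) →ₗ[k] V × k :=
    (TensorProduct.lid k (V × k)).toLinearMap ∘ₗ LinearMap.rTensor (V × k) (LinearMap.snd k V k)
  have hf : ∀ a b : V × k, f (a ⊗ₜ b) = a.2 • b := fun a b => by simp [f]
  change f (koszulMul (unitGrading 𝒱) (unitMul μ) w w') = unitMul μ (f w) (f w')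
  refine LinearMap.congr_fun (tmul_homogeneous_ext (unitGrading 𝒱) (unitGrading 𝒱)
    (φ := f ∘ₗ (koszulMul (unitGrading 𝒱) (unitMul μ)).flip w') (ψ := (unitMul μ).flip (f w') ∘ₗ f)
    fun p q a ha b hb => ?_) w
  simp only [LinearMap.comp_apply, LinearMap.flip_apply]
  refine LinearMap.congr_fun (tmul_homogeneous_ext (unitGrading 𝒱) (unitGrading 𝒱)
    (φ := f ∘ₗ koszulMul (unitGrading 𝒱) (unitMul μ) (a ⊗ₜ b)) (ψ := unitMul μ (f (a ⊗ₜ b)) ∘ₗ f)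
    fun r s a' ha' b' hb' => ?_) w'
  simp only [LinearMap.comp_apply]
  rw [koszulMul_tmul _ _ hb ha', LinearMap.map_smul_of_tower, hf, hf, hf, ← smul_assoc,
    unitMul_apply μ a a', mul_comm q, mul_comm a.2, negOnePow_smul_mul_snd ha']
  simp only [map_smul, LinearMap.smul_apply, smul_smul]

namespace IsReducedBialgebra

variable (h : IsReducedBialgebra 𝒱 D μ δ)
include h

/-- The coproduct of `V ⊕ k 1_H` is multiplicative. The components in which the counit is applied to one
tensor factor hold because the counit is multiplicative; the remaining one is part of the axioms of
a reduced bialgebra. -/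
theorem unitComul_mul (x y : V × k) : unitComul δ (unitMul μ x y) =
    koszulMul (unitGrading 𝒱) (unitMul μ) (unitComul δ x) (unitComul δ y) := by
  have hl : ∀ x, LinearMap.lTensor (V × k) (LinearMap.snd k V k) (unitComul δ x) = x ⊗ₜ 1 :=
    LinearMap.congr_fun lTensor_snd_unitComul
  have hr : ∀ x, LinearMap.rTensor (V × k) (LinearMap.snd k V k) (unitComul δ x) = 1 ⊗ₜ x :=
    LinearMap.congr_fun rTensor_snd_unitComul
  refine eq_of_counit_parts ?_ ?_ ?_
  · apply (TensorProduct.rid k (V × k)).injective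
    rw [lTensor_snd_koszulMul, hl, hl, hl]
    simp
  · apply (TensorProduct.lid k (V × k)).injective
    rw [rTensor_snd_koszulMul, hr, hr, hr]
    simp
  set f := TensorProduct.map (LinearMap.fst k V k) (LinearMap.fst k V k)
  refine LinearMap.congr_fun₂ (f := ((unitMul μ).compr₂ (f ∘ₗ unitComul δ)))
    (g := ((koszulMul (unitGrading 𝒱) (unitMul μ)).compl₁₂ (unitComul δ) (unitComul δ)).compr₂ f)
    (LinearMap.prod_ext (LinearMap.ext fun v => LinearMap.prod_ext (LinearMap.ext fun w => ?_)
      (LinearMap.ext_ring ?_)) (LinearMap.ext_ring (LinearMap.ext fun y => ?_))) x y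
  · simp only [LinearMap.comp_apply, LinearMap.inl_apply, LinearMap.compr₂_apply,
      LinearMap.compl₁₂_apply]
    rw [h.comul_mul, unitMul_apply]
    simp only [zero_smul, mul_zero, add_zero]
    rw [unitComul_inl]
    simp [f, TensorProduct.map_map]
  · simp only [LinearMap.comp_apply, LinearMap.inl_apply, LinearMap.inr_apply,
      LinearMap.compr₂_apply, LinearMap.compl₁₂_apply]
    rw [unitComul_one, koszulMul_one_right, unitMul_apply]
    simp
  · simp only [LinearMap.comp_apply, LinearMap.inr_apply, LinearMap.compr₂_apply,
      LinearMap.compl₁₂_apply]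
    rw [unitComul_one, koszulMul_one_left, unitMul_apply]
    simp

theorem unitMul_mem {m n : ℤ} {x y : V × k} (hx : x ∈ unitGrading 𝒱 m)
    (hy : y ∈ unitGrading 𝒱 n) : unitMul μ x y ∈ unitGrading 𝒱 (m + n) := by
  have hx' := fst_mem_of_unitGrading 𝒱 hx
  have hy' := fst_mem_of_unitGrading 𝒱 hy
  have h1 : y.2 • x.1 ∈ 𝒱 (m + n) := by
    by_cases hn : n = 0
    · subst hn; simpa using Submodule.smul_mem _ _ hx'
    · simp [snd_eq_zero_of_unitGrading 𝒱 hn hy]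
  have h2 : x.2 • y.1 ∈ 𝒱 (m + n) := by
    by_cases hm : m = 0
    · subst hm; simpa using Submodule.smul_mem _ _ hy'
    · simp [snd_eq_zero_of_unitGrading 𝒱 hm hx]
  refine ⟨add_mem (add_mem (h.mul_mem _ _ _ hx' _ hy') h1) h2, ?_⟩
  split_ifs with hmn
  · trivial
  · by_cases hm : m = 0
    · simp [unitMul_apply, snd_eq_zero_of_unitGrading 𝒱 (n := n) (by omega) hy]
    · simp [unitMul_apply, snd_eq_zero_of_unitGrading 𝒱 hm hx]

theorem unitComul_mem {n : ℤ} {x : V × k} (hx : x ∈ unitGrading 𝒱 n) :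
    unitComul δ x ∈ tensorPart (unitGrading 𝒱) n := by
  have hx' := fst_mem_of_unitGrading 𝒱 hx
  have h1 : unitComul δ (x.1, 0) ∈ tensorPart (unitGrading 𝒱) n := by
    rw [unitComul_inl]
    refine add_mem (add_mem
      (tmul_mem_tensorPart (inl_mem_unitGrading 𝒱 hx') (one_mem_unitGrading 𝒱) (add_zero _))
      (tmul_mem_tensorPart (one_mem_unitGrading 𝒱) (inl_mem_unitGrading 𝒱 hx') (zero_add _))) ?_
    exact tensorPart_le (W := (tensorPart (unitGrading 𝒱) n).comap
      (TensorProduct.map (LinearMap.inl k V k) (LinearMap.inl k V k)))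
      (fun p q hpq a ha b hb => tmul_mem_tensorPart (inl_mem_unitGrading 𝒱 ha)
        (inl_mem_unitGrading 𝒱 hb) hpq) (h.comul_mem n _ hx')
  have e : x = (x.1, 0) + x.2 • (0, 1) := by simp
  by_cases hn : n = 0
  · subst hn
    rw [e, map_add, map_smul, unitComul_one]
    exact add_mem h1 (Submodule.smul_mem _ _
      (tmul_mem_tensorPart (one_mem_unitGrading 𝒱) (one_mem_unitGrading 𝒱) (add_zero _)))
  · rw [e, snd_eq_zero_of_unitGrading 𝒱 hn hx, zero_smul, add_zero]
    exact h1

theorem unitD_mul {n : ℤ} {x : V × k} (hx : x ∈ unitGrading 𝒱 n) (y : V × k) :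
    unitD D (unitMul μ x y) =
      unitMul μ (unitD D x) y + n.negOnePow • unitMul μ x (unitD D y) := by
  have hx2 : n.negOnePow • x.2 • D y.1 = x.2 • D y.1 := by
    by_cases hn : n = 0
    · subst hn; simp
    · simp [snd_eq_zero_of_unitGrading 𝒱 hn hx]
  refine Prod.ext ?_ ?_
  · simp only [unitD_apply, unitMul_apply, map_add, map_smul, Prod.fst_add, Prod.smul_fst,
      zero_smul, add_zero, smul_add, hx2, h.d_mul n _ (fst_mem_of_unitGrading 𝒱 hx)]
    abel
  · simp [unitD_apply, unitMul_apply]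

theorem unitComul_d (x : V × k) : unitComul δ (unitD D x) =
    TensorProduct.map (unitD D) LinearMap.id (unitComul δ x) +
      TensorProduct.map (signMap (unitGrading 𝒱) 1) (unitD D) (unitComul δ x) := by
  have e1 : ∀ u : V ⊗[k] V, TensorProduct.map (unitD D) LinearMap.id
      (TensorProduct.map (LinearMap.inl k V k) (LinearMap.inl k V k) u) =
      TensorProduct.map (LinearMap.inl k V k) (LinearMap.inl k V k)
        (TensorProduct.map D LinearMap.id u) := fun u => by
    rw [TensorProduct.map_map, TensorProduct.map_map]; rfl
  have e2 : ∀ u : V ⊗[k] V, TensorProduct.map (signMap (unitGrading 𝒱) 1) (unitD D)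
      (TensorProduct.map (LinearMap.inl k V k) (LinearMap.inl k V k) u) =
      TensorProduct.map (LinearMap.inl k V k) (LinearMap.inl k V k)
        (TensorProduct.map (signMap 𝒱 1) D u) := fun u => by
    rw [TensorProduct.map_map, TensorProduct.map_map]
    congr 2
    exact LinearMap.ext fun v => signMap_unitGrading_inl 𝒱 1 v
  have e3 : unitD D (0, 1) = 0 := by simp [unitD_apply]
  refine LinearMap.congr_fun (f := unitComul δ ∘ₗ unitD D)
    (g := TensorProduct.map (unitD D) LinearMap.id ∘ₗ unitComul δ +
      TensorProduct.map (signMap (unitGrading 𝒱) 1) (unitD D) ∘ₗ unitComul δ)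
    (LinearMap.prod_ext (LinearMap.ext fun v => ?_) (LinearMap.ext_ring ?_)) x
  · simp only [LinearMap.comp_apply, LinearMap.add_apply, LinearMap.inl_apply, unitComul_inl,
      map_add, e1, e2, TensorProduct.map_tmul, e3, signMap_unitGrading_one, LinearMap.id_apply,
      TensorProduct.tmul_zero, TensorProduct.zero_tmul]
    simp only [unitD_apply, unitComul_inl, h.comul_d, map_add]
    abel
  · simp [unitComul_one, e3]

/-- The differential graded bialgebra `V ⊕ k 1_H` of a reduced bialgebra `V`. -/
def toDGBialgebra : DGBialgebra k (V × k) (unitGrading 𝒱) where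
  comul := unitComul δ
  counit := LinearMap.snd k V k
  coassoc := unitComul_coassoc h.coassoc
  rTensor_counit_comp_comul := rTensor_snd_unitComul
  lTensor_counit_comp_comul := lTensor_snd_unitComul
  d := unitD D
  mul := unitMul μ
  one := (0, 1)
  d_mem n x hx := inl_mem_unitGrading 𝒱 (h.d_mem n _ (fst_mem_of_unitGrading 𝒱 hx))
  mul_mem _ _ _ hx _ hy := h.unitMul_mem hx hy
  one_mem := one_mem_unitGrading 𝒱
  comul_mem _ _ hx := h.unitComul_mem hx
  counit_eq_zero _ hn _ hx := snd_eq_zero_of_unitGrading 𝒱 hn hx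
  mul_assoc x y z := by
    refine Prod.ext ?_ (_root_.mul_assoc _ _ _)
    simp only [unitMul_apply, map_add, map_smul, LinearMap.add_apply, LinearMap.smul_apply,
      smul_add, smul_smul, h.mul_assoc, mul_comm]
    abel
  one_mul x := by simp [unitMul_apply]
  mul_one x := by simp [unitMul_apply]
  comul_mul x y := h.unitComul_mul x y
  comul_one := unitComul_one δ
  counit_mul _ _ := rfl
  counit_one := rfl
  d_d x := by simp [unitD_apply, h.d_d]
  d_mul _ _ hx y := h.unitD_mul hx y
  comul_d x := h.unitComul_d x
  counit_d _ := rfl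

end IsReducedBialgebra

/-- Bialgebra structures on `V ⊕ k 1_H` with the given unit and counit agree if their
differentials, products and reduced coproducts agree on `V`. -/
theorem DGBialgebra.ext_of_reduced {S S' : DGBialgebra k (V × k) (unitGrading 𝒱)}
    (h1 : S.one = (0, 1)) (hε : S.counit = LinearMap.snd k V k)
    (h1' : S'.one = (0, 1)) (hε' : S'.counit = LinearMap.snd k V k)
    (hd : ∀ v, (S.d (v, 0)).1 = (S'.d (v, 0)).1)
    (hm : ∀ v w, (S.mul (v, 0) (w, 0)).1 = (S'.mul (v, 0) (w, 0)).1)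
    (hc : ∀ v, TensorProduct.map (LinearMap.fst k V k) (LinearMap.fst k V k) (S.comul (v, 0)) =
      TensorProduct.map (LinearMap.fst k V k) (LinearMap.fst k V k) (S'.comul (v, 0))) : S = S' := by
  have hd' : S.d = S'.d := by
    refine LinearMap.prod_ext (LinearMap.ext fun v => ?_) (LinearMap.ext_ring ?_)
    · simp only [LinearMap.comp_apply, LinearMap.inl_apply]
      rw [d_inl_eq S hε, d_inl_eq S' hε', hd]
    · simp only [LinearMap.comp_apply, LinearMap.inr_apply]
      rw [d_one_eq_zero S h1, d_one_eq_zero S' h1']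
  have hc' : S.comul = S'.comul := by
    refine LinearMap.prod_ext (LinearMap.ext fun v => ?_) (LinearMap.ext_ring ?_)
    · simp only [LinearMap.comp_apply, LinearMap.inl_apply]
      rw [comul_inl S hε, comul_inl S' hε', hc]
    · simp only [LinearMap.comp_apply, LinearMap.inr_apply]
      rw [← h1, S.comul_one, h1, ← h1', S'.comul_one]
  have hm' : S.mul = S'.mul := by
    refine LinearMap.prod_ext (LinearMap.ext fun v => LinearMap.prod_ext
      (LinearMap.ext fun w => ?_) (LinearMap.ext_ring ?_)) (LinearMap.ext_ring
        (LinearMap.ext fun y => ?_))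
    · simp only [LinearMap.comp_apply, LinearMap.inl_apply]
      rw [mul_inl_eq S hε, mul_inl_eq S' hε', hm]
    · simp only [LinearMap.comp_apply, LinearMap.inr_apply]
      rw [← h1, S.mul_one, h1, ← h1', S'.mul_one]
    · simp only [LinearMap.comp_apply, LinearMap.inr_apply]
      rw [← h1, S.one_mul, h1, ← h1', S'.one_mul]
  have ho : S.one = S'.one := h1.trans h1'.symm
  have hε'' : S.counit = S'.counit := hε.trans hε'.symm
  obtain ⟨@⟨⟨Δ, ε⟩, _, _, _⟩, d, μ, o⟩ := S
  obtain ⟨@⟨⟨Δ', ε'⟩, _, _, _⟩, d', μ', o'⟩ := S'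
  obtain rfl : Δ = Δ' := hc'
  obtain rfl : ε = ε' := hε''
  obtain rfl : d = d' := hd'
  obtain rfl : μ = μ' := hm'
  obtain rfl : o = o' := ho
  rfl

end Unitization

section Generators

variable {k : Type u} [Field k] {V : Type v} [AddCommGroup V] [Module k V]

/-! ### The reduced bialgebra of a well graded Cacti algebra -/

namespace ReducedTensor

variable (k V) in
/-- The embedding of `V ⊗ (V ⊗ V)` in the tensor algebra. -/
def triple : V ⊗[k] (V ⊗[k] V) →ₗ[k] TensorAlgebra k V :=
  LinearMap.mul' k (TensorAlgebra k V) ∘ₗ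
    TensorProduct.map (TensorAlgebra.ι k) ((ReducedTensor k V).subtype ∘ₗ cup k V)

theorem triple_tmul (a : V) (u : V ⊗[k] V) :
    triple k V (a ⊗ₜ u) = TensorAlgebra.ι k a * cup k V u := rfl

theorem triple_assoc_tmul (u : V ⊗[k] V) (b : V) :
    triple k V (TensorProduct.assoc k V V V (u ⊗ₜ b)) = cup k V u * TensorAlgebra.ι k b := by
  induction u with
  | zero => simp
  | tmul c d => rw [TensorProduct.assoc_tmul, triple_tmul, coe_cup_tmul, coe_cup_tmul, mul_assoc]
  | add x y hx hy =>
    simp only [TensorProduct.add_tmul, map_add, hx, hy, Submodule.coe_add, add_mul]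

variable (k V) in
/-- The retraction of `V ⊗ (V ⊗ V)` from the tensor algebra. -/
def cubic : TensorAlgebra k V →ₗ[k] V ⊗[k] (V ⊗[k] V) :=
  LinearMap.lTensor V (quadratic k V) ∘ₗ stripLeft k V

theorem stripLeft_ι (v : V) : stripLeft k V (TensorAlgebra.ι k v) = v ⊗ₜ 1 := by
  rw [← stripLeft_ι_mul, mul_one]

theorem stripLeft_one : stripLeft k V 1 = 0 := by
  simp [stripLeft]

theorem ιInv_one : TensorAlgebra.ιInv (1 : TensorAlgebra k V) = (0 : V) := by
  let _ : Module kᵐᵒᵖ V := Module.compHom _ ((RingHom.id k).fromOpposite mul_comm)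
  have : IsCentralScalar k V := ⟨fun _ _ => rfl⟩
  change (TensorAlgebra.toTrivSqZeroExt (1 : TensorAlgebra k V)).snd = 0
  rw [map_one, TrivSqZeroExt.snd_one]

theorem ιInv_ι_mul_ι_mul (v w : V) (t : TensorAlgebra k V) :
    TensorAlgebra.ιInv (TensorAlgebra.ι k v * (TensorAlgebra.ι k w * t)) = (0 : V) := by
  simp only [TensorAlgebra.ιInv, LinearMap.comp_apply, AlgHom.toLinearMap_apply, map_mul,
    TensorAlgebra.toTrivSqZeroExt_ι, TrivSqZeroExt.sndHom_apply, TrivSqZeroExt.snd_mul,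
    TrivSqZeroExt.fst_inr, TrivSqZeroExt.fst_mul, zero_smul, zero_mul, MulOpposite.op_zero,
    zero_add]
  exact zero_smul k v

theorem ιInv_ι_mul_ι (v w : V) :
    TensorAlgebra.ιInv (TensorAlgebra.ι k v * TensorAlgebra.ι k w) = (0 : V) := by
  simpa using ιInv_ι_mul_ι_mul v w 1

theorem quadratic_ι (v : V) : quadratic k V (TensorAlgebra.ι k v) = 0 := by
  rw [quadratic, LinearMap.comp_apply, stripLeft_ι, LinearMap.lTensor_tmul, ιInv_one,
    TensorProduct.tmul_zero]

theorem ιInv_cup (u : V ⊗[k] V) : TensorAlgebra.ιInv (cup k V u : TensorAlgebra k V) = 0 := by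
  induction u with
  | zero => simp
  | tmul a b => rw [coe_cup_tmul, ιInv_ι_mul_ι]
  | add x y hx hy => rw [map_add, Submodule.coe_add, map_add, hx, hy, add_zero]

theorem quadratic_triple (x : V ⊗[k] (V ⊗[k] V)) : quadratic k V (triple k V x) = 0 := by
  induction x with
  | zero => simp
  | tmul a u =>
    rw [triple_tmul, quadratic, LinearMap.comp_apply, stripLeft_ι_mul, LinearMap.lTensor_tmul,
      ιInv_cup, TensorProduct.tmul_zero]
  | add x y hx hy => rw [map_add, map_add, hx, hy, add_zero]

theorem cubic_triple (x : V ⊗[k] (V ⊗[k] V)) : cubic k V (triple k V x) = x := by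
  induction x with
  | zero => simp
  | tmul a u =>
    rw [triple_tmul, cubic, LinearMap.comp_apply, stripLeft_ι_mul, LinearMap.lTensor_tmul,
      quadratic_cup]
  | add x y hx hy => rw [map_add, map_add, hx, hy]

theorem cubic_cup (u : V ⊗[k] V) : cubic k V (cup k V u) = 0 := by
  induction u with
  | zero => simp
  | tmul a b =>
    rw [coe_cup_tmul, cubic, LinearMap.comp_apply, stripLeft_ι_mul, LinearMap.lTensor_tmul,
      quadratic_ι, TensorProduct.tmul_zero]
  | add x y hx hy => rw [map_add, Submodule.coe_add, map_add, hx, hy, add_zero]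

theorem cubic_ι (v : V) : cubic k V (TensorAlgebra.ι k v) = 0 := by
  rw [cubic, LinearMap.comp_apply, stripLeft_ι, LinearMap.lTensor_tmul, quadratic,
    LinearMap.comp_apply, stripLeft_one, map_zero, TensorProduct.tmul_zero]

theorem ιInv_triple (x : V ⊗[k] (V ⊗[k] V)) : TensorAlgebra.ιInv (triple k V x) = 0 := by
  have h : ∀ (a : V) (u : V ⊗[k] V),
      TensorAlgebra.ιInv (TensorAlgebra.ι k a * (cup k V u : TensorAlgebra k V)) = (0 : V) := by
    intro a u
    induction u with
    | zero => simp
    | tmul b c => rw [coe_cup_tmul, ιInv_ι_mul_ι_mul]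
    | add x y hx hy => rw [map_add, Submodule.coe_add, mul_add, map_add, hx, hy, add_zero]
  induction x with
  | zero => simp
  | tmul a u => rw [triple_tmul, h]
  | add x y hx hy => rw [map_add, map_add, hx, hy, add_zero]

end ReducedTensor

variable {𝒱 : ℤ → Submodule k V} [DirectSum.Decomposition 𝒱]

theorem ιInv_mem {n : ℤ} {x : TensorAlgebra k V} (hx : x ∈ tensorTotal 𝒱 n) :
    TensorAlgebra.ιInv x ∈ 𝒱 (n - 1) := by
  refine weightPart_le (W := (𝒱 (n - 1)).comap TensorAlgebra.ιInv) (fun l hl hn => ?_) hx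
  rw [Submodule.mem_comap]
  rw [weight_one_one] at hn
  rcases l with _ | ⟨a, _ | ⟨b, l⟩⟩
  · rw [tensorOf_nil, ReducedTensor.ιInv_one]
    exact zero_mem _
  · rw [tensorOf_cons, tensorOf_nil, mul_one, TensorAlgebra.ι_leftInverse]
    have : a.1 = n - 1 := by rw [← hn]; simp [totalDeg, degSum]
    exact this ▸ hl a (by simp)
  · rw [tensorOf_cons, tensorOf_cons, ReducedTensor.ιInv_ι_mul_ι_mul]
    exact zero_mem _

theorem quadratic_mem {n : ℤ} {x : TensorAlgebra k V} (hx : x ∈ tensorTotal 𝒱 n) :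
    ReducedTensor.quadratic k V x ∈ tensorPart 𝒱 (n - 2) := by
  refine weightPart_le (W := (tensorPart 𝒱 (n - 2)).comap (ReducedTensor.quadratic k V))
    (fun l hl hn => ?_) hx
  rw [Submodule.mem_comap]
  rw [weight_one_one] at hn
  rcases l with _ | ⟨a, _ | ⟨b, _ | ⟨c, l⟩⟩⟩
  · rw [tensorOf_nil, ReducedTensor.quadratic, LinearMap.comp_apply, ReducedTensor.stripLeft_one,
      map_zero]
    exact zero_mem _
  · rw [tensorOf_cons, tensorOf_nil, mul_one, ReducedTensor.quadratic_ι]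
    exact zero_mem _
  · rw [tensorOf_cons, tensorOf_cons, tensorOf_nil, mul_one, ← ReducedTensor.coe_cup_tmul,
      ReducedTensor.quadratic_cup]
    refine tmul_mem_tensorPart (hl a (by simp)) (hl b (by simp)) ?_
    rw [← hn]
    simp [totalDeg, degSum]
  · rw [tensorOf_cons, ReducedTensor.quadratic, LinearMap.comp_apply, stripLeft_ι_mul,
      LinearMap.lTensor_tmul, tensorOf_cons, tensorOf_cons,
      ReducedTensor.ιInv_ι_mul_ι_mul, TensorProduct.tmul_zero]
    exact zero_mem _

/-- The internal and the total degree of an element determine its external degree. -/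
theorem mem_externalPart_of_internal_of_total {a b : ℤ} {x : ReducedTensor k V}
    (ha : x ∈ internalPart (tensorBigrading 𝒱) a) (hb : x ∈ totalPart (tensorBigrading 𝒱) b) :
    x ∈ externalPart (tensorBigrading 𝒱) (b - a) := by
  rw [mem_internalPart] at ha
  rw [mem_totalPart] at hb
  rw [mem_externalPart]
  rw [← DirectSum.decompose_of_mem_same (weightPart 𝒱 (1 : ℤ) 1) hb]
  refine weightPart_le (W := (weightPart 𝒱 (0 : ℤ) 1 (b - a)).comap
    (GradedAlgebra.proj (weightPart 𝒱 (1 : ℤ) 1) b)) (fun l hl hn => ?_) ha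
  rw [Submodule.mem_comap, GradedAlgebra.proj_apply]
  rw [weight_one_zero] at hn
  have hl' : tensorOf k l ∈ weightPart 𝒱 (1 : ℤ) 1 (totalDeg l) :=
    tensorOf_mem hl (weight_one_one l)
  by_cases hlb : totalDeg l = b
  · subst hlb
    rw [DirectSum.decompose_of_mem_same _ hl']
    refine tensorOf_mem hl ?_
    rw [weight_zero_one, totalDeg, hn]
    ring
  · rw [DirectSum.decompose_of_mem_ne _ hl' hlb]
    exact zero_mem _

end Generators

/-! ### The differential and the product on generators -/

section GeneratorOperations

variable {k : Type u} [Field k] {V : Type v} [AddCommGroup V] [Module k V]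
  (𝒱 : ℤ → Submodule k V) [DirectSum.Decomposition 𝒱]

/-- The part `V → V` of the differential of a Cacti algebra structure on the reduced tensor
algebra. -/
def CactiData.genD (C : CactiData k (ReducedTensor k V)) : V →ₗ[k] V :=
  TensorAlgebra.ιInv ∘ₗ (ReducedTensor k V).subtype ∘ₗ C.d ∘ₗ ReducedTensor.inclLinear k V

/-- The part `V → V ⊗ V` of the differential. -/
def CactiData.genQuad (C : CactiData k (ReducedTensor k V)) : V →ₗ[k] V ⊗[k] V :=
  ReducedTensor.quadratic k V ∘ₗ (ReducedTensor k V).subtype ∘ₗ C.d ∘ₗ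
    ReducedTensor.inclLinear k V

/-- The operation `B₂` on `V`. -/
def CactiData.genB (C : CactiData k (ReducedTensor k V)) : V →ₗ[k] V →ₗ[k] V :=
  LinearMap.mk₂ k (fun x y => TensorAlgebra.ιInv
      (C.B 1 ![ReducedTensor.inclLinear k V x, ReducedTensor.inclLinear k V y] :
        TensorAlgebra k V))
    (fun x x' y => (TensorAlgebra.ιInv ∘ₗ (ReducedTensor k V).subtype ∘ₗ
      C.opLeft ![ReducedTensor.inclLinear k V y] ∘ₗ ReducedTensor.inclLinear k V).map_add x x')
    (fun c x y => (TensorAlgebra.ιInv ∘ₗ (ReducedTensor k V).subtype ∘ₗ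
      C.opLeft ![ReducedTensor.inclLinear k V y] ∘ₗ ReducedTensor.inclLinear k V).map_smul c x)
    (fun x y y' => (TensorAlgebra.ιInv ∘ₗ (ReducedTensor k V).subtype ∘ₗ
      C.opRight (ReducedTensor.inclLinear k V x) ![] ∘ₗ ReducedTensor.inclLinear k V).map_add y y')
    (fun c x y => (TensorAlgebra.ιInv ∘ₗ (ReducedTensor k V).subtype ∘ₗ
      C.opRight (ReducedTensor.inclLinear k V x) ![] ∘ₗ ReducedTensor.inclLinear k V).map_smul c y)

/-- The product `x * y = (-1) ^ (|x| + 1) B₂(x, y)` on `V`. -/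
def CactiData.genMul (C : CactiData k (ReducedTensor k V)) : V →ₗ[k] V →ₗ[k] V :=
  -(C.genB ∘ₗ signMap 𝒱 1)

variable (k) in
/-- The involution `a ⊗ b ↦ (-1) ^ |a| a ⊗ b`. -/
def leftSign : V ⊗[k] V →ₗ[k] V ⊗[k] V := TensorProduct.map (signMap 𝒱 1) LinearMap.id

/-- The reduced coproduct on `V`, for which the quadratic part of the differential of `v` is
`∑ (-1) ^ |v₁| v₁ ⊗ v₂`. -/
def CactiData.genComul (C : CactiData k (ReducedTensor k V)) : V →ₗ[k] V ⊗[k] V :=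
  leftSign k 𝒱 ∘ₗ C.genQuad

variable {𝒱}

theorem leftSign_tmul {p : ℤ} {a : V} (ha : a ∈ 𝒱 p) (b : V) :
    leftSign k 𝒱 (a ⊗ₜ b) = p.negOnePow • (a ⊗ₜ b) := by
  rw [leftSign, TensorProduct.map_tmul, signMap_of_mem _ _ ha, mul_one, LinearMap.id_apply,
    negOnePow_smul_tmul]

theorem leftSign_leftSign (u : V ⊗[k] V) : leftSign k 𝒱 (leftSign k 𝒱 u) = u := by
  rw [leftSign, TensorProduct.map_map, signMap_comp_signMap, signMap_congr 𝒱 (n := 0) (by decide),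
    signMap_zero, LinearMap.id_comp, TensorProduct.map_id, LinearMap.id_apply]

theorem genMul_of_mem (C : CactiData k (ReducedTensor k V)) {p : ℤ} {x : V} (hx : x ∈ 𝒱 p)
    (y : V) : C.genMul 𝒱 x y = (p + 1).negOnePow • C.genB x y := by
  rw [CactiData.genMul, LinearMap.neg_apply, LinearMap.neg_apply, LinearMap.comp_apply,
    signMap_of_mem _ _ hx, LinearMap.map_smul_of_tower, LinearMap.smul_apply, mul_one,
    Int.negOnePow_succ, Units.neg_smul]

theorem genB_of_mem (C : CactiData k (ReducedTensor k V)) {p : ℤ} {x : V} (hx : x ∈ 𝒱 p)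
    (y : V) : C.genB x y = (p + 1).negOnePow • C.genMul 𝒱 x y := by
  rw [genMul_of_mem C hx, smul_smul, ← Int.negOnePow_add, Int.negOnePow_even _ ⟨_, rfl⟩, one_smul]

theorem leftSign_genComul (C : CactiData k (ReducedTensor k V)) (v : V) :
    leftSign k 𝒱 (C.genComul 𝒱 v) = C.genQuad v :=
  leftSign_leftSign _

theorem ReducedTensor.incl_injective :
    Function.Injective (ReducedTensor.incl k : V → ReducedTensor k V) :=
  fun a b h => (TensorAlgebra.ι_leftInverse a).symm.trans
    ((congrArg (fun x : ReducedTensor k V => TensorAlgebra.ιInv (x : TensorAlgebra k V)) h).trans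
      (TensorAlgebra.ι_leftInverse b))

namespace CactiAlgebra

variable {C : CactiAlgebra k (ReducedTensor k V) (totalPart (tensorBigrading 𝒱))}

/-- The differential of a generator has the parts `genD` and `genQuad`, since `d` raises either the
internal or the external degree by one. -/
theorem IsWellGraded.d_incl (hC : C.IsWellGraded (tensorBigrading 𝒱)) (v : V) :
    C.d (ReducedTensor.incl k v) =
      ReducedTensor.incl k (C.genD v) + ReducedTensor.cup k V (C.genQuad v) := by
  obtain ⟨a, u, h⟩ := hC.exists_d_incl v
  have h1 : C.genD v = a := by
    simp only [CactiData.genD, LinearMap.comp_apply, ReducedTensor.inclLinear_apply, h,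
      Submodule.subtype_apply, map_add, ReducedTensor.ιInv_cup, add_zero]
    exact TensorAlgebra.ι_leftInverse a
  have h2 : C.genQuad v = u := by
    simp only [CactiData.genQuad, LinearMap.comp_apply, ReducedTensor.inclLinear_apply, h,
      Submodule.subtype_apply, map_add, ReducedTensor.quadratic_cup]
    rw [show ((ReducedTensor.incl k a : ReducedTensor k V) : TensorAlgebra k V) =
      TensorAlgebra.ι k a from rfl, ReducedTensor.quadratic_ι, zero_add]
  rw [h1, h2, h]

theorem genD_mem {p : ℤ} {v : V} (hv : v ∈ 𝒱 p) : C.genD v ∈ 𝒱 (p + 1) := by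
  have := ιInv_mem ((mem_totalPart 𝒱).1 (C.d_mem _ _ (incl_mem_totalPart hv)))
  rw [add_sub_cancel_right, ← ReducedTensor.inclLinear_apply] at this
  exact this

theorem genQuad_mem {p : ℤ} {v : V} (hv : v ∈ 𝒱 p) : C.genQuad v ∈ tensorPart 𝒱 p := by
  have := quadratic_mem ((mem_totalPart 𝒱).1 (C.d_mem _ _ (incl_mem_totalPart hv)))
  rw [← ReducedTensor.inclLinear_apply, show p + 1 + 1 - 2 = p by ring] at this
  exact this

theorem leftSign_mem {p : ℤ} {u : V ⊗[k] V} (hu : u ∈ tensorPart 𝒱 p) :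
    leftSign k 𝒱 u ∈ tensorPart 𝒱 p :=
  tensorPart_le (W := (tensorPart 𝒱 p).comap (leftSign k 𝒱)) (fun r s hrs a ha b hb => by
    rw [Submodule.mem_comap, leftSign_tmul ha]
    exact Submodule.smul_of_tower_mem _ _ (tmul_mem_tensorPart ha hb hrs)) hu

theorem genComul_mem {p : ℤ} {v : V} (hv : v ∈ 𝒱 p) : C.genComul 𝒱 v ∈ tensorPart 𝒱 p :=
  leftSign_mem (genQuad_mem hv)

theorem B_one_incl_mem_total {p q : ℤ} {v w : V} (hv : v ∈ 𝒱 p) (hw : w ∈ 𝒱 q) :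
    C.B 1 ![ReducedTensor.incl k v, ReducedTensor.incl k w] ∈
      totalPart (tensorBigrading 𝒱) (p + q + 1) := by
  have := C.B_mem 1 ![p + 1, q + 1] ![ReducedTensor.incl k v, ReducedTensor.incl k w] (fun i => by
    fin_cases i
    exacts [incl_mem_totalPart hv, incl_mem_totalPart hw])
  convert this using 2
  simp
  ring

theorem genB_mem {p q : ℤ} {v w : V} (hv : v ∈ 𝒱 p) (hw : w ∈ 𝒱 q) :
    C.genB v w ∈ 𝒱 (p + q) := by
  have := ιInv_mem ((mem_totalPart 𝒱).1 (B_one_incl_mem_total (C := C) hv hw))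
  rw [add_sub_cancel_right, ← ReducedTensor.inclLinear_apply, ← ReducedTensor.inclLinear_apply]
    at this
  exact this

theorem genMul_mem {p q : ℤ} {v w : V} (hv : v ∈ 𝒱 p) (hw : w ∈ 𝒱 q) :
    C.genMul 𝒱 v w ∈ 𝒱 (p + q) := by
  rw [genMul_of_mem _ hv]
  exact Submodule.smul_of_tower_mem _ _ (genB_mem hv hw)

/-- The operation `B₂` maps generators to generators: it preserves the internal degree and lowers the
total degree by one, so that the external degree of `B₂(v, w)` is one. -/
theorem IsWellGraded.B_one_incl (hC : C.IsWellGraded (tensorBigrading 𝒱)) (v w : V) :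
    C.B 1 ![ReducedTensor.incl k v, ReducedTensor.incl k w] = ReducedTensor.incl k (C.genB v w) := by
  rw [← ReducedTensor.inclLinear_apply, ← ReducedTensor.inclLinear_apply,
    ← ReducedTensor.inclLinear_apply]
  refine homogeneous_induction 𝒱 (W := LinearMap.eqLocus
    (C.opLeft ![ReducedTensor.inclLinear k V w] ∘ₗ ReducedTensor.inclLinear k V)
    (ReducedTensor.inclLinear k V ∘ₗ C.genB.flip w)) (fun p v hv => ?_) v
  refine homogeneous_induction 𝒱 (W := LinearMap.eqLocus
    (C.opRight (ReducedTensor.inclLinear k V v) ![] ∘ₗ ReducedTensor.inclLinear k V)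
    (ReducedTensor.inclLinear k V ∘ₗ C.genB v)) (fun q w hw => ?_) w
  change C.B 1 ![ReducedTensor.inclLinear k V v, ReducedTensor.inclLinear k V w] =
    ReducedTensor.inclLinear k V (TensorAlgebra.ιInv
      (C.B 1 ![ReducedTensor.inclLinear k V v, ReducedTensor.inclLinear k V w] :
        TensorAlgebra k V))
  simp only [ReducedTensor.inclLinear_apply]
  refine eq_incl_of_mem_externalPart 𝒱 ?_
  have h := hC.B_internal 1 ![p, q] ![ReducedTensor.incl k v, ReducedTensor.incl k w] (fun i => by
    fin_cases i
    exacts [Submodule.mem_iSup_of_mem 1 (incl_mem_tensorBigrading 𝒱 hv),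
      Submodule.mem_iSup_of_mem 1 (incl_mem_tensorBigrading 𝒱 hw)])
  have := mem_externalPart_of_internal_of_total h (B_one_incl_mem_total hv hw)
  simpa using this

/-- The product `v * w` on `V` is the brace `v{w}`, which is homogeneous of total degree
`|v| + |w| + 1`. -/
theorem IsWellGraded.brace_incl (hC : C.IsWellGraded (tensorBigrading 𝒱)) {p q : ℤ} {v : V}
    (hv : v ∈ 𝒱 p) (w : V) :
    C.brace (p + 1, ReducedTensor.incl k v) [(q + 1, ReducedTensor.incl k w)] =
      (p + q + 1, ReducedTensor.incl k (C.genMul 𝒱 v w)) := by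
  refine Prod.ext ?_ ?_
  · simp [CactiData.brace, shiftedDegSum]
    ring
  · simp only [CactiData.brace, List.map_cons, List.map_nil, op_singleton, hC.B_one_incl,
      decalage_cons, decalage_nil, add_zero, genMul_of_mem _ hv]
    simp only [← ReducedTensor.inclLinear_apply, LinearMap.map_smul_of_tower]

/-- The product on `V` is associative: this is the relation `u{v}{w} = u{v{w}} + u{v, w} ± u{w, v}`, in
which the last two braces vanish because `u` has external degree one. -/
theorem IsWellGraded.genMul_assoc (hC : C.IsWellGraded (tensorBigrading 𝒱)) (u v w : V) :
    C.genMul 𝒱 (C.genMul 𝒱 u v) w = C.genMul 𝒱 u (C.genMul 𝒱 v w) := by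
  refine LinearMap.congr_fun (homogeneous_ext 𝒱
    (φ := (C.genMul 𝒱).flip w ∘ₗ (C.genMul 𝒱).flip v)
    (ψ := (C.genMul 𝒱).flip (C.genMul 𝒱 v w)) fun p u hu => ?_) u
  refine LinearMap.congr_fun (homogeneous_ext 𝒱 (φ := (C.genMul 𝒱).flip w ∘ₗ C.genMul 𝒱 u)
    (ψ := C.genMul 𝒱 u ∘ₗ (C.genMul 𝒱).flip w) fun q v hv => ?_) v
  refine LinearMap.congr_fun (homogeneous_ext 𝒱 (φ := C.genMul 𝒱 (C.genMul 𝒱 u v))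
    (ψ := C.genMul 𝒱 u ∘ₗ C.genMul 𝒱 v) fun r w hw => ?_) w
  -- Braces carry the total degree, which on `V` is the internal degree plus one.
  have h := C.brace_brace (p + 1, ReducedTensor.incl k u) [(q + 1, ReducedTensor.incl k v)]
    [(r + 1, ReducedTensor.incl k w)] (incl_mem_totalPart hu)
    (by simpa [Homogeneous] using incl_mem_totalPart hv)
    (by simpa [Homogeneous] using incl_mem_totalPart hw)
  have h0 : ∀ Y Y' : ℤ × ReducedTensor k V,
      (C.brace (p + 1, ReducedTensor.incl k u) [Y, Y']).2 = 0 := fun Y Y' => by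
    simp only [CactiData.brace, List.map_cons, List.map_nil, op_pair]
    rw [show C.B 2 ![ReducedTensor.incl k u, Y.2, Y'.2] = 0 from hC.B_incl u ![Y.2, Y'.2],
      smul_zero]
  rw [hC.brace_incl hu, hC.brace_incl (genMul_mem hu hv)] at h
  simp only [CactiData.braceSum, List.length_cons, List.length_nil, zero_add,
    Finset.sum_range_succ, Finset.sum_range_zero, List.take_zero, List.drop_zero, tsub_zero,
    tsub_self, List.take_succ_cons, List.drop_succ_cons, List.nil_append, List.append_nil,
    List.take_nil, List.drop_nil, List.cons_append, h0, smul_zero, add_zero, hC.brace_incl hv] at h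
  have e : shiftedDegSum ([] : List (ℤ × ReducedTensor k V)) = 0 := rfl
  rw [hC.brace_incl hu] at h
  simp only [e, mul_zero, zero_mul, add_zero, Int.negOnePow_zero, one_smul] at h
  exact ReducedTensor.incl_injective h

end CactiAlgebra

end GeneratorOperations

/-! ### The boundary of `B₂` on generators -/

section GeneratorBoundary

variable {k : Type u} [Field k] {V : Type v} [AddCommGroup V] [Module k V]
  {𝒱 : ℤ → Submodule k V} [DirectSum.Decomposition 𝒱]

theorem incl_add_cup_injective {a a' : V} {u u' : V ⊗[k] V}
    (h : ReducedTensor.incl k a + ReducedTensor.cup k V u =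
      ReducedTensor.incl k a' + ReducedTensor.cup k V u') : a = a' ∧ u = u' := by
  have h' : TensorAlgebra.ι k a + (ReducedTensor.cup k V u : TensorAlgebra k V) =
      TensorAlgebra.ι k a' + (ReducedTensor.cup k V u' : TensorAlgebra k V) :=
    congrArg Subtype.val h
  constructor
  · have := congrArg TensorAlgebra.ιInv h'
    rwa [map_add, map_add, ReducedTensor.ιInv_cup, ReducedTensor.ιInv_cup, add_zero, add_zero,
      TensorAlgebra.ι_leftInverse, TensorAlgebra.ι_leftInverse] at this
  · have := congrArg (ReducedTensor.quadratic k V) h'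
    rwa [map_add, map_add, ReducedTensor.quadratic_ι, ReducedTensor.quadratic_ι, zero_add, zero_add,
      ReducedTensor.quadratic_cup, ReducedTensor.quadratic_cup] at this

variable (𝒱) in
/-- The `V ⊗ V`-component of the product on `H ⊗ H`. -/
def reducedKoszulMul (μ : V →ₗ[k] V →ₗ[k] V) :
    (V × k) ⊗[k] (V × k) →ₗ[k] (V × k) ⊗[k] (V × k) →ₗ[k] V ⊗[k] V :=
  (koszulMul (unitGrading 𝒱) (unitMul μ)).compr₂
    (TensorProduct.map (LinearMap.fst k V k) (LinearMap.fst k V k))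

theorem reducedKoszulMul_tmul (μ : V →ₗ[k] V →ₗ[k] V) {m n : ℤ} {b a' : V × k}
    (hb : b ∈ unitGrading 𝒱 m) (ha' : a' ∈ unitGrading 𝒱 n) (a b' : V × k) :
    reducedKoszulMul 𝒱 μ (a ⊗ₜ b) (a' ⊗ₜ b') =
      (m * n).negOnePow • ((unitMul μ a a').1 ⊗ₜ (unitMul μ b b').1) := by
  rw [reducedKoszulMul, LinearMap.compr₂_apply, koszulMul_tmul _ _ hb ha',
    LinearMap.map_smul_of_tower]
  rfl

/-- The product of the primitive parts `v ⊗ 1 + 1 ⊗ v` and `w ⊗ 1 + 1 ⊗ w` has the component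
`v ⊗ w ± w ⊗ v` in `V ⊗ V`. -/
theorem reducedKoszulMul_primitive {μ : V →ₗ[k] V →ₗ[k] V} {p q : ℤ} {v w : V} (hv : v ∈ 𝒱 p)
    (hw : w ∈ 𝒱 q) : reducedKoszulMul 𝒱 μ ((v, 0) ⊗ₜ (0, 1) + (0, 1) ⊗ₜ (v, 0))
      ((w, 0) ⊗ₜ (0, 1) + (0, 1) ⊗ₜ (w, 0)) = v ⊗ₜ w + (p * q).negOnePow • (w ⊗ₜ v) := by
  simp only [map_add, LinearMap.add_apply,
    reducedKoszulMul_tmul _ (inl_mem_unitGrading 𝒱 hv) (inl_mem_unitGrading 𝒱 hw),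
    reducedKoszulMul_tmul _ (inl_mem_unitGrading 𝒱 hv) (one_mem_unitGrading 𝒱),
    reducedKoszulMul_tmul _ (one_mem_unitGrading 𝒱) (inl_mem_unitGrading 𝒱 hw),
    reducedKoszulMul_tmul _ (one_mem_unitGrading 𝒱) (one_mem_unitGrading 𝒱)]
  simp [unitMul_apply, add_comm]

namespace CactiAlgebra

variable {C : CactiAlgebra k (ReducedTensor k V) (totalPart (tensorBigrading 𝒱))}

theorem IsWellGraded.B_one_incl_of_mem (hC : C.IsWellGraded (tensorBigrading 𝒱)) {p : ℤ} {v : V}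
    (hv : v ∈ 𝒱 p) (w : V) : C.B 1 ![ReducedTensor.incl k v, ReducedTensor.incl k w] =
      (p + 1).negOnePow • ReducedTensor.incl k (C.genMul 𝒱 v w) := by
  rw [hC.B_one_incl, genB_of_mem _ hv, ← ReducedTensor.inclLinear_apply,
    LinearMap.map_smul_of_tower, ReducedTensor.inclLinear_apply]

/-- Up to signs, the operation `B₂(-, w)` on `V ⊗ V` is the product of `H ⊗ H` with the primitive part
`w ⊗ 1 + 1 ⊗ w` of the coproduct of `w`. -/
theorem IsWellGraded.B_one_cup_incl (hC : C.IsWellGraded (tensorBigrading 𝒱))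
    (hT : C.ExtendsTensor) {p q : ℤ} {u : V ⊗[k] V} (hu : u ∈ tensorPart 𝒱 p) {w : V}
    (hw : w ∈ 𝒱 q) :
    C.B 1 ![ReducedTensor.cup k V (leftSign k 𝒱 u), ReducedTensor.incl k w] =
      p.negOnePow • ReducedTensor.cup k V (leftSign k 𝒱 (reducedKoszulMul 𝒱 (C.genMul 𝒱)
        (TensorProduct.map (LinearMap.inl k V k) (LinearMap.inl k V k) u)
        ((w, 0) ⊗ₜ (0, 1) + (0, 1) ⊗ₜ (w, 0)))) := by
  suffices key : u ∈ LinearMap.eqLocus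
      (C.opLeft ![ReducedTensor.incl k w] ∘ₗ ReducedTensor.cup k V ∘ₗ leftSign k 𝒱)
      (p.negOnePow • (ReducedTensor.cup k V ∘ₗ leftSign k 𝒱 ∘ₗ
        (reducedKoszulMul 𝒱 (C.genMul 𝒱)).flip ((w, 0) ⊗ₜ (0, 1) + (0, 1) ⊗ₜ (w, 0)) ∘ₗ
        TensorProduct.map (LinearMap.inl k V k) (LinearMap.inl k V k))) by
    rw [LinearMap.mem_eqLocus] at key
    simp only [LinearMap.comp_apply, LinearMap.smul_apply, LinearMap.flip_apply] at key
    exact key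
  refine tensorPart_le (fun r t hrt a ha b hb => ?_) hu
  rw [LinearMap.mem_eqLocus]
  simp only [LinearMap.comp_apply, LinearMap.smul_apply, LinearMap.flip_apply,
    TensorProduct.map_tmul, LinearMap.inl_apply]
  rw [leftSign_tmul ha, LinearMap.map_smul_of_tower, LinearMap.map_smul_of_tower]
  change r.negOnePow • C.B 1 ![ReducedTensor.cup k V (a ⊗ₜ b), ReducedTensor.incl k w] = _
  rw [← mul_incl hT, C.B_one_mul (incl_mem_totalPart ha) (incl_mem_totalPart hb)
    (incl_mem_totalPart hw), hC.B_one_incl_of_mem ha, hC.B_one_incl_of_mem hb, map_add,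
    reducedKoszulMul_tmul _ (inl_mem_unitGrading 𝒱 hb) (inl_mem_unitGrading 𝒱 hw),
    reducedKoszulMul_tmul _ (inl_mem_unitGrading 𝒱 hb) (one_mem_unitGrading 𝒱)]
  simp only [unitMul_apply, LinearMap.map_smul_of_tower, LinearMap.smul_apply, map_zero, zero_smul,
    one_smul, zero_add, add_zero, map_add, mul_incl hT, leftSign_tmul ha,
    leftSign_tmul (genMul_mem ha hw), smul_add, smul_smul, ← Int.negOnePow_add]
  rw [add_comm]
  subst hrt
  congr 2
  · exact Int.negOnePow_congr (by push_cast; grind)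
  · exact Int.negOnePow_congr (by push_cast; grind)

/-- Up to signs, the operation `B₃(-, y, z)` on `V ⊗ V` is the product of `H ⊗ H` with `y ⊗ z`. -/
theorem IsWellGraded.B_two_cup_incl (hC : C.IsWellGraded (tensorBigrading 𝒱))
    (hT : C.ExtendsTensor) (u : V ⊗[k] V) {m n : ℤ} {y z : V} (hy : y ∈ 𝒱 m) (hz : z ∈ 𝒱 n) :
    C.B 2 ![ReducedTensor.cup k V (leftSign k 𝒱 u), ReducedTensor.incl k y,
      ReducedTensor.incl k z] =
      (m + 1).negOnePow • ReducedTensor.cup k V (leftSign k 𝒱 (reducedKoszulMul 𝒱 (C.genMul 𝒱)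
        (TensorProduct.map (LinearMap.inl k V k) (LinearMap.inl k V k) u)
        ((y, 0) ⊗ₜ (z, 0)))) := by
  refine LinearMap.congr_fun (tmul_homogeneous_ext 𝒱 𝒱
    (φ := C.opLeft ![ReducedTensor.incl k y, ReducedTensor.incl k z] ∘ₗ ReducedTensor.cup k V ∘ₗ
      leftSign k 𝒱)
    (ψ := (m + 1).negOnePow • (ReducedTensor.cup k V ∘ₗ leftSign k 𝒱 ∘ₗ
      (reducedKoszulMul 𝒱 (C.genMul 𝒱)).flip ((y, 0) ⊗ₜ (z, 0)) ∘ₗ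
      TensorProduct.map (LinearMap.inl k V k) (LinearMap.inl k V k)))
    (fun r t a ha b hb => ?_)) u
  simp only [LinearMap.comp_apply, LinearMap.smul_apply, LinearMap.flip_apply,
    TensorProduct.map_tmul, LinearMap.inl_apply]
  rw [leftSign_tmul ha, LinearMap.map_smul_of_tower, LinearMap.map_smul_of_tower]
  change r.negOnePow • C.B 2 ![ReducedTensor.cup k V (a ⊗ₜ b), ReducedTensor.incl k y,
    ReducedTensor.incl k z] = _
  rw [← mul_incl hT, C.B_two_mul (incl_mem_totalPart ha) (incl_mem_totalPart hb)
    (incl_mem_totalPart hy) (incl_mem_totalPart hz) (hC.B_incl _ ![_, _]) (hC.B_incl _ ![_, _]),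
    hC.B_one_incl_of_mem ha, hC.B_one_incl_of_mem hb,
    reducedKoszulMul_tmul _ (inl_mem_unitGrading 𝒱 hb) (inl_mem_unitGrading 𝒱 hy)]
  simp only [unitMul_apply, LinearMap.map_smul_of_tower, LinearMap.smul_apply, zero_smul,
    add_zero, mul_incl hT, leftSign_tmul (genMul_mem ha hy), smul_smul, ← Int.negOnePow_add]
  congr 1
  exact Int.negOnePow_congr (by push_cast; grind)

/-- Up to signs, the operation `B₂(v, -)` on `V ⊗ V` is the product of `H ⊗ H` with the coproduct of `v`. Here the
reduced coproduct of `v` enters through the quadratic part of `d v` in the boundary of `B₃`. -/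
theorem IsWellGraded.B_one_incl_cup (hC : C.IsWellGraded (tensorBigrading 𝒱))
    (hT : C.ExtendsTensor) {p : ℤ} {v : V} (hv : v ∈ 𝒱 p) (u : V ⊗[k] V) :
    C.B 1 ![ReducedTensor.incl k v, ReducedTensor.cup k V (leftSign k 𝒱 u)] =
      -ReducedTensor.cup k V (leftSign k 𝒱 (reducedKoszulMul 𝒱 (C.genMul 𝒱)
        (unitComul (C.genComul 𝒱) (v, 0))
        (TensorProduct.map (LinearMap.inl k V k) (LinearMap.inl k V k) u))) := by
  refine LinearMap.congr_fun (tmul_homogeneous_ext 𝒱 𝒱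
    (φ := C.opRight (ReducedTensor.incl k v) ![] ∘ₗ ReducedTensor.cup k V ∘ₗ leftSign k 𝒱)
    (ψ := -(ReducedTensor.cup k V ∘ₗ leftSign k 𝒱 ∘ₗ
      reducedKoszulMul 𝒱 (C.genMul 𝒱) (unitComul (C.genComul 𝒱) (v, 0)) ∘ₗ
      TensorProduct.map (LinearMap.inl k V k) (LinearMap.inl k V k)))
    (fun m n y hy z hz => ?_)) u
  simp only [LinearMap.comp_apply, LinearMap.neg_apply, TensorProduct.map_tmul,
    LinearMap.inl_apply]
  rw [leftSign_tmul hy, LinearMap.map_smul_of_tower, LinearMap.map_smul_of_tower]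
  change m.negOnePow • C.B 1 ![ReducedTensor.incl k v, ReducedTensor.cup k V (y ⊗ₜ z)] = _
  have h2 : C.B 2 ![C.d (ReducedTensor.incl k v), ReducedTensor.incl k y, ReducedTensor.incl k z] =
      C.B 2 ![ReducedTensor.cup k V (leftSign k 𝒱 (C.genComul 𝒱 v)), ReducedTensor.incl k y,
        ReducedTensor.incl k z] := by
    rw [hC.d_incl, leftSign_genComul]
    refine ((C.opLeft ![ReducedTensor.incl k y, ReducedTensor.incl k z]).map_add _ _).trans ?_
    refine (congrArg (· + _) (hC.B_incl _ ![_, _])).trans (zero_add _)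
  rw [← mul_incl hT, C.B_one_mul_right (incl_mem_totalPart hv) (incl_mem_totalPart hy)
    (incl_mem_totalPart hz) (fun y z => hC.B_incl _ ![y, z]), h2, hC.B_two_cup_incl hT _ hy hz,
    hC.B_one_incl_of_mem hv, hC.B_one_incl_of_mem hv, unitComul_inl, map_add, map_add,
    LinearMap.add_apply, LinearMap.add_apply,
    reducedKoszulMul_tmul _ (one_mem_unitGrading 𝒱) (inl_mem_unitGrading 𝒱 hy),
    reducedKoszulMul_tmul _ (inl_mem_unitGrading 𝒱 hv) (inl_mem_unitGrading 𝒱 hy)]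
  simp only [unitMul_apply, LinearMap.map_smul_of_tower, LinearMap.smul_apply, map_zero, zero_smul,
    one_smul, zero_add, add_zero, map_add, mul_incl hT, leftSign_tmul hy,
    leftSign_tmul (genMul_mem hv hy), smul_add, smul_smul, ← Int.negOnePow_add,
    LinearMap.zero_apply]
  simp only [neg_add, ← Units.neg_smul, ← Int.negOnePow_succ]
  simp only [negOnePow_eq_paritySign]
  push_cast
  generalize (p : ZMod 2) = p', (m : ZMod 2) = m'
  obtain rfl | rfl := ZMod.two_cases p' <;> obtain rfl | rfl := ZMod.two_cases m' <;>
    simp only [mul_add, paritySign_add, paritySign_one, mul_zero, zero_add, add_zero, mul_one,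
      mul_neg, neg_neg, Units.neg_smul, one_smul] <;> abel

/-- The differential of `B₂(v, w)`, with `v, w ∈ V`. The quadratic part says that the coproduct is
multiplicative. -/
theorem IsWellGraded.d_B_one_incl (hC : C.IsWellGraded (tensorBigrading 𝒱)) (hT : C.ExtendsTensor)
    {p q : ℤ} {v w : V} (hv : v ∈ 𝒱 p) (hw : w ∈ 𝒱 q) :
    C.d (ReducedTensor.incl k (C.genB v w)) =
      ReducedTensor.incl k (-C.genB (C.genD v) w - (p + 1).negOnePow • C.genB v (C.genD w)) +
      ReducedTensor.cup k V ((p + 1).negOnePow • leftSign k 𝒱 (reducedKoszulMul 𝒱 (C.genMul 𝒱)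
        (unitComul (C.genComul 𝒱) (v, 0)) (unitComul (C.genComul 𝒱) (w, 0)))) := by
  have h := C.d_B_one (incl_mem_totalPart hv) (incl_mem_totalPart hw)
  have e1 : C.B 1 ![C.d (ReducedTensor.incl k v), ReducedTensor.incl k w] =
      ReducedTensor.incl k (C.genB (C.genD v) w) +
        p.negOnePow • ReducedTensor.cup k V (leftSign k 𝒱 (reducedKoszulMul 𝒱 (C.genMul 𝒱)
        (TensorProduct.map (LinearMap.inl k V k) (LinearMap.inl k V k) (C.genComul 𝒱 v))
        ((w, 0) ⊗ₜ (0, 1) + (0, 1) ⊗ₜ (w, 0)))) := by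
    rw [hC.d_incl, ← hC.B_one_cup_incl hT (genComul_mem hv) hw, ← hC.B_one_incl,
      leftSign_genComul]
    exact (C.opLeft ![ReducedTensor.incl k w]).map_add _ _
  have e2 : C.B 1 ![ReducedTensor.incl k v, C.d (ReducedTensor.incl k w)] =
      ReducedTensor.incl k (C.genB v (C.genD w)) -
        ReducedTensor.cup k V (leftSign k 𝒱 (reducedKoszulMul 𝒱 (C.genMul 𝒱)
        (unitComul (C.genComul 𝒱) (v, 0))
        (TensorProduct.map (LinearMap.inl k V k) (LinearMap.inl k V k) (C.genComul 𝒱 w)))) := by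
    rw [hC.d_incl, sub_eq_add_neg, ← hC.B_one_incl_cup hT hv, ← hC.B_one_incl, leftSign_genComul]
    exact (C.opRight (ReducedTensor.incl k v) ![]).map_add _ _
  rw [hC.B_one_incl, e1, e2, mul_incl hT, mul_incl hT] at h
  have e4 : reducedKoszulMul 𝒱 (C.genMul 𝒱) (unitComul (C.genComul 𝒱) (v, 0))
      ((w, 0) ⊗ₜ (0, 1) + (0, 1) ⊗ₜ (w, 0)) = v ⊗ₜ w + (p * q).negOnePow • (w ⊗ₜ v) +
      reducedKoszulMul 𝒱 (C.genMul 𝒱)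
        (TensorProduct.map (LinearMap.inl k V k) (LinearMap.inl k V k) (C.genComul 𝒱 v))
        ((w, 0) ⊗ₜ (0, 1) + (0, 1) ⊗ₜ (w, 0)) := by
    rw [unitComul_inl, LinearMap.map_add₂, reducedKoszulMul_primitive hv hw]
  rw [h, unitComul_inl _ w, map_add (reducedKoszulMul 𝒱 (C.genMul 𝒱) _) (_ + _), e4]
  simp only [← ReducedTensor.inclLinear_apply, map_add, map_sub, map_neg,
    LinearMap.map_smul_of_tower, leftSign_tmul hv, leftSign_tmul hw, smul_add, smul_sub, smul_smul,
    ← Int.negOnePow_add]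
  generalize ReducedTensor.cup k V (leftSign k 𝒱 _) = X,
    ReducedTensor.cup k V (leftSign k 𝒱 _) = Y, ReducedTensor.cup k V (leftSign k 𝒱 _) = Z
  simp only [negOnePow_eq_paritySign]
  push_cast
  generalize (p : ZMod 2) = p', (q : ZMod 2) = q'
  obtain rfl | rfl := ZMod.two_cases p' <;> obtain rfl | rfl := ZMod.two_cases q' <;>
    simp only [mul_add, paritySign_add, paritySign_zero, paritySign_one, mul_zero, zero_add,
      add_zero, mul_one, mul_neg, neg_neg, Units.neg_smul, one_smul] <;> abel

end CactiAlgebra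

end GeneratorBoundary

/-! ### From a Cacti algebra to a bialgebra -/

section GeneratorBialgebra

variable {k : Type u} [Field k] {V : Type v} [AddCommGroup V] [Module k V]
  {𝒱 : ℤ → Submodule k V} [DirectSum.Decomposition 𝒱]

theorem coe_incl (v : V) : ((ReducedTensor.incl k v : ReducedTensor k V) :
    TensorAlgebra k V) = TensorAlgebra.ι k v := rfl

theorem map_signMap_signMap_of_mem {p : ℤ} {u : V ⊗[k] V} (hu : u ∈ tensorPart 𝒱 p) :
    TensorProduct.map (signMap 𝒱 1) (signMap 𝒱 1) u = p.negOnePow • u := by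
  suffices key : u ∈ LinearMap.eqLocus (TensorProduct.map (signMap 𝒱 1) (signMap 𝒱 1))
      (p.negOnePow • LinearMap.id) by
    rw [LinearMap.mem_eqLocus] at key
    exact key
  refine tensorPart_le (fun r t hrt a ha b hb => ?_) hu
  rw [LinearMap.mem_eqLocus, TensorProduct.map_tmul, signMap_of_mem _ _ ha, signMap_of_mem _ _ hb,
    negOnePow_smul_tmul, tmul_negOnePow_smul, smul_smul, ← Int.negOnePow_add, mul_one, mul_one, hrt]
  rfl

namespace CactiAlgebra

variable {C : CactiAlgebra k (ReducedTensor k V) (totalPart (tensorBigrading 𝒱))}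

/-- The differential of a product of two generators. -/
theorem IsWellGraded.coe_d_cup (hC : C.IsWellGraded (tensorBigrading 𝒱)) (hT : C.ExtendsTensor)
    (u : V ⊗[k] V) : (C.d (ReducedTensor.cup k V u) : TensorAlgebra k V) =
      ReducedTensor.cup k V (TensorProduct.map C.genD LinearMap.id u -
        TensorProduct.map (signMap 𝒱 1) C.genD u) +
      ReducedTensor.triple k V (TensorProduct.assoc k V V V (LinearMap.rTensor V C.genQuad u) -
        TensorProduct.map (signMap 𝒱 1) C.genQuad u) := by
  refine LinearMap.congr_fun (tmul_homogeneous_ext 𝒱 𝒱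
    (φ := (ReducedTensor k V).subtype ∘ₗ C.d ∘ₗ ReducedTensor.cup k V)
    (ψ := (ReducedTensor k V).subtype ∘ₗ ReducedTensor.cup k V ∘ₗ
        (TensorProduct.map C.genD LinearMap.id - TensorProduct.map (signMap 𝒱 1) C.genD) +
      ReducedTensor.triple k V ∘ₗ ((TensorProduct.assoc k V V V).toLinearMap ∘ₗ
        LinearMap.rTensor V C.genQuad - TensorProduct.map (signMap 𝒱 1) C.genQuad))
    (fun p q a ha b hb => ?_)) u
  simp only [LinearMap.comp_apply, LinearMap.add_apply, LinearMap.sub_apply,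
    TensorProduct.map_tmul, LinearMap.rTensor_tmul, LinearEquiv.coe_coe, Submodule.subtype_apply,
    LinearMap.id_apply, map_sub]
  rw [← mul_incl hT, C.d_mul _ _ (incl_mem_totalPart ha), hC.d_incl, hC.d_incl, Submodule.coe_add,
    coe_negOnePow_smul, hT, hT, Submodule.coe_add, Submodule.coe_add, signMap_of_mem _ _ ha,
    ReducedTensor.triple_assoc_tmul, ReducedTensor.coe_cup_tmul, ReducedTensor.coe_cup_tmul,
    ReducedTensor.triple_tmul, LinearMap.map_smul_of_tower, mul_one, Int.negOnePow_succ]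
  simp only [coe_incl, mul_add, add_mul, smul_mul_assoc, smul_add, Units.neg_smul]
  abel

/-- The parts of external degree `1`, `2` and `3` of `d (d v) = 0`, for `v ∈ V`. -/
theorem IsWellGraded.d_d_parts (hC : C.IsWellGraded (tensorBigrading 𝒱)) (hT : C.ExtendsTensor)
    (v : V) : C.genD (C.genD v) = 0 ∧
      C.genQuad (C.genD v) = TensorProduct.map (signMap 𝒱 1) C.genD (C.genQuad v) -
        TensorProduct.map C.genD LinearMap.id (C.genQuad v) ∧
      TensorProduct.assoc k V V V (LinearMap.rTensor V C.genQuad (C.genQuad v)) =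
        TensorProduct.map (signMap 𝒱 1) C.genQuad (C.genQuad v) := by
  have h := congrArg Subtype.val (C.d_d (ReducedTensor.incl k v))
  rw [hC.d_incl, map_add, hC.d_incl, Submodule.coe_add, Submodule.coe_add, hC.coe_d_cup hT,
    coe_incl, Submodule.coe_zero] at h
  refine ⟨?_, ?_, ?_⟩
  · have := congrArg TensorAlgebra.ιInv h
    rwa [map_add, map_add, map_add, ReducedTensor.ιInv_cup, ReducedTensor.ιInv_cup,
      ReducedTensor.ιInv_triple, TensorAlgebra.ι_leftInverse, add_zero, add_zero, add_zero,
      map_zero] at this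
  · have := congrArg (ReducedTensor.quadratic k V) h
    rw [map_add, map_add, map_add, ReducedTensor.quadratic_cup, ReducedTensor.quadratic_cup,
      ReducedTensor.quadratic_triple, ReducedTensor.quadratic_ι, zero_add, add_zero, map_zero,
      add_eq_zero_iff_eq_neg, neg_sub] at this
    exact this
  · have := congrArg (ReducedTensor.cubic k V) h
    rwa [map_add, map_add, map_add, ReducedTensor.cubic_cup, ReducedTensor.cubic_cup,
      ReducedTensor.cubic_triple, ReducedTensor.cubic_ι, zero_add, zero_add, zero_add, map_zero,
      sub_eq_zero] at this

theorem genD_signMap : C.genD ∘ₗ signMap 𝒱 1 = -(signMap 𝒱 1 ∘ₗ C.genD) := by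
  refine homogeneous_ext 𝒱 fun p v hv => ?_
  rw [LinearMap.comp_apply, LinearMap.neg_apply, LinearMap.comp_apply, signMap_of_mem _ _ hv,
    signMap_of_mem _ _ (genD_mem hv), LinearMap.map_smul_of_tower, mul_one, mul_one,
    Int.negOnePow_succ, Units.neg_smul, neg_neg]

theorem signMap_signMap : signMap 𝒱 1 ∘ₗ signMap 𝒱 1 = LinearMap.id := by
  rw [signMap_comp_signMap, signMap_congr 𝒱 (n := 0) (by decide), signMap_zero]

theorem IsWellGraded.genComul_coassoc (hC : C.IsWellGraded (tensorBigrading 𝒱))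
    (hT : C.ExtendsTensor) (v : V) :
    TensorProduct.assoc k V V V (LinearMap.rTensor V (C.genComul 𝒱) (C.genComul 𝒱 v)) =
      LinearMap.lTensor V (C.genComul 𝒱) (C.genComul 𝒱 v) := by
  have h1 : C.genComul 𝒱 ∘ₗ signMap 𝒱 1 =
      TensorProduct.map LinearMap.id (signMap 𝒱 1) ∘ₗ C.genQuad := by
    refine homogeneous_ext 𝒱 fun p v hv => ?_
    rw [LinearMap.comp_apply, signMap_of_mem _ _ hv, LinearMap.map_smul_of_tower, mul_one,
      CactiData.genComul, LinearMap.comp_apply, ← LinearMap.map_smul_of_tower,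
      ← map_signMap_signMap_of_mem (genQuad_mem hv), leftSign, TensorProduct.map_map,
      signMap_signMap, LinearMap.id_comp]
    rfl
  have h2 : LinearMap.rTensor V (C.genComul 𝒱) (C.genComul 𝒱 v) =
      TensorProduct.map (TensorProduct.map LinearMap.id (signMap 𝒱 1)) LinearMap.id
        (LinearMap.rTensor V C.genQuad (C.genQuad v)) := by
    rw [LinearMap.rTensor, CactiData.genComul, LinearMap.comp_apply, ← CactiData.genComul, leftSign,
      TensorProduct.map_map, h1, LinearMap.rTensor, TensorProduct.map_map]
  have h3 : ∀ x : (V ⊗[k] V) ⊗[k] V, TensorProduct.assoc k V V V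
      (TensorProduct.map (TensorProduct.map LinearMap.id (signMap 𝒱 1)) LinearMap.id x) =
      TensorProduct.map LinearMap.id (TensorProduct.map (signMap 𝒱 1) LinearMap.id)
        (TensorProduct.assoc k V V V x) := fun x =>
    (TensorProduct.map_map_assoc _ _ _ x).symm
  rw [h2, h3, (hC.d_d_parts hT v).2.2, TensorProduct.map_map, LinearMap.lTensor,
    CactiData.genComul, LinearMap.comp_apply, leftSign, TensorProduct.map_map, LinearMap.id_comp,
    LinearMap.comp_id]

theorem IsWellGraded.genComul_genD (hC : C.IsWellGraded (tensorBigrading 𝒱))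
    (hT : C.ExtendsTensor) (v : V) : C.genComul 𝒱 (C.genD v) =
      TensorProduct.map C.genD LinearMap.id (C.genComul 𝒱 v) +
        TensorProduct.map (signMap 𝒱 1) C.genD (C.genComul 𝒱 v) := by
  have hneg : ∀ f g : V →ₗ[k] V, TensorProduct.map (-f) g = -TensorProduct.map f g := fun f g => by
    ext a b
    simp [TensorProduct.neg_tmul]
  rw [CactiData.genComul, LinearMap.comp_apply, (hC.d_d_parts hT v).2.1, LinearMap.comp_apply,
    leftSign, map_sub, TensorProduct.map_map, TensorProduct.map_map, TensorProduct.map_map,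
    TensorProduct.map_map, genD_signMap, signMap_signMap, LinearMap.id_comp, LinearMap.comp_id,
    LinearMap.comp_id, hneg, LinearMap.neg_apply]
  abel

/-- The parts of external degree `1` and `2` of the boundary of `B₂` on two generators: the differential
is a derivation of the product on `V`, and the coproduct is multiplicative. -/
theorem IsWellGraded.genMul_parts (hC : C.IsWellGraded (tensorBigrading 𝒱))
    (hT : C.ExtendsTensor) {p q : ℤ} {v w : V} (hv : v ∈ 𝒱 p) (hw : w ∈ 𝒱 q) :
    C.genD (C.genMul 𝒱 v w) =
        C.genMul 𝒱 (C.genD v) w + p.negOnePow • C.genMul 𝒱 v (C.genD w) ∧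
      C.genComul 𝒱 (C.genMul 𝒱 v w) = reducedKoszulMul 𝒱 (C.genMul 𝒱)
        (unitComul (C.genComul 𝒱) (v, 0)) (unitComul (C.genComul 𝒱) (w, 0)) := by
  obtain ⟨h1, h2⟩ := incl_add_cup_injective
    ((hC.d_incl (C.genB v w)).symm.trans (hC.d_B_one_incl hT hv hw))
  constructor
  · rw [genMul_of_mem _ hv, LinearMap.map_smul_of_tower, h1, genB_of_mem _ (genD_mem hv),
      genB_of_mem _ hv, smul_sub, smul_neg, smul_smul, smul_smul, smul_smul]
    simp only [← Int.negOnePow_add]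
    rw [sub_eq_add_neg, ← Units.neg_smul, ← Units.neg_smul, ← Int.negOnePow_succ,
      ← Int.negOnePow_succ]
    congr 1
    · rw [Int.negOnePow_even _ ⟨p + 2, by ring⟩, one_smul]
    · congr 1
      exact Int.negOnePow_congr (by push_cast; grind)
  · rw [genMul_of_mem _ hv, LinearMap.map_smul_of_tower, CactiData.genComul, LinearMap.comp_apply,
      h2, LinearMap.map_smul_of_tower, leftSign_leftSign, smul_smul, ← Int.negOnePow_add,
      Int.negOnePow_even _ ⟨_, rfl⟩, one_smul]
    rfl

/-- The reduced bialgebra of a well graded Cacti algebra structure that extends the free product: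
the associativity of the product is the brace relation for two generators, the relations for the
coproduct alone are the parts of `d ^ 2 = 0` of external degree `1`, `2`, `3`, and the boundary of
`B₂` gives the compatibility of the product with the differential and the coproduct. -/
theorem IsWellGraded.isReducedBialgebra (hC : C.IsWellGraded (tensorBigrading 𝒱))
    (hT : C.ExtendsTensor) : IsReducedBialgebra 𝒱 C.genD (C.genMul 𝒱) (C.genComul 𝒱) where
  d_mem _ _ hv := genD_mem hv
  mul_mem _ _ _ hv _ hw := genMul_mem hv hw
  comul_mem _ _ hv := genComul_mem hv
  mul_assoc := hC.genMul_assoc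
  coassoc := hC.genComul_coassoc hT
  d_d v := (hC.d_d_parts hT v).1
  d_mul n v hv w := LinearMap.congr_fun (homogeneous_ext 𝒱 (φ := C.genD ∘ₗ C.genMul 𝒱 v)
    (ψ := C.genMul 𝒱 (C.genD v) + n.negOnePow • (C.genMul 𝒱 v ∘ₗ C.genD))
    fun q w hw => (hC.genMul_parts hT hv hw).1) w
  comul_d := hC.genComul_genD hT
  comul_mul v w := by
    refine Eq.symm (LinearMap.congr_fun (homogeneous_ext 𝒱
      (φ := C.genComul 𝒱 ∘ₗ (C.genMul 𝒱).flip w)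
      (ψ := (reducedKoszulMul 𝒱 (C.genMul 𝒱)).flip (unitComul (C.genComul 𝒱) (w, 0)) ∘ₗ
        unitComul (C.genComul 𝒱) ∘ₗ LinearMap.inl k V k) fun p v hv => ?_) v)
    exact LinearMap.congr_fun (homogeneous_ext 𝒱 (φ := C.genComul 𝒱 ∘ₗ C.genMul 𝒱 v)
      (ψ := reducedKoszulMul 𝒱 (C.genMul 𝒱) (unitComul (C.genComul 𝒱) (v, 0)) ∘ₗ
        unitComul (C.genComul 𝒱) ∘ₗ LinearMap.inl k V k)
      fun q w hw => (hC.genMul_parts hT hv hw).2) w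

variable (𝒱) in
/-- The element `∑ (-1) ^ |w₁| π w₁ ⊗ π w₂` of the tensor algebra only depends on the component of
`w` in `V ⊗ V`. -/
theorem mul'_map_signMap (w : (V × k) ⊗[k] (V × k)) :
    LinearMap.mul' k (TensorAlgebra k V) (TensorProduct.map
      (TensorAlgebra.ι k ∘ₗ LinearMap.fst k V k ∘ₗ signMap (unitGrading 𝒱) 1)
      (TensorAlgebra.ι k ∘ₗ LinearMap.fst k V k) w) =
    ReducedTensor.cup k V (leftSign k 𝒱
      (TensorProduct.map (LinearMap.fst k V k) (LinearMap.fst k V k) w)) := by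
  have h : LinearMap.fst k V k ∘ₗ signMap (unitGrading 𝒱) 1 = signMap 𝒱 1 ∘ₗ LinearMap.fst k V k := by
    refine LinearMap.prod_ext (LinearMap.ext fun v => ?_) (LinearMap.ext_ring ?_)
    · simp [signMap_unitGrading_inl]
    · simp [signMap_unitGrading_one]
  rw [ReducedTensor.coe_cup, leftSign, TensorProduct.map_map, TensorProduct.map_map, h]
  rfl

theorem IsWellGraded.induces (hC : C.IsWellGraded (tensorBigrading 𝒱)) (hT : C.ExtendsTensor) :
    Induces 𝒱 C.toCactiData (hC.isReducedBialgebra hT).toDGBialgebra where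
  differential := by
    obtain ⟨di, de, h⟩ := hC.exists_splitting
    have key : ∀ v, di (ReducedTensor.incl k v) = ReducedTensor.incl k (C.genD v) ∧
        de (ReducedTensor.incl k v) = ReducedTensor.cup k V (C.genQuad v) := fun v => by
      obtain ⟨a, u, ha, hu⟩ := h.exists_incl v
      have := hC.d_incl v
      rw [h.eq_add, LinearMap.add_apply, ha, hu] at this
      obtain ⟨rfl, rfl⟩ := incl_add_cup_injective this
      exact ⟨ha, hu⟩
    refine ⟨di, de, h, fun v => (key v).1, fun v => ?_⟩
    rw [mul'_map_signMap, (key v).2]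
    change _ = ((ReducedTensor.cup k V (leftSign k 𝒱 (TensorProduct.map (LinearMap.fst k V k)
      (LinearMap.fst k V k) (unitComul (C.genComul 𝒱) (v, 0)))) : ReducedTensor k V) :
        TensorAlgebra k V)
    rw [unitComul_inl, ← leftSign_genComul (𝒱 := 𝒱)]
    simp [TensorProduct.map_map]
  product p x hx y := by
    change ReducedTensor.incl k (unitMul (C.genMul 𝒱) (x, 0) (y, 0)).1 = _
    rw [hC.B_one_incl_of_mem hx, smul_smul, ← Int.negOnePow_add, Int.negOnePow_even _ ⟨_, rfl⟩,
      one_smul]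
    simp [unitMul_apply]

end CactiAlgebra

/-! ### A Cacti algebra and the bialgebra it induces determine each other -/

namespace Induces

variable {S S' : DGBialgebra k (V × k) (unitGrading 𝒱)}

theorem d_incl {C : CactiData k (ReducedTensor k V)} (h : Induces 𝒱 C S) (v : V) :
    C.d (ReducedTensor.incl k v) = ReducedTensor.incl k (S.d (v, 0)).1 +
      ReducedTensor.cup k V (leftSign k 𝒱
        (TensorProduct.map (LinearMap.fst k V k) (LinearMap.fst k V k) (S.comul (v, 0)))) := by
  obtain ⟨di, de, hs, hi, he⟩ := h.differential
  rw [hs.eq_add, LinearMap.add_apply, hi]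
  congr 1
  exact Subtype.ext ((he v).trans (CactiAlgebra.mul'_map_signMap 𝒱 _))

theorem B_one_incl {C : CactiData k (ReducedTensor k V)} (h : Induces 𝒱 C S) {p : ℤ} {v : V}
    (hv : v ∈ 𝒱 p) (w : V) : C.B 1 ![ReducedTensor.incl k v, ReducedTensor.incl k w] =
      (p + 1).negOnePow • ReducedTensor.incl k (S.mul (v, 0) (w, 0)).1 := by
  rw [h.product p v hv, smul_smul, ← Int.negOnePow_add, Int.negOnePow_even _ ⟨_, rfl⟩, one_smul]

/-- A bialgebra structure determines the well graded Cacti algebra structure that induces it. -/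
theorem cacti_eq {C C' : CactiAlgebra k (ReducedTensor k V) (totalPart (tensorBigrading 𝒱))}
    (hC : C.IsWellGraded (tensorBigrading 𝒱)) (hC' : C'.IsWellGraded (tensorBigrading 𝒱))
    (hT : C.ExtendsTensor) (hT' : C'.ExtendsTensor) (h : Induces 𝒱 C.toCactiData S)
    (h' : Induces 𝒱 C'.toCactiData S) : C = C' := by
  refine CactiAlgebra.eq_of_generators hC hC' hT hT' (fun v => by rw [h.d_incl, h'.d_incl])
    (fun v w => ?_)
  rw [← ReducedTensor.inclLinear_apply v]
  refine LinearMap.congr_fun (homogeneous_ext 𝒱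
    (φ := C.opLeft ![ReducedTensor.incl k w] ∘ₗ ReducedTensor.inclLinear k V)
    (ψ := C'.opLeft ![ReducedTensor.incl k w] ∘ₗ ReducedTensor.inclLinear k V)
    fun p v hv => ?_) v
  change C.B 1 ![ReducedTensor.inclLinear k V v, ReducedTensor.incl k w] =
    C'.B 1 ![ReducedTensor.inclLinear k V v, ReducedTensor.incl k w]
  rw [ReducedTensor.inclLinear_apply, h.B_one_incl hv, h'.B_one_incl hv]

/-- A Cacti algebra structure induces at most one bialgebra structure. -/
theorem bialgebra_eq {C : CactiData k (ReducedTensor k V)} (h : Induces 𝒱 C S)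
    (h' : Induces 𝒱 C S') (h1 : S.one = (0, 1)) (hε : S.counit = LinearMap.snd k V k)
    (h1' : S'.one = (0, 1)) (hε' : S'.counit = LinearMap.snd k V k) : S = S' := by
  have hd (v : V) := incl_add_cup_injective ((h.d_incl v).symm.trans (h'.d_incl v))
  refine DGBialgebra.ext_of_reduced h1 hε h1' hε' (fun v => (hd v).1) (fun v w => ?_) (fun v => ?_)
  · refine LinearMap.congr_fun (homogeneous_ext 𝒱
      (φ := LinearMap.fst k V k ∘ₗ S.mul.flip (w, 0) ∘ₗ LinearMap.inl k V k)
      (ψ := LinearMap.fst k V k ∘ₗ S'.mul.flip (w, 0) ∘ₗ LinearMap.inl k V k)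
      fun p v hv => ?_) v
    exact ReducedTensor.incl_injective ((h.product p v hv w).trans (h'.product p v hv w).symm)
  · rw [← leftSign_leftSign (𝒱 := 𝒱) (TensorProduct.map _ _ (S.comul (v, 0))), (hd v).2,
      leftSign_leftSign]

end Induces

end GeneratorBialgebra

end

theorem theorem1 {k : Type u} [Field k] {V : Type v} [AddCommGroup V] [Module k V]
    (𝒱 : ℤ → Submodule k V) [DirectSum.Decomposition 𝒱] :
    ∃ e :
      {C : CactiAlgebra k (ReducedTensor k V) (totalPart (tensorBigrading 𝒱)) //
        C.IsWellGraded (tensorBigrading 𝒱) ∧ C.ExtendsTensor} ≃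
      {S : DGBialgebra k (V × k) (unitGrading 𝒱) //
        S.one = (0, 1) ∧ S.counit = LinearMap.snd k V k},
      (∀ C, Induces 𝒱 C.1.toCactiData (e C).1) ∧
      ∀ S, IsKadeishvili (e.symm S).1.toCactiData S.1 := by
  refine ⟨⟨fun C => ⟨(C.2.1.isReducedBialgebra C.2.2).toDGBialgebra, rfl, rfl⟩,
    fun S => ⟨kadeishviliAlgebra S.1 S.2.1 S.2.2, isWellGraded_kadeishviliAlgebra S.1 S.2.1 S.2.2,
      kadeishviliAlgebra_extendsTensor S.1 S.2.1 S.2.2⟩, fun C => Subtype.ext ?_,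
    fun S => Subtype.ext ?_⟩, fun C => C.2.1.induces C.2.2,
    fun S => isKadeishvili_kadeishviliAlgebra S.1 S.2.1 S.2.2⟩
  · exact Induces.cacti_eq (isWellGraded_kadeishviliAlgebra _ rfl rfl) C.2.1
      (kadeishviliAlgebra_extendsTensor _ rfl rfl) C.2.2 (induces_kadeishviliAlgebra _ rfl rfl)
      (C.2.1.induces C.2.2)
  · exact Induces.bialgebra_eq
      (CactiAlgebra.IsWellGraded.induces (isWellGraded_kadeishviliAlgebra S.1 S.2.1 S.2.2)
        (kadeishviliAlgebra_extendsTensor S.1 S.2.1 S.2.2))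
      (induces_kadeishviliAlgebra S.1 S.2.1 S.2.2) rfl rfl S.2.1 S.2.2
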